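/- Let $n\ge 4$ and let $W$ be the Weyl group of type $D_n$ with simple reflections $s_0,\dots,s_{n-1}$, where $s_0$ and $s_1$ are the two vertices of the Dynkin diagram joined to $s_2$, and $s_i$ is joined to $s_{i+1}$ for $i\ge 2$. Let $\mathcal L=\mathbb Z[q,q^{-1}]$, and let $\mathcal H$ be the Hecke algebra of $W$ over $\mathcal L$, with standard basis $H_w$ and relations $H_vH_w=H_{vw}$ if $\ell(v)+\ell(w)=\ell(vw)$ and $H_s^2=(q^{-1}-q)H_s+H_e$; put $C_s=H_s+q$. Let $W_{\mathfrak p}=\langle s_1,\dots,s_{n-1}\rangle$, let $W^{\mathfrak p}$ be the set of shortest representatives of $W_{\mathfrak p}\backslash W$, let $\mathcal H_{\mathfrak p}$ be the subalgebra generated by $C_{s_1},\dots,C_{s_{n-1}}$, and let $\mathcal N=\mathcal L\otimes_{\mathcal H_{\mathfrak p}}\mathcal H$, where these $C_{s_i}$ act by $0$ on $\mathcal L$. Put $N_w=1\otimes H_w$. For $w\in W^{\mathfrak p}$ the Kazhdan–Lusztig element $\underline N_w\in\mathcal N$ is the unique element fixed by the involution induced by $q\mapsto q^{-1}$, $H_x\mapsto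 (H_{x^{-1}})^{-1}$ and lying in $N_w+\sum_{v\ne w}q\mathbb Z[q]N_v$; these elements form a basis of $\mathcal N$. A decorated tangle with $k$ bottom and $n$ top points in a rectangle is a crossingless diagram of lines (joining the boundary points in pairs) and circles, with finitely many dots on them, every dot being accessible from the left face; lines joining two top points are cups, lines joining two bottom points are caps, and the other lines are edges. Let $e_i$ ($1\le i\le n-1$) be the tangle with $n$ top and $n$ bottom points that has a cup and a cap at the places $i,i+1$ and vertical edges elsewhere, and let $e_0$ be $e_1$ with one dot on its cup and one dot on its cap. Let $\mathbb{DT}_n$ be the subalgebra generated by $e_0,\dots,e_{n-1}$ of the $\mathcal L$-algebra with basis all decorated tangles with $n$ top and $n$ bottom points and with concatenation as multiplication. Consider the following rules: (i) an undotted circle may be removed and replaced by the factor $q+q^{-1}$; (ii) two dots on the same line or circle may be removed; (iii) a tangle containing a circle with exactly one dot is $0$; (iv) a tangle containing an undotted cap is $0$; (v) a cap with exactly one dot may be removed, together with its two end points. An even decorated cup diagram is a decorated tangle with $n$ top points and $k$ bottom points, $0\le k\le n$, without circles and with at most one dot on each line, such that every bottom point is joined to a top point and the number of dotted edges plus the number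 of undotted cups is even. Let $\mathcal N_t$ be the free $\mathcal L$-module on these diagrams. For $w\in W^{\mathfrak p}$ let $\alpha_w\in\{+,-\}^n$ be the sequence obtained from $(+,\dots,+)$ by applying successively, from left to right, the letters of a word for $w$, where $s_i$ ($i\ge1$) swaps the signs at the places $i,i+1$, and $s_0$ swaps the signs at the places $1,2$ and changes both. Let $\underline w$ be the decorated cup diagram obtained from $\alpha_w$ by successively joining neighbouring pairs $+-$ by undotted cups, ignoring the signs already joined, then joining the remaining $-$ in pairs from left to right by dotted cups, and attaching edges to the remaining signs, dotted for $-$ and undotted for $+$. Then $w\mapsto\underline w$ is a bijection from $W^{\mathfrak p}$ to the set of even decorated cup diagrams, so that $\Phi(\underline N_w)=\underline w$ defines an isomorphism of $\mathcal L$-modules $\Phi:\mathcal N\to\mathcal N_t$. There is an action of $\mathbb{DT}_n$ on $\mathcal N_t$ in which $e_i$ acts on a cup diagram $b$ by putting $e_i$ on top of $b$ and applying the rules (i)–(v), which gives an $\mathcal L$-multiple of an even decorated cup diagram. Moreover: 1. $\Phi(xC_{s_i})=e_i\,\Phi(x)$ for all $x\in\mathcal N$ and $0\le i\le n-1$. 2.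 The action of $\mathbb{DT}_n$ factors through $\widehat{\mathrm{TL}}(W)$, which is the quotient of $\mathbb{DT}_n$ modulo the relations (i)–(iii) if $n$ is odd, and modulo the relations (i)–(iii) together with the subspace $I$ spanned by all tangles in $\mathbb{DT}_n$ without edges and with an odd number of undotted cups if $n$ is even. Here a cup counts as undotted if its number of dots is even; modulo (i)–(iii), the same subspace is obtained with caps in place of cups; and the subspace that is factored out is a two-sided ideal. 3. The resulting action of $\widehat{\mathrm{TL}}(W)$ on $\mathcal N_t$ is faithful. -/

import Mathlib

open scoped LaurentPolynomial

noncomputable section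

namespace TypeD

/-! ### The Coxeter group of type `D_n` -/

/-- Adjacency in the Dynkin diagram of type `D_n` with vertices `0, 1, …, n - 1`: the vertices
`0` and `1` are both joined to `2`, and `i` is joined to `i + 1` for `2 ≤ i`. -/
def dynkinAdj (a b : ℕ) : Prop :=
  (a = 0 ∧ b = 2) ∨ (b = 0 ∧ a = 2) ∨ (1 ≤ a ∧ b = a + 1) ∨ (1 ≤ b ∧ a = b + 1)

instance (a b : ℕ) : Decidable (dynkinAdj a b) := by
  unfold dynkinAdj; infer_instance

/-- The Coxeter matrix of type `D_n`, indexed by `0, …, n - 1`. -/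
def coxeterMatrix (n : ℕ) : CoxeterMatrix (Fin n) where
  M := Matrix.of fun i j => if i = j then 1 else if dynkinAdj i j then 3 else 2
  isSymm := by
    ext i j
    have h : dynkinAdj (j : ℕ) i ↔ dynkinAdj (i : ℕ) j := by unfold dynkinAdj; omega
    simp only [Matrix.transpose_apply, Matrix.of_apply, h, eq_comm (a := j) (b := i)]
  diagonal := by simp
  off_diagonal := by
    intro i j hij
    simp only [Matrix.of_apply, if_neg hij]
    split_ifs <;> simp

/-- The Weyl group `W` of type `D_n`, as an abstract Coxeter group. -/
abbrev W (n : ℕ) : Type := (coxeterMatrix n).Group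

/-- The Coxeter system `(W, {s_0, …, s_{n-1}})`. -/
abbrev cox (n : ℕ) : CoxeterSystem (coxeterMatrix n) (W n) := (coxeterMatrix n).toCoxeterSystem

/-- The simple reflection `s_i`. -/
abbrev s {n : ℕ} (i : Fin n) : W n := (cox n).simple i

/-- The Coxeter length. -/
abbrev len {n : ℕ} (w : W n) : ℕ := (cox n).length w

/-- `W^𝔭`: the shortest coset representatives for `W_𝔭 \ W`, where `W_𝔭` is generated by
`s_1, …, s_{n-1}`. -/
def Wp (n : ℕ) : Type := {w : W n // ∀ i : Fin n, i.1 ≠ 0 → len w < len (s i * w)}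

/-! ### The sign sequence of an element of `W` -/

/-- The left one of the two places that `s_i` acts on: place `1` for `i = 0`, and place `i`
otherwise. Places `1, …, n` are the elements `0, …, n - 1` of `Fin n`. -/
def lo {n : ℕ} (i : Fin n) : Fin n := ⟨i.1 - 1, by omega⟩

/-- The right one of the two places that `s_i` acts on: place `2` for `i = 0`, and place `i + 1`
otherwise. (The reduction modulo `n` only matters for `n = 1`.) -/
def hi {n : ℕ} (i : Fin n) : Fin n := ⟨max i.1 1 % n, Nat.mod_lt _ i.pos⟩

/-- Swap the signs at the places `x` and `y` and multiply both by `ε`. -/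
def signedSwap {n : ℕ} (ε : ℤˣ) (x y : Fin n) (α : Fin n → ℤˣ) : Fin n → ℤˣ := fun k =>
  (if k = x ∨ k = y then ε else 1) * α (Equiv.swap x y k)

/-- The action of `s_i` on sequences of signs: for `i ≠ 0` it swaps the signs at the places `i` and
`i + 1`; for `i = 0` it swaps the signs at the places `1` and `2` and changes both. -/
def reflSeq {n : ℕ} (i : Fin n) (α : Fin n → ℤˣ) : Fin n → ℤˣ :=
  signedSwap (if i.1 = 0 then -1 else 1) (lo i) (hi i) α

theorem signedSwap_self {n : ℕ} (ε : ℤˣ) (x y : Fin n) (α : Fin n → ℤˣ) :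
    signedSwap ε x y (signedSwap ε x y α) = α := by
  funext k
  have h : (Equiv.swap x y k = x ∨ Equiv.swap x y k = y) ↔ (k = x ∨ k = y) := by
    rw [Equiv.swap_apply_eq_iff, Equiv.swap_apply_eq_iff, Equiv.swap_apply_left,
      Equiv.swap_apply_right, or_comm]
  simp only [signedSwap, h, Equiv.swap_apply_self]
  rw [← mul_assoc]
  split_ifs <;> simp [Int.units_mul_self]

theorem signedSwap_comm {n : ℕ} (ε δ : ℤˣ) {x y z t : Fin n} (h1 : x ≠ z) (h2 : x ≠ t)
    (h3 : y ≠ z) (h4 : y ≠ t) (α : Fin n → ℤˣ) :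
    signedSwap ε x y (signedSwap δ z t α) = signedSwap δ z t (signedSwap ε x y α) := by
  funext k
  simp only [signedSwap, Equiv.swap_apply_def]
  grind

theorem signedSwap_comm' {n : ℕ} (ε δ : ℤˣ) (x y : Fin n) (α : Fin n → ℤˣ) :
    signedSwap ε x y (signedSwap δ x y α) = signedSwap δ x y (signedSwap ε x y α) := by
  funext k
  simp only [signedSwap, Equiv.swap_apply_def]
  grind

theorem signedSwap_symm {n : ℕ} (ε : ℤˣ) (x y : Fin n) (α : Fin n → ℤˣ) :
    signedSwap ε x y α = signedSwap ε y x α := by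
  funext k
  simp only [signedSwap, Equiv.swap_comm x y, or_comm]

theorem signedSwap_braid {n : ℕ} (ε δ : ℤˣ) {x y z : Fin n} (h1 : x ≠ y) (h2 : y ≠ z)
    (h3 : x ≠ z) (α : Fin n → ℤˣ) :
    signedSwap ε x y (signedSwap δ y z (signedSwap ε x y α)) =
      signedSwap δ y z (signedSwap ε x y (signedSwap δ y z α)) := by
  have he := Int.units_mul_self ε
  have hd := Int.units_mul_self δ
  funext k
  simp only [signedSwap]
  by_cases hx : k = x
  · subst hx
    simp [Equiv.swap_apply_of_ne_of_ne, h1, h2, h3, h2.symm, h3.symm, mul_left_comm]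
  by_cases hy : k = y
  · subst hy
    simp [Equiv.swap_apply_of_ne_of_ne, h1, h2, h3, h1.symm, h2.symm, h3.symm, ← mul_assoc, he, hd]
  by_cases hz : k = z
  · subst hz
    simp [Equiv.swap_apply_of_ne_of_ne, h1, h3, h1.symm, h2.symm, h3.symm, mul_left_comm]
  simp [Equiv.swap_apply_of_ne_of_ne, hx, hy, hz]

/-- `reflSeq` as a permutation of the set of sign sequences. -/
def reflPerm {n : ℕ} (i : Fin n) : Equiv.Perm (Fin n → ℤˣ) where
  toFun := reflSeq i
  invFun := reflSeq i
  left_inv := signedSwap_self _ _ _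
  right_inv := signedSwap_self _ _ _

theorem reflPerm_mul_self {n : ℕ} (i : Fin n) : reflPerm i * reflPerm i = 1 :=
  Equiv.ext fun α => signedSwap_self _ _ _ α

theorem reflPerm_comm {n : ℕ} {i j : Fin n} (hij : i ≠ j) (h : ¬ dynkinAdj i j) :
    reflPerm i * reflPerm j = reflPerm j * reflPerm i := by
  have hn : 1 < n := by
    have : i.1 ≠ j.1 := fun h => hij (Fin.ext h)
    omega
  have key : ∀ i : Fin n, max i.1 1 % n = max i.1 1 := fun i => Nat.mod_eq_of_lt (by omega)
  refine Equiv.ext fun α => ?_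
  change reflSeq i (reflSeq j α) = reflSeq j (reflSeq i α)
  have hne : i.1 ≠ j.1 := fun h => hij (Fin.ext h)
  by_cases h01 : i.1 + j.1 = 1
  · have hl : lo i = lo j := by simp only [lo, Fin.mk.injEq]; omega
    have hh : hi i = hi j := by
      simp only [hi, Fin.mk.injEq, key]
      omega
    unfold reflSeq
    rw [hl, hh]
    exact signedSwap_comm' _ _ _ _ _
  · unfold dynkinAdj at h
    apply signedSwap_comm <;> simp only [lo, hi, key, ne_eq, Fin.mk.injEq] <;> omega

theorem reflPerm_braid {n : ℕ} {i j : Fin n} (h : dynkinAdj i j) (hlt : i.1 < j.1) :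
    reflPerm i * reflPerm j * reflPerm i = reflPerm j * reflPerm i * reflPerm j := by
  have hn : 1 < n := by omega
  have key : ∀ i : Fin n, max i.1 1 % n = max i.1 1 := fun i => Nat.mod_eq_of_lt (by omega)
  refine Equiv.ext fun α => ?_
  change reflSeq i (reflSeq j (reflSeq i α)) = reflSeq j (reflSeq i (reflSeq j α))
  unfold dynkinAdj at h
  have hl : lo j = hi i := by
    simp only [lo, hi, Fin.mk.injEq, key]; omega
  unfold reflSeq
  rw [hl]
  apply signedSwap_braid <;> simp only [lo, hi, key, ne_eq, Fin.mk.injEq] <;> omega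

theorem pow_three_of_braid {G : Type*} [Group G] {a b : G} (ha : a * a = 1) (hb : b * b = 1)
    (h : a * b * a = b * a * b) : (a * b) ^ 3 = 1 := by
  calc (a * b) ^ 3 = (a * b * a) * (b * a * b) := by simp only [pow_succ, pow_zero, one_mul, mul_assoc]
    _ = (b * a * b) * (b * a * b) := by rw [h]
    _ = b * a * (b * b) * a * b := by simp only [mul_assoc]
    _ = b * (a * a) * b := by rw [hb]; simp only [mul_assoc, mul_one]
    _ = 1 := by rw [ha, mul_one, hb]

theorem reflPerm_liftable (n : ℕ) :
    (coxeterMatrix n).IsLiftable (reflPerm : Fin n → Equiv.Perm (Fin n → ℤˣ)) := by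
  intro i j
  change (reflPerm i * reflPerm j) ^ (if i = j then 1 else if dynkinAdj i j then 3 else 2) = 1
  split_ifs with h1 h2
  · subst h1
    rw [pow_one, reflPerm_mul_self]
  · have hne : i.1 ≠ j.1 := fun h => h1 (Fin.ext h)
    apply pow_three_of_braid (reflPerm_mul_self i) (reflPerm_mul_self j)
    rcases Nat.lt_or_gt_of_ne hne with hlt | hlt
    · exact reflPerm_braid h2 hlt
    · refine (reflPerm_braid ?_ hlt).symm
      unfold dynkinAdj at h2 ⊢
      omega
  · rw [pow_two, mul_assoc, ← mul_assoc (reflPerm j), ← reflPerm_comm h1 h2, mul_assoc,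
      reflPerm_mul_self, mul_one, reflPerm_mul_self]

/-- The action of `W` on sign sequences. -/
def seqAction (n : ℕ) : W n →* Equiv.Perm (Fin n → ℤˣ) :=
  (cox n).lift ⟨reflPerm, reflPerm_liftable n⟩

/-- The sign sequence `α_w` of `w`, obtained from `(+, …, +)` by letting the letters of a word for
`w` act one after the other, read from left to right. So `α_e = (+, …, +)` and
`α_{w s_i} = reflSeq i α_w`. -/
def signSeq {n : ℕ} (w : W n) : Fin n → ℤˣ := seqAction n w⁻¹ 1

/-! ### The Hecke algebra and its parabolic module -/

/-- The ring `ℤ[q, q⁻¹]`. -/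
abbrev L : Type := ℤ[T;T⁻¹]

/-- The element `q`. -/
abbrev q : L := LaurentPolynomial.T 1

/-- The element `q⁻¹`. -/
abbrev qi : L := LaurentPolynomial.T (-1)

/-- The defining relations of the Hecke algebra, on generators `H_w`, `w ∈ W`. -/
inductive HeckeRel (n : ℕ) : FreeAlgebra L (W n) → FreeAlgebra L (W n) → Prop
  | one : HeckeRel n (FreeAlgebra.ι L 1) 1
  | mul (v w : W n) (h : len v + len w = len (v * w)) :
      HeckeRel n (FreeAlgebra.ι L v * FreeAlgebra.ι L w) (FreeAlgebra.ι L (v * w))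
  | sq (i : Fin n) :
      HeckeRel n (FreeAlgebra.ι L (s i) * FreeAlgebra.ι L (s i))
        ((qi - q) • FreeAlgebra.ι L (s i) + 1)

/-- The Hecke algebra of `W` over `ℤ[q, q⁻¹]`: generators `H_w`, relations
`H_v H_w = H_{vw}` if lengths add up, and `H_s² = (q⁻¹ - q) H_s + H_e` with `H_e = 1`. -/
def Hecke (n : ℕ) : Type := RingQuot (HeckeRel n)

instance (n : ℕ) : Semiring (Hecke n) := inferInstanceAs (Semiring (RingQuot (HeckeRel n)))

instance (n : ℕ) : Algebra L (Hecke n) := inferInstanceAs (Algebra L (RingQuot (HeckeRel n)))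

instance (n : ℕ) : Ring (Hecke n) := Algebra.semiringToRing L

/-- The standard basis element `H_w`. -/
def H {n : ℕ} (w : W n) : Hecke n := RingQuot.mkAlgHom L (HeckeRel n) (FreeAlgebra.ι L w)

/-- The Kazhdan–Lusztig generator `C_{s_i} = H_{s_i} + q`. -/
def C {n : ℕ} (i : Fin n) : Hecke n := H (s i) + algebraMap L (Hecke n) q

/-- The projection from the free algebra. -/
def heckeProj (n : ℕ) : FreeAlgebra L (W n) →ₐ[L] Hecke n := RingQuot.mkAlgHom L (HeckeRel n)

theorem H_one (n : ℕ) : H (1 : W n) = 1 :=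
  (RingQuot.mkAlgHom_rel L (HeckeRel.one (n := n))).trans (map_one (heckeProj n))

theorem H_mul {n : ℕ} (v w : W n) (h : len v + len w = len (v * w)) :
    H v * H w = H (v * w) :=
  (map_mul (heckeProj n) _ _).symm.trans (RingQuot.mkAlgHom_rel L (HeckeRel.mul v w h))

theorem H_sq {n : ℕ} (i : Fin n) : H (s i) * H (s i) = (qi - q) • H (s i) + 1 := by
  have h : heckeProj n _ = heckeProj n _ := RingQuot.mkAlgHom_rel L (HeckeRel.sq i)
  simp only [map_mul, map_add, map_smul, map_one] at h
  exact h

theorem qi_mul_q : qi * q = 1 := by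
  rw [← LaurentPolynomial.T_add]; simp

theorem H_s_mul_inv {n : ℕ} (i : Fin n) : H (s i) * (H (s i) - (qi - q) • 1) = 1 := by
  rw [mul_sub, H_sq]; simp

theorem H_inv_mul_s {n : ℕ} (i : Fin n) : (H (s i) - (qi - q) • 1) * H (s i) = 1 := by
  rw [sub_mul, H_sq]; simp

theorem isUnit_H_s {n : ℕ} (i : Fin n) : IsUnit (H (s i)) :=
  ⟨⟨_, _, H_s_mul_inv i, H_inv_mul_s i⟩, rfl⟩

theorem inverse_H_s {n : ℕ} (i : Fin n) :
    Ring.inverse (H (s i)) = H (s i) - (qi - q) • 1 :=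
  Ring.inverse_unit ⟨_, _, H_s_mul_inv i, H_inv_mul_s i⟩

theorem isUnit_H {n : ℕ} (w : W n) : IsUnit (H w) := by
  induction h : len w generalizing w with
  | zero =>
    rw [(cox n).length_eq_zero_iff] at h
    subst h
    rw [H_one]; exact isUnit_one
  | succ k ih =>
    have hw : w ≠ 1 := by
      rintro rfl; simp at h
    obtain ⟨i, hi⟩ := (cox n).exists_leftDescent_of_ne_one hw
    have h1 : len (s i * w) + 1 = len w := (cox n).isLeftDescent_iff.1 hi
    have h2 := H_mul (s i) (s i * w) (by
      have h3 : len (s i) = 1 := (cox n).length_simple i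
      rw [(cox n).simple_mul_simple_cancel_left]; omega)
    rw [(cox n).simple_mul_simple_cancel_left] at h2
    rw [← h2]
    exact (isUnit_H_s i).mul (ih _ (by omega))

/-- The substitution `q ↦ q⁻¹`. -/
abbrev σ : L →+* L := (LaurentPolynomial.invert (R := ℤ)).toRingEquiv.toRingHom

/-- The bar involution on the free algebra, with values in the Hecke algebra. -/
def barFree (n : ℕ) : FreeAlgebra L (W n) →+* Hecke n :=
  letI : Algebra L (Hecke n) :=
    ((algebraMap L (Hecke n)).comp σ).toAlgebra' fun a x => Algebra.commutes (σ a) x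
  (FreeAlgebra.lift L fun w : W n => Ring.inverse (H w⁻¹)).toRingHom

theorem barFree_ι {n : ℕ} (w : W n) : barFree n (FreeAlgebra.ι L w) = Ring.inverse (H w⁻¹) := by
  let _ : Algebra L (Hecke n) :=
    ((algebraMap L (Hecke n)).comp σ).toAlgebra' fun a x => Algebra.commutes (σ a) x
  exact FreeAlgebra.lift_ι_apply _ _

theorem barFree_smul {n : ℕ} (a : L) (x : FreeAlgebra L (W n)) :
    barFree n (a • x) = σ a • barFree n x := by
  have h : barFree n (algebraMap L _ a) = algebraMap L (Hecke n) (σ a) := by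
    let _ : Algebra L (Hecke n) :=
      ((algebraMap L (Hecke n)).comp σ).toAlgebra' fun a x => Algebra.commutes (σ a) x
    exact AlgHom.commutes
      (FreeAlgebra.lift L fun w : W n => Ring.inverse (H w⁻¹)) a
  rw [Algebra.smul_def, map_mul, h, ← Algebra.smul_def]

theorem inverse_mul_of_isUnit {R : Type*} [Semiring R] {x y : R} (hx : IsUnit x) (hy : IsUnit y) :
    Ring.inverse (x * y) = Ring.inverse y * Ring.inverse x := by
  obtain ⟨u, rfl⟩ := hx
  obtain ⟨v, rfl⟩ := hy
  rw [← Units.val_mul, Ring.inverse_unit, Ring.inverse_unit, Ring.inverse_unit, mul_inv_rev,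
    Units.val_mul]

theorem barFree_rel {n : ℕ} {x y : FreeAlgebra L (W n)} (h : HeckeRel n x y) :
    barFree n x = barFree n y := by
  cases h with
  | one => rw [barFree_ι, inv_one, H_one, map_one, Ring.inverse_one]
  | mul v w h =>
    have h' : len w⁻¹ + len v⁻¹ = len (w⁻¹ * v⁻¹) := by
      have h1 : len v⁻¹ = len v := (cox n).length_inv v
      have h2 : len w⁻¹ = len w := (cox n).length_inv w
      have h3 : len (v * w)⁻¹ = len (v * w) := (cox n).length_inv _
      rw [← mul_inv_rev]; omega
    rw [map_mul, barFree_ι, barFree_ι, barFree_ι, mul_inv_rev, ← H_mul _ _ h',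
      inverse_mul_of_isUnit (isUnit_H _) (isUnit_H _)]
  | sq i =>
    have hσ : σ (qi - q) = -(qi - q) := by simp [σ]
    rw [map_mul, map_add, barFree_smul, map_one, barFree_ι, (cox n).inv_simple, inverse_H_s, hσ,
      mul_sub, H_inv_mul_s, neg_smul, sub_eq_add_neg, add_comm, mul_smul_comm, mul_one]

/-- The bar involution of the Hecke algebra: the ring homomorphism with `q ↦ q⁻¹` and
`H_w ↦ (H_{w⁻¹})⁻¹`; see `bar_H` and `bar_smul`. -/
def bar (n : ℕ) : Hecke n →+* Hecke n :=
  RingQuot.lift ⟨barFree n, fun _ _ h => barFree_rel h⟩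

theorem bar_proj {n : ℕ} (x : FreeAlgebra L (W n)) : bar n (heckeProj n x) = barFree n x := by
  have : heckeProj n x = RingQuot.mkRingHom (HeckeRel n) x := by
    rw [← RingQuot.mkAlgHom_coe L]; rfl
  rw [this]
  exact RingQuot.lift_mkRingHom_apply _ _ _

theorem bar_H {n : ℕ} (w : W n) : bar n (H w) = Ring.inverse (H w⁻¹) :=
  (bar_proj _).trans (barFree_ι w)

theorem bar_smul {n : ℕ} (a : L) (x : Hecke n) : bar n (a • x) = σ a • bar n x := by
  obtain ⟨y, rfl⟩ := RingQuot.mkAlgHom_surjective L (HeckeRel n) x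
  change bar n (a • heckeProj n y) = σ a • bar n (heckeProj n y)
  rw [← map_smul, bar_proj, bar_proj, barFree_smul]

theorem bar_C {n : ℕ} (i : Fin n) : bar n (C i) = C i := by
  have h : bar n (algebraMap L (Hecke n) q) = algebraMap L (Hecke n) qi := by
    rw [Algebra.algebraMap_eq_smul_one, bar_smul, map_one, Algebra.algebraMap_eq_smul_one]
    simp [σ]
  rw [C, map_add, bar_H, (cox n).inv_simple, inverse_H_s, h, sub_smul, Algebra.algebraMap_eq_smul_one,
    Algebra.algebraMap_eq_smul_one]
  abel

/-- The submodule of `Hecke n` spanned by all `C_s h` with `s ∈ S_𝔭`. -/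
def parSubmodule (n : ℕ) : Submodule L (Hecke n) :=
  Submodule.span L {x | ∃ (i : Fin n) (h : Hecke n), i.1 ≠ 0 ∧ x = C i * h}

/-- The right `Hecke n`-module `N = ℤ[q, q⁻¹] ⊗_{H_𝔭} Hecke n`, where `H_𝔭` is the subalgebra
generated by the `C_s` with `s ∈ S_𝔭` and these `C_s` act by zero on `ℤ[q, q⁻¹]`. The tensor
product is the quotient of `Hecke n` by all `C_s h`; the class of `h` is `1 ⊗ h`. -/
abbrev N (n : ℕ) : Type := Hecke n ⧸ parSubmodule n

/-- The right action of `h` on `N`. -/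
def actN {n : ℕ} (h : Hecke n) : N n →ₗ[L] N n :=
  Submodule.mapQ _ _ (LinearMap.mulRight L h) <| by
    rw [parSubmodule, Submodule.span_le]
    rintro _ ⟨i, g, hi, rfl⟩
    exact Submodule.subset_span ⟨i, g * h, hi, mul_assoc _ _ _⟩

/-- The standard basis element `N_w = 1 ⊗ H_w`. -/
def stdN {n : ℕ} (w : Wp n) : N n := Submodule.Quotient.mk (H w.1)

/-- The involution of `N` induced by the bar involution. -/
def barN (n : ℕ) : N n →+ N n :=
  QuotientAddGroup.map _ _ (bar n).toAddMonoidHom <| by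
    intro x hx
    induction hx using Submodule.span_induction with
    | mem x hx =>
      obtain ⟨i, h, hi, rfl⟩ := hx
      refine Submodule.subset_span ⟨i, bar n h, hi, ?_⟩
      change bar n (C i * h) = _
      rw [map_mul, bar_C]
    | zero => exact zero_mem _
    | add x y _ _ hx hy => exact add_mem hx hy
    | smul a x _ hx =>
      change bar n (a • x) ∈ parSubmodule n
      rw [bar_smul]
      exact Submodule.smul_mem _ _ hx

/-- `x` is the Kazhdan–Lusztig basis element of `N` attached to `w`: it is fixed by the bar
involution and lies in `N_w + ∑_{v ≠ w} q ℤ[q] N_v`. -/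
def IsKLElement {n : ℕ} (w : Wp n) (x : N n) : Prop :=
  barN n x = x ∧ x - stdN w ∈
    AddSubgroup.closure {y : N n | ∃ (v : Wp n) (k : ℕ), v ≠ w ∧ y = q ^ (k + 1) • stdN v}

/-! ### Decorated tangles -/

/-- Combinatorial data of a decorated diagram with `m` points on the bottom face and `n` points on
the top face of a rectangle: a finite set of components (the lines and circles), for every boundary
point the component which it belongs to (`Sum.inl j` is the bottom point `j`, `Sum.inr i` the top
point `i`), and for every component its number of dots. The geometric conditions are stated
separately in `PreDiag.IsTangle`. -/
structure PreDiag (m n : ℕ) where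
  /-- The components. -/
  Comp : Type
  finite : Finite Comp
  /-- The component of a boundary point. -/
  e : Fin m ⊕ Fin n → Comp
  /-- The number of dots of a component. -/
  dots : Comp →₀ ℕ

namespace PreDiag

/-- Two diagrams are the same if there is a bijection of the components which is compatible with
the boundary points and the numbers of dots. -/
def Iso {m n : ℕ} (P Q : PreDiag m n) : Prop :=
  ∃ φ : P.Comp ≃ Q.Comp, (∀ x, φ (P.e x) = Q.e x) ∧ P.dots.mapDomain φ = Q.dots

instance setoid (m n : ℕ) : Setoid (PreDiag m n) where
  r := Iso
  iseqv :=
    { refl := fun P => ⟨Equiv.refl _, fun _ => rfl, Finsupp.mapDomain_id⟩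
      symm := by
        rintro P Q ⟨φ, h1, h2⟩
        refine ⟨φ.symm, fun x => by rw [← h1, φ.symm_apply_apply], ?_⟩
        rw [← h2, ← Finsupp.mapDomain_comp, φ.symm_comp_self, Finsupp.mapDomain_id]
      trans := by
        rintro P Q R ⟨φ, h1, h2⟩ ⟨ψ, h3, h4⟩
        refine ⟨φ.trans ψ, fun x => by rw [Equiv.trans_apply, h1, h3], ?_⟩
        rw [← h4, ← h2, ← Finsupp.mapDomain_comp]; rfl }

/-- Gluing of components: for every point `j` on the middle line, the component of `S` at the
bottom point `j` becomes the same as the component of `T` at the top point `j`. -/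
inductive Glue {m k n : ℕ} (S : PreDiag k n) (T : PreDiag m k) :
    S.Comp ⊕ T.Comp → S.Comp ⊕ T.Comp → Prop
  | mk (j : Fin k) : Glue S T (Sum.inl (S.e (Sum.inl j))) (Sum.inr (T.e (Sum.inr j)))

/-- The components after concatenation. -/
abbrev GlueComp {m k n : ℕ} (S : PreDiag k n) (T : PreDiag m k) : Type := Quot (Glue S T)

/-- The component of the concatenation that contains a given component of the upper diagram. -/
def up {m k n : ℕ} (S : PreDiag k n) (T : PreDiag m k) (c : S.Comp) : GlueComp S T :=
  Quot.mk _ (Sum.inl c)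

/-- The component of the concatenation that contains a given component of the lower diagram. -/
def down {m k n : ℕ} (S : PreDiag k n) (T : PreDiag m k) (c : T.Comp) : GlueComp S T :=
  Quot.mk _ (Sum.inr c)

theorem up_eq_down {m k n : ℕ} (S : PreDiag k n) (T : PreDiag m k) (j : Fin k) :
    up S T (S.e (Sum.inl j)) = down S T (T.e (Sum.inr j)) := Quot.sound (Glue.mk j)

/-- Vertical concatenation, `S` on top of `T`. -/
abbrev comp {m k n : ℕ} (S : PreDiag k n) (T : PreDiag m k) : PreDiag m n where
  Comp := GlueComp S T
  finite := by
    have := S.finite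
    have := T.finite
    infer_instance
  e := Sum.elim (fun j => down S T (T.e (Sum.inl j))) (fun i => up S T (S.e (Sum.inr i)))
  dots := S.dots.mapDomain (up S T) + T.dots.mapDomain (down S T)

/-- Maps out of the set of components of a concatenation. -/
def glueLift {m k n : ℕ} {S : PreDiag k n} {T : PreDiag m k} {X : Type} (f : S.Comp → X)
    (g : T.Comp → X) (h : ∀ j, f (S.e (Sum.inl j)) = g (T.e (Sum.inr j))) : GlueComp S T → X :=
  Quot.lift (Sum.elim f g) (by rintro _ _ ⟨j⟩; exact h j)

theorem glue_ext {m k n : ℕ} {S : PreDiag k n} {T : PreDiag m k} {P : GlueComp S T → Prop}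
    (h1 : ∀ c, P (up S T c)) (h2 : ∀ c, P (down S T c)) (x : GlueComp S T) : P x := by
  induction x using Quot.ind with
  | mk x => cases x with
    | inl c => exact h1 c
    | inr c => exact h2 c

theorem comp_congr {m k n : ℕ} {S S' : PreDiag k n} {T T' : PreDiag m k} (hS : S ≈ S')
    (hT : T ≈ T') : comp S T ≈ comp S' T' := by
  obtain ⟨φ, h1, h2⟩ := hS
  obtain ⟨ψ, h3, h4⟩ := hT
  have h1' : ∀ x, φ.symm (S'.e x) = S.e x := fun x => by rw [← h1, φ.symm_apply_apply]
  have h3' : ∀ x, ψ.symm (T'.e x) = T.e x := fun x => by rw [← h3, ψ.symm_apply_apply]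
  refine ⟨⟨glueLift (fun c => up S' T' (φ c)) (fun c => down S' T' (ψ c)) ?_,
    glueLift (fun c => up S T (φ.symm c)) (fun c => down S T (ψ.symm c)) ?_, ?_, ?_⟩, ?_, ?_⟩
  · intro j; rw [h1, h3]; exact up_eq_down S' T' j
  · intro j; rw [h1', h3']; exact up_eq_down S T j
  · refine glue_ext (fun c => ?_) (fun c => ?_)
    · exact congrArg (up S T) (φ.symm_apply_apply c)
    · exact congrArg (down S T) (ψ.symm_apply_apply c)
  · refine glue_ext (fun c => ?_) (fun c => ?_)
    · exact congrArg (up S' T') (φ.apply_symm_apply c)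
    · exact congrArg (down S' T') (ψ.apply_symm_apply c)
  · rintro (j | i)
    · exact congrArg (down S' T') (h3 _)
    · exact congrArg (up S' T') (h1 _)
  · change Finsupp.mapDomain _ (S.dots.mapDomain (up S T) + T.dots.mapDomain (down S T)) =
      S'.dots.mapDomain (up S' T') + T'.dots.mapDomain (down S' T')
    rw [Finsupp.mapDomain_add, ← Finsupp.mapDomain_comp, ← Finsupp.mapDomain_comp, ← h2, ← h4,
      ← Finsupp.mapDomain_comp, ← Finsupp.mapDomain_comp]
    rfl

theorem comp_assoc {l m k n : ℕ} (S : PreDiag k n) (T : PreDiag m k) (U : PreDiag l m) :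
    comp (comp S T) U ≈ comp S (comp T U) := by
  refine ⟨⟨glueLift (glueLift (fun c => up S (comp T U) c) (fun c => down S (comp T U) (up T U c))
      ?_) (fun c => down S (comp T U) (down T U c)) ?_,
    glueLift (fun c => up (comp S T) U (up S T c)) (glueLift
      (fun c => up (comp S T) U (down S T c)) (fun c => down (comp S T) U c) ?_) ?_, ?_, ?_⟩,
      ?_, ?_⟩
  · intro j; exact up_eq_down S (comp T U) j
  · intro j; exact congrArg (down S (comp T U)) (up_eq_down T U j)
  · intro j; exact up_eq_down (comp S T) U j
  · intro j; exact congrArg (up (comp S T) U) (up_eq_down S T j)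
  · exact glue_ext (glue_ext (fun _ => rfl) (fun _ => rfl)) (fun _ => rfl)
  · exact glue_ext (fun _ => rfl) (glue_ext (fun _ => rfl) (fun _ => rfl))
  · rintro (j | i) <;> rfl
  · change Finsupp.mapDomain _ ((S.dots.mapDomain (up S T) + T.dots.mapDomain (down S T)).mapDomain
      (up (comp S T) U) + U.dots.mapDomain (down (comp S T) U)) = S.dots.mapDomain
      (up S (comp T U)) + (T.dots.mapDomain (up T U) + U.dots.mapDomain (down T U)).mapDomain
      (down S (comp T U))
    simp only [Finsupp.mapDomain_add, ← Finsupp.mapDomain_comp, add_assoc]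
    rfl

/-- The identity tangle: `n` vertical undotted edges. -/
abbrev id (n : ℕ) : PreDiag n n where
  Comp := Fin n
  finite := inferInstance
  e := Sum.elim (fun j => j) (fun i => i)
  dots := 0

theorem id_comp {m n : ℕ} (T : PreDiag m n) : comp (id n) T ≈ T := by
  refine ⟨⟨glueLift (fun c => T.e (Sum.inr c)) (fun c => c) fun _ => rfl,
    fun c => down (id n) T c, ?_, fun _ => rfl⟩, ?_, ?_⟩
  · exact glue_ext (fun c => (up_eq_down (id n) T c).symm) (fun _ => rfl)
  · rintro (j | i) <;> rfl
  · change Finsupp.mapDomain _ (Finsupp.mapDomain _ 0 + T.dots.mapDomain (down (id n) T)) = T.dots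
    rw [Finsupp.mapDomain_zero, zero_add, ← Finsupp.mapDomain_comp]
    exact Finsupp.mapDomain_id

theorem comp_id {m n : ℕ} (T : PreDiag m n) : comp T (id m) ≈ T := by
  refine ⟨⟨glueLift (fun c => c) (fun c => T.e (Sum.inl c)) fun _ => rfl,
    fun c => up T (id m) c, ?_, fun _ => rfl⟩, ?_, ?_⟩
  · exact glue_ext (fun _ => rfl) (fun c => up_eq_down T (id m) c)
  · rintro (j | i) <;> rfl
  · change Finsupp.mapDomain _ (T.dots.mapDomain (up T (id m)) + Finsupp.mapDomain _ 0) = T.dots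
    rw [Finsupp.mapDomain_zero, add_zero, ← Finsupp.mapDomain_comp]
    exact Finsupp.mapDomain_id


/-- The position of a boundary point on the boundary of the rectangle, read clockwise from the left
face: first the top points from left to right, then the bottom points from right to left. -/
def pos {m n : ℕ} : Fin m ⊕ Fin n → ℕ :=
  Sum.elim (fun j => n + (m - 1 - j.1)) (fun i => i.1)

/-- The conditions for a decorated tangle: every boundary point is connected to exactly one other
boundary point (so that a component is a line with two end points, or a circle), the lines do not
intersect, and every dotted line is accessible from the left face, that is, no line separates it
from the left face. (Circles can always be drawn next to the left face.) -/
structure IsTangle {m n : ℕ} (P : PreDiag m n) : Prop where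
  paired : ∀ x, ∃! y, y ≠ x ∧ P.e y = P.e x
  planar : ∀ a b c d, pos a < pos b → pos b < pos c → pos c < pos d →
    P.e a = P.e c → P.e b = P.e d → P.e a = P.e b
  accessible : ∀ x, 0 < P.dots (P.e x) → ∀ a b, P.e a = P.e b → ¬ (pos a < pos x ∧ pos x < pos b)

theorem IsTangle.congr {m n : ℕ} {P Q : PreDiag m n} (h : P ≈ Q) (hP : P.IsTangle) :
    Q.IsTangle := by
  obtain ⟨φ, h1, h2⟩ := h
  have key : ∀ x y, Q.e x = Q.e y ↔ P.e x = P.e y := fun x y => by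
    rw [← h1, ← h1, φ.apply_eq_iff_eq]
  have hd : ∀ x, Q.dots (Q.e x) = P.dots (P.e x) := fun x => by
    rw [← h1, ← h2, Finsupp.mapDomain_apply φ.injective]
  exact ⟨by simpa only [key] using hP.paired, by simpa only [key] using hP.planar,
    by simpa only [key, hd] using hP.accessible⟩

/-- Planarity of a system of lines and dots on a set `A` of points on a line; `R` is the relation
of belonging to the same component, `D` says that the component of a point is dotted. -/
structure Planar {X : Type} (p : X → ℕ) (A : X → Prop) (R : X → X → Prop) (D : X → Prop) :
    Prop where
  eqv : Equivalence R
  dot : ∀ x y, R x y → D x → D y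
  paired : ∀ x, A x → ∃ y, A y ∧ y ≠ x ∧ R x y ∧ ∀ z, A z → R x z → z = x ∨ z = y
  planar : ∀ a b c d, A a → A b → A c → A d → p a < p b → p b < p c → p c < p d →
    R a c → R b d → R a b
  acc : ∀ x a b, A x → A a → A b → D x → R a b → p a < p x → p x < p b → R x a

theorem Planar.step {X : Type} {p : X → ℕ} (hp : Function.Injective p) {A : X → Prop}
    {R : X → X → Prop} {D : X → Prop} (h : Planar p A R D) {u v : X} (hu : A u) (hv : A v)
    (huv : p u < p v) (hadj : ∀ x, A x → ¬ (p u < p x ∧ p x < p v)) :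
    Planar p (fun x => A x ∧ x ≠ u ∧ x ≠ v)
      (fun x y => R x y ∨ ((R x u ∨ R x v) ∧ (R y u ∨ R y v)))
      (fun x => D x ∨ ((R x u ∨ R x v) ∧ (D u ∨ D v))) := by
  have hr := h.eqv.refl
  have hs : ∀ {x y}, R x y → R y x := fun h' => h.eqv.symm h'
  have ht : ∀ {x y z}, R x y → R y z → R x z := fun h1 h2 => h.eqv.trans h1 h2
  have hne : ∀ {x y}, x ≠ y → p x < p y ∨ p y < p x := fun h' =>
    Nat.lt_or_gt_of_ne fun h'' => h' (hp h'')
  have side : ∀ x, A x → x ≠ u → x ≠ v → (p x < p u ∧ p x < p v) ∨ (p u < p x ∧ p v < p x) := by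
    intro x hx h1 h2
    have := hadj x hx
    rcases hne h1 with h3 | h3 <;> rcases hne h2 with h4 | h4 <;> omega
  -- a class which is not merged does not separate a merged point from `u` and `v`
  have sep : ∀ a b c d, A a → A b → A c → A d → p a < p b → p b < p c → (p c < p d ∨ p d < p a) →
      R a c → R b d → R a b := by
    intro a b c d ha hb hc hd h1 h2 h3 h4 h5
    rcases h3 with h3 | h3
    · exact h.planar a b c d ha hb hc hd h1 h2 h3 h4 h5
    · exact ht h4 (ht (hs h4) (ht (hs (h.planar d a b c hd ha hb hc h3 h1 h2 (hs h5) h4)) (hs h5)))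
  have sep2 : ∀ a b c x, A a → A b → A c → A x → p a < p x → p x < p b → R a b →
      a ≠ u → a ≠ v → b ≠ u → b ≠ v →
      (R x u ∨ R x v) → (R c u ∨ R c v) → (p c < p a ∨ p b < p c) → (R a u ∨ R a v) := by
    intro a b c x ha hb hc hx h1 h2 hab hau hav hbu hbv hxm hcm hcs
    have sa := side a ha hau hav
    have sb := side b hb hbu hbv
    by_cases hin : p a < p u ∧ p u < p b
    · -- `u` and `v` are inside, `c` is outside
      have hin' : p a < p v ∧ p v < p b := by omega
      rcases hcm with hcm | hcm
      · exact Or.inl (sep a u b c ha hu hb hc hin.1 hin.2 (by omega) hab (hs hcm))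
      · exact Or.inr (sep a v b c ha hv hb hc hin'.1 hin'.2 (by omega) hab (hs hcm))
    · have hu' : p b < p u ∨ p u < p a := by omega
      have hv' : p b < p v ∨ p v < p a := by omega
      rcases hxm with hxm | hxm
      · exact Or.inl (ht (sep a x b u ha hx hb hu h1 h2 hu' hab hxm) hxm)
      · exact Or.inr (ht (sep a x b v ha hx hb hv h1 h2 hv' hab hxm) hxm)
  refine ⟨⟨fun x => Or.inl (hr x), ?_, ?_⟩, ?_, ?_, ?_, ?_⟩
  · rintro x y (h1 | ⟨h1, h2⟩)
    · exact Or.inl (hs h1)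
    · exact Or.inr ⟨h2, h1⟩
  · rintro x y z (h1 | ⟨h1, h2⟩) (h3 | ⟨h3, h4⟩)
    · exact Or.inl (ht h1 h3)
    · exact Or.inr ⟨h3.imp (ht h1) (ht h1), h4⟩
    · exact Or.inr ⟨h1, h2.imp (ht (hs h3)) (ht (hs h3))⟩
    · exact Or.inr ⟨h1, h4⟩
  · rintro x y (h1 | ⟨h1, h2⟩) (h3 | ⟨h3, h4⟩)
    · exact Or.inl (h.dot x y h1 h3)
    · exact Or.inr ⟨h3.imp (ht (hs h1)) (ht (hs h1)), h4⟩
    · exact Or.inr ⟨h2, h1.imp (fun h' => h.dot _ _ h' h3) (fun h' => h.dot _ _ h' h3)⟩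
    · exact Or.inr ⟨h2, h4⟩
  · rintro x ⟨hx, hxu, hxv⟩
    obtain ⟨a, ha, hau, hua, hza⟩ := h.paired u hu
    obtain ⟨b, hb, hbv, hvb, hzb⟩ := h.paired v hv
    obtain ⟨y, hy, hyx, hxy, hzy⟩ := h.paired x hx
    by_cases h1 : R x u
    · have hxa : x = a := by
        rcases hza x hx (hs h1) with h | h
        · exact absurd h hxu
        · exact h
      subst hxa
      have huv' : ¬ R u v := fun h' => by
        rcases hza v hv h' with h | h
        · exact absurd (congrArg p h) (by omega)
        · exact hxv h.symm
      refine ⟨b, ⟨hb, ?_, hbv⟩, ?_, Or.inr ⟨Or.inl h1, Or.inr (hs hvb)⟩, ?_⟩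
      · rintro rfl; exact huv' (hs hvb)
      · rintro rfl; exact huv' (ht hua (hs hvb))
      · rintro z ⟨hz, hzu, hzv⟩ (h' | ⟨_, h' | h'⟩)
        · exact Or.inl ((hza z hz (ht hua h')).resolve_left hzu)
        · exact Or.inl ((hza z hz (hs h')).resolve_left hzu)
        · exact Or.inr ((hzb z hz (hs h')).resolve_left hzv)
    · by_cases h2 : R x v
      · have hxb : x = b := (hzb x hx (hs h2)).resolve_left hxv
        subst hxb
        have huv' : ¬ R u v := fun h' => h1 (ht h2 (hs h'))
        refine ⟨a, ⟨ha, hau, ?_⟩, ?_, Or.inr ⟨Or.inr h2, Or.inl (hs hua)⟩, ?_⟩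
        · rintro rfl; exact huv' hua
        · rintro rfl; exact huv' (ht hua (hs hvb))
        · rintro z ⟨hz, hzu, hzv⟩ (h' | ⟨_, h' | h'⟩)
          · exact Or.inl ((hzb z hz (ht hvb h')).resolve_left hzv)
          · exact Or.inr ((hza z hz (hs h')).resolve_left hzu)
          · exact Or.inl ((hzb z hz (hs h')).resolve_left hzv)
      · refine ⟨y, ⟨hy, ?_, ?_⟩, hyx, Or.inl hxy, ?_⟩
        · rintro rfl; exact h1 hxy
        · rintro rfl; exact h2 hxy
        · rintro z ⟨hz, hzu, hzv⟩ (h' | ⟨h' | h', _⟩)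
          · exact hzy z hz h'
          · exact absurd h' h1
          · exact absurd h' h2
  · rintro a b c d ⟨ha, hau, hav⟩ ⟨hb, hbu, hbv⟩ ⟨hc, hcu, hcv⟩ ⟨hd, hdu, hdv⟩ h1 h2 h3
      (h4 | ⟨h4, h5⟩) (h6 | ⟨h6, h7⟩)
    · exact Or.inl (h.planar a b c d ha hb hc hd h1 h2 h3 h4 h6)
    · exact Or.inr ⟨sep2 a c d b ha hc hd hb h1 h2 h4 hau hav hcu hcv h6 h7 (Or.inr h3), h6⟩
    · exact Or.inr ⟨h4, sep2 b d a c hb hd ha hc h2 h3 h6 hbu hbv hdu hdv h5 h4 (Or.inl h1)⟩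
    · exact Or.inr ⟨h4, h6⟩
  · rintro x a b ⟨hx, hxu, hxv⟩ ⟨ha, hau, hav⟩ ⟨hb, hbu, hbv⟩ hD (h1 | ⟨h1, h1'⟩) h2 h3
    · rcases hD with hD | ⟨hm, hD⟩
      · exact Or.inl (h.acc x a b hx ha hb hD h1 h2 h3)
      · refine Or.inr ⟨hm, ?_⟩
        have sa := side a ha hau hav
        have sb := side b hb hbu hbv
        by_cases hin : p a < p u ∧ p u < p b
        · have hin' : p a < p v ∧ p v < p b := by omega
          rcases hD with hD | hD
          · exact Or.inl (hs (h.acc u a b hu ha hb hD h1 hin.1 hin.2))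
          · exact Or.inr (hs (h.acc v a b hv ha hb hD h1 hin'.1 hin'.2))
        · exact sep2 a b u x ha hb hu hx h2 h3 h1 hau hav hbu hbv hm (Or.inl (hr u)) (by omega)
    · refine Or.inr ⟨?_, h1⟩
      rcases hD with hD | ⟨hm, hD⟩
      · rcases side x hx hxu hxv with ⟨h4, h5⟩ | ⟨h4, h5⟩
        · rcases h1 with h1 | h1
          · exact Or.inl (ht (h.acc x a u hx ha hu hD h1 h2 h4) h1)
          · exact Or.inr (ht (h.acc x a v hx ha hv hD h1 h2 h5) h1)
        · rcases h1' with h1 | h1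
          · exact Or.inl (h.acc x u b hx hu hb hD (hs h1) h4 h3)
          · exact Or.inr (h.acc x v b hx hv hb hD (hs h1) h5 h3)
      · exact hm


theorem pos_lt {m n : ℕ} (x : Fin m ⊕ Fin n) : pos x < n + m := by
  rcases x with j | i
  · have := j.2; simp only [pos, Sum.elim_inl]; omega
  · have := i.2; simp only [pos, Sum.elim_inr]; omega

theorem pos_injective {m n : ℕ} : Function.Injective (pos : Fin m ⊕ Fin n → ℕ) := by
  rintro (j | i) (j' | i') h <;> simp only [pos, Sum.elim_inl, Sum.elim_inr] at h
  · congr 1; ext; omega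
  · omega
  · omega
  · congr 1; ext; omega

theorem IsTangle.comp {m k n : ℕ} {S : PreDiag k n} {T : PreDiag m k} (hS : S.IsTangle)
    (hT : T.IsTangle) : (comp S T).IsTangle := by
  -- all points, in their order on the boundary of the rectangle of `S` followed by that of `T`
  let X := (Fin k ⊕ Fin n) ⊕ (Fin m ⊕ Fin k)
  let p : X → ℕ := Sum.elim pos (fun y => n + k + pos y)
  have hp : Function.Injective p := by
    rintro (x | x) (y | y) h <;> simp only [p, Sum.elim_inl, Sum.elim_inr] at h
    · rw [pos_injective h]
    · have := pos_lt x; omega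
    · have := pos_lt y; omega
    · rw [pos_injective (Nat.add_left_cancel h)]
  let cx : X → S.Comp ⊕ T.Comp := Sum.map S.e T.e
  let F : X → GlueComp S T := fun x => Quot.mk _ (cx x)
  let D0 : X → Prop := fun x => 0 < Sum.elim S.dots T.dots (cx x)
  let u : Fin k → X := fun i => Sum.inl (Sum.inl i)
  let v : Fin k → X := fun i => Sum.inr (Sum.inr i)
  let A : ℕ → X → Prop := fun j x => ∀ i : Fin k, i.1 < j → x ≠ u i ∧ x ≠ v i
  have hu : ∀ i, p (u i) = n + (k - 1 - i.1) := fun _ => rfl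
  have hv : ∀ i, p (v i) = n + k + i.1 := fun _ => rfl
  have main : ∀ j, j ≤ k → ∃ (R : X → X → Prop) (D : X → Prop), Planar p (A j) R D ∧
      (∀ x y, cx x = cx y → R x y) ∧ (∀ i : Fin k, i.1 < j → R (u i) (v i)) ∧
      (∀ x y, R x y → F x = F y) ∧ (∀ x, D0 x → D x) := by
    intro j
    induction j with
    | zero =>
      intro _
      refine ⟨fun x y => cx x = cx y, D0, ⟨⟨fun _ => rfl, fun h => h.symm, fun h h' => h.trans h'⟩,
        fun x y h h' => ?_, fun x _ => ?_, fun a b c d _ _ _ _ h1 h2 h3 h4 h5 => ?_,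
        fun x a b _ _ _ hD h1 h2 h3 => ?_⟩, fun _ _ h => h, fun i hi => absurd hi (by omega),
        fun x y h => congrArg (Quot.mk _) h, fun _ h => h⟩
      · change 0 < Sum.elim S.dots T.dots (cx y)
        rw [← h]; exact h'
      · rcases x with x | x
        · obtain ⟨y, ⟨h1, h2⟩, h3⟩ := hS.paired x
          refine ⟨Sum.inl y, fun i hi => absurd hi (by omega), fun h => h1 (Sum.inl_injective h),
            congrArg Sum.inl h2.symm, ?_⟩
          rintro (z | z) _ hz
          · by_cases hzx : z = x
            · exact Or.inl (congrArg _ hzx)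
            · exact Or.inr (congrArg _ (h3 z ⟨hzx, (Sum.inl_injective hz).symm⟩))
          · exact absurd hz (by simp [cx])
        · obtain ⟨y, ⟨h1, h2⟩, h3⟩ := hT.paired x
          refine ⟨Sum.inr y, fun i hi => absurd hi (by omega), fun h => h1 (Sum.inr_injective h),
            congrArg Sum.inr h2.symm, ?_⟩
          rintro (z | z) _ hz
          · exact absurd hz (by simp [cx])
          · by_cases hzx : z = x
            · exact Or.inl (congrArg _ hzx)
            · exact Or.inr (congrArg _ (h3 z ⟨hzx, (Sum.inr_injective hz).symm⟩))
      · rcases a with a | a <;> rcases c with c | c <;> rcases b with b | b <;>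
          rcases d with d | d <;> simp only [cx, Sum.map_inl, Sum.map_inr, Sum.inl.injEq,
            Sum.inr.injEq, reduceCtorEq, p, Sum.elim_inl, Sum.elim_inr] at h1 h2 h3 h4 h5 ⊢
        · exact hS.planar a b c d h1 h2 h3 h4 h5
        · have := pos_lt c; omega
        · have := pos_lt b; omega
        · exact hT.planar a b c d (by omega) (by omega) (by omega) h4 h5
      · rcases a with a | a <;> rcases b with b | b <;> rcases x with x | x <;>
          simp only [cx, Sum.map_inl, Sum.map_inr, Sum.inl.injEq, D0,
            Sum.inr.injEq, reduceCtorEq, p, Sum.elim_inl, Sum.elim_inr] at hD h1 h2 h3 ⊢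
        · exact absurd ⟨h2, h3⟩ (hS.accessible x hD a b h1)
        · have := pos_lt b; omega
        · have := pos_lt x; omega
        · exact absurd ⟨by omega, by omega⟩ (hT.accessible x hD a b h1)
    | succ j ih =>
      intro hj
      obtain ⟨R, D, hP, h1, h2, h3, h4⟩ := ih (by omega)
      let i : Fin k := ⟨j, hj⟩
      have hA : ∀ x, A (j + 1) x ↔ (A j x ∧ x ≠ u i ∧ x ≠ v i) := by
        intro x
        constructor
        · exact fun h => ⟨fun i' hi' => h i' (by omega), h i (by simp [i])⟩
        · rintro ⟨h5, h6⟩ i' hi'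
          rcases Nat.lt_succ_iff_lt_or_eq.1 hi' with h7 | h7
          · exact h5 i' h7
          · have : i' = i := Fin.ext h7
            rw [this]; exact h6
      have hadj : ∀ x, A j x → ¬ (p (u i) < p x ∧ p x < p (v i)) := by
        rintro x hx ⟨h5, h6⟩
        rw [hu] at h5
        rw [hv] at h6
        rcases x with (l | l) | (l | l)
        · have h7 : ¬ l.1 < j := fun h => (hx l h).1 rfl
          have h8 : p (Sum.inl (Sum.inl l)) = n + (k - 1 - l.1) := rfl
          simp only [i] at h5 h6; omega
        · have h8 : p (Sum.inl (Sum.inr l)) = l.1 := rfl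
          omega
        · have h8 : p (Sum.inr (Sum.inl l)) = n + k + (k + (m - 1 - l.1)) := rfl
          simp only [i] at h5 h6; omega
        · have h7 : ¬ l.1 < j := fun h => (hx l h).2 rfl
          have h8 : p (Sum.inr (Sum.inr l)) = n + k + l.1 := rfl
          simp only [i] at h5 h6; omega
      have hstep := hP.step hp (u := u i) (v := v i)
        (fun i' hi' => ⟨fun h => by
          have := Sum.inl_injective (Sum.inl_injective h)
          simp [← this, i] at hi', fun h => by cases h⟩)
        (fun i' hi' => ⟨fun h => by (cases h), fun h => by
          have := Sum.inr_injective (Sum.inr_injective h)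
          simp [← this, i] at hi'⟩) (by rw [hu, hv]; omega) hadj
      have hA' : A (j + 1) = fun x => A j x ∧ x ≠ u i ∧ x ≠ v i := funext fun x => propext (hA x)
      have hr := hP.eqv.refl
      have huv : F (u i) = F (v i) := up_eq_down S T i
      refine ⟨_, _, hA' ▸ hstep, fun x y h => Or.inl (h1 x y h), fun i' hi' => ?_, ?_,
        fun x h => Or.inl (h4 x h)⟩
      · rcases Nat.lt_succ_iff_lt_or_eq.1 hi' with h7 | h7
        · exact Or.inl (h2 i' h7)
        · have : i' = i := Fin.ext h7
          rw [this]
          exact Or.inr ⟨Or.inl (hr _), Or.inr (hr _)⟩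
      · have key : ∀ x, (R x (u i) ∨ R x (v i)) → F x = F (u i) := fun x h =>
          h.elim (h3 _ _) fun h' => (h3 _ _ h').trans huv.symm
        rintro x y (h | ⟨h, h'⟩)
        · exact h3 x y h
        · exact (key x h).trans (key y h').symm
  obtain ⟨R, D, hP, h1, h2, h3, h4⟩ := main k le_rfl
  have hr := hP.eqv.refl
  have hs : ∀ {x y}, R x y → R y x := fun h' => hP.eqv.symm h'
  have ht : ∀ {x y z}, R x y → R y z → R x z := fun h1 h2 => hP.eqv.trans h1 h2
  -- equality of components of the concatenation
  have hK : ∀ a b : S.Comp ⊕ T.Comp, (Quot.mk (Glue S T) a = Quot.mk (Glue S T) b) →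
      a = b ∨ ∃ x y, cx x = a ∧ cx y = b ∧ R x y := by
    intro a b h
    have h' := Quot.eqvGen_exact h
    clear h
    induction h' with
    | rel a b h =>
      obtain ⟨i⟩ := h
      exact Or.inr ⟨u i, v i, rfl, rfl, h2 i i.2⟩
    | refl a => exact Or.inl rfl
    | symm a b h' ih =>
      rcases ih with rfl | ⟨x, y, hx, hy, hxy⟩
      · exact Or.inl rfl
      · exact Or.inr ⟨y, x, hy, hx, hs hxy⟩
    | trans a b c h' h'' ih ih' =>
      rcases ih with rfl | ⟨x, y, hx, hy, hxy⟩
      · exact ih'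
      · rcases ih' with rfl | ⟨x', y', hx', hy', hxy'⟩
        · exact Or.inr ⟨x, y, hx, hy, hxy⟩
        · exact Or.inr ⟨x, y', hx, hy', ht hxy (ht (h1 _ _ (hy.trans hx'.symm)) hxy')⟩
  have hF : ∀ x y, F x = F y ↔ R x y := by
    refine fun x y => ⟨fun h => ?_, h3 x y⟩
    rcases hK _ _ h with h | ⟨x', y', hx, hy, hxy⟩
    · exact h1 x y h
    · exact ht (h1 _ _ hx.symm) (ht hxy (h1 _ _ hy))
  -- the boundary points of the concatenation
  let ι : Fin m ⊕ Fin n → X := Sum.elim (fun j => Sum.inr (Sum.inl j)) (fun i => Sum.inl (Sum.inr i))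
  have hι : ∀ x, (PreDiag.comp S T).e x = F (ι x) := by rintro (j | i) <;> rfl
  have hιA : ∀ x, A k (ι x) := by
    rintro (j | i) i' _ <;> exact ⟨fun h => (by cases h), fun h => (by cases h)⟩
  have hιA' : ∀ x, A k x → ∃ y, ι y = x := by
    rintro ((i | i) | (i | i)) hx
    · exact absurd rfl (hx i i.2).1
    · exact ⟨Sum.inr i, rfl⟩
    · exact ⟨Sum.inl i, rfl⟩
    · exact absurd rfl (hx i i.2).2
  have hιinj : Function.Injective ι := by
    rintro (x | x) (y | y) h <;> cases h <;> rfl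
  have hιp : ∀ x y, pos x < pos y → p (ι x) < p (ι y) := by
    have e1 : ∀ j : Fin m, p (ι (Sum.inl j)) = n + k + (k + (m - 1 - j.1)) := fun _ => rfl
    have e2 : ∀ i : Fin n, p (ι (Sum.inr i)) = i.1 := fun _ => rfl
    rintro (x | x) (y | y) h <;> simp only [pos, Sum.elim_inl, Sum.elim_inr] at h <;>
      simp only [e1, e2] <;> omega
  refine ⟨fun x => ?_, fun a b c d hab hbc hcd => ?_, ?_⟩
  · obtain ⟨y, hy, hyx, hxy, hz⟩ := hP.paired (ι x) (hιA x)
    obtain ⟨y, rfl⟩ := hιA' y hy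
    refine ⟨y, ⟨fun h => hyx (congrArg ι h), ?_⟩, ?_⟩
    · rw [hι, hι]; exact h3 _ _ (hs hxy)
    · rintro z ⟨hzx, hz'⟩
      rw [hι, hι, hF] at hz'
      rcases hz (ι z) (hιA z) (hs hz') with h | h
      · exact absurd (hιinj h) hzx
      · exact hιinj h
  · rw [hι, hι, hι, hι, hF, hF, hF]
    exact hP.planar _ _ _ _ (hιA a) (hιA b) (hιA c) (hιA d) (hιp _ _ hab) (hιp _ _ hbc)
      (hιp _ _ hcd)
  · intro x hx a b hab ⟨hax, hxb⟩
    have hD : D (ι x) := by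
      have hd : ∃ c : S.Comp ⊕ T.Comp, Quot.mk (Glue S T) c = F (ι x) ∧
          0 < Sum.elim S.dots T.dots c := by
        rw [hι] at hx
        have hx' : 0 < S.dots.mapDomain (up S T) (F (ι x)) +
          T.dots.mapDomain (down S T) (F (ι x)) := hx
        classical
        rcases Nat.eq_zero_or_pos (S.dots.mapDomain (up S T) (F (ι x))) with h0 | h0
        · have h5 := Finsupp.mapDomain_support (Finsupp.mem_support_iff.2
            (show T.dots.mapDomain (down S T) (F (ι x)) ≠ 0 by omega))
          obtain ⟨c, hc, hc'⟩ := Finset.mem_image.1 h5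
          exact ⟨Sum.inr c, hc', Nat.pos_of_ne_zero (Finsupp.mem_support_iff.1 hc)⟩
        · have h5 := Finsupp.mapDomain_support (Finsupp.mem_support_iff.2 h0.ne')
          obtain ⟨c, hc, hc'⟩ := Finset.mem_image.1 h5
          exact ⟨Sum.inl c, hc', Nat.pos_of_ne_zero (Finsupp.mem_support_iff.1 hc)⟩
      obtain ⟨c, hc, hc'⟩ := hd
      rcases hK _ _ hc with h | ⟨x', y', hx', hy', hxy'⟩
      · rw [h] at hc'; exact h4 _ hc'
      · refine hP.dot _ _ (ht hxy' (h1 _ _ hy')) (h4 x' ?_)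
        change 0 < Sum.elim S.dots T.dots (cx x')
        rw [hx']; exact hc'
    rw [hι, hι, hF] at hab
    have h5 := hP.acc _ _ _ (hιA x) (hιA a) (hιA b) hD hab (hιp _ _ hax) (hιp _ _ hxb)
    obtain ⟨y, hy, hyx, hxy, hz⟩ := hP.paired (ι x) (hιA x)
    have e1 := hz (ι a) (hιA a) h5
    have e2 := hz (ι b) (hιA b) (ht h5 hab)
    have n1 : ι a ≠ ι x := fun h => by have := hιinj h; subst this; omega
    have n2 : ι b ≠ ι x := fun h => by have := hιinj h; subst this; omega
    have n3 : ι a ≠ ι b := fun h => by have := hιinj h; subst this; omega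
    exact n3 ((e1.resolve_left n1).trans (e2.resolve_left n2).symm)

theorem isTangle_id (n : ℕ) : (id n).IsTangle where
  paired x := by
    rcases x with j | j
    · refine ⟨Sum.inr j, ⟨by simp, rfl⟩, ?_⟩
      rintro (z | z) ⟨h1, h2⟩
      · exact absurd (congrArg Sum.inl h2) h1
      · exact congrArg Sum.inr h2
    · refine ⟨Sum.inl j, ⟨by simp, rfl⟩, ?_⟩
      rintro (z | z) ⟨h1, h2⟩
      · exact congrArg Sum.inl h2
      · exact absurd (congrArg Sum.inr h2) h1
  planar := by
    rintro (a | a) (b | b) (c | c) (d | d) h1 h2 h3 h4 h5 <;>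
      simp only [pos, Sum.elim_inl, Sum.elim_inr] at h1 h2 h3 h4 h5 ⊢ <;> subst h4 <;> subst h5 <;>
      omega
  accessible := by
    intro x hx
    exact absurd hx (by simp)


/-- The dots of the tangle `e_i`: one on the cup and one on the cap if `i = 0`, and none
otherwise. -/
def genDots {n : ℕ} (i : Fin n) : Fin n →₀ ℕ :=
  if i.1 = 0 then Finsupp.single (lo i) 1 + Finsupp.single (hi i) 1 else 0

theorem genDots_pos {n : ℕ} {i c : Fin n} (h : 0 < genDots i c) :
    i.1 = 0 ∧ (c = lo i ∨ c = hi i) := by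
  unfold genDots at h
  split_ifs at h with h0
  · refine ⟨h0, ?_⟩
    by_contra hc
    rw [not_or] at hc
    rw [Finsupp.add_apply, Finsupp.single_eq_of_ne hc.1, Finsupp.single_eq_of_ne hc.2] at h
    exact absurd h (by simp)
  · exact absurd h (by simp)

/-- The tangle `e_i`: a cup and a cap at the two places of `s_i` and vertical edges elsewhere. For
`i = 0` the cup and the cap have one dot each. The cup is the component `lo i`, the cap is the
component `hi i`, and the other components are the edges. -/
def gen {n : ℕ} (i : Fin n) : PreDiag n n where
  Comp := Fin n
  finite := inferInstance
  e := Sum.elim (fun j => if j = lo i ∨ j = hi i then hi i else j)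
    (fun j => if j = lo i ∨ j = hi i then lo i else j)
  dots := genDots i

theorem isTangle_gen {n : ℕ} (i : Fin n) : (gen i).IsTangle := by
  have hl : (lo i).1 = i.1 - 1 := rfl
  have hh : (hi i).1 = max i.1 1 % n := rfl
  have hn : n = 1 ∨ (hi i).1 = (lo i).1 + 1 := by
    by_cases h : n = 1
    · exact Or.inl h
    · rw [Nat.mod_eq_of_lt (by omega)] at hh
      exact Or.inr (by omega)
  rcases hn with rfl | hn
  · have h1 : ∀ x y, (gen i).e x = (gen i).e y := fun x y => Subsingleton.elim (α := Fin 1) _ _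
    refine ⟨fun x => ?_, fun a b c d _ _ _ _ _ => h1 _ _, fun x _ a b _ h => ?_⟩
    · rcases x with x | x
      · refine ⟨Sum.inr x, ⟨by simp, h1 _ _⟩, ?_⟩
        rintro (z | z) ⟨h, -⟩
        · exact absurd (congrArg Sum.inl (Subsingleton.elim z x)) h
        · exact congrArg Sum.inr (Subsingleton.elim z x)
      · refine ⟨Sum.inl x, ⟨by simp, h1 _ _⟩, ?_⟩
        rintro (z | z) ⟨h, -⟩
        · exact congrArg Sum.inl (Subsingleton.elim z x)
        · exact absurd (congrArg Sum.inr (Subsingleton.elim z x)) h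
    · have := pos_lt a; have := pos_lt b; have := pos_lt x; omega
  have e1 : ∀ j : Fin n, Fin.val (n := n) ((gen i).e (Sum.inl j)) =
      if j.1 = (lo i).1 ∨ j.1 = (lo i).1 + 1 then (lo i).1 + 1 else j.1 := by
    intro j
    simp only [gen, Sum.elim_inl, Fin.ext_iff, hn]
    split_ifs <;> simp [hn]
  have e2 : ∀ j : Fin n, Fin.val (n := n) ((gen i).e (Sum.inr j)) =
      if j.1 = (lo i).1 ∨ j.1 = (lo i).1 + 1 then (lo i).1 else j.1 := by
    intro j
    simp only [gen, Sum.elim_inr, Fin.ext_iff, hn]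
    split_ifs <;> simp
  have key : ∀ x y, (gen i).e x = (gen i).e y ↔
      Fin.val (n := n) ((gen i).e x) = Fin.val (n := n) ((gen i).e y) := fun x y => Fin.ext_iff
  have p1 : ∀ j : Fin n, pos (Sum.inl j : Fin n ⊕ Fin n) = n + (n - 1 - j.1) := fun _ => rfl
  have p2 : ∀ j : Fin n, pos (Sum.inr j : Fin n ⊕ Fin n) = j.1 := fun _ => rfl
  have hlt := (hi i).2
  have hd : ∀ x, 0 < (gen i).dots ((gen i).e x) → Fin.val (n := n) ((gen i).e x) ≤ 1 := by
    intro x hx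
    obtain ⟨h0, h1 | h1⟩ := genDots_pos hx
    · rw [h1, hl]; omega
    · rw [h1, hn, hl]; omega
  refine ⟨?_, ?_, ?_⟩
  · intro x
    simp only [key]
    rcases x with x | x
    · have hx := x.2
      by_cases h1 : x.1 = (lo i).1
      · refine ⟨Sum.inl (hi i), ⟨?_, ?_⟩, ?_⟩
        · simp only [ne_eq, Sum.inl.injEq, Fin.ext_iff]; omega
        · rw [e1, e1]; split_ifs <;> omega
        · rintro (z | z) ⟨h2, h3⟩ <;> simp only [e1, e2, ne_eq, Sum.inl.injEq, Fin.ext_iff,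
            reduceCtorEq] at h2 h3 ⊢ <;> split_ifs at h3 <;> omega
      by_cases h2 : x.1 = (lo i).1 + 1
      · refine ⟨Sum.inl (lo i), ⟨?_, ?_⟩, ?_⟩
        · simp only [ne_eq, Sum.inl.injEq, Fin.ext_iff]; omega
        · rw [e1, e1]; split_ifs <;> omega
        · rintro (z | z) ⟨h2, h3⟩ <;> simp only [e1, e2, ne_eq, Sum.inl.injEq, Fin.ext_iff,
            reduceCtorEq] at h2 h3 ⊢ <;> split_ifs at h3 <;> omega
      · refine ⟨Sum.inr x, ⟨by simp, ?_⟩, ?_⟩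
        · rw [e1, e2]; split_ifs <;> omega
        · rintro (z | z) ⟨h2, h3⟩ <;> simp only [e1, e2, ne_eq, Sum.inl.injEq, Sum.inr.injEq,
            Fin.ext_iff, reduceCtorEq] at h2 h3 ⊢ <;> split_ifs at h3 <;> omega
    · have hx := x.2
      by_cases h1 : x.1 = (lo i).1
      · refine ⟨Sum.inr (hi i), ⟨?_, ?_⟩, ?_⟩
        · simp only [ne_eq, Sum.inr.injEq, Fin.ext_iff]; omega
        · rw [e2, e2]; split_ifs <;> omega
        · rintro (z | z) ⟨h2, h3⟩ <;> simp only [e1, e2, ne_eq, Sum.inr.injEq, Fin.ext_iff,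
            reduceCtorEq] at h2 h3 ⊢ <;> split_ifs at h3 <;> omega
      by_cases h2 : x.1 = (lo i).1 + 1
      · refine ⟨Sum.inr (lo i), ⟨?_, ?_⟩, ?_⟩
        · simp only [ne_eq, Sum.inr.injEq, Fin.ext_iff]; omega
        · rw [e2, e2]; split_ifs <;> omega
        · rintro (z | z) ⟨h2, h3⟩ <;> simp only [e1, e2, ne_eq, Sum.inr.injEq, Fin.ext_iff,
            reduceCtorEq] at h2 h3 ⊢ <;> split_ifs at h3 <;> omega
      · refine ⟨Sum.inl x, ⟨by simp, ?_⟩, ?_⟩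
        · rw [e1, e2]; split_ifs <;> omega
        · rintro (z | z) ⟨h2, h3⟩ <;> simp only [e1, e2, ne_eq, Sum.inl.injEq, Sum.inr.injEq,
            Fin.ext_iff, reduceCtorEq] at h2 h3 ⊢ <;> split_ifs at h3 <;> omega
  · rintro (a | a) (b | b) (c | c) (d | d) h1 h2 h3 h4 h5 <;>
      rw [key] at h4 h5 ⊢ <;> simp only [e1, e2, p1, p2] at h1 h2 h3 h4 h5 ⊢ <;>
      have := a.2 <;> have := b.2 <;> have := c.2 <;> have := d.2 <;>
      split_ifs at h4 h5 ⊢ <;> omega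
  · intro x hx a b hab h
    have h6 := hd x hx
    have h7 : (lo i).1 = 0 := by
      have := (genDots_pos hx).1
      omega
    rw [key] at hab
    rcases x with x | x <;> rcases a with a | a <;> rcases b with b | b <;>
      simp only [e1, e2, p1, p2] at hab h h6 <;>
      have := a.2 <;> have := b.2 <;> have := x.2 <;>
      split_ifs at hab h6 <;> omega

/-- Add a circle with `d` dots. -/
def addLoop {m n : ℕ} (P : PreDiag m n) (d : ℕ) : PreDiag m n where
  Comp := Option P.Comp
  finite := by
    have := P.finite
    infer_instance
  e := fun x => some (P.e x)
  dots := P.dots.mapDomain some + Finsupp.single none d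

/-- Add `d` dots to the component `c`. -/
def addDots {m n : ℕ} (P : PreDiag m n) (c : P.Comp) (d : ℕ) : PreDiag m n where
  Comp := P.Comp
  finite := P.finite
  e := P.e
  dots := P.dots + Finsupp.single c d

open scoped Classical in
/-- Add two points to the bottom face and connect them by a cap with `d` dots; `ι` tells where the
old bottom points are among the new ones. -/
def addCap {m n : ℕ} (P : PreDiag m n) (ι : Fin m ↪o Fin (m + 2)) (d : ℕ) :
    PreDiag (m + 2) n where
  Comp := Option P.Comp
  finite := by
    have := P.finite
    infer_instance
  e := Sum.elim (fun j => if h : ∃ j', ι j' = j then some (P.e (Sum.inl h.choose)) else none)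
    (fun i => some (P.e (Sum.inr i)))
  dots := P.dots.mapDomain some + Finsupp.single none d

/-- `c` connects two points of the top face. -/
def IsCup {m n : ℕ} (P : PreDiag m n) (c : P.Comp) : Prop :=
  ∃ i i', i ≠ i' ∧ P.e (Sum.inr i) = c ∧ P.e (Sum.inr i') = c

/-- `c` connects two points of the bottom face. -/
def IsCap {m n : ℕ} (P : PreDiag m n) (c : P.Comp) : Prop :=
  ∃ j j', j ≠ j' ∧ P.e (Sum.inl j) = c ∧ P.e (Sum.inl j') = c

/-- `c` connects a point of the bottom face and a point of the top face. -/
def IsEdge {m n : ℕ} (P : PreDiag m n) (c : P.Comp) : Prop :=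
  ∃ j i, P.e (Sum.inl j) = c ∧ P.e (Sum.inr i) = c

/-- The number of cups with an even number of dots. These are the undotted cups, if one removes
pairs of dots. -/
def undottedCups {m n : ℕ} (P : PreDiag m n) : ℕ :=
  Nat.card {c : P.Comp // P.IsCup c ∧ Even (P.dots c)}

/-- The number of caps with an even number of dots. -/
def undottedCaps {m n : ℕ} (P : PreDiag m n) : ℕ :=
  Nat.card {c : P.Comp // P.IsCap c ∧ Even (P.dots c)}

/-- The number of edges with an odd number of dots. -/
def dottedEdges {m n : ℕ} (P : PreDiag m n) : ℕ :=
  Nat.card {c : P.Comp // P.IsEdge c ∧ Odd (P.dots c)}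

end PreDiag

/-- Decorated tangles with `m` points on the bottom face and `n` points on the top face. -/
def Tangle (m n : ℕ) : Type 1 :=
  Quotient ((PreDiag.setoid m n).comap (Subtype.val : {P : PreDiag m n // P.IsTangle} → _))

namespace Tangle

/-- The tangle with the given data. -/
def mk {m n : ℕ} (P : PreDiag m n) (h : P.IsTangle) : Tangle m n := Quotient.mk _ ⟨P, h⟩

theorem ind {m n : ℕ} {p : Tangle m n → Prop} (h : ∀ P hP, p (mk P hP)) (T : Tangle m n) : p T :=
  Quotient.ind (fun P => h P.1 P.2) T

theorem sound {m n : ℕ} {P Q : PreDiag m n} {hP : P.IsTangle} {hQ : Q.IsTangle} (h : P ≈ Q) :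
    mk P hP = mk Q hQ := Quotient.sound h

/-- Vertical concatenation, `S` on top of `T`. -/
def comp {m k n : ℕ} (S : Tangle k n) (T : Tangle m k) : Tangle m n :=
  Quotient.map₂ (fun P Q => ⟨PreDiag.comp P.1 Q.1, P.2.comp Q.2⟩)
    (fun _ _ h _ _ h' => PreDiag.comp_congr h h') S T

/-- Multiplication is concatenation; the left factor is on top. -/
instance (n : ℕ) : Monoid (Tangle n n) where
  mul := comp
  one := mk (PreDiag.id n) (PreDiag.isTangle_id n)
  mul_assoc := by
    intro S T U
    induction S using ind
    induction T using ind
    induction U using ind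
    exact sound (PreDiag.comp_assoc _ _ _)
  one_mul := by
    intro T
    induction T using ind
    exact sound (PreDiag.id_comp _)
  mul_one := by
    intro T
    induction T using ind
    exact sound (PreDiag.comp_id _)

/-- The tangle `e_i`. -/
def gen {n : ℕ} (i : Fin n) : Tangle n n := mk (PreDiag.gen i) (PreDiag.isTangle_gen i)

end Tangle

/-! ### The algebras of decorated tangles -/

/-- The free module on the decorated `(n, n)`-tangles, with concatenation as multiplication. -/
abbrev TangleAlgebra (n : ℕ) : Type 1 := MonoidAlgebra L (Tangle n n)

/-- The subalgebra `𝔻𝕋_n` generated by `e_0, …, e_{n-1}`. -/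
def DT (n : ℕ) : Subalgebra L (TangleAlgebra n) :=
  Algebra.adjoin L (Set.range fun i : Fin n => MonoidAlgebra.of L _ (Tangle.gen i))

/-- The element `e_i` of `𝔻𝕋_n`. -/
def DT.e {n : ℕ} (i : Fin n) : DT n :=
  ⟨MonoidAlgebra.of L _ (Tangle.gen i), Algebra.subset_adjoin ⟨i, rfl⟩⟩

/-- The local relations, for tangles as elements of a module `M` by means of `b`:
an undotted circle may be removed and gives a factor `q + q⁻¹`; two dots on one component may be
removed; a tangle that contains a circle with exactly one dot is zero. -/
def localRel {m n : ℕ} {M : Type*} [AddCommGroup M] [Module L M] (b : Tangle m n → M) :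
    Submodule L M :=
  Submodule.span L
    ({x | ∃ (P : PreDiag m n) (h : _) (h' : _), x = b (.mk (P.addLoop 0) h') - (q + qi) • b (.mk P h)} ∪
      {x | ∃ (P : PreDiag m n) (c : _) (h : _) (h' : _),
        x = b (.mk (P.addDots c 2) h') - b (.mk P h)} ∪
      {x | ∃ (P : PreDiag m n) (h' : _), x = b (.mk (P.addLoop 1) h')})

/-- The elements of `𝔻𝕋_n` that vanish by the local relations. -/
def relDT (n : ℕ) : Submodule L (DT n) :=
  (localRel (fun T : Tangle n n => MonoidAlgebra.of L _ T)).comap (DT n).val.toLinearMap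

/-- The span of the tangles in `𝔻𝕋_n` without edges and with an odd number of undotted cups. -/
def oddCups (n : ℕ) : Submodule L (DT n) :=
  Submodule.span L {x | ∃ P h, x.1 = MonoidAlgebra.of L _ (.mk P h) ∧
    (∀ c, ¬ P.IsEdge c) ∧ Odd P.undottedCups}

/-- The span of the tangles in `𝔻𝕋_n` without edges and with an odd number of undotted caps. -/
def oddCaps (n : ℕ) : Submodule L (DT n) :=
  Submodule.span L {x | ∃ P h, x.1 = MonoidAlgebra.of L _ (.mk P h) ∧
    (∀ c, ¬ P.IsEdge c) ∧ Odd P.undottedCaps}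

/-- The subspace of `𝔻𝕋_n` that is factored out. -/
def relTL (n : ℕ) : Submodule L (DT n) :=
  if Even n then relDT n ⊔ oddCups n else relDT n

/-- Congruence modulo `relTL n`. -/
def TLRel (n : ℕ) (x y : DT n) : Prop := x - y ∈ relTL n

/-- The algebra `TL^(W)`, the quotient of `𝔻𝕋_n` by the two-sided ideal generated by `relTL n`. -/
abbrev TLhat (n : ℕ) : Type 1 := RingQuot (TLRel n)

/-- The projection from `𝔻𝕋_n` to `TL^(W)`. -/
def TLproj (n : ℕ) : DT n →ₐ[L] TLhat n := RingQuot.mkAlgHom L (TLRel n)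

/-! ### Decorated cup diagrams -/

/-- `T` is an even decorated cup diagram: there are no circles and at most one dot on each line,
every bottom point is connected to a top point, and the number of dotted edges plus the number of
undotted cups is even. -/
def Tangle.IsEvenCupDiagram {k n : ℕ} (T : Tangle k n) : Prop :=
  ∃ P h, T = .mk P h ∧ (∀ c, ∃ x, P.e x = c) ∧ (∀ c, P.dots c ≤ 1) ∧
    (∀ j, ∃ i, P.e (Sum.inl j) = P.e (Sum.inr i)) ∧ Even (P.dottedEdges + P.undottedCups)

/-- The set of even decorated cup diagrams with `n` top points. -/
def CupDiagram (n : ℕ) : Type 1 := {T : Σ k, Tangle k n // T.2.IsEvenCupDiagram}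

/-- The free module `N_t` on the even decorated cup diagrams. -/
abbrev Nt (n : ℕ) : Type 1 := CupDiagram n →₀ L

/-- The tangle `T` as a basis vector of the free module on all decorated tangles with `n` top
points. -/
def bas {k n : ℕ} (T : Tangle k n) : (Σ k, Tangle k n) →₀ L := Finsupp.single ⟨k, T⟩ 1

/-- The rules for the action on cup diagrams: the local relations; moreover, a tangle that contains
an undotted cap is zero, and a cap with exactly one dot may be removed. -/
def cupRel (n : ℕ) : Submodule L ((Σ k, Tangle k n) →₀ L) :=
  (⨆ k, localRel (bas : Tangle k n → _)) ⊔
    Submodule.span L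
      ({x | ∃ (k : ℕ) (P : PreDiag k n) (ι : _) (h' : _), x = bas (.mk (P.addCap ι 0) h')} ∪
        {x | ∃ (k : ℕ) (P : PreDiag k n) (ι : _) (h : _) (h' : _),
          x = bas (.mk (P.addCap ι 1) h') - bas (.mk P h)})

/-! ### The cup diagram of a sign sequence -/

/-- A plus at place `i` and a minus at place `j > i` are joined by an undotted cup: the signs
strictly in between form a balanced bracket sequence, with `+` as opening and `-` as closing
bracket. This is the result of successively joining neighbouring pairs `+ -`, ignoring signs that
are already joined. -/
def PlusMinus {n : ℕ} (α : Fin n → ℤˣ) (i j : Fin n) : Prop :=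
  i < j ∧ α i = 1 ∧ α j = -1 ∧ (∑ l ∈ Finset.Ioo i j, (α l : ℤ)) = 0 ∧
    ∀ k, i < k → k < j → 0 ≤ ∑ l ∈ Finset.Ioc i k, (α l : ℤ)

/-- A minus at place `i` that is not joined to a plus. -/
def FreeMinus {n : ℕ} (α : Fin n → ℤˣ) (i : Fin n) : Prop :=
  α i = -1 ∧ ∀ j, ¬ PlusMinus α j i

/-- Two minuses are joined by a dotted cup: the minuses that are not joined to a plus are paired
from left to right, the first with the second, the third with the fourth, and so on. -/
def MinusMinus {n : ℕ} (α : Fin n → ℤˣ) (i j : Fin n) : Prop :=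
  i < j ∧ FreeMinus α i ∧ FreeMinus α j ∧ (∀ l, i < l → l < j → ¬ FreeMinus α l) ∧
    Even (Nat.card {l : Fin n // l < i ∧ FreeMinus α l})

/-- `T` is the decorated cup diagram of the sign sequence `α`: the cups are as described by
`PlusMinus` (undotted) and `MinusMinus` (dotted), and the remaining places are end points of
edges, which have one dot at a minus and no dot at a plus. -/
def Tangle.IsCupDiagramOf {k n : ℕ} (T : Tangle k n) (α : Fin n → ℤˣ) : Prop :=
  ∃ P h, T = .mk P h ∧
    (∀ i j, i < j → (P.e (Sum.inr i) = P.e (Sum.inr j) ↔ PlusMinus α i j ∨ MinusMinus α i j)) ∧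
    (∀ i j, PlusMinus α i j → P.dots (P.e (Sum.inr i)) = 0) ∧
    (∀ i j, MinusMinus α i j → P.dots (P.e (Sum.inr i)) = 1) ∧
    (∀ i j, P.e (Sum.inl j) = P.e (Sum.inr i) →
      P.dots (P.e (Sum.inr i)) = if α i = 1 then 0 else 1)

end TypeD
end

open TypeD

open scoped LaurentPolynomial

noncomputable section

namespace TypeD

/-! ### The exchange property -/

/-! Both sides of the theorem are compared through a state sum. A tangle with signs at its boundary
points has a weight, the product of the weights of its components. An undotted cup has weight `1`
for `+ -` and `q` for `- +`; an undotted cap has weight `1` for `- +` and `q⁻¹` for `+ -`; an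
undotted edge transports its sign and an undotted circle counts `q + q⁻¹`. A dot changes the sign at
the left end of its line and makes a circle vanish. The resulting matrix `entry` respects the rules
(i)–(iii), and with plus signs at all bottom points also the rules (iv) and (v): `localRel_le_ker`,
`cupRel_le_ker`. Placing `e_i` on top of a tangle applies the operator `opE i`: `entry_gen_comp`.

On the algebraic side, `N` has a standard basis indexed by the sign sequences with an even number of
minuses, and the length of a shortest representative is the height `ht` of its sequence. Spanning is
a direct computation. Independence comes from the regular representation of the Hecke algebra, which
exists because left and right multiplication operators commute, by the exchange property. In these
coordinates the action of `C_{s_i}` is again `opE i` (`coord_actN_C`), so a cup diagram, evaluated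
with plus signs at the bottom, is an element of `N`, and the intertwining property holds because the
same operator appears on both sides.

The expansion of a cup diagram has coefficients `0` or `q ^ d` with `d ≥ 0`. The coefficient `1`
occurs only at the leading signs, which are also the unique ones of greatest height. The bracket
rule recovers the diagram from its leading signs (`IsArcSystem.eq_of_ne`). Conversely, if `s_i`
lowers `α`, then `e_i` turns the diagram of `s_i α` into the diagram of `α` with coefficient `1`; as
`C_{s_i}` commutes with the bar involution, every even sequence is a leading one and every expansion
is bar invariant. Hence the expansions are the Kazhdan–Lusztig elements.

For faithfulness, an element of `𝔻𝕋_n` is modulo the local relations a combination of reduced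
diagrams. After multiplication by `q` to the number of caps, each weight of a reduced diagram is
zero or a power of `q`, and it is `1` exactly if the signs have degree zero on every line. Signs of
degree zero with a minus on at most the leftmost edge determine the diagram among those with no more
edges. So the lowest power of `q`, and there the diagrams with most edges, isolate a single
coefficient (`eq_zero_of_entries`). Only even bottom signs are visible on cup diagrams. A diagram
with an edge has suitable even signs, as the sign of the leftmost edge is free. Without edges the
parity is forced by the number of undotted caps, and equally by that of undotted cups because the
generators preserve parity. The odd diagrams without edges act by zero and are the only further
elements of the kernel. -/

open scoped Classical in
/-- The action of an involution `s` of a group `G` on `G × ZMod 2`, by conjugation on the first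
factor and by a translation of the second one at `s`. -/
def inversionPerm {G : Type*} [Group G] (s : G) (hs : s * s = 1) : Equiv.Perm (G × ZMod 2) where
  toFun x := (s * x.1 * s, x.2 + if x.1 = s then 1 else 0)
  invFun x := (s * x.1 * s, x.2 + if x.1 = s then 1 else 0)
  left_inv := by
    rintro ⟨t, ε⟩
    have h1 : s * (s * t * s) * s = t := by
      rw [show s * (s * t * s) * s = (s * s) * t * (s * s) by group, hs]; simp
    have h2 : s * t * s = s ↔ t = s := by
      constructor
      · intro h
        rw [← h1, h, hs, one_mul]
      · rintro rfl
        rw [hs, one_mul]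
    simp only [h1, h2, add_assoc]
    split_ifs <;> simp [CharTwo.add_self_eq_zero]
  right_inv := by
    rintro ⟨t, ε⟩
    have h1 : s * (s * t * s) * s = t := by
      rw [show s * (s * t * s) * s = (s * s) * t * (s * s) by group, hs]; simp
    have h2 : s * t * s = s ↔ t = s := by
      constructor
      · intro h
        rw [← h1, h, hs, one_mul]
      · rintro rfl
        rw [hs, one_mul]
    simp only [h1, h2, add_assoc]
    split_ifs <;> simp [CharTwo.add_self_eq_zero]

section InversionPerm

variable {G : Type*} [Group G]

theorem inversionPerm_mul_self (s : G) (hs : s * s = 1) :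
    inversionPerm s hs * inversionPerm s hs = 1 :=
  Equiv.ext (inversionPerm s hs).left_inv

theorem conj_eq_iff {s : G} (hs : s * s = 1) (t u : G) : s * t * s = u ↔ t = s * u * s := by
  constructor
  · rintro rfl
    rw [show s * (s * t * s) * s = (s * s) * t * (s * s) by group, hs]; simp
  · rintro rfl
    rw [show s * (s * u * s) * s = (s * s) * u * (s * s) by group, hs]; simp

theorem inversionPerm_comm {s t : G} (hs : s * s = 1) (ht : t * t = 1) (h : s * t = t * s) :
    inversionPerm s hs * inversionPerm t ht = inversionPerm t ht * inversionPerm s hs := by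
  refine Equiv.ext ?_
  rintro ⟨u, ε⟩
  simp only [Equiv.Perm.mul_apply, inversionPerm, Equiv.coe_fn_mk, Prod.mk.injEq]
  have h1 : t * s * t = s := by rw [← h, mul_assoc, ht, mul_one]
  have h2 : s * t * s = t := by rw [h, mul_assoc, hs, mul_one]
  constructor
  · rw [show s * (t * u * t) * s = (s * t) * u * (t * s) by group,
      show t * (s * u * s) * t = (t * s) * u * (s * t) by group, h]
  · rw [conj_eq_iff ht, conj_eq_iff hs, h1, h2, add_right_comm]

/-- Both sides conjugate the first factor by the same element and shift the second one once for each
coincidence of `u` with `s`, `s * t * s` and `t`. The two sides merely meet these three reflections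
in opposite orders. -/
theorem inversionPerm_braid {s t : G} (hs : s * s = 1) (ht : t * t = 1)
    (h : s * t * s = t * s * t) :
    inversionPerm s hs * inversionPerm t ht * inversionPerm s hs =
      inversionPerm t ht * inversionPerm s hs * inversionPerm t ht := by
  refine Equiv.ext ?_
  rintro ⟨u, ε⟩
  simp only [Equiv.Perm.mul_apply, inversionPerm, Equiv.coe_fn_mk, Prod.mk.injEq]
  have h1 : s * (t * s * t) * s = t := by
    rw [← h, show s * (s * t * s) * s = (s * s) * t * (s * s) by group, hs]; simp
  have h2 : t * (s * t * s) * t = s := by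
    rw [h, show t * (t * s * t) * t = (t * t) * s * (t * t) by group, ht]; simp
  constructor
  · rw [show s * (t * (s * u * s) * t) * s = (s * t * s) * u * (s * t * s) by group, h]; group
  · have h3 : (s * u * s = t) ↔ (t * u * t = s) := by
      rw [conj_eq_iff hs, conj_eq_iff ht, h]
    have h4 : (t * (s * u * s) * t = s) ↔ u = t := by
      rw [conj_eq_iff ht, conj_eq_iff hs, h1]
    have h5 : (s * (t * u * t) * s = t) ↔ u = s := by
      rw [conj_eq_iff hs, conj_eq_iff ht, h2]
    classical
    rw [if_congr h3 rfl rfl, if_congr h4 rfl rfl, if_congr h5 rfl rfl]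
    abel

end InversionPerm

theorem simple_comm {n : ℕ} {i j : Fin n} (hij : i ≠ j) (h : ¬ dynkinAdj i j) :
    (s i : W n) * s j = s j * s i := by
  have h1 := (cox n).simple_mul_simple_pow i j
  have h2 : (coxeterMatrix n) i j = 2 := by
    change (if i = j then 1 else if dynkinAdj i j then 3 else 2) = 2
    rw [if_neg hij, if_neg h]
  rw [h2, pow_two] at h1
  have h3 := mul_eq_one_iff_eq_inv.1 h1
  rw [h3, mul_inv_rev, (cox n).inv_simple, (cox n).inv_simple]

theorem simple_braid {n : ℕ} {i j : Fin n} (h : dynkinAdj i j) :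
    (s i : W n) * s j * s i = s j * s i * s j := by
  have hij : i ≠ j := by
    rintro rfl
    unfold dynkinAdj at h; omega
  have h1 := (cox n).simple_mul_simple_pow i j
  have h2 : (coxeterMatrix n) i j = 3 := by
    change (if i = j then 1 else if dynkinAdj i j then 3 else 2) = 3
    rw [if_neg hij, if_pos h]
  rw [h2] at h1
  have h3 : (s i : W n) * s j * s i * (s j * s i * s j) = 1 := by
    rw [← h1]; simp only [pow_succ, pow_zero, one_mul, mul_assoc]
  rw [mul_eq_one_iff_eq_inv.1 h3, mul_inv_rev, mul_inv_rev, (cox n).inv_simple,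
    (cox n).inv_simple, mul_assoc]

theorem len_simple_mul {n : ℕ} (i : Fin n) (w : W n) :
    len (s i * w) = len w + 1 ∨ len (s i * w) + 1 = len w := (cox n).length_simple_mul w i

theorem len_mul_simple {n : ℕ} (w : W n) (i : Fin n) :
    len (w * s i) = len w + 1 ∨ len (w * s i) + 1 = len w := (cox n).length_mul_simple w i

theorem simple_mul_cancel {n : ℕ} (i : Fin n) (w : W n) : s i * (s i * w) = w :=
  (cox n).simple_mul_simple_cancel_left i

theorem mul_simple_cancel {n : ℕ} (w : W n) (i : Fin n) : w * s i * s i = w :=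
  (cox n).simple_mul_simple_cancel_right i

theorem wordProd_cons {n : ℕ} (i : Fin n) (ω : List (Fin n)) :
    (cox n).wordProd (i :: ω) = s i * (cox n).wordProd ω := (cox n).wordProd_cons i ω

/-- The action of `W` on `W × ZMod 2` which counts inversions modulo two. -/
def inversionAction (n : ℕ) : W n →* Equiv.Perm (W n × ZMod 2) :=
  (cox n).lift ⟨fun i => inversionPerm (s i) ((cox n).simple_mul_simple_self i), by
    intro i j
    change (_ * _) ^ (if i = j then 1 else if dynkinAdj i j then 3 else 2) = 1
    split_ifs with h1 h2
    · subst h1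
      rw [pow_one, inversionPerm_mul_self]
    · exact pow_three_of_braid (inversionPerm_mul_self _ _) (inversionPerm_mul_self _ _)
        (inversionPerm_braid _ _ (simple_braid h2))
    · rw [pow_two, mul_assoc, ← mul_assoc (inversionPerm (s j) _),
        ← inversionPerm_comm _ _ (simple_comm h1 h2), mul_assoc,
        inversionPerm_mul_self, mul_one, inversionPerm_mul_self]⟩

open scoped Classical in
theorem inversionAction_simple {n : ℕ} (i : Fin n) (x : W n × ZMod 2) :
    inversionAction n (s i) x = (s i * x.1 * s i, x.2 + if x.1 = s i then 1 else 0) := by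
  have h : inversionAction n (s i) =
      inversionPerm (s i) ((cox n).simple_mul_simple_self i) :=
    (cox n).lift_apply_simple _ i
  rw [h]; rfl

open scoped Classical in
-- Since the left side depends on the group element only, the parity with which `t` occurs in the
-- right inversion sequence is the same for all words for that element.
theorem inversionAction_wordProd {n : ℕ} (ω : List (Fin n)) (t : W n) (ε : ZMod 2) :
    inversionAction n ((cox n).wordProd ω) (t, ε) =
      ((cox n).wordProd ω * t * ((cox n).wordProd ω)⁻¹,
        ε + (((cox n).rightInvSeq ω).count t : ZMod 2)) := by
  induction ω with
  | nil => simp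
  | cons i ω ih =>
    rw [(cox n).wordProd_cons, map_mul, Equiv.Perm.mul_apply, ih, inversionAction_simple]
    simp only [CoxeterSystem.rightInvSeq, List.count_cons, mul_inv_rev, (cox n).inv_simple,
      Prod.mk.injEq]
    constructor
    · simp only [mul_assoc]
    · have : ((cox n).wordProd ω * t * ((cox n).wordProd ω)⁻¹ = s i) ↔
          ((((cox n).wordProd ω)⁻¹ * s i * (cox n).wordProd ω) == t) = true := by
        rw [beq_iff_eq, mul_inv_eq_iff_eq_mul, mul_assoc, inv_mul_eq_iff_eq_mul, eq_comm]
      simp only [this]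
      push_cast
      split_ifs <;> simp [add_assoc]

/-- The exchange property: a simple right descent of `w` occurs among the right inversions of every
word for `w`. -/
theorem mem_rightInvSeq_of_descent {n : ℕ} (ω : List (Fin n)) (i : Fin n)
    (h : len ((cox n).wordProd ω * s i) < len ((cox n).wordProd ω)) :
    s i ∈ (cox n).rightInvSeq ω := by
  classical
  -- A reduced word of the shorter element `w * s i` does not have `s i` among its inversions.
  -- Acting with one more `s i` changes the parity at `s i`, so `s i` occurs an odd number of times
  -- in the sequence of any word for `w`.
  obtain ⟨ω', hω', h'⟩ := (cox n).exists_isReduced ((cox n).wordProd ω * s i)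
  have h0 : ((cox n).rightInvSeq ω').count (s i) = 0 := by
    rw [List.count_eq_zero]
    intro hm
    have := ((cox n).isRightInversion_of_mem_rightInvSeq hω' hm).2
    rw [← h', mul_assoc, (cox n).simple_mul_simple_self, mul_one] at this
    exact lt_asymm h this
  have h1 : (cox n).wordProd ω = (cox n).wordProd ω' * s i := by
    rw [← h', mul_assoc, (cox n).simple_mul_simple_self, mul_one]
  have h2 := inversionAction_wordProd ω (s i) 0
  rw [h1, map_mul, Equiv.Perm.mul_apply, inversionAction_simple] at h2
  simp only [if_true, zero_add] at h2
  rw [(cox n).simple_mul_simple_self, one_mul, inversionAction_wordProd, h0] at h2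
  have h3 := congrArg Prod.snd h2
  simp only [Nat.cast_zero, add_zero] at h3
  by_contra hm
  rw [List.count_eq_zero.2 hm] at h3
  simp at h3

/-- By the exchange property `s j` is a right inversion of the word `i :: ω`. It cannot come from
the reduced word `ω`, as `s j` is no right descent of `w`; so it comes from the first letter, which
is the assertion. -/
theorem simple_mul_eq_mul_simple {n : ℕ} {w : W n} {i j : Fin n} (h1 : len w < len (s i * w))
    (h2 : len w < len (w * s j)) (h3 : len (s i * w * s j) < len (w * s j)) :
    s i * w = w * s j := by
  obtain ⟨ω, hω, rfl⟩ := (cox n).exists_isReduced w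
  have h4 := len_simple_mul i ((cox n).wordProd ω)
  have h5 := len_mul_simple ((cox n).wordProd ω) j
  have h6 := mem_rightInvSeq_of_descent (i :: ω) j (by
    rw [wordProd_cons]; omega)
  rw [CoxeterSystem.rightInvSeq, List.mem_cons] at h6
  rcases h6 with h6 | h6
  · rw [h6]; group
  · have := ((cox n).isRightInversion_of_mem_rightInvSeq hω h6).2
    simp only [len] at h2
    omega

/-! ### The regular representation of the Hecke algebra -/

/-- Left multiplication by `H_{s_i}` on the free module on `W`. -/
def leftOp {n : ℕ} (i : Fin n) : (W n →₀ L) →ₗ[L] (W n →₀ L) :=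
  Finsupp.linearCombination L fun w =>
    Finsupp.single (s i * w) 1 + (if len (s i * w) < len w then qi - q else 0) • Finsupp.single w 1

/-- Right multiplication by `H_{s_j}` on the free module on `W`. -/
def rightOp {n : ℕ} (j : Fin n) : (W n →₀ L) →ₗ[L] (W n →₀ L) :=
  Finsupp.linearCombination L fun w =>
    Finsupp.single (w * s j) 1 + (if len (w * s j) < len w then qi - q else 0) • Finsupp.single w 1

theorem leftOp_single {n : ℕ} (i : Fin n) (w : W n) :
    leftOp i (Finsupp.single w 1) = Finsupp.single (s i * w) 1 +
      (if len (s i * w) < len w then qi - q else 0) • Finsupp.single w 1 := by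
  rw [leftOp, Finsupp.linearCombination_single, one_smul]

theorem rightOp_single {n : ℕ} (j : Fin n) (w : W n) :
    rightOp j (Finsupp.single w 1) = Finsupp.single (w * s j) 1 +
      (if len (w * s j) < len w then qi - q else 0) • Finsupp.single w 1 := by
  rw [rightOp, Finsupp.linearCombination_single, one_smul]

/-- This makes the correction terms of `leftOp i` and `rightOp j` independent of the order in which
they are applied. An ascent that became a descent would fall under `simple_mul_eq_mul_simple`; the
converse case is the same one for `s i * w`. -/
theorem descent_iff_of_ne {n : ℕ} {w : W n} {i j : Fin n} (h : s i * w ≠ w * s j) :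
    len (s i * w * s j) < len (w * s j) ↔ len (s i * w) < len w := by
  have key : ∀ w : W n, s i * w ≠ w * s j → len w < len (s i * w) →
      len (w * s j) < len (s i * w * s j) := by
    intro w h h1
    have e1 := len_simple_mul i w
    have e2 := len_mul_simple w j
    have e3 := len_mul_simple (s i * w) j
    have e4 := len_simple_mul i (w * s j)
    rw [← mul_assoc] at e4
    by_contra h2
    by_cases h3 : len w < len (w * s j)
    · exact h (simple_mul_eq_mul_simple h1 h3 (by omega))
    · omega
  have e1 := len_simple_mul i w
  have e4 := len_simple_mul i (w * s j)
  rw [← mul_assoc] at e4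
  constructor
  · intro h1
    by_contra h2
    have := key w h (by omega)
    omega
  · intro h1
    have := key (s i * w) (by
      rw [simple_mul_cancel]
      intro h2
      apply h
      conv_lhs => rw [h2]
      rw [mul_assoc, simple_mul_cancel]) (by rw [simple_mul_cancel]; exact h1)
    rwa [simple_mul_cancel] at this

/-- If `s i * w = w * s j`, the two operators have the same effect on the vectors of `w` and of `s i
* w`. Otherwise neither operator influences the descents seen by the other one. -/
theorem leftOp_rightOp_comm {n : ℕ} (i j : Fin n) (x : W n →₀ L) :
    leftOp i (rightOp j x) = rightOp j (leftOp i x) := by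
  suffices h : leftOp i ∘ₗ rightOp j = rightOp j ∘ₗ leftOp i from LinearMap.congr_fun h x
  refine Finsupp.lhom_ext' fun w => LinearMap.ext_ring ?_
  simp only [LinearMap.comp_apply, Finsupp.lsingle_apply]
  rw [leftOp_single, rightOp_single, map_add, map_add, map_smul, map_smul, leftOp_single,
    leftOp_single, rightOp_single, rightOp_single, ← mul_assoc]
  have e1 := len_simple_mul i w
  have e2 := len_mul_simple w j
  have e3 := len_mul_simple (s i * w) j
  have e4 := len_simple_mul i (w * s j)
  rw [← mul_assoc] at e4
  by_cases h : s i * w = w * s j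
  · have e : s i * w * s j = w := by rw [h, mul_simple_cancel]
    rw [e, h]
  · have h1 := descent_iff_of_ne h
    have h2 : len (s i * w * s j) < len (s i * w) ↔ len (w * s j) < len w := by
      rcases e1 with e1 | e1 <;> rcases e4 with e4 | e4 <;> omega
    simp only [h1, h2, smul_add]
    rw [smul_comm]
    abel

theorem smul_single_leftOp {n : ℕ} (i : Fin n) (x : W n →₀ L) :
    leftOp i (leftOp i x) = (qi - q) • leftOp i x + x := by
  suffices h : leftOp i ∘ₗ leftOp i = (qi - q) • leftOp i + LinearMap.id from
    LinearMap.congr_fun h x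
  refine Finsupp.lhom_ext' fun w => LinearMap.ext_ring ?_
  simp only [LinearMap.comp_apply, Finsupp.lsingle_apply, LinearMap.add_apply,
    LinearMap.smul_apply, LinearMap.id_apply]
  rw [leftOp_single, map_add, map_smul, leftOp_single, leftOp_single, simple_mul_cancel]
  rcases len_simple_mul i w with h | h
  · rw [if_pos (by omega), if_neg (by omega)]
    simp [add_comm]
  · rw [if_neg (by omega), if_pos (by omega)]
    simp only [zero_smul, add_zero]
    abel

/-- The operators that commute with all right multiplications. -/
def rightCentralizer (n : ℕ) : Subalgebra L (Module.End L (W n →₀ L)) :=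
  Subalgebra.centralizer L (Set.range (rightOp (n := n)))

/-- The basis vector of `1` generates the free module under the right operators: stripping a right
descent writes the vector of `w` as `rightOp i` of a shorter one. Every relation between operators
in the centralizer can therefore be checked at that single vector, which avoids any computation with
braid relations. -/
theorem rightCentralizer_ext {n : ℕ} {A B : Module.End L (W n →₀ L)}
    (hA : A ∈ rightCentralizer n) (hB : B ∈ rightCentralizer n)
    (h : A (Finsupp.single 1 1) = B (Finsupp.single 1 1)) : A = B := by
  have comm : ∀ {A}, A ∈ rightCentralizer n → ∀ j x, A (rightOp j x) = rightOp j (A x) := by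
    intro A hA j x
    exact (LinearMap.congr_fun ((Subalgebra.mem_centralizer_iff L).1 hA _ ⟨j, rfl⟩) x).symm
  refine Finsupp.lhom_ext' fun w => LinearMap.ext_ring ?_
  simp only [LinearMap.comp_apply, Finsupp.lsingle_apply]
  induction hk : len w generalizing w with
  | zero =>
    rw [(cox n).length_eq_zero_iff] at hk
    subst hk
    exact h
  | succ k ih =>
    have hw : w ≠ 1 := by
      rintro rfl; simp at hk
    obtain ⟨i, hi⟩ := (cox n).exists_rightDescent_of_ne_one hw
    have h1 : len (w * s i) + 1 = len w := (cox n).isRightDescent_iff.1 hi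
    have h2 : Finsupp.single w (1 : L) = rightOp i (Finsupp.single (w * s i) 1) := by
      rw [rightOp_single, mul_simple_cancel, if_neg (by omega), zero_smul, add_zero]
    rw [h2, comm hA, comm hB, ih _ (by omega)]

/-- Left multiplication by `H_w` on the free module on `W`. -/
def leftMul {n : ℕ} (w : W n) : Module.End L (W n →₀ L) :=
  (((cox n).exists_isReduced w).choose.map leftOp).prod

theorem leftOp_mem {n : ℕ} (i : Fin n) : leftOp i ∈ rightCentralizer n := by
  rw [rightCentralizer, Subalgebra.mem_centralizer_iff]
  rintro _ ⟨j, rfl⟩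
  exact LinearMap.ext fun x => (leftOp_rightOp_comm i j x).symm

theorem leftMul_mem {n : ℕ} (w : W n) : leftMul w ∈ rightCentralizer n := by
  refine list_prod_mem ?_
  intro x hx
  obtain ⟨i, -, rfl⟩ := List.mem_map.1 hx
  exact leftOp_mem i

/-- Additivity of the lengths forces every letter of the reduced word to be an ascent, so no
correction term ever appears. -/
theorem leftMul_single {n : ℕ} (v w : W n) (h : len v + len w = len (v * w)) :
    leftMul v (Finsupp.single w 1) = Finsupp.single (v * w) 1 := by
  obtain ⟨hr, hv⟩ := ((cox n).exists_isReduced v).choose_spec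
  rw [leftMul]
  generalize ((cox n).exists_isReduced v).choose = ω at hr hv
  subst hv
  have key : len ((cox n).wordProd ω) = ω.length := hr
  clear hr
  induction ω with
  | nil => simp
  | cons i ω ih =>
    rw [List.length_cons, wordProd_cons] at key
    rw [wordProd_cons] at h
    have e1 : len ((cox n).wordProd ω) ≤ ω.length := (cox n).length_wordProd_le ω
    have e2 := len_simple_mul i ((cox n).wordProd ω)
    have e3 := len_simple_mul i ((cox n).wordProd ω * w)
    have e4 : len ((cox n).wordProd ω * w) ≤ len ((cox n).wordProd ω) + len w :=
      (cox n).length_mul_le _ _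
    rw [mul_assoc] at h
    rw [List.map_cons, List.prod_cons, Module.End.mul_apply, ih (by omega) (by omega),
      leftOp_single, if_neg (by omega), zero_smul, add_zero, wordProd_cons, mul_assoc]

theorem leftMul_simple {n : ℕ} (i : Fin n) : leftMul (s i) = leftOp i := by
  refine rightCentralizer_ext (leftMul_mem _) (leftOp_mem i) ?_
  have h1 : len (1 : W n) = 0 := (cox n).length_one
  have h2 : len (s i) = 1 := (cox n).length_simple i
  rw [leftMul_single _ _ (by rw [mul_one]; omega), leftOp_single, mul_one, if_neg (by omega),
    zero_smul, add_zero]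

/-- The left regular representation of the Hecke algebra. -/
def regRep (n : ℕ) : Hecke n →ₐ[L] Module.End L (W n →₀ L) :=
  RingQuot.liftAlgHom L ⟨FreeAlgebra.lift L leftMul, by
    have h1 : len (1 : W n) = 0 := (cox n).length_one
    intro x y h
    cases h with
    | one =>
      rw [FreeAlgebra.lift_ι_apply, map_one]
      refine rightCentralizer_ext (leftMul_mem _) (one_mem _) ?_
      rw [leftMul_single _ _ (by rw [mul_one]; omega)]; simp
    | mul v w h =>
      rw [map_mul, FreeAlgebra.lift_ι_apply, FreeAlgebra.lift_ι_apply, FreeAlgebra.lift_ι_apply]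
      refine rightCentralizer_ext (mul_mem (leftMul_mem _) (leftMul_mem _)) (leftMul_mem _) ?_
      rw [Module.End.mul_apply, leftMul_single w 1 (by rw [mul_one]; omega),
        leftMul_single (v * w) 1 (by rw [mul_one]; omega), mul_one, mul_one, leftMul_single _ _ h]
    | sq i =>
      rw [map_mul, map_add, map_smul, map_one, FreeAlgebra.lift_ι_apply, leftMul_simple]
      exact LinearMap.ext fun x => smul_single_leftOp i x⟩

theorem regRep_H {n : ℕ} (w : W n) : regRep n (H w) = leftMul w := by
  rw [regRep, H]
  erw [RingQuot.liftAlgHom_mkAlgHom_apply]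
  rw [FreeAlgebra.lift_ι_apply]

/-- This separates the elements `H w` and is the source of the linear independence of the standard
basis of `N`. -/
theorem regRep_H_single_one {n : ℕ} (w : W n) :
    regRep n (H w) (Finsupp.single 1 1) = Finsupp.single w 1 := by
  have h1 : len (1 : W n) = 0 := (cox n).length_one
  rw [regRep_H, leftMul_single _ _ (by rw [mul_one]; omega), mul_one]

theorem regRep_C {n : ℕ} (i : Fin n) : regRep n (C i) = leftOp i + algebraMap L _ q := by
  rw [C, map_add, regRep_H, leftMul_simple, AlgHom.commutes]

/-! ### Sign sequences -/

/-- Sequences of `n` signs. -/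
abbrev Seq (n : ℕ) : Type := Fin n → ℤˣ

/-- The sign by which `s_i` multiplies the entries that it swaps. -/
def sgn {n : ℕ} (i : Fin n) : ℤˣ := if i.1 = 0 then -1 else 1

/-- The sum of the places with a minus, where places are numbered from zero. -/
def ht {n : ℕ} (α : Seq n) : ℕ := ∑ k, if α k = -1 then k.1 else 0

/-- `s_i` lowers `ht α`. -/
def IsDesc {n : ℕ} (i : Fin n) (α : Seq n) : Prop := α (lo i) = sgn i ∧ α (hi i) = -1

/-- `s_i` raises `ht α`. -/
def IsAsc {n : ℕ} (i : Fin n) (α : Seq n) : Prop := α (lo i) = -sgn i ∧ α (hi i) = 1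

/-! ### Fixed sequences, descents and ascents of a simple reflection -/

section Signs

theorem sgn_mul_self {n : ℕ} (i : Fin n) : sgn i * sgn i = 1 := Int.units_mul_self _

theorem sgn_of_ne {n : ℕ} {i : Fin n} (h : i.1 ≠ 0) : sgn i = 1 := if_neg h

theorem sgn_of_eq {n : ℕ} {i : Fin n} (h : i.1 = 0) : sgn i = -1 := if_pos h

theorem units_cases (u : ℤˣ) : u = 1 ∨ u = -1 := Int.units_eq_one_or u

theorem one_ne_neg_one_units : (1 : ℤˣ) ≠ -1 := by decide

variable {n : ℕ} [hn : Fact (2 ≤ n)]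

omit hn in
theorem lo_val (i : Fin n) : (lo i).1 = i.1 - 1 := rfl

theorem hi_val (i : Fin n) : (hi i).1 = max i.1 1 := by
  have := hn.1
  exact Nat.mod_eq_of_lt (by omega)

theorem hi_val' (i : Fin n) : (hi i).1 = (lo i).1 + 1 := by
  rw [hi_val, lo_val]; omega

theorem lo_ne_hi (i : Fin n) : lo i ≠ hi i := by
  intro h
  have := congrArg Fin.val h
  rw [hi_val'] at this; omega

omit hn in
theorem reflSeq_reflSeq (i : Fin n) (α : Seq n) : reflSeq i (reflSeq i α) = α :=
  signedSwap_self _ _ _ _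

omit hn in
theorem reflSeq_lo (i : Fin n) (α : Seq n) : reflSeq i α (lo i) = sgn i * α (hi i) := by
  simp [reflSeq, signedSwap, sgn]

omit hn in
theorem reflSeq_hi (i : Fin n) (α : Seq n) : reflSeq i α (hi i) = sgn i * α (lo i) := by
  simp [reflSeq, signedSwap, sgn]

omit hn in
theorem reflSeq_of_ne {i k : Fin n} (h1 : k ≠ lo i) (h2 : k ≠ hi i) (α : Seq n) :
    reflSeq i α k = α k := by
  simp [reflSeq, signedSwap, h1, h2, Equiv.swap_apply_of_ne_of_ne]

omit hn in
theorem reflSeq_eq_self_iff {i : Fin n} {α : Seq n} :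
    reflSeq i α = α ↔ sgn i * α (lo i) = α (hi i) := by
  constructor
  · intro h
    rw [← reflSeq_hi, h]
  · intro h
    funext k
    by_cases h1 : k = lo i
    · subst h1
      rw [reflSeq_lo, ← h, ← mul_assoc, sgn_mul_self, one_mul]
    · by_cases h2 : k = hi i
      · subst h2
        rw [reflSeq_hi, h]
      · exact reflSeq_of_ne h1 h2 α

omit hn in
theorem fixed_or_desc_or_asc (i : Fin n) (α : Seq n) :
    reflSeq i α = α ∨ IsDesc i α ∨ IsAsc i α := by
  rw [reflSeq_eq_self_iff, IsDesc, IsAsc]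
  rcases units_cases (α (lo i)) with h1 | h1 <;> rcases units_cases (α (hi i)) with h2 | h2 <;>
    rcases units_cases (sgn i) with h3 | h3 <;> rw [h1, h2, h3] <;> decide

omit hn in
theorem IsDesc.not_fixed {i : Fin n} {α : Seq n} (h : IsDesc i α) :
    sgn i * α (lo i) ≠ α (hi i) := by
  rw [h.1, h.2, sgn_mul_self]; decide

omit hn in
theorem IsAsc.not_fixed {i : Fin n} {α : Seq n} (h : IsAsc i α) :
    sgn i * α (lo i) ≠ α (hi i) := by
  rw [h.1, h.2, mul_neg, sgn_mul_self]; decide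

omit hn in
theorem IsAsc.refl_desc {i : Fin n} {α : Seq n} (h : IsAsc i α) : IsDesc i (reflSeq i α) := by
  rw [IsDesc, reflSeq_lo, reflSeq_hi, h.1, h.2, mul_neg, sgn_mul_self]; simp

theorem sum_split {M : Type*} [AddCommMonoid M] (i : Fin n) (f : Fin n → M) :
    ∑ k, f k = f (lo i) + (f (hi i) + ∑ k ∈ (Finset.univ.erase (lo i)).erase (hi i), f k) := by
  rw [Finset.add_sum_erase _ _ (by simp [(lo_ne_hi i).symm]),
    Finset.add_sum_erase _ _ (Finset.mem_univ _)]

theorem prod_split {M : Type*} [CommMonoid M] (i : Fin n) (f : Fin n → M) :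
    ∏ k, f k = f (lo i) * (f (hi i) * ∏ k ∈ (Finset.univ.erase (lo i)).erase (hi i), f k) := by
  rw [Finset.mul_prod_erase _ _ (by simp [(lo_ne_hi i).symm]),
    Finset.mul_prod_erase _ _ (Finset.mem_univ _)]

theorem prod_reflSeq (i : Fin n) (α : Seq n) : ∏ k, reflSeq i α k = ∏ k, α k := by
  rw [prod_split i, prod_split i α, reflSeq_lo, reflSeq_hi, Finset.prod_congr rfl
    (g := α) fun k hk => ?_]
  · rw [← mul_assoc, mul_mul_mul_comm, sgn_mul_self, one_mul, mul_comm (α (hi i)), mul_assoc]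
  · simp only [Finset.mem_erase] at hk
    exact reflSeq_of_ne hk.2.1 hk.1 α

/-- For `i ≠ 0` a minus moves one place to the left. For `i = 0` the minuses at the places numbered
`0` and `1` disappear, and this also costs exactly `1` because the numbering starts at zero. -/
theorem IsDesc.ht_reflSeq {i : Fin n} {α : Seq n} (h : IsDesc i α) :
    ht (reflSeq i α) + 1 = ht α := by
  have h3 : ∑ k ∈ (Finset.univ.erase (lo i)).erase (hi i), (if reflSeq i α k = -1 then k.1 else 0)
      = ∑ k ∈ (Finset.univ.erase (lo i)).erase (hi i), (if α k = -1 then k.1 else 0) := by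
    refine Finset.sum_congr rfl fun k hk => ?_
    simp only [Finset.mem_erase] at hk
    rw [reflSeq_of_ne hk.2.1 hk.1 α]
  rw [ht, ht, sum_split i, sum_split i (fun k => if α k = -1 then k.1 else 0), h3, reflSeq_lo,
    reflSeq_hi, h.1, h.2, sgn_mul_self, hi_val', if_neg one_ne_neg_one_units, if_pos rfl]
  by_cases h0 : i.1 = 0
  · rw [sgn_of_eq h0, lo_val, h0]; simp; omega
  · rw [sgn_of_ne h0]; simp; omega

theorem IsAsc.ht_reflSeq {i : Fin n} {α : Seq n} (h : IsAsc i α) :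
    ht (reflSeq i α) = ht α + 1 := by
  rw [← h.refl_desc.ht_reflSeq, reflSeq_reflSeq]

theorem ht_reflSeq_le (i : Fin n) (α : Seq n) : ht (reflSeq i α) ≤ ht α + 1 := by
  rcases fixed_or_desc_or_asc i α with h | h | h
  · rw [h]; omega
  · have := h.ht_reflSeq; omega
  · rw [h.ht_reflSeq]

/-- A descent needs a minus at its right place and, unless `i = 0`, a plus at its left place. A
common place of two different descents would carry both signs. Descents can therefore be
interchanged. -/
theorem disjoint_of_desc {i k : Fin n} {α : Seq n} (hi' : IsDesc i α) (hk : IsDesc k α)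
    (h : i ≠ k) : lo i ≠ lo k ∧ lo i ≠ hi k ∧ hi i ≠ lo k ∧ hi i ≠ hi k := by
  have hne : i.1 ≠ k.1 := fun h' => h (Fin.ext h')
  have h1 : lo i ≠ lo k := by
    intro h1
    have h2 := congrArg Fin.val h1
    simp only [lo_val] at h2
    have h3 := hi'.1.symm.trans ((congrArg α h1).trans hk.1)
    by_cases h4 : i.1 = 0
    · rw [sgn_of_eq h4, sgn_of_ne (by omega)] at h3
      exact absurd h3 (by decide)
    · rw [sgn_of_ne h4, sgn_of_eq (by omega)] at h3
      exact absurd h3 (by decide)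
  refine ⟨h1, ?_, ?_, ?_⟩
  · intro h2
    have h3 := hi'.1.symm.trans ((congrArg α h2).trans hk.2)
    have h4 := congrArg Fin.val h2
    rw [lo_val, hi_val] at h4
    rw [sgn_of_ne (by omega)] at h3
    exact absurd h3 (by decide)
  · intro h2
    have h3 := hk.1.symm.trans ((congrArg α h2.symm).trans hi'.2)
    have h4 := congrArg Fin.val h2
    rw [lo_val, hi_val] at h4
    rw [sgn_of_ne (by omega)] at h3
    exact absurd h3 (by decide)
  · intro h2
    apply h1
    have h4 := congrArg Fin.val h2
    rw [hi_val', hi_val'] at h4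
    exact Fin.ext (by omega)

omit hn in
theorem reflSeq_comm {i j : Fin n} (hij : i ≠ j) (h : ¬ dynkinAdj i j) (α : Seq n) :
    reflSeq i (reflSeq j α) = reflSeq j (reflSeq i α) :=
  Equiv.congr_fun (reflPerm_comm hij h) α

omit hn in
theorem reflSeq_braid {i j : Fin n} (h : dynkinAdj i j) (α : Seq n) :
    reflSeq i (reflSeq j (reflSeq i α)) = reflSeq j (reflSeq i (reflSeq j α)) := by
  rcases lt_trichotomy i.1 j.1 with h1 | h1 | h1
  · exact Equiv.congr_fun (reflPerm_braid h h1) α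
  · unfold dynkinAdj at h; omega
  · refine (Equiv.congr_fun (reflPerm_braid (i := j) (j := i) ?_ h1) α).symm
    unfold dynkinAdj at h ⊢; omega

/-- Without a descent by `s_k`, `k ≥ 1`, a plus is followed by pluses only, and without a descent by
`s_0` the first two signs are not both minus. Only the first sign could then be a minus, and the
parity excludes this. -/
theorem exists_desc {α : Seq n} (h : ∏ k, α k = 1) (h1 : α ≠ 1) : ∃ i, IsDesc i α := by
  by_contra hno
  push Not at hno
  have h2 := hn.1
  -- after a plus there are only pluses
  have hplus : ∀ k : ℕ, ∀ (hk : k + 1 < n), α ⟨k, by omega⟩ = 1 → α ⟨k + 1, hk⟩ = 1 := by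
    intro k hk h3
    rcases units_cases (α ⟨k + 1, hk⟩) with h4 | h4
    · exact h4
    · refine absurd ⟨?_, ?_⟩ (hno ⟨k + 1, hk⟩)
      · rw [sgn_of_ne (by simp)]; exact h3
      · have : hi (⟨k + 1, hk⟩ : Fin n) = ⟨k + 1, hk⟩ := Fin.ext (by rw [hi_val]; simp)
        rw [this]; exact h4
  have hplus' : ∀ (k l : ℕ) (hl : k + l < n), α ⟨k, by omega⟩ = 1 → α ⟨k + l, hl⟩ = 1 := by
    intro k l
    induction l with
    | zero => exact fun _ h => h
    | succ l ih => exact fun hl h => hplus (k + l) hl (ih (by omega) h)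
  have e0 : lo (⟨0, by omega⟩ : Fin n) = ⟨0, by omega⟩ := Fin.ext (by rw [lo_val]; simp)
  have e1 : hi (⟨0, by omega⟩ : Fin n) = ⟨1, by omega⟩ := Fin.ext (by rw [hi_val]; simp)
  have h01 : α ⟨1, by omega⟩ = 1 := by
    rcases units_cases (α ⟨1, by omega⟩) with h4 | h4
    · exact h4
    · rcases units_cases (α ⟨0, by omega⟩) with h5 | h5
      · exact hplus 0 _ h5
      · refine absurd ⟨?_, ?_⟩ (hno ⟨0, by omega⟩)
        · rw [sgn_of_eq rfl, e0, h5]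
        · rw [e1, h4]
  have hge : ∀ k : Fin n, 1 ≤ k.1 → α k = 1 := by
    intro k hk
    have := hplus' 1 (k.1 - 1) (by omega) h01
    convert this
    omega
  have h00 : α ⟨0, by omega⟩ = 1 := by
    rw [← h, Finset.prod_eq_single ⟨0, by omega⟩]
    · intro b _ hb
      exact hge b (by
        have : b.1 ≠ 0 := fun h' => hb (Fin.ext h')
        omega)
    · intro h'; exact absurd (Finset.mem_univ _) h'
  apply h1
  funext k
  rcases Nat.eq_zero_or_pos k.1 with h3 | h3
  · rw [show k = ⟨0, by omega⟩ from Fin.ext h3, h00]; rfl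
  · exact hge k h3

end Signs

/-! ### Shortest coset representatives -/

section Cosets

theorem signSeq_one {n : ℕ} : signSeq (1 : W n) = 1 := by
  rw [signSeq, inv_one, map_one (seqAction n)]; rfl

theorem seqAction_simple {n : ℕ} (i : Fin n) (α : Seq n) :
    seqAction n (s i) α = reflSeq i α := by
  have h : seqAction n (s i) = reflPerm i := (cox n).lift_apply_simple _ i
  rw [h]; rfl

theorem signSeq_mul_simple {n : ℕ} (w : W n) (i : Fin n) :
    signSeq (w * s i) = reflSeq i (signSeq w) := by
  rw [signSeq, mul_inv_rev, (cox n).inv_simple, map_mul, Equiv.Perm.mul_apply, seqAction_simple,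
    signSeq]

theorem reflSeq_one {n : ℕ} {i : Fin n} (h : i.1 ≠ 0) : reflSeq i 1 = (1 : Seq n) := by
  rw [reflSeq_eq_self_iff, sgn_of_ne h]; rfl

/-- The generators of `W_𝔭` fix the sequence of pluses, where the action starts; so the sign
sequence only depends on the coset. -/
theorem signSeq_simple_mul {n : ℕ} (w : W n) {i : Fin n} (h : i.1 ≠ 0) :
    signSeq (s i * w) = signSeq w := by
  rw [signSeq, mul_inv_rev, (cox n).inv_simple, map_mul, Equiv.Perm.mul_apply, seqAction_simple,
    reflSeq_one h, signSeq]

open scoped Classical in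
/-- `elt α` computed with a bound for the number of steps. -/
def eltAux {n : ℕ} : ℕ → Seq n → W n
  | 0, _ => 1
  | k + 1, α => if h : ∃ i, IsDesc i α then eltAux k (reflSeq h.choose α) * s h.choose else 1

/-- The shortest element of `W` with sign sequence `α` (for an even number of minuses). -/
def elt {n : ℕ} (α : Seq n) : W n := eltAux (ht α) α

variable {n : ℕ} [hn : Fact (2 ≤ n)]

theorem elt_choose {α : Seq n} (h : ∃ i, IsDesc i α) :
    elt α = elt (reflSeq h.choose α) * s h.choose := by
  have h1 := h.choose_spec.ht_reflSeq
  rw [elt, ← h1, eltAux, dif_pos h, elt]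

omit hn in
theorem elt_one : elt (1 : Seq n) = 1 := by
  have h : ht (1 : Seq n) = 0 := by simp [ht]
  rw [elt, h, eltAux]

/-- The descent chosen in the definition of `elt` is irrelevant. Two different descents act on
disjoint places, so the reflections commute, and both orders of removing them lead to the same lower
sequence, where the induction hypothesis applies. -/
theorem elt_desc {α : Seq n} {k : Fin n} (hk : IsDesc k α) :
    elt α = elt (reflSeq k α) * s k := by
  induction hm : ht α using Nat.strong_induction_on generalizing α k with
  | _ m ih =>
    subst hm
    have h : ∃ i, IsDesc i α := ⟨k, hk⟩
    rw [elt_choose h]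
    have hi' := h.choose_spec
    generalize h.choose = i at hi'
    by_cases hik : i = k
    · rw [hik]
    obtain ⟨d1, d2, d3, d4⟩ := disjoint_of_desc hi' hk hik
    have hadj : ¬ dynkinAdj i k := by
      have e1 : (lo i).1 ≠ (hi k).1 := fun h => d2 (Fin.ext h)
      have e2 : (hi i).1 ≠ (lo k).1 := fun h => d3 (Fin.ext h)
      rw [lo_val, hi_val] at e1 e2
      unfold dynkinAdj; omega
    have hk' : IsDesc k (reflSeq i α) := by
      rw [IsDesc, reflSeq_of_ne d1.symm d3.symm, reflSeq_of_ne d2.symm d4.symm]; exact hk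
    have hi'' : IsDesc i (reflSeq k α) := by
      rw [IsDesc, reflSeq_of_ne d1 d2, reflSeq_of_ne d3 d4]; exact hi'
    have l1 := hi'.ht_reflSeq
    have l2 := hk.ht_reflSeq
    rw [ih _ (by omega) hk' rfl, ih _ (by omega) hi'' rfl, reflSeq_comm hik hadj, mul_assoc,
      mul_assoc, simple_comm hik hadj]

/-- This is the third case of Deodhar's trichotomy: if `s i` does not move the coset, it can be
pulled through the shortest representative as a generator of `W_𝔭`. The induction removes a descent
`k`. If `s k` and `s i` commute, this is immediate. Otherwise `i` is a descent of the next sequence,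
the sequence after both steps is fixed by `s k`, and the braid relation passes from `s i` to `s k`.
-/
theorem elt_fixed {α : Seq n} (hα : ∏ k, α k = 1) {i : Fin n} (h : reflSeq i α = α) :
    ∃ j : Fin n, j.1 ≠ 0 ∧ elt α * s i = s j * elt α := by
  induction hm : ht α using Nat.strong_induction_on generalizing α i with
  | _ m ih =>
    subst hm
    by_cases h1 : α = 1
    · subst h1
      refine ⟨i, fun h0 => ?_, by rw [elt_one, one_mul, mul_one]⟩
      rw [reflSeq_eq_self_iff, sgn_of_eq h0, Pi.one_apply, Pi.one_apply] at h
      exact absurd h (by decide)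
    obtain ⟨k, hk⟩ := exists_desc hα h1
    have hki : k ≠ i := by
      rintro rfl
      exact hk.not_fixed (reflSeq_eq_self_iff.1 h)
    have hne : k.1 ≠ i.1 := fun h' => hki (Fin.ext h')
    have l1 := hk.ht_reflSeq
    have hf := reflSeq_eq_self_iff.1 h
    by_cases hadj : dynkinAdj i k
    -- The places of `i` and `k` share one point. The descent `k` flips the sign there, and this
    -- turns the fixed pair at `i` into a descent.
    · have hd : IsDesc i (reflSeq k α) := by
        rcases Nat.lt_or_gt_of_ne hne with hlt | hlt
        · have e1 : hi k = lo i := Fin.ext (by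
            rw [hi_val, lo_val]; unfold dynkinAdj at hadj; omega)
          have e2 : hi i ≠ lo k := fun h' => by
            have := congrArg Fin.val h'
            rw [hi_val, lo_val] at this; omega
          have e3 : hi i ≠ hi k := fun h' => by
            rw [e1] at h'; exact lo_ne_hi i h'.symm
          have hs : sgn i = 1 := sgn_of_ne (by omega)
          rw [IsDesc, reflSeq_of_ne e2 e3, ← hf, hs, ← e1, reflSeq_hi, hk.1, hk.2, sgn_mul_self]
          exact ⟨rfl, by simp⟩
        · have e1 : hi i = lo k := Fin.ext (by
            rw [hi_val, lo_val]; unfold dynkinAdj at hadj; omega)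
          have e2 : lo i ≠ hi k := fun h' => by
            have := congrArg Fin.val h'
            rw [hi_val, lo_val] at this; omega
          have e3 : lo i ≠ lo k := fun h' => by
            rw [← e1] at h'; exact lo_ne_hi i h'
          have hs : sgn k = 1 := sgn_of_ne (by omega)
          rw [e1, hk.1, hs] at hf
          rw [IsDesc, reflSeq_of_ne e3 e2, e1, reflSeq_lo, hk.2, hs]
          refine ⟨?_, by simp⟩
          rw [← one_mul (α (lo i)), ← sgn_mul_self i, mul_assoc, hf, mul_one]
      have l2 := hd.ht_reflSeq
      have hadj' : dynkinAdj k i := by unfold dynkinAdj at hadj ⊢; omega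
      have hf' : reflSeq k (reflSeq i (reflSeq k α)) = reflSeq i (reflSeq k α) := by
        rw [reflSeq_braid hadj', h]
      obtain ⟨j, hj, hj'⟩ := ih (ht (reflSeq i (reflSeq k α))) (by omega)
        (by rw [prod_reflSeq, prod_reflSeq, hα]) hf' rfl
      refine ⟨j, hj, ?_⟩
      rw [elt_desc hk, elt_desc hd, ← mul_assoc, ← mul_assoc, ← hj']
      simp only [mul_assoc]
      rw [← mul_assoc (s i), ← mul_assoc (s k), simple_braid hadj]
    · have hadj' : ¬ dynkinAdj k i := by unfold dynkinAdj at hadj ⊢; omega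
      obtain ⟨j, hj, hj'⟩ := ih (ht (reflSeq k α)) (by omega) (by rw [prod_reflSeq, hα])
        (by rw [← reflSeq_comm hki hadj', h]) rfl
      refine ⟨j, hj, ?_⟩
      rw [elt_desc hk, mul_assoc, simple_comm hki hadj', ← mul_assoc, hj', mul_assoc]

theorem prod_signSeq (w : W n) : ∏ k, signSeq w k = 1 := by
  induction w using (cox n).simple_induction_right with
  | one => rw [signSeq_one]; simp
  | mul_simple_right w i ih => rw [signSeq_mul_simple, prod_reflSeq, ih]

/-- Every letter raises the height by at most one. This bounds lengths from below, and the elements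
`elt α` attain the bound. -/
theorem ht_signSeq_le (w : W n) : ht (signSeq w) ≤ len w := by
  induction hk : len w generalizing w with
  | zero =>
    rw [(cox n).length_eq_zero_iff] at hk
    rw [hk, signSeq_one]
    simp [ht]
  | succ k ih =>
    have hw : w ≠ 1 := by
      rintro rfl; simp at hk
    obtain ⟨i, hi⟩ := (cox n).exists_rightDescent_of_ne_one hw
    have h1 : len (w * s i) + 1 = len w := (cox n).isRightDescent_iff.1 hi
    rw [← mul_simple_cancel w i, signSeq_mul_simple]
    have h2 := ht_reflSeq_le i (signSeq (w * s i))
    have h3 := ih (w * s i) (by omega)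
    omega

theorem signSeq_elt {α : Seq n} (hα : ∏ k, α k = 1) : signSeq (elt α) = α := by
  induction hm : ht α using Nat.strong_induction_on generalizing α with
  | _ m ih =>
    by_cases h1 : α = 1
    · rw [h1, elt_one, signSeq_one]
    obtain ⟨k, hk⟩ := exists_desc hα h1
    have := hk.ht_reflSeq
    rw [elt_desc hk, signSeq_mul_simple, ih _ (by omega) (by rw [prod_reflSeq, hα]) rfl,
      reflSeq_reflSeq]

theorem len_elt {α : Seq n} (hα : ∏ k, α k = 1) : len (elt α) = ht α := by
  refine le_antisymm ?_ (by simpa only [signSeq_elt hα] using ht_signSeq_le (elt α))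
  induction hm : ht α using Nat.strong_induction_on generalizing α with
  | _ m ih =>
    by_cases h1 : α = 1
    · rw [h1, elt_one, len, (cox n).length_one]; omega
    obtain ⟨k, hk⟩ := exists_desc hα h1
    have h2 := hk.ht_reflSeq
    have h3 := ih (ht (reflSeq k α)) (by omega) (by rw [prod_reflSeq, hα]) rfl
    have h4 := len_mul_simple (elt (reflSeq k α)) k
    rw [elt_desc hk]
    omega

/-- The product with `s i` has the same sign sequence, hence at least the same height bound for its
length; as the length changes by one, it grows. -/
theorem elt_mem {α : Seq n} (hα : ∏ k, α k = 1) (i : Fin n) (hi : i.1 ≠ 0) :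
    len (elt α) < len (s i * elt α) := by
  have h1 := ht_signSeq_le (s i * elt α)
  rw [signSeq_simple_mul _ hi, signSeq_elt hα, ← len_elt hα] at h1
  have := len_simple_mul i (elt α)
  omega

/-- Removing a right descent `s i` leaves a shortest representative, to which induction applies. Its
sequence cannot be fixed by `s i`, since by `elt_fixed` the element `w` would then have a left
descent in `W_𝔭`. In the two remaining cases `elt_desc` compares the sequences before and after. -/
theorem eq_elt_signSeq (w : W n) (hw : ∀ i : Fin n, i.1 ≠ 0 → len w < len (s i * w)) :
    w = elt (signSeq w) := by
  induction hk : len w generalizing w with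
  | zero =>
    rw [(cox n).length_eq_zero_iff] at hk
    rw [hk, signSeq_one, elt_one]
  | succ k ih =>
    have hw1 : w ≠ 1 := by
      rintro rfl; simp at hk
    obtain ⟨i, hi⟩ := (cox n).exists_rightDescent_of_ne_one hw1
    have h1 : len (w * s i) + 1 = len w := (cox n).isRightDescent_iff.1 hi
    have h2 := ih (w * s i) (fun j hj => by
      have h3 := len_simple_mul j (w * s i)
      have h4 := len_mul_simple (s j * w) i
      have h5 := hw j hj
      rw [← mul_assoc] at h3 ⊢
      omega) (by omega)
    have hev := prod_signSeq (w * s i)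
    have hl := len_elt hev
    rw [← h2] at hl
    have e : w = w * s i * s i := (mul_simple_cancel w i).symm
    have e' : signSeq w = reflSeq i (signSeq (w * s i)) := by
      rw [← signSeq_mul_simple, mul_simple_cancel]
    rcases fixed_or_desc_or_asc i (signSeq (w * s i)) with h | h | h
    · obtain ⟨j, hj, hj'⟩ := elt_fixed hev h
      rw [← h2, ← e] at hj'
      have h3 := hw j hj
      rw [hj', simple_mul_cancel] at h3
      rw [← hj'] at h3
      omega
    · have h3 := elt_desc h
      rw [← h2, ← e'] at h3
      have h4 : w = elt (signSeq w) * s i * s i := by rw [← h3, ← e]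
      rwa [mul_simple_cancel] at h4
    · have h3 := elt_desc h.refl_desc
      rw [reflSeq_reflSeq, ← e', ← h2, ← e] at h3
      exact h3.symm

/-- Sign sequences with an even number of minuses. -/
abbrev EvenSeq (n : ℕ) : Type := {α : Seq n // ∏ k, α k = 1}

/-- The sign sequence as a bijection from `W^𝔭` to the sign sequences with an even number of
minuses. -/
def wpEquiv (n : ℕ) [Fact (2 ≤ n)] : Wp n ≃ EvenSeq n where
  toFun w := ⟨signSeq w.1, prod_signSeq w.1⟩
  invFun α := ⟨elt α.1, elt_mem α.2⟩
  left_inv w := Subtype.ext (eq_elt_signSeq w.1 w.2).symm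
  right_inv α := Subtype.ext (signSeq_elt α.2)

end Cosets

/-! ### Coordinates on the parabolic module -/

open scoped Classical in
/-- The operator of `C_{s_i}` and of `e_i` on functions of sign sequences. -/
def opE {n : ℕ} (i : Fin n) : (Seq n → L) →ₗ[L] (Seq n → L) where
  toFun f β := if sgn i * β (lo i) = β (hi i) then 0 else
    f (reflSeq i β) + (if β (hi i) = -1 then qi else q) * f β
  map_add' f g := by
    funext β
    simp only [Pi.add_apply]
    split_ifs <;> ring
  map_smul' a f := by
    funext β
    simp only [Pi.smul_apply, smul_eq_mul, RingHom.id_apply]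
    split_ifs <;> ring

theorem opE_fixed {n : ℕ} {i : Fin n} {β : Seq n} (h : reflSeq i β = β) (f : Seq n → L) :
    opE i f β = 0 :=
  if_pos (reflSeq_eq_self_iff.1 h)

theorem opE_desc {n : ℕ} {i : Fin n} {β : Seq n} (h : IsDesc i β) (f : Seq n → L) :
    opE i f β = f (reflSeq i β) + qi * f β :=
  (if_neg h.not_fixed).trans (by rw [if_pos h.2])

theorem opE_asc {n : ℕ} {i : Fin n} {β : Seq n} (h : IsAsc i β) (f : Seq n → L) :
    opE i f β = f (reflSeq i β) + q * f β :=
  (if_neg h.not_fixed).trans (by rw [if_neg (by rw [h.2]; decide)])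

open scoped Classical in
/-- The characteristic function of a sign sequence. -/
def delta {n : ℕ} (α : Seq n) : Seq n → L := Pi.single α 1

theorem delta_self {n : ℕ} (α : Seq n) : delta α α = 1 := by
  classical
  simp [delta]

theorem delta_of_ne {n : ℕ} {α β : Seq n} (h : β ≠ α) : delta α β = 0 := by
  classical
  simp [delta, h]

theorem opE_delta_fixed {n : ℕ} {i : Fin n} {α : Seq n} (h : reflSeq i α = α) :
    opE i (delta α) = 0 := by
  funext β
  rcases fixed_or_desc_or_asc i β with h1 | h1 | h1
  · exact opE_fixed h1 _
  all_goals
    have h2 : β ≠ α := by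
      rintro rfl
      exact h1.not_fixed (reflSeq_eq_self_iff.1 h)
    have h3 : reflSeq i β ≠ α := fun h' => h2 (by rw [← reflSeq_reflSeq i β, h', h])
  · rw [opE_desc h1, delta_of_ne h2, delta_of_ne h3]; simp
  · rw [opE_asc h1, delta_of_ne h2, delta_of_ne h3]; simp

theorem opE_delta_of_not_fixed {n : ℕ} {i : Fin n} {α : Seq n} {c : L}
    (h : reflSeq i α ≠ α) (hc : ∀ f, opE i f α = f (reflSeq i α) + c * f α) :
    opE i (delta α) = delta (reflSeq i α) + c • delta α := by
  funext β
  rw [Pi.add_apply, Pi.smul_apply, smul_eq_mul]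
  by_cases h1 : β = α
  · subst h1
    rw [hc, delta_of_ne h, delta_of_ne h.symm]
  rw [delta_of_ne h1, mul_zero, add_zero]
  by_cases h2 : β = reflSeq i α
  · subst h2
    have e : opE i (delta α) (reflSeq i α) = delta α (reflSeq i (reflSeq i α)) := by
      rcases fixed_or_desc_or_asc i (reflSeq i α) with h3 | h3 | h3
      · rw [reflSeq_reflSeq] at h3
        exact absurd h3.symm h
      · rw [opE_desc h3, delta_of_ne h1, mul_zero, add_zero]
      · rw [opE_asc h3, delta_of_ne h1, mul_zero, add_zero]
    rw [e, reflSeq_reflSeq, delta_self, delta_self]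
  · have h4 : reflSeq i β ≠ α := fun h' => h2 (by rw [← h', reflSeq_reflSeq])
    rw [delta_of_ne h2]
    rcases fixed_or_desc_or_asc i β with h3 | h3 | h3
    · exact opE_fixed h3 _
    · rw [opE_desc h3, delta_of_ne h1, delta_of_ne h4]; simp
    · rw [opE_asc h3, delta_of_ne h1, delta_of_ne h4]; simp

theorem IsDesc.reflSeq_ne {n : ℕ} {i : Fin n} {α : Seq n} (h : IsDesc i α) : reflSeq i α ≠ α :=
  fun h' => h.not_fixed (reflSeq_eq_self_iff.1 h')

theorem IsAsc.reflSeq_ne {n : ℕ} {i : Fin n} {α : Seq n} (h : IsAsc i α) : reflSeq i α ≠ α :=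
  fun h' => h.not_fixed (reflSeq_eq_self_iff.1 h')

theorem opE_delta_desc {n : ℕ} {i : Fin n} {α : Seq n} (h : IsDesc i α) :
    opE i (delta α) = delta (reflSeq i α) + qi • delta α :=
  opE_delta_of_not_fixed h.reflSeq_ne fun f => opE_desc h f

theorem opE_delta_asc {n : ℕ} {i : Fin n} {α : Seq n} (h : IsAsc i α) :
    opE i (delta α) = delta (reflSeq i α) + q • delta α :=
  opE_delta_of_not_fixed h.reflSeq_ne fun f => opE_asc h f

/-- Functions that vanish at the sign sequences with an odd number of minuses. -/
def EvenFun (n : ℕ) : Submodule L (Seq n → L) where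
  carrier := {f | ∀ α, ∏ k, α k ≠ 1 → f α = 0}
  add_mem' hf hg α hα := by simp [hf α hα, hg α hα]
  zero_mem' _ _ := rfl
  smul_mem' a f hf α hα := by simp [hf α hα]

theorem delta_mem {n : ℕ} {α : Seq n} (h : ∏ k, α k = 1) : delta α ∈ EvenFun n := by
  intro β hβ
  exact delta_of_ne (by rintro rfl; exact hβ h)

theorem actN_mk {n : ℕ} (g h : Hecke n) :
    actN g (Submodule.Quotient.mk h : N n) = Submodule.Quotient.mk (h * g) := rfl

theorem actN_mul {n : ℕ} (g h : Hecke n) (x : N n) : actN (g * h) x = actN h (actN g x) := by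
  obtain ⟨y, rfl⟩ := Submodule.Quotient.mk_surjective _ x
  simp only [actN_mk, mul_assoc]

theorem actN_add {n : ℕ} (g h : Hecke n) (x : N n) : actN (g + h) x = actN g x + actN h x := by
  obtain ⟨y, rfl⟩ := Submodule.Quotient.mk_surjective _ x
  simp only [actN_mk, mul_add, Submodule.Quotient.mk_add]

theorem actN_algebraMap {n : ℕ} (a : L) (x : N n) : actN (algebraMap L _ a) x = a • x := by
  obtain ⟨y, rfl⟩ := Submodule.Quotient.mk_surjective _ x
  rw [actN_mk, ← Algebra.commutes, ← Algebra.smul_def, Submodule.Quotient.mk_smul]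

theorem H_induction {n : ℕ} {p : Hecke n → Prop} (hs : ∀ i, p (H (s i)))
    (ha : ∀ a, p (algebraMap L _ a)) (hadd : ∀ x y, p x → p y → p (x + y))
    (hmul : ∀ x y, p x → p y → p (x * y)) (x : Hecke n) : p x := by
  have hH : ∀ w : W n, p (H w) := by
    intro w
    induction h : len w generalizing w with
    | zero =>
      rw [(cox n).length_eq_zero_iff] at h
      subst h
      rw [H_one, ← map_one (algebraMap L _)]; exact ha 1
    | succ k ih =>
      have hw : w ≠ 1 := by
        rintro rfl; simp at h
      obtain ⟨i, hi⟩ := (cox n).exists_leftDescent_of_ne_one hw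
      have h1 : len (s i * w) + 1 = len w := (cox n).isLeftDescent_iff.1 hi
      have h3 : len (s i) = 1 := (cox n).length_simple i
      have h2 := H_mul (s i) (s i * w) (by rw [simple_mul_cancel]; omega)
      rw [simple_mul_cancel] at h2
      rw [← h2]
      exact hmul _ _ (hs i) (ih _ (by omega))
  obtain ⟨y, rfl⟩ := RingQuot.mkAlgHom_surjective L (HeckeRel n) x
  change p (heckeProj n y)
  induction y using FreeAlgebra.induction with
  | grade0 a => rw [AlgHom.commutes]; exact ha a
  | grade1 w => exact hH w
  | mul a b h1 h2 => rw [map_mul]; exact hmul _ _ h1 h2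
  | add a b h1 h2 => rw [map_add]; exact hadd _ _ h1 h2

/-- The class of `H_w` for the shortest `w` with sign sequence `α`. -/
def stdElt {n : ℕ} (α : Seq n) : N n := Submodule.Quotient.mk (H (elt α))

/-! ### The standard basis of the parabolic module -/

section Coord

variable {n : ℕ} [hn : Fact (2 ≤ n)]

theorem stdN_eq (w : Wp n) : stdN w = stdElt (signSeq w.1) := by
  rw [stdN, stdElt, ← eq_elt_signSeq w.1 w.2]

omit hn in
theorem actN_C_mk (i : Fin n) (h : Hecke n) :
    actN (C i) (Submodule.Quotient.mk h : N n) =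
      Submodule.Quotient.mk (h * H (s i)) + q • Submodule.Quotient.mk h := by
  rw [C, actN_add, actN_algebraMap, actN_mk]

theorem actN_C_asc {i : Fin n} {α : Seq n} (hα : ∏ k, α k = 1) (h : IsAsc i α) :
    actN (C i) (stdElt α) = stdElt (reflSeq i α) + q • stdElt α := by
  have h1 := elt_desc h.refl_desc
  have h2 := h.ht_reflSeq
  have h3 : len (s i) = 1 := (cox n).length_simple i
  rw [reflSeq_reflSeq] at h1
  rw [stdElt, actN_C_mk, stdElt, H_mul _ _ (by
    rw [← h1, len_elt hα, len_elt (by rw [prod_reflSeq, hα])]; omega), h1]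

theorem actN_C_desc {i : Fin n} {α : Seq n} (hα : ∏ k, α k = 1) (h : IsDesc i α) :
    actN (C i) (stdElt α) = stdElt (reflSeq i α) + qi • stdElt α := by
  have h1 := elt_desc h
  have h2 := h.ht_reflSeq
  have h3 : len (s i) = 1 := (cox n).length_simple i
  have h4 := H_mul (elt (reflSeq i α)) (s i) (by
    rw [← h1, len_elt hα, len_elt (by rw [prod_reflSeq, hα])]; omega)
  rw [← h1] at h4
  have h5 : H (elt α) * H (s i) = (qi - q) • H (elt α) + H (elt (reflSeq i α)) := by
    rw [← h4, mul_assoc, H_sq, mul_add, mul_smul_comm, mul_one]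
  rw [stdElt, actN_C_mk, h5, Submodule.Quotient.mk_add, Submodule.Quotient.mk_smul, stdElt]
  module

/-- By `elt_fixed` the right factor `H (s i)` becomes a left factor `H (s j)` with `j ≠ 0`, so the
result is the class of `C j * H (elt α)`, which is zero in the quotient. -/
theorem actN_C_fixed {i : Fin n} {α : Seq n} (hα : ∏ k, α k = 1) (h : reflSeq i α = α) :
    actN (C i) (stdElt α) = 0 := by
  obtain ⟨j, hj, h1⟩ := elt_fixed hα h
  have h2 := elt_mem hα j hj
  have h3 := len_simple_mul j (elt α)
  have h4 : len (s j) = 1 := (cox n).length_simple j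
  have h5 : len (s i) = 1 := (cox n).length_simple i
  rw [stdElt, actN_C_mk, H_mul _ _ (by rw [h1]; omega), h1, ← H_mul _ _ (by omega)]
  have h6 : H (s j) * H (elt α) + q • H (elt α) = C j * H (elt α) := by
    rw [C, add_mul, ← Algebra.smul_def]
  rw [← Submodule.Quotient.mk_smul, ← Submodule.Quotient.mk_add, h6,
    Submodule.Quotient.mk_eq_zero]
  exact Submodule.subset_span ⟨j, _, hj, rfl⟩

/-- The span contains the class of `1` and is stable under the operators `C i`, by the three cases
for a sign sequence. The elements `H (s i)` and the scalars generate the Hecke algebra, so it is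
stable under all of it. -/
theorem span_stdElt :
    Submodule.span L (Set.range fun α : EvenSeq n => stdElt α.1) = ⊤ := by
  have key : ∀ h : Hecke n, ∀ x ∈ Submodule.span L (Set.range fun α : EvenSeq n => stdElt α.1),
      actN h x ∈ Submodule.span L (Set.range fun α : EvenSeq n => stdElt α.1) := by
    have hC : ∀ i, ∀ x ∈ Submodule.span L (Set.range fun α : EvenSeq n => stdElt α.1),
        actN (C i) x ∈ Submodule.span L (Set.range fun α : EvenSeq n => stdElt α.1) := by
      intro i x hx
      induction hx using Submodule.span_induction with
      | mem x hx =>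
        obtain ⟨⟨α, hα⟩, rfl⟩ := hx
        have m1 : stdElt α ∈ Submodule.span L (Set.range fun α : EvenSeq n => stdElt α.1) :=
          Submodule.subset_span ⟨⟨α, hα⟩, rfl⟩
        have m2 : stdElt (reflSeq i α) ∈
            Submodule.span L (Set.range fun α : EvenSeq n => stdElt α.1) :=
          Submodule.subset_span ⟨⟨reflSeq i α, by rw [prod_reflSeq, hα]⟩, rfl⟩
        change actN (C i) (stdElt α) ∈ _
        rcases fixed_or_desc_or_asc i α with h | h | h
        · rw [actN_C_fixed hα h]; exact zero_mem _
        · rw [actN_C_desc hα h]; exact add_mem m2 (Submodule.smul_mem _ _ m1)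
        · rw [actN_C_asc hα h]; exact add_mem m2 (Submodule.smul_mem _ _ m1)
      | zero => rw [map_zero]; exact zero_mem _
      | add x y _ _ h1 h2 => rw [map_add]; exact add_mem h1 h2
      | smul a x _ h1 => rw [map_smul]; exact Submodule.smul_mem _ _ h1
    intro h
    induction h using H_induction with
    | hs i =>
      intro x hx
      have e : H (s i) = C i + algebraMap L _ (-q) := by
        rw [C, map_neg]; abel
      rw [e, actN_add, actN_algebraMap]
      exact add_mem (hC i x hx) (Submodule.smul_mem _ _ hx)
    | ha a =>
      intro x hx
      rw [actN_algebraMap]; exact Submodule.smul_mem _ _ hx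
    | hadd a b h1 h2 =>
      intro x hx
      rw [actN_add]; exact add_mem (h1 x hx) (h2 x hx)
    | hmul a b h1 h2 =>
      intro x hx
      rw [actN_mul]; exact h2 _ (h1 _ hx)
  rw [eq_top_iff]
  rintro x -
  obtain ⟨y, rfl⟩ := Submodule.Quotient.mk_surjective _ x
  have h1 : (Submodule.Quotient.mk 1 : N n) = stdElt 1 := by
    rw [stdElt, elt_one, H_one]
  have h3 : (stdElt 1 : N n) ∈ Submodule.span L (Set.range fun α : EvenSeq n => stdElt α.1) :=
    Submodule.subset_span ⟨⟨1, by simp⟩, rfl⟩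
  have h2 := key y _ h3
  rwa [← h1, actN_mk, one_mul] at h2

/-- The map from the free module on `W` to functions of sign sequences that induces `coord`. -/
def coordW (n : ℕ) : (W n →₀ L) →ₗ[L] (Seq n → L) :=
  Finsupp.linearCombination L fun w =>
    -- Since `C_s` acts by zero, a left factor `H_s` with `s` in `W_𝔭` counts `-q`. There is one
    -- such factor for each unit by which `w` is longer than the shortest element of its coset.
    ((-q) ^ (len w - ht (signSeq w)) : L) • delta (signSeq w)

omit hn in
theorem coordW_single (w : W n) : coordW n (Finsupp.single w 1) =
    ((-q) ^ (len w - ht (signSeq w)) : L) • delta (signSeq w) := by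
  rw [coordW, Finsupp.linearCombination_single, one_smul]

/-- The elements `w` and `s i * w` have the same sign sequence and lengths that differ by one, so
both contribute multiples of one vector; these cancel, for a descent by means of `qi * q = 1`. Hence
`coordW` induces a map on `N`. -/
theorem coordW_leftOp {i : Fin n} (hi : i.1 ≠ 0) (x : W n →₀ L) :
    coordW n (leftOp i x + q • x) = 0 := by
  suffices h : coordW n ∘ₗ (leftOp i + q • LinearMap.id) = 0 from LinearMap.congr_fun h x
  refine Finsupp.lhom_ext' fun w => LinearMap.ext_ring ?_
  simp only [LinearMap.comp_apply, Finsupp.lsingle_apply, LinearMap.add_apply,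
    LinearMap.smul_apply, LinearMap.id_apply, LinearMap.zero_apply]
  rw [leftOp_single, map_add, map_add, map_smul, map_smul, coordW_single, coordW_single,
    signSeq_simple_mul _ hi]
  have h1 := ht_signSeq_le w
  have h2 := ht_signSeq_le (s i * w)
  rw [signSeq_simple_mul _ hi] at h2
  rw [smul_smul, smul_smul, ← add_smul, ← add_smul]
  convert zero_smul L (delta (signSeq w))
  rcases len_simple_mul i w with h | h
  · rw [if_neg (by omega), show len (s i * w) - ht (signSeq w) =
      (len w - ht (signSeq w)) + 1 by omega]
    ring
  · rw [if_pos (by omega), show len w - ht (signSeq w) =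
      (len (s i * w) - ht (signSeq w)) + 1 by omega, pow_succ]
    linear_combination (-(-q) ^ (len (s i * w) - ht (signSeq w)) : L) * qi_mul_q

/-- The coordinates of an element of `N` with respect to the standard basis. -/
def coord (n : ℕ) [Fact (2 ≤ n)] : N n →ₗ[L] (Seq n → L) :=
  (parSubmodule n).liftQ (coordW n ∘ₗ LinearMap.applyₗ (Finsupp.single 1 1) ∘ₗ
    (regRep n).toLinearMap) <| by
    rw [parSubmodule, Submodule.span_le]
    rintro _ ⟨i, g, hi, rfl⟩
    change coordW n (regRep n (C i * g) (Finsupp.single 1 1)) = 0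
    rw [map_mul, regRep_C, Module.End.mul_apply, LinearMap.add_apply,
      Module.algebraMap_end_apply]
    exact coordW_leftOp hi _

theorem coord_stdElt {α : Seq n} (hα : ∏ k, α k = 1) : coord n (stdElt α) = delta α := by
  change coordW n (regRep n (H (elt α)) (Finsupp.single 1 1)) = _
  rw [regRep_H_single_one, coordW_single, signSeq_elt hα, len_elt hα, Nat.sub_self, pow_zero,
    one_smul]

theorem N_induction {p : N n → Prop} (hstd : ∀ α : Seq n, ∏ k, α k = 1 → p (stdElt α))
    (h0 : p 0) (hadd : ∀ x y, p x → p y → p (x + y)) (hsmul : ∀ (a : L) x, p x → p (a • x))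
    (x : N n) : p x := by
  have hx : x ∈ Submodule.span L (Set.range fun α : EvenSeq n => stdElt α.1) := by
    rw [span_stdElt]; exact Submodule.mem_top
  induction hx using Submodule.span_induction with
  | mem x hx =>
    obtain ⟨α, rfl⟩ := hx
    exact hstd α.1 α.2
  | zero => exact h0
  | add x y _ _ h1 h2 => exact hadd x y h1 h2
  | smul a x _ h1 => exact hsmul a x h1

theorem coord_actN_C (i : Fin n) (x : N n) : coord n (actN (C i) x) = opE i (coord n x) := by
  induction x using N_induction with
  | hstd α hα =>
    have hα' : ∏ k, reflSeq i α k = 1 := by rw [prod_reflSeq, hα]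
    rw [coord_stdElt hα]
    rcases fixed_or_desc_or_asc i α with h | h | h
    · rw [actN_C_fixed hα h, opE_delta_fixed h, map_zero]
    · rw [actN_C_desc hα h, opE_delta_desc h, map_add, map_smul, coord_stdElt hα,
        coord_stdElt hα']
    · rw [actN_C_asc hα h, opE_delta_asc h, map_add, map_smul, coord_stdElt hα,
        coord_stdElt hα']
  | h0 => simp only [map_zero]
  | hadd x y h1 h2 => simp only [map_add, h1, h2]
  | hsmul a x h => simp only [map_smul, h]

/-- The element of `N` with given coordinates. -/
def fromCoord (n : ℕ) : (Seq n → L) →ₗ[L] N n where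
  toFun f := ∑ α : EvenSeq n, f α.1 • stdElt α.1
  map_add' f g := by simp only [Pi.add_apply, add_smul, Finset.sum_add_distrib]
  map_smul' a f := by
    simp only [Pi.smul_apply, smul_eq_mul, mul_smul, Finset.smul_sum, RingHom.id_apply]

theorem fromCoord_coord (x : N n) : fromCoord n (coord n x) = x := by
  induction x using N_induction with
  | hstd α hα =>
    rw [coord_stdElt hα]
    change ∑ β : EvenSeq n, delta α β.1 • stdElt β.1 = _
    rw [Finset.sum_eq_single (⟨α, hα⟩ : EvenSeq n), delta_self, one_smul]
    · intro β _ hβ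
      rw [delta_of_ne fun h => hβ (Subtype.ext h), zero_smul]
    · intro h; exact absurd (Finset.mem_univ _) h
  | h0 => simp only [map_zero]
  | hadd x y h1 h2 => simp only [map_add, h1, h2]
  | hsmul a x h => simp only [map_smul, h]

theorem coord_fromCoord_apply (f : Seq n → L) {α : Seq n} (hα : ∏ k, α k = 1) :
    coord n (fromCoord n f) α = f α := by
  change coord n (∑ β : EvenSeq n, f β.1 • stdElt β.1) α = _
  rw [map_sum, Finset.sum_apply, Finset.sum_eq_single (⟨α, hα⟩ : EvenSeq n)]
  · rw [map_smul, coord_stdElt hα, Pi.smul_apply, delta_self, smul_eq_mul, mul_one]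
  · intro β _ hβ
    rw [map_smul, coord_stdElt β.2, Pi.smul_apply,
      delta_of_ne fun h => hβ (Subtype.ext h.symm), smul_zero]
  · intro h; exact absurd (Finset.mem_univ _) h

theorem coord_mem (x : N n) : coord n x ∈ EvenFun n := by
  induction x using N_induction with
  | hstd α hα => rw [coord_stdElt hα]; exact delta_mem hα
  | h0 => rw [map_zero]; exact zero_mem _
  | hadd x y h1 h2 => rw [map_add]; exact add_mem h1 h2
  | hsmul a x h => rw [map_smul]; exact Submodule.smul_mem _ _ h

theorem coord_fromCoord {f : Seq n → L} (hf : f ∈ EvenFun n) : coord n (fromCoord n f) = f := by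
  funext α
  by_cases h : ∏ k, α k = 1
  · exact coord_fromCoord_apply f h
  · rw [hf α h, coord_mem _ α h]

theorem opE_mem {f : Seq n → L} (hf : f ∈ EvenFun n) (i : Fin n) : opE i f ∈ EvenFun n := by
  rw [← coord_fromCoord hf, ← coord_actN_C]; exact coord_mem _

end Coord

/-! ### The state sum of a tangle -/

/-- The weight of a cup with signs `s` and `t` at its left and right end. -/
def cupW (s t : ℤˣ) : L := if s = t then 0 else if s = 1 then 1 else q

/-- The weight of a cap with signs `s` and `t` at its left and right end. -/
def capW (s t : ℤˣ) : L := if s = t then 0 else if s = 1 then qi else 1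

/-- The weight of an edge with signs `s` and `t` at its ends. -/
def edgeW (s t : ℤˣ) : L := if s = t then 1 else 0

/-- The weight of a circle with `(-1) ^ d` dots. -/
def circleW (δ : ℤˣ) : L := if δ = 1 then q + qi else 0

/-- The weight of a line whose ends are `u` and `v` in clockwise order; `δ` is `-1` to the number of
dots. A dot changes the sign at the left end of the line. -/
def lineW {m n : ℕ} (δ : ℤˣ) (l : Fin m ⊕ Fin n → ℤˣ) : Fin m ⊕ Fin n → Fin m ⊕ Fin n → L
  | Sum.inr i, Sum.inr j => cupW (δ * l (Sum.inr i)) (l (Sum.inr j))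
  | Sum.inr i, Sum.inl j => edgeW (δ * l (Sum.inr i)) (l (Sum.inl j))
  | Sum.inl i, Sum.inl j => capW (δ * l (Sum.inl j)) (l (Sum.inl i))
  | Sum.inl _, Sum.inr _ => 0

theorem lineW_congr {m n : ℕ} {δ : ℤˣ} {l l' : Fin m ⊕ Fin n → ℤˣ} {u v : Fin m ⊕ Fin n}
    (hu : l u = l' u) (hv : l v = l' v) : lineW δ l u v = lineW δ l' u v := by
  rcases u with u | u <;> rcases v with v | v <;> simp only [lineW, hu, hv]

namespace PreDiag

/-- `-1` to the number of dots of a component. -/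
def dsign {m n : ℕ} (P : PreDiag m n) (c : P.Comp) : ℤˣ := (-1) ^ P.dots c

open scoped Classical in
/-- The weight of a component if the signs at the boundary points are given by `l`. -/
def compW {m n : ℕ} (P : PreDiag m n) (l : Fin m ⊕ Fin n → ℤˣ) (c : P.Comp) : L :=
  if h : ∃ uv : (Fin m ⊕ Fin n) × (Fin m ⊕ Fin n),
      pos uv.1 < pos uv.2 ∧ P.e uv.1 = c ∧ P.e uv.2 = c then
    lineW (P.dsign c) l h.choose.1 h.choose.2
  else circleW (P.dsign c)

/-- The product of the weights of all components. -/
def weight {m n : ℕ} (P : PreDiag m n) (l : Fin m ⊕ Fin n → ℤˣ) : L := ∏ᶠ c, P.compW l c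

section

variable {m n : ℕ} {P : PreDiag m n}

theorem IsTangle.eq_or_eq (hP : P.IsTangle) {u v z : Fin m ⊕ Fin n} (huv : u ≠ v)
    (h : P.e u = P.e v) (hz : P.e z = P.e u) : z = u ∨ z = v := by
  by_cases hzu : z = u
  · exact Or.inl hzu
  · obtain ⟨y, -, hy⟩ := hP.paired u
    exact Or.inr ((hy z ⟨hzu, hz⟩).trans (hy v ⟨huv.symm, h.symm⟩).symm)

theorem IsTangle.exists_partner (hP : P.IsTangle) (u : Fin m ⊕ Fin n) :
    ∃ v, v ≠ u ∧ P.e v = P.e u := by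
  obtain ⟨y, hy, -⟩ := hP.paired u
  exact ⟨y, hy⟩

/-- A line has only two end points and `pos` orders them, so the choice in the definition of `compW`
is forced. -/
theorem IsTangle.compW_line (hP : P.IsTangle) (l : Fin m ⊕ Fin n → ℤˣ) {u v : Fin m ⊕ Fin n}
    {c : P.Comp} (huv : pos u < pos v) (hu : P.e u = c) (hv : P.e v = c) :
    P.compW l c = lineW (P.dsign c) l u v := by
  have hex : ∃ uv : (Fin m ⊕ Fin n) × (Fin m ⊕ Fin n),
      pos uv.1 < pos uv.2 ∧ P.e uv.1 = c ∧ P.e uv.2 = c := ⟨(u, v), huv, hu, hv⟩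
  rw [compW, dif_pos hex]
  obtain ⟨h1, h2, h3⟩ := hex.choose_spec
  generalize hex.choose = uv at h1 h2 h3
  obtain ⟨u', v'⟩ := uv
  have hne : u ≠ v := fun h => by rw [h] at huv; exact lt_irrefl _ huv
  simp only at h1 h2 h3 ⊢
  rcases hP.eq_or_eq hne (hu.trans hv.symm) (h2.trans hu.symm) with rfl | rfl <;>
    rcases hP.eq_or_eq hne (hu.trans hv.symm) (h3.trans hu.symm) with rfl | rfl
  · exact absurd h1 (lt_irrefl _)
  · rfl
  · exact absurd h1 (lt_asymm huv)
  · exact absurd h1 (lt_irrefl _)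

theorem compW_circle (l : Fin m ⊕ Fin n → ℤˣ) {c : P.Comp} (h : ∀ x, P.e x ≠ c) :
    P.compW l c = circleW (P.dsign c) :=
  dif_neg fun ⟨uv, _, h1, _⟩ => h uv.1 h1

theorem compW_congr {l l' : Fin m ⊕ Fin n → ℤˣ} {c : P.Comp}
    (h : ∀ x, P.e x = c → l x = l' x) : P.compW l c = P.compW l' c := by
  rw [compW, compW]
  split_ifs with hex
  · obtain ⟨-, h1, h2⟩ := hex.choose_spec
    exact lineW_congr (h _ h1) (h _ h2)
  · rfl

/-- Components of two diagrams with the same end points and the same number of dots modulo two have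
the same weight. -/
theorem IsTangle.compW_eq {Q : PreDiag m n} (hP : P.IsTangle) (hQ : Q.IsTangle)
    {l : Fin m ⊕ Fin n → ℤˣ} {c : P.Comp} {d : Q.Comp}
    (h : ∀ x, P.e x = c ↔ Q.e x = d) (hd : P.dsign c = Q.dsign d) :
    P.compW l c = Q.compW l d := by
  by_cases hex : ∃ x, P.e x = c
  · obtain ⟨x, hx⟩ := hex
    obtain ⟨y, hyx, hy⟩ := hP.exists_partner x
    rcases Nat.lt_or_gt_of_ne (fun h => hyx (pos_injective h)) with hlt | hlt
    · rw [hP.compW_line l hlt (hy.trans hx) hx,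
        hQ.compW_line l hlt ((h _).1 (hy.trans hx)) ((h _).1 hx), hd]
    · rw [hP.compW_line l hlt hx (hy.trans hx),
        hQ.compW_line l hlt ((h _).1 hx) ((h _).1 (hy.trans hx)), hd]
  · push Not at hex
    rw [compW_circle l hex, compW_circle l (fun x hx => hex x ((h x).2 hx)), hd]

theorem IsTangle.weight_congr {Q : PreDiag m n} (hP : P.IsTangle) (h : P ≈ Q)
    (l : Fin m ⊕ Fin n → ℤˣ) : P.weight l = Q.weight l := by
  have hQ := hP.congr h
  obtain ⟨φ, h1, h2⟩ := h
  rw [weight, weight, ← finprod_comp_equiv φ]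
  refine finprod_congr fun c => hP.compW_eq hQ (fun x => ?_) ?_
  · rw [← h1, φ.apply_eq_iff_eq]
  · rw [dsign, dsign, ← h2, Finsupp.mapDomain_apply φ.injective]

end

end PreDiag

/-- The entry of the matrix of a tangle at the sign sequences `α` at the bottom and `β` at the
top. -/
def entry {m n : ℕ} (T : Tangle m n) (α : Seq m) (β : Seq n) : L :=
  Quotient.lift (fun P : {P : PreDiag m n // P.IsTangle} => P.1.weight (Sum.elim α β))
    (fun P _ h => P.2.weight_congr h _) T

theorem entry_mk {m n : ℕ} {P : PreDiag m n} (hP : P.IsTangle) (α : Seq m) (β : Seq n) :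
    entry (.mk P hP) α β = P.weight (Sum.elim α β) := rfl

/-! ### Concatenation with a generator -/

theorem cupW_pp : cupW 1 1 = 0 := if_pos rfl
theorem cupW_mm : cupW (-1) (-1) = 0 := if_pos rfl
theorem cupW_pm : cupW 1 (-1) = 1 := by simp [cupW]
theorem cupW_mp : cupW (-1) 1 = q := by simp [cupW]
theorem capW_pp : capW 1 1 = 0 := if_pos rfl
theorem capW_mm : capW (-1) (-1) = 0 := if_pos rfl
theorem capW_pm : capW 1 (-1) = qi := by simp [capW]
theorem capW_mp : capW (-1) 1 = 1 := by simp [capW]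
theorem edgeW_pp : edgeW 1 1 = 1 := if_pos rfl
theorem edgeW_mm : edgeW (-1) (-1) = 1 := if_pos rfl
theorem edgeW_pm : edgeW 1 (-1) = 0 := by simp [edgeW]
theorem edgeW_mp : edgeW (-1) 1 = 0 := by simp [edgeW]
theorem circleW_p : circleW 1 = q + qi := if_pos rfl
theorem circleW_m : circleW (-1) = 0 := by simp [circleW]

/-- This and the following six identities are the local computations for the cap of `e_i`. The names
tell where the lines through the two places lead: back to each other, so that a circle arises, to a
top point on the left or on the right, or to the bottom. In each case the left side is the cup of
`e_i` times the joined component, and the right side is the formula of `opE i`. The sign `σ` of the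
dots of `e_i` occurs only if no line leads to the left, as a point on the left excludes `i = 0`. The
identities are finite checks over the signs. -/
theorem cap_cup_circle (σ δ s t : ℤˣ) (h : σ * s ≠ t) :
    cupW (σ * s) t * circleW (σ * δ) = cupW (δ * (σ * t)) (σ * s) +
      (if t = -1 then qi else q) * cupW (δ * s) t := by
  rcases units_cases σ with rfl | rfl <;> rcases units_cases δ with rfl | rfl <;>
    rcases units_cases s with rfl | rfl <;> rcases units_cases t with rfl | rfl <;>
    simp only [mul_one, mul_neg, neg_neg, ne_eq, not_true_eq_false] at h <;>
    simp only [mul_one, one_mul, mul_neg, neg_neg, if_true, if_neg one_ne_neg_one_units,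
      cupW_pp, cupW_mm, cupW_pm, cupW_mp,
      circleW_p, circleW_m] <;>
    first
    | ring1
    | linear_combination qi_mul_q

theorem cap_left_right (δ ε a b s t : ℤˣ) (h : s ≠ t) :
    cupW s t * cupW (δ * ε * a) b = cupW (δ * a) t * cupW (ε * s) b +
      (if t = -1 then qi else q) * (cupW (δ * a) s * cupW (ε * t) b) := by
  rcases units_cases δ with rfl | rfl <;> rcases units_cases ε with rfl | rfl <;>
    rcases units_cases a with rfl | rfl <;> rcases units_cases b with rfl | rfl <;>
    rcases units_cases s with rfl | rfl <;> rcases units_cases t with rfl | rfl <;>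
    simp only [ne_eq, not_true_eq_false] at h <;>
    simp only [mul_one, one_mul, mul_neg, neg_neg, if_true, if_neg one_ne_neg_one_units,
      cupW_pp, cupW_mm, cupW_pm, cupW_mp] <;>
    first
    | ring1
    | linear_combination qi_mul_q
    | linear_combination -qi_mul_q
    | linear_combination q * qi_mul_q
    | linear_combination -q * qi_mul_q

theorem cap_left_left (ε a b s t : ℤˣ) (h : s ≠ t) :
    cupW s t * cupW (ε * b) a = cupW a t * cupW (ε * b) s +
      (if t = -1 then qi else q) * (cupW a s * cupW (ε * b) t) := by
  rcases units_cases ε with rfl | rfl <;>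
    rcases units_cases a with rfl | rfl <;> rcases units_cases b with rfl | rfl <;>
    rcases units_cases s with rfl | rfl <;> rcases units_cases t with rfl | rfl <;>
    simp only [ne_eq, not_true_eq_false] at h <;>
    simp only [mul_one, one_mul, mul_neg, neg_neg, if_true, if_neg one_ne_neg_one_units,
      cupW_pp, cupW_mm, cupW_pm, cupW_mp] <;>
    first
    | ring1
    | linear_combination qi_mul_q
    | linear_combination -qi_mul_q

theorem cap_right_right (σ δ a b s t : ℤˣ) (h : σ * s ≠ t) :
    cupW (σ * s) t * cupW (σ * δ * b) a = cupW (δ * (σ * t)) a * cupW (σ * s) b +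
      (if t = -1 then qi else q) * (cupW (δ * s) a * cupW t b) := by
  rcases units_cases δ with rfl | rfl <;> rcases units_cases σ with rfl | rfl <;>
    rcases units_cases a with rfl | rfl <;> rcases units_cases b with rfl | rfl <;>
    rcases units_cases s with rfl | rfl <;> rcases units_cases t with rfl | rfl <;>
    simp only [mul_one, mul_neg, neg_neg, ne_eq, not_true_eq_false] at h <;>
    simp only [mul_one, one_mul, mul_neg, neg_neg, if_true, if_neg one_ne_neg_one_units,
      cupW_pp, cupW_mm, cupW_pm, cupW_mp] <;>
    first
    | ring1
    | linear_combination qi_mul_q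
    | linear_combination -qi_mul_q
    | linear_combination q * qi_mul_q
    | linear_combination -q * qi_mul_q

theorem cap_left_edge (δ ε a b s t : ℤˣ) (h : s ≠ t) :
    cupW s t * edgeW (δ * ε * a) b = cupW (δ * a) t * edgeW (ε * s) b +
      (if t = -1 then qi else q) * (cupW (δ * a) s * edgeW (ε * t) b) := by
  rcases units_cases δ with rfl | rfl <;> rcases units_cases ε with rfl | rfl <;>
    rcases units_cases a with rfl | rfl <;> rcases units_cases b with rfl | rfl <;>
    rcases units_cases s with rfl | rfl <;> rcases units_cases t with rfl | rfl <;>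
    simp only [ne_eq, not_true_eq_false] at h <;>
    simp only [mul_one, one_mul, mul_neg, neg_neg, if_true, if_neg one_ne_neg_one_units,
      cupW_pp, cupW_mm, cupW_pm, cupW_mp, edgeW_pp, edgeW_mm,
      edgeW_pm, edgeW_mp] <;>
    first
    | ring1
    | linear_combination qi_mul_q
    | linear_combination -qi_mul_q

theorem cap_edge_right (σ δ a b s t : ℤˣ) (h : σ * s ≠ t) :
    cupW (σ * s) t * edgeW (σ * δ * b) a = edgeW (δ * (σ * t)) a * cupW (σ * s) b +
      (if t = -1 then qi else q) * (edgeW (δ * s) a * cupW t b) := by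
  rcases units_cases δ with rfl | rfl <;> rcases units_cases σ with rfl | rfl <;>
    rcases units_cases a with rfl | rfl <;> rcases units_cases b with rfl | rfl <;>
    rcases units_cases s with rfl | rfl <;> rcases units_cases t with rfl | rfl <;>
    simp only [mul_one, mul_neg, neg_neg, ne_eq, not_true_eq_false] at h <;>
    simp only [mul_one, one_mul, mul_neg, neg_neg, if_true, if_neg one_ne_neg_one_units,
      cupW_pp, cupW_mm, cupW_pm, cupW_mp, edgeW_pp, edgeW_mm,
      edgeW_pm, edgeW_mp] <;>
    first
    | ring1
    | linear_combination qi_mul_q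
    | linear_combination -qi_mul_q

theorem cap_edge_edge (σ δ a b s t : ℤˣ) (h : σ * s ≠ t) :
    cupW (σ * s) t * capW (σ * δ * a) b = edgeW (δ * (σ * t)) a * edgeW (σ * s) b +
      (if t = -1 then qi else q) * (edgeW (δ * s) a * edgeW t b) := by
  rcases units_cases δ with rfl | rfl <;> rcases units_cases σ with rfl | rfl <;>
    rcases units_cases a with rfl | rfl <;> rcases units_cases b with rfl | rfl <;>
    rcases units_cases s with rfl | rfl <;> rcases units_cases t with rfl | rfl <;>
    simp only [mul_one, mul_neg, neg_neg, ne_eq, not_true_eq_false] at h <;>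
    simp only [mul_one, one_mul, mul_neg, neg_neg, if_true, if_neg one_ne_neg_one_units,
      cupW_pm, cupW_mp, capW_pp, capW_mm, capW_pm, capW_mp, edgeW_pp, edgeW_mm,
      edgeW_pm, edgeW_mp] <;>
    first
    | ring1
    | linear_combination qi_mul_q

namespace PreDiag

/-! ### Gluing the cap of a generator to a diagram -/

section Gen

variable {k n : ℕ} [hn : Fact (2 ≤ n)] {P : PreDiag k n} {i : Fin n}

omit hn in
theorem gen_e_inl (j : Fin n) :
    (gen i).e (Sum.inl j) = if j = lo i ∨ j = hi i then hi i else j := rfl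

omit hn in
theorem gen_e_inr (j : Fin n) :
    (gen i).e (Sum.inr j) = if j = lo i ∨ j = hi i then lo i else j := rfl

theorem gen_e_inl_ne_lo (j : Fin n) : (gen i).e (Sum.inl j) ≠ lo i := by
  rw [gen_e_inl]
  split_ifs with h
  · exact (lo_ne_hi i).symm
  · exact fun h' => h (Or.inl h')

/-- The cup of `e_i` has no end point on the middle line. Therefore the predicate of being this cup
is compatible with the gluing, and it separates the two components. -/
theorem up_lo_ne_down (c : P.Comp) : up (gen i) P (lo i) ≠ down (gen i) P c := by
  intro h
  have := congrArg (glueLift (S := gen i) (T := P) (X := Prop) (fun c => c = lo i)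
    (fun _ => False) fun j => eq_false (gen_e_inl_ne_lo j)) h
  change (lo i = lo i) = False at this
  simp at this

omit hn in
theorem up_hi : up (gen i) P (hi i) = down (gen i) P (P.e (Sum.inr (lo i))) := by
  rw [← up_eq_down, gen_e_inl, if_pos (Or.inl rfl)]

omit hn in
theorem up_hi' : up (gen i) P (hi i) = down (gen i) P (P.e (Sum.inr (hi i))) := by
  rw [← up_eq_down, gen_e_inl, if_pos (Or.inr rfl)]

omit hn in
theorem up_of_ne {j : Fin n} (h1 : j ≠ lo i) (h2 : j ≠ hi i) :
    up (gen i) P j = down (gen i) P (P.e (Sum.inr j)) := by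
  rw [← up_eq_down, gen_e_inl, if_neg (by tauto)]

omit hn in
theorem glueComp_gen_cases (C : GlueComp (gen i) P) :
    C = up (gen i) P (lo i) ∨ ∃ c, C = down (gen i) P c := by
  induction C using glue_ext with
  | h1 c =>
    by_cases h1 : c = lo i
    · exact Or.inl (congrArg _ h1)
    · by_cases h2 : c = hi i
      · exact Or.inr ⟨_, (congrArg _ h2).trans up_hi⟩
      · exact Or.inr ⟨_, up_of_ne h1 h2⟩
  | h2 c => exact Or.inr ⟨c, rfl⟩

omit hn in
-- The cap of `e_i` merges the components at its two ends and does nothing else. To see this, send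
-- these two to the set `M` that they form and every other component to its singleton: this is
-- compatible with the gluing and separates everything that is not merged.
theorem down_eq_down_iff {c d : P.Comp} : down (gen i) P c = down (gen i) P d ↔
    c = d ∨ ((c = P.e (Sum.inr (lo i)) ∨ c = P.e (Sum.inr (hi i))) ∧
      (d = P.e (Sum.inr (lo i)) ∨ d = P.e (Sum.inr (hi i)))) := by
  classical
  constructor
  · intro h
    let M : Set P.Comp := {P.e (Sum.inr (lo i)), P.e (Sum.inr (hi i))}
    let g : P.Comp → Set P.Comp := fun c => if c ∈ M then M else {c}
    let f : Fin n → Set P.Comp := fun j => if j = hi i then M else g (P.e (Sum.inr j))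
    have hm1 : P.e (Sum.inr (lo i)) ∈ M := Or.inl rfl
    have hm2 : P.e (Sum.inr (hi i)) ∈ M := Or.inr rfl
    have hfg : ∀ j, f ((gen i).e (Sum.inl j)) = g (P.e (Sum.inr j)) := by
      intro j
      rw [gen_e_inl]
      by_cases h1 : j = lo i
      · rw [if_pos (Or.inl h1), h1]
        simp only [f, g, if_true, if_pos hm1]
      · by_cases h2 : j = hi i
        · rw [if_pos (Or.inr h2), h2]
          simp only [f, g, if_true, if_pos hm2]
        · rw [if_neg (by tauto)]
          simp only [f, if_neg h2]
    have h1 : g c = g d := congrArg (glueLift f g hfg) h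
    by_cases hc : c ∈ M <;> by_cases hd : d ∈ M
    · exact Or.inr ⟨hc, hd⟩
    · simp only [g, if_pos hc, if_neg hd] at h1
      have h2 : P.e (Sum.inr (lo i)) = d := by
        have := hm1
        rwa [h1] at this
      exact absurd (h2 ▸ hm1) hd
    · simp only [g, if_neg hc, if_pos hd] at h1
      have h2 : P.e (Sum.inr (lo i)) = c := by
        have := hm1
        rwa [← h1] at this
      exact absurd (h2 ▸ hm1) hc
    · simp only [g, if_neg hc, if_neg hd] at h1
      exact Or.inl (Set.singleton_injective h1)
  · have e : down (gen i) P (P.e (Sum.inr (lo i))) = down (gen i) P (P.e (Sum.inr (hi i))) :=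
      up_hi.symm.trans up_hi'
    rintro (h | ⟨rfl | rfl, rfl | rfl⟩)
    · rw [h]
    · rfl
    · exact e
    · exact e.symm
    · rfl

omit hn in
theorem comp_gen_e_of_ne {z : Fin k ⊕ Fin n} (h1 : z ≠ Sum.inr (lo i)) (h2 : z ≠ Sum.inr (hi i)) :
    (comp (gen i) P).e z = down (gen i) P (P.e z) := by
  rcases z with z | z
  · rfl
  · have h1' : z ≠ lo i := fun h => h1 (congrArg _ h)
    have h2' : z ≠ hi i := fun h => h2 (congrArg _ h)
    change up (gen i) P ((gen i).e (Sum.inr z)) = _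
    rw [gen_e_inr, if_neg (by tauto), up_of_ne h1' h2']

omit hn in
theorem comp_gen_e_lo : (comp (gen i) P).e (Sum.inr (lo i)) = up (gen i) P (lo i) := by
  change up (gen i) P ((gen i).e (Sum.inr (lo i))) = _
  rw [gen_e_inr, if_pos (Or.inl rfl)]

omit hn in
theorem comp_gen_e_hi : (comp (gen i) P).e (Sum.inr (hi i)) = up (gen i) P (lo i) := by
  change up (gen i) P ((gen i).e (Sum.inr (hi i))) = _
  rw [gen_e_inr, if_pos (Or.inr rfl)]

open scoped Classical in
theorem mapDomain_apply_eq_sum {X Y : Type} [Fintype X] (f : X → Y) (d : X →₀ ℕ) (y : Y) :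
    d.mapDomain f y = ∑ x, if f x = y then d x else 0 := by
  rw [Finsupp.mapDomain, Finsupp.sum_fintype _ _ (by simp), Finsupp.finsetSum_apply]
  refine Finset.sum_congr rfl fun x _ => ?_
  rw [Finsupp.single_apply]

omit hn in
theorem genDots_mapDomain {Y : Type} (f : Fin n → Y) : (genDots i).mapDomain f =
    if i.1 = 0 then Finsupp.single (f (lo i)) 1 + Finsupp.single (f (hi i)) 1 else 0 := by
  rw [genDots]
  split_ifs
  · rw [Finsupp.mapDomain_add, Finsupp.mapDomain_single, Finsupp.mapDomain_single]
  · rw [Finsupp.mapDomain_zero]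

omit hn in
open scoped Classical in
theorem comp_gen_dots (C : GlueComp (gen i) P) :
    (comp (gen i) P).dots C = (if i.1 = 0 then (if up (gen i) P (lo i) = C then 1 else 0) +
      (if up (gen i) P (hi i) = C then 1 else 0) else 0) + P.dots.mapDomain (down (gen i) P) C := by
  refine congrArg (· + P.dots.mapDomain (down (gen i) P) C)
    ((DFunLike.congr_fun (genDots_mapDomain (up (gen i) P)) C).trans ?_)
  by_cases h : i.1 = 0
  · rw [if_pos h, if_pos h, Finsupp.add_apply, Finsupp.single_apply, Finsupp.single_apply]
  · rw [if_neg h, if_neg h, Finsupp.zero_apply]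

omit hn in
theorem sgn_eq_pow (i : Fin n) : sgn i = (-1) ^ (if i.1 = 0 then 1 else 0) := by
  rw [sgn]; split_ifs <;> simp

theorem comp_gen_dsign_lo :
    (comp (gen i) P).dsign (up (gen i) P (lo i)) = sgn i := by
  classical
  let _ := P.finite
  let _ := Fintype.ofFinite P.Comp
  have h1 : P.dots.mapDomain (down (gen i) P) (up (gen i) P (lo i)) = 0 := by
    rw [mapDomain_apply_eq_sum]
    exact Finset.sum_eq_zero fun c _ => if_neg (up_lo_ne_down c).symm
  have h2 : up (gen i) P (hi i) ≠ up (gen i) P (lo i) := by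
    rw [up_hi]; exact (up_lo_ne_down _).symm
  rw [dsign, comp_gen_dots, h1, if_pos rfl, if_neg h2, sgn_eq_pow]
  simp

theorem comp_gen_dsign_of_ne {c : P.Comp} (h1 : c ≠ P.e (Sum.inr (lo i)))
    (h2 : c ≠ P.e (Sum.inr (hi i))) :
    (comp (gen i) P).dsign (down (gen i) P c) = P.dsign c := by
  classical
  let _ := P.finite
  let _ := Fintype.ofFinite P.Comp
  have h3 : P.dots.mapDomain (down (gen i) P) (down (gen i) P c) = P.dots c := by
    rw [mapDomain_apply_eq_sum, Finset.sum_eq_single c]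
    · rw [if_pos rfl]
    · intro d _ hd
      refine if_neg fun h => ?_
      rcases down_eq_down_iff.1 h with h | ⟨-, h | h⟩
      · exact hd h
      · exact h1 h
      · exact h2 h
    · intro h; exact absurd (Finset.mem_univ _) h
  have h4 : up (gen i) P (hi i) ≠ down (gen i) P c := by
    rw [up_hi]
    intro h
    rcases down_eq_down_iff.1 h with h | ⟨-, h | h⟩
    · exact h1 h.symm
    · exact h1 h
    · exact h2 h
  rw [dsign, comp_gen_dots, h3, if_neg (up_lo_ne_down c), if_neg h4, dsign]
  simp

theorem comp_gen_dsign_circle (h : P.e (Sum.inr (lo i)) = P.e (Sum.inr (hi i))) :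
    (comp (gen i) P).dsign (down (gen i) P (P.e (Sum.inr (lo i)))) =
      sgn i * P.dsign (P.e (Sum.inr (lo i))) := by
  classical
  let _ := P.finite
  let _ := Fintype.ofFinite P.Comp
  have h3 : P.dots.mapDomain (down (gen i) P) (down (gen i) P (P.e (Sum.inr (lo i)))) =
      P.dots (P.e (Sum.inr (lo i))) := by
    rw [mapDomain_apply_eq_sum, Finset.sum_eq_single (P.e (Sum.inr (lo i)))]
    · rw [if_pos rfl]
    · intro d _ hd
      refine if_neg fun h' => ?_
      rcases down_eq_down_iff.1 h' with h' | ⟨h' | h', -⟩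
      · exact hd h'
      · exact hd h'
      · exact hd (h'.trans h.symm)
    · intro h; exact absurd (Finset.mem_univ _) h
  rw [dsign, comp_gen_dots, h3, if_neg (up_lo_ne_down _), if_pos up_hi, dsign, pow_add, sgn_eq_pow]

theorem comp_gen_dsign_merge (h : P.e (Sum.inr (lo i)) ≠ P.e (Sum.inr (hi i))) :
    (comp (gen i) P).dsign (down (gen i) P (P.e (Sum.inr (lo i)))) =
      sgn i * P.dsign (P.e (Sum.inr (lo i))) * P.dsign (P.e (Sum.inr (hi i))) := by
  classical
  let _ := P.finite
  let _ := Fintype.ofFinite P.Comp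
  have h3 : P.dots.mapDomain (down (gen i) P) (down (gen i) P (P.e (Sum.inr (lo i)))) =
      P.dots (P.e (Sum.inr (lo i))) + P.dots (P.e (Sum.inr (hi i))) := by
    rw [mapDomain_apply_eq_sum, ← Finset.add_sum_erase _ _ (Finset.mem_univ (P.e (Sum.inr (lo i)))),
      ← Finset.add_sum_erase _ _ (Finset.mem_erase.2 ⟨h.symm, Finset.mem_univ _⟩),
      Finset.sum_eq_zero, if_pos rfl, if_pos (up_hi'.symm.trans up_hi), add_zero]
    intro d hd
    simp only [Finset.mem_erase] at hd
    refine if_neg fun h' => ?_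
    rcases down_eq_down_iff.1 h' with h' | ⟨h' | h', -⟩
    · exact hd.2.1 h'
    · exact hd.2.1 h'
    · exact hd.1 h'
  rw [dsign, comp_gen_dots, h3, if_neg (up_lo_ne_down _), if_pos up_hi, dsign, dsign, pow_add,
    pow_add, sgn_eq_pow, mul_assoc]

omit hn in
theorem comp_gen_line {z w : Fin k ⊕ Fin n} {c : P.Comp} (l : Fin k ⊕ Fin n → ℤˣ)
    (hP : P.IsTangle) (hz : z ≠ Sum.inr (lo i)) (hz' : z ≠ Sum.inr (hi i))
    (hw : w ≠ Sum.inr (lo i)) (hw' : w ≠ Sum.inr (hi i)) (hzw : pos z < pos w)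
    (ez : down (gen i) P (P.e z) = down (gen i) P c) (ew : down (gen i) P (P.e w) = down (gen i) P c) :
    (comp (gen i) P).compW l (down (gen i) P c) =
      lineW ((comp (gen i) P).dsign (down (gen i) P c)) l z w :=
  ((isTangle_gen i).comp hP).compW_line l hzw ((comp_gen_e_of_ne hz hz').trans ez)
    ((comp_gen_e_of_ne hw hw').trans ew)

theorem comp_gen_compW_of_ne (hP : P.IsTangle) (l : Fin k ⊕ Fin n → ℤˣ) {c : P.Comp}
    (h1 : c ≠ P.e (Sum.inr (lo i))) (h2 : c ≠ P.e (Sum.inr (hi i))) :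
    (comp (gen i) P).compW l (down (gen i) P c) = P.compW l c := by
  refine ((isTangle_gen i).comp hP).compW_eq hP (fun x => ?_) (comp_gen_dsign_of_ne h1 h2)
  by_cases hx1 : x = Sum.inr (lo i)
  · subst hx1
    rw [comp_gen_e_lo]
    exact ⟨fun h => absurd h (up_lo_ne_down c), fun h => absurd h.symm h1⟩
  · by_cases hx2 : x = Sum.inr (hi i)
    · subst hx2
      rw [comp_gen_e_hi]
      exact ⟨fun h => absurd h (up_lo_ne_down c), fun h => absurd h.symm h2⟩
    · rw [comp_gen_e_of_ne hx1 hx2, down_eq_down_iff]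
      constructor
      · rintro (h | ⟨-, h | h⟩)
        · exact h
        · exact absurd h h1
        · exact absurd h h2
      · exact Or.inl

omit hn in
theorem pos_inr (j : Fin n) : pos (Sum.inr j : Fin k ⊕ Fin n) = j.1 := rfl

omit hn in
theorem pos_inl (j : Fin k) : pos (Sum.inl j : Fin k ⊕ Fin n) = n + (k - 1 - j.1) := rfl

theorem comp_gen_compW_lo (hP : P.IsTangle) (l : Fin k ⊕ Fin n → ℤˣ) :
    (comp (gen i) P).compW l (up (gen i) P (lo i)) =
      cupW (sgn i * l (Sum.inr (lo i))) (l (Sum.inr (hi i))) := by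
  rw [((isTangle_gen i).comp hP).compW_line l (u := Sum.inr (lo i)) (v := Sum.inr (hi i))
    (by rw [pos_inr, pos_inr, hi_val']; omega) comp_gen_e_lo comp_gen_e_hi, comp_gen_dsign_lo]
  rfl

omit hn in
theorem dsign_eq_one_of_enclosed (hP : P.IsTangle) {x a b : Fin k ⊕ Fin n} (h : P.e a = P.e b)
    (h1 : pos a < pos x) (h2 : pos x < pos b) : P.dsign (P.e x) = 1 := by
  rcases Nat.eq_zero_or_pos (P.dots (P.e x)) with h0 | h0
  · rw [dsign, h0, pow_zero]
  · exact absurd ⟨h1, h2⟩ (hP.accessible x h0 a b h)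

/-- The local computation behind `weight_comp_gen` if the two places of `s_i` are on different
components: the weight of the line that arises by joining them with the cap of `e_i`. -/
theorem comp_gen_merge (hP : P.IsTangle) (l : Fin k ⊕ Fin n → ℤˣ)
    (h : P.e (Sum.inr (lo i)) ≠ P.e (Sum.inr (hi i)))
    (hne : sgn i * l (Sum.inr (lo i)) ≠ l (Sum.inr (hi i))) (l' : Fin k ⊕ Fin n → ℤˣ)
    (h1 : l' (Sum.inr (lo i)) = sgn i * l (Sum.inr (hi i)))
    (h2 : l' (Sum.inr (hi i)) = sgn i * l (Sum.inr (lo i)))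
    (h3 : ∀ z, z ≠ Sum.inr (lo i) → z ≠ Sum.inr (hi i) → l' z = l z) :
    cupW (sgn i * l (Sum.inr (lo i))) (l (Sum.inr (hi i))) *
        (comp (gen i) P).compW l (down (gen i) P (P.e (Sum.inr (lo i)))) =
      P.compW l' (P.e (Sum.inr (lo i))) * P.compW l' (P.e (Sum.inr (hi i))) +
        (if l (Sum.inr (hi i)) = -1 then qi else q) *
          (P.compW l (P.e (Sum.inr (lo i))) * P.compW l (P.e (Sum.inr (hi i)))) := by
  obtain ⟨x', hx'ne, hx'⟩ := hP.exists_partner (Sum.inr (lo i))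
  obtain ⟨y', hy'ne, hy'⟩ := hP.exists_partner (Sum.inr (hi i))
  have nxy : (Sum.inr (lo i) : Fin k ⊕ Fin n) ≠ Sum.inr (hi i) := fun h' => h (congrArg _ h')
  have hx'y : x' ≠ Sum.inr (hi i) := fun h' => h (by rw [← hx', h'])
  have hy'x : y' ≠ Sum.inr (lo i) := fun h' => h (by rw [← hy', h'])
  have hx'y' : x' ≠ y' := fun h' => h (by rw [← hx', h', hy'])
  have ex : down (gen i) P (P.e x') = down (gen i) P (P.e (Sum.inr (lo i))) := by rw [hx']
  have ey : down (gen i) P (P.e y') = down (gen i) P (P.e (Sum.inr (lo i))) := by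
    rw [hy', ← up_hi', up_hi]
  have hm := comp_gen_dsign_merge h
  have hadj : ∀ z : Fin k ⊕ Fin n, z ≠ Sum.inr (lo i) → z ≠ Sum.inr (hi i) →
      pos z < (lo i).1 ∨ (lo i).1 + 1 < pos z := by
    intro z hz1 hz2
    have e1 : pos z ≠ (lo i).1 := fun h' => hz1 (pos_injective (h'.trans (pos_inr _).symm))
    have e2 : pos z ≠ (hi i).1 := fun h' => hz2 (pos_injective (h'.trans (pos_inr _).symm))
    rw [hi_val'] at e2
    omega
  have px : pos (Sum.inr (lo i) : Fin k ⊕ Fin n) = (lo i).1 := rfl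
  have py : pos (Sum.inr (hi i) : Fin k ⊕ Fin n) = (lo i).1 + 1 := by rw [pos_inr, hi_val']
  have ax := hadj x' hx'ne hx'y
  have ay := hadj y' hy'x hy'ne
  have hpxy : pos x' ≠ pos y' := fun h' => hx'y' (pos_injective h')
  have hxl := h3 x' hx'ne hx'y
  have hyl := h3 y' hy'x hy'ne
  -- the crossing position is impossible
  have hcross : ¬ ((lo i).1 + 1 < pos x' ∧ (pos y' < (lo i).1 ∨ pos x' < pos y')) := by
    rintro ⟨c1, c2 | c2⟩
    · exact h ((hP.planar y' (Sum.inr (lo i)) (Sum.inr (hi i)) x' (by omega) (by omega) (by omega)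
        hy' hx'.symm).symm.trans hy')
    · exact h (hP.planar (Sum.inr (lo i)) (Sum.inr (hi i)) x' y' (by omega) (by omega) (by omega)
        hx'.symm hy'.symm)
  -- A point to the left of the two places shows that `i ≥ 2`, so `e_i` has no dots.
  have hsg : ∀ z : Fin k ⊕ Fin n, pos z < (lo i).1 → sgn i = 1 := by
    intro z hz
    rw [lo_val] at hz
    exact sgn_of_ne (by omega)
  rcases ax with ax | ax
  · have hs := hsg x' ax
    rw [hs] at hne h1 h2 hm ⊢
    rw [one_mul] at hne h1 h2 hm ⊢
    rcases x' with x' | x'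
    · rw [pos_inl] at ax; omega
    rcases ay with ay | ay
    · rcases y' with y' | y'
      · rw [pos_inl] at ay; omega
      have hlt : pos (Sum.inr y' : Fin k ⊕ Fin n) < pos (Sum.inr x' : Fin k ⊕ Fin n) := by
        by_contra hc
        exact h (hx'.symm.trans ((hP.planar _ _ _ _ (by omega) (by omega) (by omega) hx' hy').trans
          hy'))
      -- Both lines lead to the left and are nested. The one through `lo i` is the inner one, hence
      -- not accessible and without dots. The joined line runs from the outer partner `y'` to the
      -- inner partner `x'`.
      have hδ := dsign_eq_one_of_enclosed hP (x := Sum.inr (lo i)) hy' (by omega) (by omega)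
      rw [hδ, one_mul] at hm
      rw [comp_gen_line l hP hy'x hy'ne hx'ne hx'y hlt ey ex, hm,
        hP.compW_line l (by omega) hx' rfl, hP.compW_line l' (by omega) hx' rfl,
        hP.compW_line l (by omega) hy' rfl, hP.compW_line l' (by omega) hy' rfl, hδ]
      simp only [lineW, h1, h2, hxl, hyl, one_mul]
      exact cap_left_left _ _ _ _ _ hne
    · rw [comp_gen_line l hP hx'ne hx'y hy'x hy'ne (by omega) ex ey, hm,
        hP.compW_line l (by omega) hx' rfl, hP.compW_line l' (by omega) hx' rfl,
        hP.compW_line l (by omega) rfl hy', hP.compW_line l' (by omega) rfl hy']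
      rcases y' with y' | y'
      · simp only [lineW, h1, h2, hxl, hyl]
        exact cap_left_edge _ _ _ _ _ _ hne
      · simp only [lineW, h1, h2, hxl, hyl]
        exact cap_left_right _ _ _ _ _ _ hne
  · have ay' : (lo i).1 + 1 < pos y' := by
      rcases ay with ay | ay
      · exact absurd ⟨ax, Or.inl ay⟩ hcross
      · exact ay
    have hlt : pos y' < pos x' := by
      by_contra hc
      exact hcross ⟨ax, Or.inr (by omega)⟩
    -- Here the line through `hi i` is the inner one and has no dots. The joined line starts at
    -- `y'`, which comes first in clockwise order.
    have hε := dsign_eq_one_of_enclosed hP (x := Sum.inr (hi i)) hx'.symm (by omega) (by omega)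
    rw [hε, mul_one] at hm
    rw [comp_gen_line l hP hy'x hy'ne hx'ne hx'y hlt ey ex, hm,
      hP.compW_line l (by omega) rfl hx', hP.compW_line l' (by omega) rfl hx',
      hP.compW_line l (by omega) rfl hy', hP.compW_line l' (by omega) rfl hy', hε]
    rcases y' with y' | y'
    · rcases x' with x' | x'
      · simp only [lineW, h1, h2, hxl, hyl, one_mul]
        exact cap_edge_edge _ _ _ _ _ _ hne
      · rw [pos_inl, pos_inr] at hlt; omega
    · rcases x' with x' | x'
      · simp only [lineW, h1, h2, hxl, hyl, one_mul]
        exact cap_edge_right _ _ _ _ _ _ hne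
      · simp only [lineW, h1, h2, hxl, hyl, one_mul]
        exact cap_right_right _ _ _ _ _ _ hne

omit hn in
theorem weight_eq_prod {m : ℕ} {Q : PreDiag m n} [Fintype Q.Comp] (l : Fin m ⊕ Fin n → ℤˣ) :
    Q.weight l = ∏ c, Q.compW l c := finprod_eq_prod_of_fintype _

omit hn in
theorem opE_of_not_fixed {f : Seq n → L} {β : Seq n} (h : sgn i * β (lo i) ≠ β (hi i)) :
    opE i f β = f (reflSeq i β) + (if β (hi i) = -1 then qi else q) * f β := if_neg h

/-- Concatenation with `e_i` corresponds to the operator `opE i`. -/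
theorem weight_comp_gen (hP : P.IsTangle) (α : Seq k) (β : Seq n) :
    (comp (gen i) P).weight (Sum.elim α β) = opE i (fun β => P.weight (Sum.elim α β)) β := by
  classical
  let _ := P.finite
  let _ := (comp (gen i) P).finite
  let _ := Fintype.ofFinite P.Comp
  let _ : Fintype (GlueComp (gen i) P) := Fintype.ofFinite (comp (gen i) P).Comp
  have hprod : (comp (gen i) P).weight (Sum.elim α β) =
      ∏ C : GlueComp (gen i) P, (comp (gen i) P).compW (Sum.elim α β) C :=
    finprod_eq_prod_of_fintype _
  have huniv : (Finset.univ : Finset (GlueComp (gen i) P)) =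
      insert (up (gen i) P (lo i)) (Finset.univ.image (down (gen i) P)) := by
    ext C
    simp only [Finset.mem_univ, Finset.mem_insert, Finset.mem_image, true_and, true_iff]
    rcases glueComp_gen_cases C with h | ⟨c, h⟩
    · exact Or.inl h
    · exact Or.inr ⟨c, h.symm⟩
  have hnot : up (gen i) P (lo i) ∉ Finset.univ.image (down (gen i) P) := by
    simp only [Finset.mem_image, Finset.mem_univ, true_and, not_exists]
    exact fun c h => up_lo_ne_down c h.symm
  rw [hprod, huniv, Finset.prod_insert hnot, comp_gen_compW_lo hP]
  by_cases hfix : sgn i * β (lo i) = β (hi i)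
  · rw [opE_fixed (reflSeq_eq_self_iff.2 hfix), cupW, if_pos, zero_mul]
    exact hfix
  rw [opE_of_not_fixed hfix]
  simp only [weight_eq_prod]
  have hrest : ∀ c, c ≠ P.e (Sum.inr (lo i)) → c ≠ P.e (Sum.inr (hi i)) →
      P.compW (Sum.elim α (reflSeq i β)) c = P.compW (Sum.elim α β) c := by
    intro c h1 h2
    refine compW_congr fun x hx => ?_
    rcases x with x | x
    · rfl
    · exact reflSeq_of_ne (fun h => h1 (by rw [← hx, h])) (fun h => h2 (by rw [← hx, h])) β
  -- If the two places lie on one component, the cap closes it to a circle and no components are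
  -- merged. Otherwise exactly two components become one and `comp_gen_merge` applies. All other
  -- components keep their weights in both cases.
  by_cases heq : P.e (Sum.inr (lo i)) = P.e (Sum.inr (hi i))
  · have hinj : Function.Injective (down (gen i) P) := by
      intro c d h
      rcases down_eq_down_iff.1 h with h | ⟨h1 | h1, h2 | h2⟩
      · exact h
      all_goals rw [h1, h2]
      · exact heq
      · exact heq.symm
    rw [Finset.prod_image hinj.injOn]
    rw [← Finset.mul_prod_erase _ _ (Finset.mem_univ (P.e (Sum.inr (lo i)))),
      ← Finset.mul_prod_erase _ (fun c => P.compW (Sum.elim α β) c)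
        (Finset.mem_univ (P.e (Sum.inr (lo i)))),
      ← Finset.mul_prod_erase _ (fun c => P.compW (Sum.elim α (reflSeq i β)) c)
        (Finset.mem_univ (P.e (Sum.inr (lo i))))]
    have hlt : pos (Sum.inr (lo i) : Fin k ⊕ Fin n) < pos (Sum.inr (hi i) : Fin k ⊕ Fin n) := by
      rw [pos_inr, pos_inr, hi_val']; omega
    have hcirc : (comp (gen i) P).compW (Sum.elim α β) (down (gen i) P (P.e (Sum.inr (lo i)))) =
        circleW (sgn i * P.dsign (P.e (Sum.inr (lo i)))) := by
      rw [← comp_gen_dsign_circle heq]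
      refine compW_circle _ fun x hx => ?_
      by_cases hx1 : x = Sum.inr (lo i)
      · rw [hx1, comp_gen_e_lo] at hx
        exact up_lo_ne_down _ hx
      · by_cases hx2 : x = Sum.inr (hi i)
        · rw [hx2, comp_gen_e_hi] at hx
          exact up_lo_ne_down _ hx
        · rw [comp_gen_e_of_ne hx1 hx2] at hx
          rcases hP.eq_or_eq (fun h => by rw [h] at hlt; exact lt_irrefl _ hlt) heq (hinj hx) with h | h
          · exact hx1 h
          · exact hx2 h
    rw [hcirc, hP.compW_line _ hlt rfl heq.symm, hP.compW_line _ hlt rfl heq.symm]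
    have e1 : ∏ c ∈ Finset.univ.erase (P.e (Sum.inr (lo i))),
        (comp (gen i) P).compW (Sum.elim α β) (down (gen i) P c) =
        ∏ c ∈ Finset.univ.erase (P.e (Sum.inr (lo i))), P.compW (Sum.elim α β) c := by
      refine Finset.prod_congr rfl fun c hc => ?_
      have hc' := (Finset.mem_erase.1 hc).1
      exact comp_gen_compW_of_ne hP _ hc' (fun h => hc' (h.trans heq.symm))
    have e2 : ∏ c ∈ Finset.univ.erase (P.e (Sum.inr (lo i))),
        P.compW (Sum.elim α (reflSeq i β)) c =
        ∏ c ∈ Finset.univ.erase (P.e (Sum.inr (lo i))), P.compW (Sum.elim α β) c := by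
      refine Finset.prod_congr rfl fun c hc => ?_
      have hc' := (Finset.mem_erase.1 hc).1
      exact hrest c hc' (fun h => hc' (h.trans heq.symm))
    rw [e1, e2, ← mul_assoc, ← mul_assoc, ← add_mul]
    congr 1
    simp only [lineW, Sum.elim_inr, reflSeq_lo, reflSeq_hi]
    exact cap_cup_circle _ _ _ _ hfix
  · have himg : Finset.univ.image (down (gen i) P) =
        insert (down (gen i) P (P.e (Sum.inr (lo i))))
          (((Finset.univ.erase (P.e (Sum.inr (lo i)))).erase (P.e (Sum.inr (hi i)))).image
            (down (gen i) P)) := by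
      ext C
      simp only [Finset.mem_image, Finset.mem_univ, true_and, Finset.mem_insert, Finset.mem_erase]
      constructor
      · rintro ⟨c, rfl⟩
        by_cases h1 : c = P.e (Sum.inr (lo i))
        · exact Or.inl (congrArg _ h1)
        · by_cases h2 : c = P.e (Sum.inr (hi i))
          · exact Or.inl (down_eq_down_iff.2 (Or.inr ⟨Or.inr h2, Or.inl rfl⟩))
          · exact Or.inr ⟨c, ⟨h2, h1, trivial⟩, rfl⟩
      · rintro (h | ⟨c, -, h⟩)
        · exact ⟨_, h.symm⟩
        · exact ⟨_, h⟩
    have hnot' : down (gen i) P (P.e (Sum.inr (lo i))) ∉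
        ((Finset.univ.erase (P.e (Sum.inr (lo i)))).erase (P.e (Sum.inr (hi i)))).image
            (down (gen i) P) := by
      simp only [Finset.mem_image, Finset.mem_erase, Finset.mem_univ, not_exists, not_and]
      rintro c ⟨h2, h1, -⟩ h
      rcases down_eq_down_iff.1 h with h | ⟨h | h, -⟩
      · exact h1 h
      · exact h1 h
      · exact h2 h
    have hinj : Set.InjOn (down (gen i) P)
        ((Finset.univ.erase (P.e (Sum.inr (lo i)))).erase (P.e (Sum.inr (hi i))) :
          Finset P.Comp) := by
      intro c hc d _ h
      simp only [Finset.coe_erase, Finset.coe_univ, Set.mem_sdiff, Set.mem_univ, true_and,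
        Set.mem_singleton_iff] at hc
      rcases down_eq_down_iff.1 h with h | ⟨h | h, -⟩
      · exact h
      · exact absurd h hc.1
      · exact absurd h hc.2
    rw [himg, Finset.prod_insert hnot', Finset.prod_image hinj]
    have hmem : P.e (Sum.inr (hi i)) ∈ Finset.univ.erase (P.e (Sum.inr (lo i))) :=
      Finset.mem_erase.2 ⟨fun h => heq h.symm, Finset.mem_univ _⟩
    have hsplit : ∀ g : P.Comp → L, ∏ c, g c = g (P.e (Sum.inr (lo i))) *
        g (P.e (Sum.inr (hi i))) *
          ∏ c ∈ (Finset.univ.erase (P.e (Sum.inr (lo i)))).erase (P.e (Sum.inr (hi i))), g c := by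
      intro g
      rw [mul_assoc, Finset.mul_prod_erase _ _ hmem, Finset.mul_prod_erase _ _ (Finset.mem_univ _)]
    rw [hsplit, hsplit]
    have e1 : ∏ c ∈ (Finset.univ.erase (P.e (Sum.inr (lo i)))).erase (P.e (Sum.inr (hi i))),
        (comp (gen i) P).compW (Sum.elim α β) (down (gen i) P c) =
        ∏ c ∈ (Finset.univ.erase (P.e (Sum.inr (lo i)))).erase (P.e (Sum.inr (hi i))),
          P.compW (Sum.elim α β) c := by
      refine Finset.prod_congr rfl fun c hc => ?_
      simp only [Finset.mem_erase] at hc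
      exact comp_gen_compW_of_ne hP _ hc.2.1 hc.1
    have e2 : ∏ c ∈ (Finset.univ.erase (P.e (Sum.inr (lo i)))).erase (P.e (Sum.inr (hi i))),
        P.compW (Sum.elim α (reflSeq i β)) c =
        ∏ c ∈ (Finset.univ.erase (P.e (Sum.inr (lo i)))).erase (P.e (Sum.inr (hi i))),
          P.compW (Sum.elim α β) c := by
      refine Finset.prod_congr rfl fun c hc => ?_
      simp only [Finset.mem_erase] at hc
      exact hrest c hc.2.1 hc.1
    rw [e1, e2, ← mul_assoc, ← mul_assoc, ← add_mul]
    congr 1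
    refine comp_gen_merge hP (Sum.elim α β) heq hfix (Sum.elim α (reflSeq i β))
      (reflSeq_lo _ _) (reflSeq_hi _ _) fun z hz1 hz2 => ?_
    rcases z with z | z
    · rfl
    · exact reflSeq_of_ne (fun h => hz1 (congrArg _ h)) (fun h => hz2 (congrArg _ h)) β

end Gen

end PreDiag

theorem entry_gen_comp {k n : ℕ} [Fact (2 ≤ n)] (i : Fin n) (T : Tangle k n) (α : Seq k) :
    entry ((Tangle.gen i).comp T) α = opE i (entry T α) := by
  funext β
  induction T using Tangle.ind with
  | h P hP => exact PreDiag.weight_comp_gen hP α β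

namespace PreDiag

/-! ### Removing components -/

section Remove

variable {m m' n : ℕ}

/-- Remove the component `c`; the remaining bottom points are given by `ι`. -/
def remove (P : PreDiag m n) (c : P.Comp) (ι : Fin m' ↪o Fin m)
    (h : ∀ x, P.e (Sum.map ι _root_.id x) ≠ c) : PreDiag m' n where
  Comp := {d // d ≠ c}
  finite := by
    have := P.finite
    infer_instance
  e x := ⟨P.e (Sum.map ι _root_.id x), h x⟩
  dots := P.dots.subtypeDomain (fun d => d ≠ c)

theorem pos_map_lt (ι : Fin m' ↪o Fin m) {x y : Fin m' ⊕ Fin n} (h : pos x < pos y) :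
    pos (Sum.map ι _root_.id x) < pos (Sum.map ι _root_.id y) := by
  rcases x with x | x <;> rcases y with y | y <;> simp only [pos_inl, pos_inr, Sum.map_inl,
    Sum.map_inr, id_eq] at h ⊢
  · have h1 : y < x := by
      rw [Fin.lt_def]; omega
    have h2 := ι.lt_iff_lt.2 h1
    rw [Fin.lt_def] at h2
    have := (ι x).2
    omega
  · have := y.2; omega
  · have := x.2; omega
  · exact h

theorem map_injective (ι : Fin m' ↪o Fin m) :
    Function.Injective (Sum.map ι _root_.id : Fin m' ⊕ Fin n → Fin m ⊕ Fin n) :=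
  Sum.map_injective.2 ⟨ι.injective, Function.injective_id⟩

theorem IsTangle.remove {P : PreDiag m n} (hP : P.IsTangle) {c : P.Comp} {ι : Fin m' ↪o Fin m}
    {h : ∀ x, P.e (Sum.map ι _root_.id x) ≠ c}
    (hcov : ∀ x, P.e x ≠ c → ∃ y, Sum.map ι _root_.id y = x) : (P.remove c ι h).IsTangle where
  paired x := by
    obtain ⟨y, ⟨hy1, hy2⟩, hy3⟩ := hP.paired (Sum.map ι _root_.id x)
    obtain ⟨y, rfl⟩ := hcov y (hy2 ▸ h x)
    refine ⟨y, ⟨fun h => hy1 (congrArg _ h), Subtype.ext hy2⟩, ?_⟩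
    rintro z ⟨hz1, hz2⟩
    exact map_injective ι (hy3 _ ⟨fun h => hz1 (map_injective ι h), congrArg Subtype.val hz2⟩)
  planar a b c d h1 h2 h3 h4 h5 := Subtype.ext (hP.planar _ _ _ _ (pos_map_lt ι h1)
    (pos_map_lt ι h2) (pos_map_lt ι h3) (congrArg Subtype.val h4) (congrArg Subtype.val h5))
  accessible x hx a b hab h' := hP.accessible _ hx _ _ (congrArg Subtype.val hab)
    ⟨pos_map_lt ι h'.1, pos_map_lt ι h'.2⟩

theorem mapDomain_subtypeDomain_add {X : Type} (d : X →₀ ℕ) (c : X) :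
    (d.subtypeDomain (fun x => x ≠ c)).mapDomain Subtype.val + Finsupp.single c (d c) = d := by
  classical
  ext x
  rw [Finsupp.add_apply]
  by_cases hx : x = c
  · subst hx
    rw [Finsupp.mapDomain_of_notMem_range, zero_add, Finsupp.single_eq_same]
    rintro ⟨y, hy⟩
    exact y.2 hy
  · rw [Finsupp.single_eq_of_ne hx, add_zero]
    exact Finsupp.mapDomain_apply Subtype.val_injective _ (⟨x, hx⟩ : {x // x ≠ c})

open scoped Classical in
theorem mapDomain_optionSubtypeNe {X : Type} (d : X →₀ ℕ) (c : X) :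
    ((d.subtypeDomain (fun x => x ≠ c)).mapDomain some + Finsupp.single none (d c)).mapDomain
      (Equiv.optionSubtypeNe c) = d := by
  rw [Finsupp.mapDomain_add, ← Finsupp.mapDomain_comp, Finsupp.mapDomain_single]
  exact mapDomain_subtypeDomain_add d c

open scoped Classical in
-- The rules are formulated for adding a component. This lemma and `addCap_remove` present a given
-- diagram in that form, so that the rules can be used to remove one.
theorem addLoop_remove (P : PreDiag m n) (c : P.Comp) (h : ∀ x, P.e (Sum.map (RelEmbedding.refl (α := Fin m) (· ≤ ·)) _root_.id x) ≠ c) :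
    (P.remove c (RelEmbedding.refl _) h).addLoop (P.dots c) ≈ P := by
  refine ⟨Equiv.optionSubtypeNe c, fun x => ?_, ?_⟩
  · rcases x with x | x <;> rfl
  · exact mapDomain_optionSubtypeNe P.dots c

open scoped Classical in
theorem addCap_remove (P : PreDiag (m + 2) n) (c : P.Comp) (ι : Fin m ↪o Fin (m + 2))
    (h : ∀ x, P.e (Sum.map ι _root_.id x) ≠ c) (hcov : ∀ x, P.e x ≠ c → ∃ y, Sum.map ι _root_.id y = x) :
    (P.remove c ι h).addCap ι (P.dots c) ≈ P := by
  refine ⟨Equiv.optionSubtypeNe c, fun x => ?_, ?_⟩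
  · rcases x with x | x
    · change Equiv.optionSubtypeNe c (if h' : ∃ j', ι j' = x then
        some ((P.remove c ι h).e (Sum.inl h'.choose)) else none) = P.e (Sum.inl x)
      split_ifs with h'
      · change P.e (Sum.inl (ι h'.choose)) = _
        rw [h'.choose_spec]
      · by_contra hne
        obtain ⟨y, hy⟩ := hcov _ (fun h'' => hne h''.symm)
        rcases y with y | y
        · exact h' ⟨y, Sum.inl_injective hy⟩
        · cases hy
    · rfl
  · exact mapDomain_optionSubtypeNe P.dots c

end Remove

/-! ### The state sum respects the rules -/

section Rules

variable {m m' n : ℕ}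

theorem lineW_map {δ : ℤˣ} {ι : Fin m' ↪o Fin m} {l : Fin m' ⊕ Fin n → ℤˣ}
    {l' : Fin m ⊕ Fin n → ℤˣ} (hl : ∀ x, l x = l' (Sum.map ι _root_.id x)) (u v : Fin m' ⊕ Fin n) :
    lineW δ l u v = lineW δ l' (Sum.map ι _root_.id u) (Sum.map ι _root_.id v) := by
  rcases u with u | u <;> rcases v with v | v <;> simp only [lineW, hl] <;> rfl

theorem IsTangle.compW_map {P : PreDiag m' n} {Q : PreDiag m n} (hP : P.IsTangle)
    (hQ : Q.IsTangle) (ι : Fin m' ↪o Fin m) {l : Fin m' ⊕ Fin n → ℤˣ} {l' : Fin m ⊕ Fin n → ℤˣ}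
    (hl : ∀ x, l x = l' (Sum.map ι _root_.id x)) {c : P.Comp} {d : Q.Comp}
    (h : ∀ x, P.e x = c ↔ Q.e (Sum.map ι _root_.id x) = d)
    (hcov : ∀ x, Q.e x = d → ∃ y, Sum.map ι _root_.id y = x)
    (hd : P.dsign c = Q.dsign d) : P.compW l c = Q.compW l' d := by
  by_cases hex : ∃ x, P.e x = c
  · obtain ⟨x, hx⟩ := hex
    obtain ⟨y, hyx, hy⟩ := hP.exists_partner x
    rcases Nat.lt_or_gt_of_ne (fun h => hyx (pos_injective h)) with hlt | hlt
    · rw [hP.compW_line l hlt (hy.trans hx) hx,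
        hQ.compW_line l' (pos_map_lt ι hlt) ((h _).1 (hy.trans hx)) ((h _).1 hx), hd,
        lineW_map hl]
    · rw [hP.compW_line l hlt hx (hy.trans hx),
        hQ.compW_line l' (pos_map_lt ι hlt) ((h _).1 hx) ((h _).1 (hy.trans hx)), hd,
        lineW_map hl]
  · push Not at hex
    rw [compW_circle l hex, compW_circle l' (fun x hx => ?_), hd]
    obtain ⟨y, rfl⟩ := hcov x hx
    exact hex y ((h y).2 hx)

/-- The other components need to be compared for `a ≠ 0` only, because the rules with value zero do
not provide that the diagram without the additional component is a tangle. -/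
theorem weight_option {P : PreDiag m' n} {Q : PreDiag m n} (f : Option P.Comp ≃ Q.Comp)
    {l : Fin m' ⊕ Fin n → ℤˣ} {l' : Fin m ⊕ Fin n → ℤˣ} {a : L}
    (hn : Q.compW l' (f none) = a) (hs : a ≠ 0 → ∀ c, P.compW l c = Q.compW l' (f (some c))) :
    Q.weight l' = a * P.weight l := by
  classical
  let _ := P.finite
  let _ := Fintype.ofFinite P.Comp
  rw [weight, weight, ← finprod_comp_equiv f, finprod_eq_prod_of_fintype,
    finprod_eq_prod_of_fintype, Fintype.prod_option, hn]
  by_cases ha : a = 0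
  · rw [ha, zero_mul, zero_mul]
  · rw [Finset.prod_congr rfl fun c _ => hs ha c]

theorem dsign_addLoop_none (P : PreDiag m n) (d : ℕ) :
    (P.addLoop d).dsign (none : Option P.Comp) = (-1) ^ d := by
  change (-1 : ℤˣ) ^ ((P.dots.mapDomain some + Finsupp.single none d : Option P.Comp →₀ ℕ) none) = _
  rw [Finsupp.add_apply, Finsupp.mapDomain_of_notMem_range _ _ (by simp), Finsupp.single_eq_same,
    zero_add]

theorem dsign_addLoop_some (P : PreDiag m n) (d : ℕ) (c : P.Comp) :
    (P.addLoop d).dsign (some c : Option P.Comp) = P.dsign c := by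
  change (-1 : ℤˣ) ^ ((P.dots.mapDomain some + Finsupp.single none d : Option P.Comp →₀ ℕ) (some c)) = _
  rw [Finsupp.add_apply, Finsupp.mapDomain_apply (Option.some_injective _),
    Finsupp.single_eq_of_ne (by simp), add_zero, dsign]

theorem compW_addLoop_none (P : PreDiag m n) (d : ℕ) (l : Fin m ⊕ Fin n → ℤˣ) :
    (P.addLoop d).compW l (none : Option P.Comp) = circleW ((-1) ^ d) := by
  rw [← dsign_addLoop_none P d]
  refine compW_circle l fun x hx => ?_
  cases hx

theorem weight_addLoop {P : PreDiag m n} (hP : P.IsTangle) {d : ℕ} (h : (P.addLoop d).IsTangle)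
    (l : Fin m ⊕ Fin n → ℤˣ) : (P.addLoop d).weight l = circleW ((-1) ^ d) * P.weight l := by
  refine weight_option (Q := P.addLoop d) (Equiv.refl _) (compW_addLoop_none P d l) fun _ c => ?_
  refine hP.compW_eq h (fun x => ?_) (dsign_addLoop_some P d c).symm
  exact (Option.some_inj (a := P.e x) (b := c)).symm

theorem weight_addLoop_one {P : PreDiag m n} (l : Fin m ⊕ Fin n → ℤˣ) :
    (P.addLoop 1).weight l = 0 := by
  rw [weight_option (P := P) (Q := P.addLoop 1) (l := l) (a := 0) (Equiv.refl _)
    ((compW_addLoop_none P 1 l).trans (by rw [pow_one, circleW_m])) (fun h => absurd rfl h),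
    zero_mul]

theorem dsign_addDots_two (P : PreDiag m n) (c d : P.Comp) :
    (P.addDots c 2).dsign d = P.dsign d := by
  classical
  change (-1 : ℤˣ) ^ ((P.dots + Finsupp.single c 2 : P.Comp →₀ ℕ) d) = _
  rw [Finsupp.add_apply, pow_add, Finsupp.single_apply, dsign]
  split_ifs <;> simp

theorem weight_addDots_two {P : PreDiag m n} (hP : P.IsTangle) {c : P.Comp}
    (h : (P.addDots c 2).IsTangle) (l : Fin m ⊕ Fin n → ℤˣ) :
    (P.addDots c 2).weight l = P.weight l :=
  finprod_congr fun d => h.compW_eq hP (fun _ => Iff.rfl) (dsign_addDots_two P c d)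

theorem addCap_e_inl (P : PreDiag m n) (ι : Fin m ↪o Fin (m + 2)) (d : ℕ) (j : Fin m) :
    (P.addCap ι d).e (Sum.inl (ι j)) = some (P.e (Sum.inl j)) := by
  have h : ∃ j', ι j' = ι j := ⟨j, rfl⟩
  refine (dif_pos h).trans ?_
  rw [ι.injective h.choose_spec]

theorem addCap_e_map (P : PreDiag m n) (ι : Fin m ↪o Fin (m + 2)) (d : ℕ) (x : Fin m ⊕ Fin n) :
    (P.addCap ι d).e (Sum.map ι _root_.id x) = some (P.e x) := by
  rcases x with x | x
  · exact addCap_e_inl P ι d x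
  · rfl

theorem addCap_e_none (P : PreDiag m n) (ι : Fin m ↪o Fin (m + 2)) (d : ℕ) {j : Fin (m + 2)}
    (h : ∀ j', ι j' ≠ j) : (P.addCap ι d).e (Sum.inl j) = none :=
  dif_neg fun ⟨j', hj⟩ => h j' hj

theorem addCap_cases (P : PreDiag m n) (ι : Fin m ↪o Fin (m + 2)) (d : ℕ)
    (x : Fin (m + 2) ⊕ Fin n) : (∃ y, Sum.map ι _root_.id y = x) ∨
      ((P.addCap ι d).e x = none ∧ ∃ j, x = Sum.inl j) := by
  rcases x with x | x
  · by_cases h : ∃ j', ι j' = x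
    · obtain ⟨j', rfl⟩ := h
      exact Or.inl ⟨Sum.inl j', rfl⟩
    · push Not at h
      exact Or.inr ⟨addCap_e_none P ι d h, x, rfl⟩
  · exact Or.inl ⟨Sum.inr x, rfl⟩

theorem dsign_addCap_none (P : PreDiag m n) (ι : Fin m ↪o Fin (m + 2)) (d : ℕ) :
    (P.addCap ι d).dsign (none : Option P.Comp) = (-1) ^ d := dsign_addLoop_none P d

/-- Both ends of the cap carry a plus, so its weight is `capW 1 1 = 0` without a dot and `capW (-1)
1 = 1` with one dot. These are the rules (iv) and (v), and the reason for evaluating cup diagrams at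
plus signs. -/
theorem compW_addCap_none (P : PreDiag m n) (ι : Fin m ↪o Fin (m + 2)) {d : ℕ}
    (h : (P.addCap ι d).IsTangle) (β : Seq n) :
    (P.addCap ι d).compW (Sum.elim 1 β) (none : Option P.Comp) = capW ((-1) ^ d) 1 := by
  have hex : ∃ j : Fin (m + 2), ∀ j', ι j' ≠ j := by
    by_contra hno
    push Not at hno
    have := Fintype.card_le_of_surjective ι hno
    simp at this
  obtain ⟨j, hj⟩ := hex
  have hj' := addCap_e_none P ι d hj
  obtain ⟨y, hy, hy'⟩ := h.exists_partner (Sum.inl j)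
  rw [hj'] at hy'
  rcases addCap_cases P ι d y with ⟨z, rfl⟩ | ⟨-, j', rfl⟩
  · rw [addCap_e_map] at hy'
    cases hy'
  · rcases Nat.lt_or_gt_of_ne (fun h => hy (pos_injective h)) with hlt | hlt
    · rw [h.compW_line _ hlt hy' hj', dsign_addCap_none]
      simp only [lineW, Sum.elim_inl, Pi.one_apply, mul_one]
    · rw [h.compW_line _ hlt hj' hy', dsign_addCap_none]
      simp only [lineW, Sum.elim_inl, Pi.one_apply, mul_one]

theorem weight_addCap_zero {P : PreDiag m n} {ι : Fin m ↪o Fin (m + 2)}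
    (h : (P.addCap ι 0).IsTangle) (β : Seq n) : (P.addCap ι 0).weight (Sum.elim 1 β) = 0 := by
  rw [weight_option (P := P) (Q := P.addCap ι 0) (l := Sum.elim 1 β) (a := 0) (Equiv.refl _)
    ((compW_addCap_none P ι h β).trans (by rw [pow_zero, capW_pp])) (fun h => absurd rfl h),
    zero_mul]

theorem weight_addCap_one {P : PreDiag m n} (hP : P.IsTangle) {ι : Fin m ↪o Fin (m + 2)}
    (h : (P.addCap ι 1).IsTangle) (β : Seq n) :
    (P.addCap ι 1).weight (Sum.elim 1 β) = P.weight (Sum.elim 1 β) := by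
  rw [weight_option (P := P) (Q := P.addCap ι 1) (l := Sum.elim 1 β) (a := 1) (Equiv.refl _)
    ((compW_addCap_none P ι h β).trans (by rw [pow_one, capW_mp])) (fun _ c => ?_),
    one_mul]
  refine hP.compW_map h ι (fun x => by cases x <;> rfl) (fun x => ?_) (fun x hx => ?_)
    (dsign_addLoop_some P 1 c).symm
  · rw [addCap_e_map]
    exact (Option.some_inj (a := P.e x) (b := c)).symm
  · rcases addCap_cases P ι 1 x with h' | ⟨h', -⟩
    · exact h'
    · rw [h'] at hx
      cases hx

end Rules

end PreDiag

theorem localRel_le_ker {m n : ℕ} {M : Type*} [AddCommGroup M] [Module L M] {b : Tangle m n → M}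
    {f : M →ₗ[L] L} {α : Seq m} {β : Seq n} (hf : ∀ T, f (b T) = entry T α β) :
    localRel b ≤ LinearMap.ker f := by
  rw [localRel, Submodule.span_le]
  rintro x ((⟨P, h, h', rfl⟩ | ⟨P, c, h, h', rfl⟩) | ⟨P, h', rfl⟩)
  · rw [SetLike.mem_coe, LinearMap.mem_ker, map_sub, map_smul, hf, hf, entry_mk, entry_mk,
      PreDiag.weight_addLoop h h', pow_zero, circleW_p, smul_eq_mul, sub_self]
  · rw [SetLike.mem_coe, LinearMap.mem_ker, map_sub, hf, hf, entry_mk, entry_mk,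
      PreDiag.weight_addDots_two h h', sub_self]
  · rw [SetLike.mem_coe, LinearMap.mem_ker, hf, entry_mk, PreDiag.weight_addLoop_one]

/-- The bottom signs have to be all plus here, since the rules for caps hold for no reason other
than `compW_addCap_none`. -/
theorem cupRel_le_ker {n : ℕ} {f : ((Σ k, Tangle k n) →₀ L) →ₗ[L] L} {β : Seq n}
    (hf : ∀ k (T : Tangle k n), f (bas T) = entry T 1 β) : cupRel n ≤ LinearMap.ker f := by
  rw [cupRel]
  refine sup_le (iSup_le fun k => localRel_le_ker (hf k)) ?_
  rw [Submodule.span_le]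
  rintro x (⟨k, P, ι, h', rfl⟩ | ⟨k, P, ι, h, h', rfl⟩)
  · rw [SetLike.mem_coe, LinearMap.mem_ker, hf, entry_mk, PreDiag.weight_addCap_zero h']
  · rw [SetLike.mem_coe, LinearMap.mem_ker, map_sub, hf, hf, entry_mk, entry_mk,
      PreDiag.weight_addCap_one h h', sub_self]

namespace PreDiag

/-! ### Reduction to diagrams without circles and with at most one dot on each line -/

/-- There are no circles, and at most one dot on each line. -/
structure IsReduced {m n : ℕ} (P : PreDiag m n) : Prop where
  noCircle : ∀ c, ∃ x, P.e x = c
  dots_le : ∀ c, P.dots c ≤ 1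

/-- The diagrams connect the same boundary points, by lines with the same numbers of dots modulo
two. -/
structure SameShape {m n : ℕ} (P Q : PreDiag m n) : Prop where
  e_iff : ∀ x y, P.e x = P.e y ↔ Q.e x = Q.e y
  dsign : ∀ x, P.dsign (P.e x) = Q.dsign (Q.e x)

section

variable {m m' n : ℕ}

theorem SameShape.refl (P : PreDiag m n) : P.SameShape P := ⟨fun _ _ => Iff.rfl, fun _ => rfl⟩

theorem SameShape.trans {P Q R : PreDiag m n} (h : P.SameShape Q) (h' : Q.SameShape R) :
    P.SameShape R :=
  ⟨fun x y => (h.e_iff x y).trans (h'.e_iff x y), fun x => (h.dsign x).trans (h'.dsign x)⟩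

theorem dots_eq_of_dsign {P Q : PreDiag m n} {c : P.Comp} {d : Q.Comp} (hc : P.dots c ≤ 1)
    (hd : Q.dots d ≤ 1) (h : P.dsign c = Q.dsign d) : P.dots c = Q.dots d := by
  rw [dsign, dsign] at h
  interval_cases h1 : P.dots c <;> interval_cases h2 : Q.dots d <;> simp at h ⊢

/-- A reduced diagram is determined by its shape. -/
theorem IsReduced.equiv {P Q : PreDiag m n} (hP : P.IsReduced) (hQ : Q.IsReduced)
    (h : P.SameShape Q) : P ≈ Q := by
  have hf : ∀ x, Q.e (hP.noCircle (P.e x)).choose = Q.e x := fun x =>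
    (h.e_iff _ _).1 (hP.noCircle (P.e x)).choose_spec
  have hg : ∀ x, P.e (hQ.noCircle (Q.e x)).choose = P.e x := fun x =>
    (h.e_iff _ _).2 (hQ.noCircle (Q.e x)).choose_spec
  let φ : P.Comp ≃ Q.Comp :=
    { toFun := fun c => Q.e (hP.noCircle c).choose
      invFun := fun c => P.e (hQ.noCircle c).choose
      left_inv := fun c => (hg _).trans (hP.noCircle c).choose_spec
      right_inv := fun c => (hf _).trans (hQ.noCircle c).choose_spec }
  refine ⟨φ, hf, ?_⟩
  ext c
  obtain ⟨x, rfl⟩ := hQ.noCircle c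
  have h1 : φ (P.e x) = Q.e x := hf x
  rw [← h1, Finsupp.mapDomain_apply φ.injective, h1]
  exact dots_eq_of_dsign (hP.dots_le _) (hQ.dots_le _) (h.dsign x)

variable {M : Type*} [AddCommGroup M] [Module L M]

/-- As long as some component has at least two dots, a pair of them can be removed; the total number
of dots decreases and accessibility is preserved. The diagram `Q` is chosen before `b`, so it serves
for all modules at once. -/
theorem exists_dots_le_one {P : PreDiag m n} (hP : P.IsTangle) :
    ∃ (Q : PreDiag m n) (hQ : Q.IsTangle), P.SameShape Q ∧ (∀ c, Q.dots c ≤ 1) ∧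
      Nat.card Q.Comp = Nat.card P.Comp ∧
      ∀ b : Tangle m n → M, b (.mk P hP) - b (.mk Q hQ) ∈ localRel b := by
  classical
  induction hd : P.dots.degree using Nat.strong_induction_on generalizing P with
  | _ d ih =>
    by_cases h : ∀ c, P.dots c ≤ 1
    · exact ⟨P, hP, .refl P, h, rfl, fun b => by rw [sub_self]; exact zero_mem _⟩
    · push Not at h
      obtain ⟨c, hc⟩ := h
      let Q : PreDiag m n := ⟨P.Comp, P.finite, P.e, P.dots - Finsupp.single c 2⟩
      have hadd : P.dots - Finsupp.single c 2 + Finsupp.single c 2 = P.dots :=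
        tsub_add_cancel_of_le (by rw [Finsupp.single_le_iff]; omega)
      have hQ : Q.IsTangle := ⟨hP.paired, hP.planar, fun x hx => hP.accessible x <| by
        have h1 : Q.dots (Q.e x) ≤ P.dots (P.e x) := tsub_le_self (α := P.Comp →₀ ℕ) (b := Finsupp.single c 2) (P.e x)
        omega⟩
      have hPQ : P = Q.addDots c 2 := by
        conv_lhs => rw [show P = ⟨P.Comp, P.finite, P.e, P.dots⟩ from rfl]
        change _ = (⟨P.Comp, P.finite, P.e, P.dots - Finsupp.single c 2 + Finsupp.single c 2⟩ :
          PreDiag m n)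
        rw [hadd]
      have hdeg : Q.dots.degree < d := by
        have := congrArg Finsupp.degree hadd
        rw [map_add, Finsupp.degree_single, hd] at this
        change (P.dots - Finsupp.single c 2).degree < d
        omega
      obtain ⟨R, hR, h1, h2, h3, h4⟩ := ih _ hdeg hQ rfl
      have hsh : P.SameShape Q := by
        rw [hPQ]
        exact ⟨fun _ _ => Iff.rfl, fun x => dsign_addDots_two Q c _⟩
      refine ⟨R, hR, hsh.trans h1, h2, h3, fun b => ?_⟩
      have h5 : b (.mk P hP) - b (.mk Q hQ) ∈ localRel b :=
        Submodule.subset_span (Or.inl (Or.inr ⟨Q, c, hQ, hPQ ▸ hP, by simp only [← hPQ]⟩))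
      have := add_mem h5 (h4 b)
      rwa [sub_add_sub_cancel] at this

theorem remove_sameShape (P : PreDiag m n) (c : P.Comp)
    (h : ∀ x, P.e (Sum.map (RelEmbedding.refl (α := Fin m) (· ≤ ·)) _root_.id x) ≠ c) :
    P.SameShape (P.remove c (RelEmbedding.refl _) h) := by
  have hx : ∀ x : Fin m ⊕ Fin n,
      Sum.map (RelEmbedding.refl (α := Fin m) (· ≤ ·)) _root_.id x = x := by
    rintro (x | x) <;> rfl
  refine ⟨fun x y => ?_, fun x => ?_⟩
  · refine Iff.trans ?_ Subtype.ext_iff.symm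
    change P.e x = P.e y ↔ P.e (Sum.map _ _ x) = P.e (Sum.map _ _ y)
    rw [hx, hx]
  · change (-1) ^ P.dots (P.e x) = (-1) ^ P.dots (P.e (Sum.map _ _ x))
    rw [hx]

theorem card_remove_lt (P : PreDiag m n) (c : P.Comp) (ι : Fin m' ↪o Fin m)
    (h : ∀ x, P.e (Sum.map ι _root_.id x) ≠ c) :
    Nat.card (P.remove c ι h).Comp < Nat.card P.Comp := by
  have := P.finite
  exact Finite.card_subtype_lt (p := fun d => d ≠ c) (x := c) (by simp)

/-- Once there is at most one dot on each component, a circle is either undotted and gives the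
factor `q + qi`, or has one dot and gives zero. Neither removal affects the lines. -/
theorem exists_reduced {P : PreDiag m n} (hP : P.IsTangle) :
    ∃ (Q : PreDiag m n) (hQ : Q.IsTangle) (a : L), P.SameShape Q ∧ Q.IsReduced ∧
      ∀ b : Tangle m n → M, b (.mk P hP) - a • b (.mk Q hQ) ∈ localRel b := by
  suffices H : ∀ {P : PreDiag m n} (hP : P.IsTangle), (∀ c, P.dots c ≤ 1) →
      ∃ (Q : PreDiag m n) (hQ : Q.IsTangle) (a : L), P.SameShape Q ∧ Q.IsReduced ∧
      ∀ b : Tangle m n → M, b (.mk P hP) - a • b (.mk Q hQ) ∈ localRel b by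
    obtain ⟨Q, hQ, h1, h2, -, h3⟩ := exists_dots_le_one (M := M) hP
    obtain ⟨R, hR, a, h4, h5, h6⟩ := H hQ h2
    refine ⟨R, hR, a, h1.trans h4, h5, fun b => ?_⟩
    have := add_mem (h3 b) (h6 b)
    rwa [sub_add_sub_cancel] at this
  intro P hP hd
  induction hk : Nat.card P.Comp using Nat.strong_induction_on generalizing P with
  | _ k ih =>
    by_cases hc : ∀ c, ∃ x, P.e x = c
    · exact ⟨P, hP, 1, .refl P, ⟨hc, hd⟩, fun b => by rw [one_smul, sub_self]; exact zero_mem _⟩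
    push Not at hc
    obtain ⟨c, hc⟩ := hc
    have hc' : ∀ x, P.e (Sum.map (RelEmbedding.refl (α := Fin m) (· ≤ ·)) _root_.id x) ≠ c :=
      fun x => hc _
    let Q := P.remove c (RelEmbedding.refl _) hc'
    have hQ : Q.IsTangle := hP.remove fun x _ => ⟨x, by rcases x with x | x <;> rfl⟩
    obtain ⟨R, hR, a, h1, h2, h3⟩ := ih _ (hk ▸ card_remove_lt P c _ hc') hQ
      (fun d => hd d.1) rfl
    have hequiv : Q.addLoop (P.dots c) ≈ P := addLoop_remove P c hc'
    have hT := hP.congr (Setoid.symm hequiv)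
    have heq : Tangle.mk P hP = .mk _ hT := Tangle.sound (Setoid.symm hequiv)
    rcases Nat.eq_zero_or_pos (P.dots c) with h0 | h0
    · refine ⟨R, hR, (q + qi) * a, (remove_sameShape P c hc').trans h1, h2, fun b => ?_⟩
      have h5 : b (.mk P hP) - (q + qi) • b (.mk Q hQ) ∈ localRel b := by
        rw [heq]
        generalize P.dots c = d at h0 hT
        subst h0
        exact Submodule.subset_span (Or.inl (Or.inl ⟨Q, hQ, hT, rfl⟩))
      have := add_mem h5 (Submodule.smul_mem _ (q + qi) (h3 b))
      rwa [smul_sub, sub_add_sub_cancel, ← mul_smul] at this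
    -- The coefficient is zero, but a reduced diagram of the same shape is still supplied, so that
    -- the shape is available without a case distinction.
    · refine ⟨R, hR, 0, (remove_sameShape P c hc').trans h1, h2, fun b => ?_⟩
      have h1 : P.dots c = 1 := le_antisymm (hd c) h0
      rw [zero_smul, sub_zero, heq]
      generalize P.dots c = d at h1 hT
      subst h1
      exact Submodule.subset_span (Or.inr ⟨Q, hT, rfl⟩)

/-- Every bottom point is connected to a top point. -/
def NoCap (P : PreDiag m n) : Prop := ∀ j, ∃ i, P.e (Sum.inl j) = P.e (Sum.inr i)

/-- In a reduced diagram a cap has no dot, and then the diagram is zero, or one dot, and then the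
cap is removed with its two end points. The induction runs over the number of bottom points. -/
theorem exists_cup_diagram {k : ℕ} {P : PreDiag k n} (hP : P.IsTangle) :
    ∃ (k' : ℕ) (Q : PreDiag k' n) (hQ : Q.IsTangle) (a : L), Q.IsReduced ∧ Q.NoCap ∧
      bas (.mk P hP) - a • bas (.mk Q hQ) ∈ cupRel n := by
  suffices H : ∀ {k : ℕ} {P : PreDiag k n} (hP : P.IsTangle), P.IsReduced →
      ∃ (k' : ℕ) (Q : PreDiag k' n) (hQ : Q.IsTangle) (a : L), Q.IsReduced ∧ Q.NoCap ∧
      bas (.mk P hP) - a • bas (.mk Q hQ) ∈ cupRel n by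
    obtain ⟨Q, hQ, a, -, h1, h2⟩ := exists_reduced (M := (Σ k, Tangle k n) →₀ L) hP
    obtain ⟨k', R, hR, a', h4, h5, h6⟩ := H hQ h1
    refine ⟨k', R, hR, a * a', h4, h5, ?_⟩
    have h7 : bas (.mk P hP) - a • bas (.mk Q hQ) ∈ cupRel n :=
      Submodule.mem_sup_left (Submodule.mem_iSup_of_mem k (h2 bas))
    have := add_mem h7 (Submodule.smul_mem _ a h6)
    rwa [smul_sub, sub_add_sub_cancel, ← mul_smul] at this
  intro k P hP hr
  induction k using Nat.strong_induction_on with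
  | _ k ih =>
    by_cases hc : P.NoCap
    · exact ⟨k, P, hP, 1, hr, hc, by rw [one_smul, sub_self]; exact zero_mem _⟩
    unfold NoCap at hc
    push Not at hc
    obtain ⟨j, hj⟩ := hc
    obtain ⟨j' | i, hj1, hj2⟩ := hP.exists_partner (Sum.inl j)
    swap
    · exact absurd hj2.symm (hj i)
    have hne : j' ≠ j := fun h => hj1 (congrArg _ h)
    obtain ⟨k, rfl⟩ : ∃ k', k = k' + 2 := by
      have h1 := j.2
      have h2 := j'.2
      have h3 : j'.1 ≠ j.1 := fun h => hne (Fin.ext h)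
      exact ⟨k - 2, by omega⟩
    have hcard : (Finset.univ \ {j', j} : Finset (Fin (k + 2))).card = k := by
      rw [Finset.card_sdiff, Finset.inter_univ, Finset.card_pair hne, Finset.card_univ,
        Fintype.card_fin, Nat.add_sub_cancel]
    -- The increasing enumeration of the bottom points that are not on the cap.
    let ι : Fin k ↪o Fin (k + 2) := Finset.orderEmbOfFin _ hcard
    have hι : ∀ x, (∃ y, ι y = x) ↔ x ≠ j' ∧ x ≠ j := by
      intro x
      rw [← Set.mem_range, Finset.range_orderEmbOfFin]
      simp
    have hcl : ∀ z, P.e z = P.e (Sum.inl j) ↔ z = Sum.inl j' ∨ z = Sum.inl j := by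
      intro z
      constructor
      · intro hz
        exact hP.eq_or_eq hj1 hj2 (hz.trans hj2.symm)
      · rintro (rfl | rfl)
        · exact hj2
        · rfl
    have h : ∀ x, P.e (Sum.map ι _root_.id x) ≠ P.e (Sum.inl j) := by
      intro x hx
      rw [hcl] at hx
      rcases x with x | x
      · have := (hι (ι x)).1 ⟨x, rfl⟩
        rcases hx with hx | hx
        · exact this.1 (Sum.inl_injective hx)
        · exact this.2 (Sum.inl_injective hx)
      · rcases hx with hx | hx <;> cases hx
    have hcov : ∀ x, P.e x ≠ P.e (Sum.inl j) → ∃ y, Sum.map ι _root_.id y = x := by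
      intro x hx
      rw [Ne, hcl, not_or] at hx
      rcases x with x | x
      · obtain ⟨y, hy⟩ := (hι x).2 ⟨fun h => hx.1 (congrArg _ h), fun h => hx.2 (congrArg _ h)⟩
        exact ⟨Sum.inl y, congrArg _ hy⟩
      · exact ⟨Sum.inr x, rfl⟩
    let Q := P.remove (P.e (Sum.inl j)) ι h
    have hQ : Q.IsTangle := hP.remove hcov
    have hQr : Q.IsReduced := by
      refine ⟨?_, fun d => hr.dots_le d.1⟩
      rintro ⟨d, hd⟩
      obtain ⟨x, rfl⟩ := hr.noCircle d
      obtain ⟨y, rfl⟩ := hcov x hd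
      exact ⟨y, rfl⟩
    obtain ⟨k', R, hR, a, h1, h2, h3⟩ := ih k (by omega) hQ hQr
    have hequiv : Q.addCap ι (P.dots (P.e (Sum.inl j))) ≈ P := addCap_remove P _ ι h hcov
    have hT := hP.congr (Setoid.symm hequiv)
    have heq : Tangle.mk P hP = .mk _ hT := Tangle.sound (Setoid.symm hequiv)
    have hle := hr.dots_le (P.e (Sum.inl j))
    rcases Nat.eq_zero_or_pos (P.dots (P.e (Sum.inl j))) with h0 | h0
    · refine ⟨k', R, hR, 0, h1, h2, ?_⟩
      rw [zero_smul, sub_zero, heq]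
      generalize P.dots (P.e (Sum.inl j)) = d at h0 hT
      subst h0
      exact Submodule.mem_sup_right
        (Submodule.subset_span (Or.inl ⟨k, Q, ι, hT, rfl⟩))
    · refine ⟨k', R, hR, a, h1, h2, ?_⟩
      have h5 : bas (.mk P hP) - bas (.mk Q hQ) ∈ cupRel n := by
        have h0' := le_antisymm hle h0
        rw [heq]
        generalize P.dots (P.e (Sum.inl j)) = d at h0' hT
        subst h0'
        exact Submodule.mem_sup_right
          (Submodule.subset_span (Or.inr ⟨k, Q, ι, hQ, hT, rfl⟩))
      have := add_mem h5 h3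
      rwa [sub_add_sub_cancel] at this

end

end PreDiag

/-! ### Systems of arcs and sign sequences -/

/-- A system of disjoint arcs above the points of a line, where `p` interchanges the end points of
each arc; the fixed points of `p` are end points of vertical rays. The signs are minus at the right
end of each arc. The left end of an arc has sign plus if the arc is not accessible from the left. -/
structure IsArcSystem {n : ℕ} (p : Fin n → Fin n) (α : Seq n) : Prop where
  inv : ∀ i, p (p i) = i
  planar : ∀ a b, a < b → b < p a → a < p b ∧ p b < p a ∧ p b ≠ b
  right : ∀ i, i < p i → α (p i) = -1
  acc : ∀ a b, a < b → b < p a → b < p b → α b = 1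
  acc_ray : ∀ a b, p a = a → a < b → b < p b → α b = 1

/-- All signs at the rays are plus, except possibly at the first one. -/
def RaysAccessible {n : ℕ} (p : Fin n → Fin n) (α : Seq n) : Prop :=
  ∀ a b, p a = a → p b = b → a < b → α b = 1

/-! ### Arc systems and the bracket rule -/

section

variable {n : ℕ} {p : Fin n → Fin n} {α : Seq n}

/-- The map `p` embeds the pluses of `S` into the minuses of `S`. -/
theorem sum_nonpos_of_matched {S : Finset (Fin n)} (hp : Function.Injective p)
    (h : ∀ l ∈ S, α l = 1 → p l ∈ S ∧ α (p l) = -1) : ∑ l ∈ S, (α l : ℤ) ≤ 0 := by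
  classical
  have h1 : ∀ l, (α l : ℤ) = (if α l = 1 then 1 else 0) - (if α l = -1 then 1 else 0) := by
    intro l
    rcases units_cases (α l) with h | h <;> rw [h] <;> simp
  simp only [h1]
  rw [Finset.sum_sub_distrib, Finset.sum_boole, Finset.sum_boole, sub_nonpos, Nat.cast_le]
  refine Finset.card_le_card_of_injOn p (fun l hl => ?_) hp.injOn
  simp only [Finset.coe_filter, Set.mem_ofPred_eq] at hl ⊢
  exact h l hl.1 hl.2

theorem sum_nonneg_of_matched {S : Finset (Fin n)} (hp : Function.Injective p)
    (h : ∀ l ∈ S, α l = -1 → p l ∈ S ∧ α (p l) = 1) : 0 ≤ ∑ l ∈ S, (α l : ℤ) := by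
  have := sum_nonpos_of_matched (α := fun l => -α l) hp (S := S) fun l hl hl' => by
    obtain ⟨h1, h2⟩ := h l hl (neg_eq_iff_eq_neg.1 hl')
    exact ⟨h1, by rw [h2]⟩
  simpa using this

theorem sum_Ico_of_plusMinus {i j : Fin n} (h : PlusMinus α i j) :
    ∑ l ∈ Finset.Ico i j, (α l : ℤ) = 1 := by
  rw [← Finset.Ioo_insert_left h.1, Finset.sum_insert Finset.left_notMem_Ioo, h.2.2.2.1, h.2.1]
  rfl

/-- For `i < i'` the sum over `[i, j)` would be `1`. It is also the plus at `i`, a nonnegative sum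
up to `i'`, and the sum `1` over `[i', j)`, together at least `2`. -/
theorem PlusMinus.left_unique {i i' j : Fin n} (h : PlusMinus α i j) (h' : PlusMinus α i' j) :
    i = i' := by
  have key : ∀ {i i' : Fin n}, PlusMinus α i j → PlusMinus α i' j → ¬ i < i' := by
    intro i i' h h' hlt
    have h1 := sum_Ico_of_plusMinus h
    rw [← Finset.Ico_union_Ico_eq_Ico hlt.le h'.1.le,
      Finset.sum_union (Finset.Ico_disjoint_Ico_consecutive _ _ _), sum_Ico_of_plusMinus h',
      ← Finset.Ioo_insert_left hlt, Finset.sum_insert Finset.left_notMem_Ioo, h.2.1] at h1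
    have h2 : 0 ≤ ∑ l ∈ Finset.Ioo i i', (α l : ℤ) := by
      by_cases h3 : i.1 + 1 = i'.1
      · rw [Finset.sum_eq_zero]
        intro l hl
        rw [Finset.mem_Ioo, Fin.lt_def, Fin.lt_def] at hl
        omega
      · have h4 : i.1 < i'.1 := hlt
        have h5 := i'.2
        have h6 := h.2.2.2.2 ⟨i'.1 - 1, by omega⟩ (by rw [Fin.lt_def]; simp only; omega)
          (lt_trans (b := i') (by rw [Fin.lt_def]; simp only; omega) h'.1)
        convert h6 using 2
        ext l
        simp only [Finset.mem_Ioo, Finset.mem_Ioc, Fin.lt_def, Fin.le_def]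
        omega
    simp only [Units.val_one] at h1
    omega
  exact le_antisymm (not_lt.1 (key h' h)) (not_lt.1 (key h h'))

/-- A partner `j` of the minus at `r` would give the sum `1` over `[j, r)`. But every plus in this
interval is matched to a minus in it, so the sum is not positive. -/
theorem freeMinus_of_matched {r : Fin n} (hp : Function.Injective p) (hr : α r = -1)
    (h : ∀ l, l < r → α l = 1 → l < p l ∧ p l < r ∧ α (p l) = -1) : FreeMinus α r := by
  refine ⟨hr, fun j hj => ?_⟩
  have h1 := sum_Ico_of_plusMinus hj
  have h2 : ∑ l ∈ Finset.Ico j r, (α l : ℤ) ≤ 0 := by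
    refine sum_nonpos_of_matched hp fun l hl hl' => ?_
    rw [Finset.mem_Ico] at hl ⊢
    obtain ⟨h3, h4, h5⟩ := h l hl.2 hl'
    exact ⟨⟨hl.1.trans h3.le, h4⟩, h5⟩
  omega

namespace IsArcSystem

theorem injective (h : IsArcSystem p α) : Function.Injective p :=
  Function.LeftInverse.injective h.inv

/-- Below an arc nothing is accessible from the left, so all points there are ends of arcs `+ -`
that stay below it. -/
theorem inside (h : IsArcSystem p α) {i l : Fin n} (h1 : i < l) (h2 : l < p i) :
    i < p l ∧ p l < p i ∧ ((l < p l ∧ α l = 1 ∧ α (p l) = -1) ∨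
      (p l < l ∧ α l = -1 ∧ α (p l) = 1)) := by
  obtain ⟨h3, h4, h5⟩ := h.planar i l h1 h2
  refine ⟨h3, h4, ?_⟩
  rcases lt_or_gt_of_ne h5 with h6 | h6
  · refine Or.inr ⟨h6, ?_, h.acc i _ h3 h4 (by rwa [h.inv])⟩
    have := h.right (p l) (by rwa [h.inv])
    rwa [h.inv] at this
  · exact Or.inl ⟨h6, h.acc i l h1 h2 h6, h.right l h6⟩

/-- The points below the arc are matched in pairs `+ -`, so they are balanced. Each minus comes
after its own plus, so the partial sums are nonnegative. -/
theorem plusMinus (h : IsArcSystem p α) {i : Fin n} (hi : i < p i) (h1 : α i = 1) :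
    PlusMinus α i (p i) := by
  refine ⟨hi, h1, h.right i hi, le_antisymm ?_ ?_, fun k hk hk' => ?_⟩
  · refine sum_nonpos_of_matched h.injective fun l hl hl' => ?_
    rw [Finset.mem_Ioo] at hl ⊢
    obtain ⟨h2, h3, ⟨h4, h5, h6⟩ | ⟨h4, h5, h6⟩⟩ := h.inside hl.1 hl.2
    · exact ⟨⟨h2, h3⟩, h6⟩
    · exact absurd (hl'.symm.trans h5) one_ne_neg_one_units
  · refine sum_nonneg_of_matched h.injective fun l hl hl' => ?_
    rw [Finset.mem_Ioo] at hl ⊢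
    obtain ⟨h2, h3, ⟨h4, h5, h6⟩ | ⟨h4, h5, h6⟩⟩ := h.inside hl.1 hl.2
    · exact absurd (h5.symm.trans hl') one_ne_neg_one_units
    · exact ⟨⟨h2, h3⟩, h6⟩
  · refine sum_nonneg_of_matched h.injective fun l hl hl' => ?_
    rw [Finset.mem_Ioc] at hl ⊢
    obtain ⟨h2, h3, ⟨h4, h5, h6⟩ | ⟨h4, h5, h6⟩⟩ := h.inside hl.1 (hl.2.trans_lt hk')
    · exact absurd (h5.symm.trans hl') one_ne_neg_one_units
    · exact ⟨⟨h2, h4.le.trans hl.2⟩, h6⟩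

/-- A point of a dotted arc lies to the right of a whole arc system. -/
theorem left_of_minus (h : IsArcSystem p α) {i l : Fin n} (hi : i < p i) (h1 : α i = -1)
    (hl : l < i) : p l ≠ l ∧ p l < i := by
  have h2 : ¬ α i = 1 := fun h' => one_ne_neg_one_units (h'.symm.trans h1)
  have h3 : p l ≠ l := fun h' => h2 (h.acc_ray l i h' hl hi)
  refine ⟨h3, lt_of_not_ge fun h4 => ?_⟩
  rcases h4.lt_or_eq with h5 | h5
  · exact h2 (h.acc l i hl h5 hi)
  · rw [h5, h.inv] at hi
    exact lt_asymm hl (h5 ▸ hi)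

theorem matched_of_plus (h : IsArcSystem p α) {l : Fin n} (hl : p l ≠ l) (hl' : α l = 1) :
    l < p l ∧ α (p l) = -1 := by
  rcases lt_or_gt_of_ne hl with h6 | h6
  · have := h.right (p l) (by rwa [h.inv])
    rw [h.inv, hl'] at this
    exact absurd this one_ne_neg_one_units
  · exact ⟨h6, h.right l h6⟩

theorem freeMinus_left (h : IsArcSystem p α) {i : Fin n} (hi : i < p i) (h1 : α i = -1) :
    FreeMinus α i := by
  refine freeMinus_of_matched h.injective h1 fun l hl hl' => ?_
  obtain ⟨h2, h3⟩ := h.left_of_minus hi h1 hl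
  obtain ⟨h4, h5⟩ := h.matched_of_plus h2 hl'
  exact ⟨h4, h3, h5⟩

theorem freeMinus_right (h : IsArcSystem p α) {i : Fin n} (hi : i < p i) (h1 : α i = -1) :
    FreeMinus α (p i) := by
  refine freeMinus_of_matched h.injective (h.right i hi) fun l hl hl' => ?_
  rcases lt_trichotomy l i with h2 | rfl | h2
  · obtain ⟨h2, h3⟩ := h.left_of_minus hi h1 h2
    obtain ⟨h4, h5⟩ := h.matched_of_plus h2 hl'
    exact ⟨h4, h3.trans hi, h5⟩
  · exact absurd (hl'.symm.trans h1) one_ne_neg_one_units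
  · obtain ⟨h3, h4, h5⟩ := h.planar i l h2 hl
    obtain ⟨h6, h7⟩ := h.matched_of_plus h5 hl'
    exact ⟨h6, h4, h7⟩

theorem not_freeMinus_inside (h : IsArcSystem p α) {i l : Fin n} (h1 : i < l) (h2 : l < p i) :
    ¬ FreeMinus α l := by
  rintro ⟨h3, h4⟩
  obtain ⟨-, -, ⟨-, h5, -⟩ | ⟨h5, -, h6⟩⟩ := h.inside h1 h2
  · exact one_ne_neg_one_units (h5.symm.trans h3)
  · have := h.plusMinus (i := p l) (by rwa [h.inv]) h6
    rw [h.inv] at this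
    exact h4 _ this

theorem freeMinus_cases (h : IsArcSystem p α) {l : Fin n} (hl : FreeMinus α l) (hne : p l ≠ l) :
    FreeMinus α (p l) ∧ ((l < p l ∧ α l = -1) ∨ (p l < l ∧ α (p l) = -1)) := by
  rcases lt_or_gt_of_ne hne with h1 | h1
  · rcases units_cases (α (p l)) with h2 | h2
    · have := h.plusMinus (i := p l) (by rwa [h.inv]) h2
      rw [h.inv] at this
      exact absurd this (hl.2 _)
    · exact ⟨h.freeMinus_left (by rwa [h.inv]) h2, Or.inr ⟨h1, h2⟩⟩
  · exact ⟨h.freeMinus_right h1 hl.1, Or.inl ⟨h1, hl.1⟩⟩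

/-- The involution `p` acts without fixed points on the free minuses to the left of a dotted arc:
the arcs there are complete, and the partner of a free minus is again free. Parity is read off from
the product of signs `-1` over this set. -/
theorem even_freeMinus (h : IsArcSystem p α) {i : Fin n} (hi : i < p i) (h1 : α i = -1) :
    Even (Nat.card {l : Fin n // l < i ∧ FreeMinus α l}) := by
  classical
  rw [Nat.card_eq_fintype_card, Fintype.card_subtype]
  have := Finset.prod_involution (s := Finset.univ.filter fun l => l < i ∧ FreeMinus α l)
    (f := fun _ => (-1 : ℤˣ)) (fun l _ => p l) (fun l _ => by simp)
    (fun l hl _ => (h.left_of_minus hi h1 (Finset.mem_filter.1 hl).2.1).1)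
    (fun l hl => ?_) (fun l _ => h.inv l)
  · rw [Finset.prod_const] at this
    by_contra hodd
    rw [Nat.not_even_iff_odd] at hodd
    rw [hodd.neg_one_pow] at this
    exact one_ne_neg_one_units this.symm
  · obtain ⟨-, h2, h3⟩ := Finset.mem_filter.1 hl
    obtain ⟨h4, h5⟩ := h.left_of_minus hi h1 h2
    exact Finset.mem_filter.2 ⟨Finset.mem_univ _, h5, (h.freeMinus_cases h3 h4).1⟩

theorem minusMinus (h : IsArcSystem p α) {i : Fin n} (hi : i < p i) (h1 : α i = -1) :
    MinusMinus α i (p i) :=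
  ⟨hi, h.freeMinus_left hi h1, h.freeMinus_right hi h1, fun _ h2 h3 => h.not_freeMinus_inside h2 h3,
    h.even_freeMinus hi h1⟩

theorem plusMinus_or_minusMinus (h : IsArcSystem p α) {i : Fin n} (hi : i < p i) :
    PlusMinus α i (p i) ∨ MinusMinus α i (p i) :=
  (units_cases (α i)).imp (h.plusMinus hi) (h.minusMinus hi)

theorem ray_not_enclosed (h : IsArcSystem p α) {a b : Fin n} (ha : p a = a) (hab : b < a) :
    p b < a := by
  refine lt_of_not_ge fun h1 => ?_
  rcases h1.lt_or_eq with h2 | h2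
  · exact (h.planar b a hab h2).2.2 ha
  · rw [h2, h.inv] at ha
    exact absurd (ha.trans h2.symm) hab.ne

/-- The minus at `j` is not free, and this leaves only one place for `p j`. If `j` were a ray or the
left end of an arc, or the right end of an arc with two minuses, then `j` would be free. So it ends
an arc `+ -`, whose left end is `i` by `PlusMinus.left_unique`. -/
theorem eq_of_plusMinus (h : IsArcSystem p α) (hr : RaysAccessible p α) {i j : Fin n}
    (hij : PlusMinus α i j) : p i = j := by
  have hj : ¬ FreeMinus α j := fun hf => hf.2 i hij
  have h1 := hij.2.2.1
  rcases lt_trichotomy (p j) j with h2 | h2 | h2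
  · have h3 : p j < p (p j) := by rwa [h.inv]
    rcases units_cases (α (p j)) with h4 | h4
    · have := h.plusMinus h3 h4
      rw [h.inv] at this
      rw [hij.left_unique this, h.inv]
    · have := h.freeMinus_right h3 h4
      rw [h.inv] at this
      exact absurd this hj
  · refine absurd (freeMinus_of_matched h.injective h1 fun l hl hl' => ?_) hj
    have h3 : p l ≠ l := fun h' => one_ne_neg_one_units ((hr l j h' h2 hl).symm.trans h1)
    obtain ⟨h4, h5⟩ := h.matched_of_plus h3 hl'
    exact ⟨h4, h.ray_not_enclosed h2 hl, h5⟩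
  · exact absurd (h.freeMinus_left h2 h1) hj

/-- A ray at `i` would force a plus at `j` or at the left end of its arc. If `i` were the right end
of an arc, an odd number of free minuses would precede it. So `i` is a left end, and its partner is
the next free minus, as there is none below the arc. -/
theorem eq_of_minusMinus (h : IsArcSystem p α) (hr : RaysAccessible p α) {i j : Fin n}
    (hij : MinusMinus α i j) : p i = j := by
  obtain ⟨h1, h2, h3, h4, h5⟩ := hij
  by_cases h6 : p i = i
  · exfalso
    by_cases h7 : p j = j
    · exact one_ne_neg_one_units ((hr i j h6 h7 h1).symm.trans h3.1)
    · obtain ⟨-, ⟨h8, h9⟩ | ⟨h8, h9⟩⟩ := h.freeMinus_cases h3 h7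
      · exact one_ne_neg_one_units ((h.acc_ray i j h6 h1 h8).symm.trans h9)
      · rcases lt_trichotomy (p j) i with h10 | h10 | h10
        · have := h.ray_not_enclosed h6 h10
          rw [h.inv] at this
          exact lt_asymm this h1
        · rw [← h10, h.inv] at h6
          exact h7 h6.symm
        · exact one_ne_neg_one_units
            ((h.acc_ray i (p j) h6 h10 (by rwa [h.inv])).symm.trans h9)
  · obtain ⟨h7, ⟨h8, h9⟩ | ⟨h8, h9⟩⟩ := h.freeMinus_cases h2 h6
    · rcases lt_trichotomy (p i) j with h10 | h10 | h10
      · exact absurd h7 (h4 _ h8 h10)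
      · exact h10
      · exact absurd h3 (h.not_freeMinus_inside h1 h10)
    · exfalso
      have h10 : p i < p (p i) := by rwa [h.inv]
      have h11 := h.even_freeMinus h10 h9
      classical
      rw [Nat.card_eq_fintype_card, Fintype.card_subtype] at h5 h11
      have h12 : (Finset.univ.filter fun l => l < i ∧ FreeMinus α l) =
          insert (p i) (Finset.univ.filter fun l => l < p i ∧ FreeMinus α l) := by
        ext l
        simp only [Finset.mem_filter, Finset.mem_univ, true_and, Finset.mem_insert]
        constructor
        · rintro ⟨h13, h14⟩
          rcases lt_trichotomy l (p i) with h15 | h15 | h15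
          · exact Or.inr ⟨h15, h14⟩
          · exact Or.inl h15
          · exact absurd h14 (h.not_freeMinus_inside h15 (by rwa [h.inv]))
        · rintro (rfl | ⟨h13, h14⟩)
          · exact ⟨h8, h7⟩
          · exact ⟨h13.trans h8, h14⟩
      rw [h12, Finset.card_insert_of_notMem (by simp), Nat.even_add_one] at h5
      exact h5 h11

/-- A further arc system for the same signs has only arcs that belong to the first one, if the
latter has at most one ray with a minus. -/
theorem eq_of_ne {p' : Fin n → Fin n} (h : IsArcSystem p α) (hr : RaysAccessible p α)
    (h' : IsArcSystem p' α) {i : Fin n} (hi : p' i ≠ i) : p i = p' i := by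
  have key : ∀ i, i < p' i → p i = p' i := fun i hi =>
    (h'.plusMinus_or_minusMinus hi).elim (h.eq_of_plusMinus hr) (h.eq_of_minusMinus hr)
  rcases lt_or_gt_of_ne hi with h1 | h1
  · have := key (p' i) (by rwa [h'.inv])
    rw [h'.inv] at this
    rw [← this, h.inv, this]
  · exact key i h1

end IsArcSystem

end

namespace PreDiag

/-! ### The arcs at the top and at the bottom of a tangle -/

/-- The point `y` lies between `x` and `z` on the boundary of the rectangle. -/
def Between {m n : ℕ} (x y z : Fin m ⊕ Fin n) : Prop :=
  (pos x < pos y ∧ pos y < pos z) ∨ (pos z < pos y ∧ pos y < pos x)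

/-- `f` parametrizes one of the two faces from left to right. -/
structure IsFace {m n N : ℕ} (f : Fin N → Fin m ⊕ Fin n) : Prop where
  inj : Function.Injective f
  between : ∀ a b c, Between (f a) (f b) (f c) ↔ (a < b ∧ b < c) ∨ (c < b ∧ b < a)
  convex : ∀ a c x, Between (f a) x (f c) → ∃ b, f b = x
  other : ∀ a b x, a < b → (∀ c, f c ≠ x) → Between (f a) (f b) x

theorem isFace_top {m n : ℕ} : IsFace (Sum.inr : Fin n → Fin m ⊕ Fin n) where
  inj := Sum.inr_injective
  between a b c := by simp only [Between, pos_inr, Fin.lt_def]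
  convex a c x h := by
    rcases x with x | x
    · have := a.2
      have := c.2
      simp only [Between, pos_inr, pos_inl] at h
      omega
    · exact ⟨x, rfl⟩
  other a b x h hx := by
    rcases x with x | x
    · have := b.2
      rw [Fin.lt_def] at h
      simp only [Between, pos_inr, pos_inl]
      omega
    · exact absurd rfl (hx x)

/-- Along the bottom face `pos` runs from right to left, whereas the face is parametrized from left
to right. As `Between` is symmetric in its ends, top and bottom can be treated together. -/
theorem isFace_bot {m n : ℕ} : IsFace (Sum.inl : Fin m → Fin m ⊕ Fin n) where
  inj := Sum.inl_injective
  between a b c := by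
    have := a.2
    have := b.2
    have := c.2
    simp only [Between, pos_inl, Fin.lt_def]
    omega
  convex a c x h := by
    rcases x with x | x
    · exact ⟨x, rfl⟩
    · have := x.2
      simp only [Between, pos_inr, pos_inl] at h
      omega
  other a b x h hx := by
    rcases x with x | x
    · exact absurd rfl (hx x)
    · have := b.2
      have := x.2
      rw [Fin.lt_def] at h
      simp only [Between, pos_inr, pos_inl]
      omega

/-! ### The arcs on one face -/

section

variable {m n N : ℕ} {P : PreDiag m n} {f : Fin N → Fin m ⊕ Fin n}

theorem IsTangle.between (hP : P.IsTangle) {a b c d : Fin m ⊕ Fin n} (hac : P.e a = P.e c)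
    (hb : Between a b c) (hbd : P.e b = P.e d) : Between a d c ∧ P.e b ≠ P.e a := by
  have hne : P.e b ≠ P.e a := by
    intro h
    have hac' : a ≠ c := by
      rintro rfl
      rcases hb with hb | hb <;> omega
    rcases hP.eq_or_eq hac' hac h with rfl | rfl
    · rcases hb with hb | hb <;> omega
    · rcases hb with hb | hb <;> omega
  refine ⟨?_, hne⟩
  have key : ∀ {a b c d : Fin m ⊕ Fin n}, P.e a = P.e c → P.e b = P.e d → P.e b ≠ P.e a →
      pos a < pos b → pos b < pos c → pos a < pos d ∧ pos d < pos c := by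
    intro a b c d hac hbd hne h1 h2
    have h3 : pos d ≠ pos a := fun h => hne (by rw [hbd, pos_injective h])
    have h4 : pos d ≠ pos c := fun h => hne (by rw [hbd, pos_injective h, hac])
    refine ⟨lt_of_le_of_ne (not_lt.1 fun h5 => ?_) h3.symm,
      lt_of_le_of_ne (not_lt.1 fun h5 => ?_) h4⟩
    · exact hne (hbd.trans (hP.planar d a b c h5 h1 h2 hbd.symm hac))
    · exact hne (hP.planar a b c d h1 h2 h5 hac hbd).symm
  rcases hb with hb | hb
  · exact Or.inl (key hac hbd hne hb.1 hb.2)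
  · exact Or.inr (key hac.symm hbd (hac ▸ hne) hb.1 hb.2)

theorem IsTangle.dsign_of_between (hP : P.IsTangle) {a b c : Fin m ⊕ Fin n} (hac : P.e a = P.e c)
    (hb : Between a b c) : P.dsign (P.e b) = 1 := by
  rcases hb with hb | hb
  · exact dsign_eq_one_of_enclosed hP hac hb.1 hb.2
  · exact dsign_eq_one_of_enclosed hP hac.symm hb.1 hb.2

open scoped Classical in
/-- The other end point of a line with both end points on the face `f`, and the same point for the
other lines. -/
def mate (P : PreDiag m n) (f : Fin N → Fin m ⊕ Fin n) (i : Fin N) : Fin N :=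
  if h : ∃ j, j ≠ i ∧ P.e (f j) = P.e (f i) then h.choose else i

theorem e_mate (i : Fin N) : P.e (f (P.mate f i)) = P.e (f i) := by
  rw [mate]
  split_ifs with h
  · exact h.choose_spec.2
  · rfl

theorem IsTangle.mate_eq (hP : P.IsTangle) (hf : Function.Injective f) {i j : Fin N} (hij : j ≠ i)
    (h : P.e (f j) = P.e (f i)) : P.mate f i = j := by
  have hex : ∃ j, j ≠ i ∧ P.e (f j) = P.e (f i) := ⟨j, hij, h⟩
  rw [mate, dif_pos hex]
  obtain ⟨h1, h2⟩ := hex.choose_spec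
  exact hf ((hP.eq_or_eq (fun h => hij (hf h)) h (h2.trans h.symm)).resolve_right
    fun h => h1 (hf h))

theorem mate_eq_self_iff {i : Fin N} :
    P.mate f i = i ↔ ∀ j, P.e (f j) = P.e (f i) → j = i := by
  rw [mate]
  split_ifs with h
  · refine ⟨fun h' => absurd h' h.choose_spec.1, fun h' => h' _ h.choose_spec.2⟩
  · push Not at h
    refine ⟨fun _ j hj => ?_, fun _ => rfl⟩
    by_contra hne
    exact h j hne hj

theorem IsTangle.e_eq_iff (hP : P.IsTangle) (hf : Function.Injective f) {i j : Fin N} :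
    P.e (f i) = P.e (f j) ↔ i = j ∨ P.mate f i = j := by
  constructor
  · intro h
    by_cases hij : i = j
    · exact Or.inl hij
    · exact Or.inr (hP.mate_eq hf (Ne.symm hij) h.symm)
  · rintro (rfl | rfl)
    · rfl
    · exact (e_mate _).symm

theorem IsTangle.mate_mate (hP : P.IsTangle) (hf : Function.Injective f) (i : Fin N) :
    P.mate f (P.mate f i) = i := by
  by_cases h : P.mate f i = i
  · rw [h, h]
  · exact hP.mate_eq hf (Ne.symm h) (e_mate _).symm

theorem IsTangle.exists_other (hP : P.IsTangle) {i : Fin N} (hi : P.mate f i = i) :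
    ∃ x, (∀ c, f c ≠ x) ∧ P.e (f i) = P.e x := by
  obtain ⟨x, hx, hx'⟩ := hP.exists_partner (f i)
  refine ⟨x, ?_, hx'.symm⟩
  rintro c rfl
  exact hx (congrArg f (mate_eq_self_iff.1 hi c hx'))

/-- The signs at the end points of a line with both end points on the face `f` have degree zero. -/
def DegZero (P : PreDiag m n) (f : Fin N → Fin m ⊕ Fin n) (γ : Seq N) : Prop :=
  ∀ i j, i < j → P.e (f i) = P.e (f j) → P.dsign (P.e (f i)) = γ i ∧ γ j = -1

/-- In degree zero the left end of an arc has the dot sign of the arc. A line below an arc or to the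
right of a ray is not accessible, hence undotted, and so its left end has a plus. -/
theorem IsTangle.isArcSystem (hP : P.IsTangle) (hf : IsFace f) {γ : Seq N} (h : P.DegZero f γ) :
    IsArcSystem (P.mate f) γ where
  inv := hP.mate_mate hf.inj
  planar a b h1 h2 := by
    have h3 := hP.between (e_mate (f := f) a).symm
      ((hf.between _ _ _).2 (Or.inl ⟨h1, h2⟩)) (e_mate (f := f) b).symm
    have h4 := (hf.between _ _ _).1 h3.1
    have h5 : a < P.mate f b ∧ P.mate f b < P.mate f a := by
      rcases h4 with h4 | h4
      · exact h4
      · exact absurd (h4.1.trans h4.2) (lt_asymm (h1.trans h2))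
    refine ⟨h5.1, h5.2, fun h6 => ?_⟩
    obtain ⟨x, hx, hx'⟩ := hP.exists_other h6
    obtain ⟨c, hc⟩ := hf.convex _ _ _ (hP.between (e_mate (f := f) a).symm
      ((hf.between _ _ _).2 (Or.inl ⟨h1, h2⟩)) hx').1
    exact hx c hc
  right i hi := (h i _ hi (e_mate _).symm).2
  acc a b h1 h2 h3 := by
    rw [← (h b _ h3 (e_mate _).symm).1]
    exact hP.dsign_of_between (e_mate (f := f) a).symm ((hf.between _ _ _).2 (Or.inl ⟨h1, h2⟩))
  acc_ray a b h1 h2 h3 := by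
    rw [← (h b _ h3 (e_mate _).symm).1]
    obtain ⟨x, hx, hx'⟩ := hP.exists_other h1
    exact hP.dsign_of_between hx' (hf.other a b x h2 hx)

theorem IsTangle.dsign_ray (hP : P.IsTangle) (hf : IsFace f) {a b : Fin N} (ha : P.mate f a = a)
    (hab : a < b) : P.dsign (P.e (f b)) = 1 := by
  obtain ⟨x, hx, hx'⟩ := hP.exists_other ha
  exact hP.dsign_of_between hx' (hf.other a b x hab hx)

theorem IsTangle.mate_top_eq_self_iff (hP : P.IsTangle) {i : Fin n} :
    P.mate Sum.inr i = i ↔ ∃ j, P.e (Sum.inl j) = P.e (Sum.inr i) := by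
  constructor
  · intro h
    obtain ⟨j | i', h1, h2⟩ := hP.exists_other h
    · exact ⟨j, h2.symm⟩
    · exact absurd rfl (h1 i')
  · rintro ⟨j, hj⟩
    by_contra hne
    rcases hP.eq_or_eq (fun h => hne (Sum.inr_injective h)) (e_mate i) (hj.trans (e_mate i).symm)
      with h | h <;> cases h

theorem IsTangle.mate_bot_eq_self_iff (hP : P.IsTangle) {j : Fin m} :
    P.mate Sum.inl j = j ↔ ∃ i, P.e (Sum.inl j) = P.e (Sum.inr i) := by
  constructor
  · intro h
    obtain ⟨j' | i, h1, h2⟩ := hP.exists_other h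
    · exact absurd rfl (h1 j')
    · exact ⟨i, h2⟩
  · rintro ⟨i, hi⟩
    by_contra hne
    rcases hP.eq_or_eq (fun h => hne (Sum.inl_injective h)) (e_mate j)
      (hi.symm.trans (e_mate j).symm) with h | h <;> cases h

/-- Edges in the wrong order would cross. -/
theorem IsTangle.edge_lt (hP : P.IsTangle) {i i' : Fin n} {j j' : Fin m}
    (h : P.e (Sum.inl j) = P.e (Sum.inr i)) (h' : P.e (Sum.inl j') = P.e (Sum.inr i'))
    (hi : i < i') : j < j' := by
  rw [Fin.lt_def] at hi ⊢
  have h1 := j.2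
  have h2 := j'.2
  have h3 := i'.2
  have hne : P.e (Sum.inr i) ≠ P.e (Sum.inr i') := by
    intro h4
    rcases hP.eq_or_eq (fun h => hi.ne (congrArg Fin.val (Sum.inr_injective h))) h4 h with h | h <;>
      cases h
  by_contra hj
  rcases Nat.lt_or_ge j'.1 j.1 with h4 | h4
  · refine hne (hP.planar (Sum.inr i) (Sum.inr i') (Sum.inl j) (Sum.inl j') ?_ ?_ ?_ h.symm h'.symm)
    · exact hi
    · rw [pos_inl, pos_inr]; omega
    · rw [pos_inl, pos_inl]; omega
  · have : j = j' := Fin.ext (by omega)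
    subst this
    exact hne (h.symm.trans h')

/-- The bijection between the rays at the bottom and at the top that is given by the edges. -/
def IsTangle.edgeIso (hP : P.IsTangle) :
    {i : Fin n // P.mate Sum.inr i = i} ≃o {j : Fin m // P.mate Sum.inl j = j} := by
  have h1 : ∀ i : {i : Fin n // P.mate Sum.inr i = i}, ∃ j, P.e (Sum.inl j) = P.e (Sum.inr i.1) :=
    fun i => hP.mate_top_eq_self_iff.1 i.2
  have h2 : ∀ j : {j : Fin m // P.mate Sum.inl j = j}, ∃ i, P.e (Sum.inl j.1) = P.e (Sum.inr i) :=
    fun j => hP.mate_bot_eq_self_iff.1 j.2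
  refine StrictMono.orderIsoOfRightInverse
    (fun i => ⟨(h1 i).choose, hP.mate_bot_eq_self_iff.2 ⟨_, (h1 i).choose_spec⟩⟩)
    (fun i i' hii => hP.edge_lt (h1 i).choose_spec (h1 i').choose_spec hii)
    (fun j => ⟨(h2 j).choose, hP.mate_top_eq_self_iff.2 ⟨_, (h2 j).choose_spec⟩⟩) fun j => ?_
  refine Subtype.ext ?_
  have h3 := (h1 ⟨(h2 j).choose, hP.mate_top_eq_self_iff.2 ⟨_, (h2 j).choose_spec⟩⟩).choose_spec
  have h4 := h3.trans (h2 j).choose_spec.symm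
  exact mate_eq_self_iff.1 j.2 _ h4

theorem IsTangle.e_edgeIso (hP : P.IsTangle) (i : {i : Fin n // P.mate Sum.inr i = i}) :
    P.e (Sum.inl (hP.edgeIso i).1) = P.e (Sum.inr i.1) :=
  (hP.mate_top_eq_self_iff.1 i.2).choose_spec

/-- The lines of a tangle are determined by the arcs at the top and at the bottom. -/
theorem IsTangle.e_iff_of_mate_eq {Q : PreDiag m n} (hP : P.IsTangle) (hQ : Q.IsTangle)
    (ht : P.mate Sum.inr = Q.mate Sum.inr) (hb : P.mate Sum.inl = Q.mate Sum.inl)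
    (x y : Fin m ⊕ Fin n) : P.e x = P.e y ↔ Q.e x = Q.e y := by
  have key : ∀ {P Q : PreDiag m n} (hP : P.IsTangle) (hQ : Q.IsTangle),
      P.mate Sum.inr = Q.mate Sum.inr → P.mate Sum.inl = Q.mate Sum.inl → ∀ j i,
      P.e (Sum.inl j) = P.e (Sum.inr i) → Q.e (Sum.inl j) = Q.e (Sum.inr i) := by
    intro P Q hP hQ ht hb j i h
    have hi : P.mate Sum.inr i = i := hP.mate_top_eq_self_iff.2 ⟨j, h⟩
    have hi' : Q.mate Sum.inr i = i := ht ▸ hi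
    have h1 : (hP.edgeIso ⟨i, hi⟩).1 = j := by
      have h2 := hP.e_edgeIso ⟨i, hi⟩
      exact (mate_eq_self_iff.1 (hP.edgeIso ⟨i, hi⟩).2 j (h.trans h2.symm)).symm
    -- Between two finite linear orders there is at most one order isomorphism, so the rays at both
    -- faces determine the edges.
    have h3 : ∀ (p : Fin n → Fin n) (r : Fin m → Fin m)
        (φ ψ : {i : Fin n // p i = i} ≃o {j : Fin m // r j = j}), φ = ψ := by
      intro p r φ ψ
      exact Subsingleton.elim _ _
    have h4 : (hQ.edgeIso ⟨i, hi'⟩).1 = j := by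
      rw [← h1]
      have hφ : ∀ (p p' : Fin n → Fin n) (r r' : Fin m → Fin m) (_ : p = p') (_ : r = r')
          (φ : {i : Fin n // p i = i} ≃o {j : Fin m // r j = j})
          (ψ : {i : Fin n // p' i = i} ≃o {j : Fin m // r' j = j}) (i : Fin n) (h : p i = i)
          (h' : p' i = i), (φ ⟨i, h⟩).1 = (ψ ⟨i, h'⟩).1 := by
        rintro p _ r _ rfl rfl φ ψ i h h'
        rw [h3 p r φ ψ]
      exact hφ _ _ _ _ ht.symm hb.symm _ _ i hi' hi
    rw [← h4]
    exact hQ.e_edgeIso ⟨i, hi'⟩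
  rcases x with x | x <;> rcases y with y | y
  · rw [hP.e_eq_iff Sum.inl_injective, hQ.e_eq_iff Sum.inl_injective, hb]
  · exact ⟨key hP hQ ht hb x y, key hQ hP ht.symm hb.symm x y⟩
  · rw [eq_comm, eq_comm (a := Q.e _)]
    exact ⟨key hP hQ ht hb y x, key hQ hP ht.symm hb.symm y x⟩
  · rw [hP.e_eq_iff Sum.inr_injective, hQ.e_eq_iff Sum.inr_injective, ht]

end

end PreDiag

/-! ### Monomials -/

/-- `x` is zero or a power of `q`. -/
def IsMonomial (x : L) : Prop := x = 0 ∨ ∃ d : ℕ, x = q ^ d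

theorem q_pow_injective : Function.Injective fun d : ℕ => q ^ d := by
  intro d d' h
  simp only [LaurentPolynomial.T_pow, mul_one] at h
  have := congrArg (fun x : L => x.coeff d) h
  by_contra hne
  rw [LaurentPolynomial.T_apply, LaurentPolynomial.T_apply, if_pos rfl,
    if_neg fun h => hne (by exact_mod_cast h.symm)] at this
  exact one_ne_zero this

theorem isMonomial_one : IsMonomial 1 := Or.inr ⟨0, (pow_zero q).symm⟩

theorem IsMonomial.mul {x y : L} (hx : IsMonomial x) (hy : IsMonomial y) : IsMonomial (x * y) := by
  rcases hx with rfl | ⟨d, rfl⟩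
  · exact Or.inl (zero_mul y)
  rcases hy with rfl | ⟨d', rfl⟩
  · exact Or.inl (mul_zero _)
  · exact Or.inr ⟨d + d', (pow_add q d d').symm⟩

/-- The exponents are natural numbers, so they can only add up to zero if both vanish. This is how a
weight `1` is detected on each line separately. -/
theorem IsMonomial.mul_eq_one {x y : L} (hx : IsMonomial x) (hy : IsMonomial y) (h : x * y = 1) :
    x = 1 ∧ y = 1 := by
  rcases hx with rfl | ⟨d, rfl⟩
  · rw [zero_mul] at h
    exact absurd h zero_ne_one
  rcases hy with rfl | ⟨d', rfl⟩
  · rw [mul_zero] at h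
    exact absurd h zero_ne_one
  · rw [← pow_add] at h
    have := q_pow_injective (a₁ := d + d') (a₂ := 0) (h.trans (pow_zero q).symm)
    rw [show d = 0 by omega, show d' = 0 by omega, pow_zero]
    exact ⟨rfl, rfl⟩

theorem isMonomial_prod {X : Type*} {S : Finset X} {g : X → L} (h : ∀ c ∈ S, IsMonomial (g c)) :
    IsMonomial (∏ c ∈ S, g c) ∧ (∏ c ∈ S, g c = 1 → ∀ c ∈ S, g c = 1) := by
  classical
  induction S using Finset.induction_on with
  | empty => exact ⟨by rw [Finset.prod_empty]; exact isMonomial_one, fun _ c hc => by simp at hc⟩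
  | insert a S ha ih =>
    obtain ⟨h1, h2⟩ := ih fun c hc => h c (Finset.mem_insert_of_mem hc)
    rw [Finset.prod_insert ha]
    have h3 := h a (Finset.mem_insert_self a S)
    refine ⟨h3.mul h1, fun h4 c hc => ?_⟩
    obtain ⟨h5, h6⟩ := h3.mul_eq_one h1 h4
    rcases Finset.mem_insert.1 hc with rfl | hc
    · exact h5
    · exact h2 h6 c hc

theorem isMonomial_cupW (s t : ℤˣ) : IsMonomial (cupW s t) := by
  unfold cupW
  split_ifs
  · exact Or.inl rfl
  · exact isMonomial_one
  · exact Or.inr ⟨1, (pow_one q).symm⟩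

theorem isMonomial_edgeW (s t : ℤˣ) : IsMonomial (edgeW s t) := by
  unfold edgeW
  split_ifs
  · exact isMonomial_one
  · exact Or.inl rfl

theorem cupW_eq_one_iff {s t : ℤˣ} : cupW s t = 1 ↔ s = 1 ∧ t = -1 := by
  have h : q ≠ 1 := fun h => one_ne_zero (q_pow_injective (a₁ := 1) (a₂ := 0) (by simpa using h))
  rcases units_cases s with rfl | rfl <;> rcases units_cases t with rfl | rfl <;>
    simp [cupW_pp, cupW_mm, cupW_pm, cupW_mp, h]

theorem edgeW_eq_one_iff {s t : ℤˣ} : edgeW s t = 1 ↔ s = t := by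
  unfold edgeW
  split_ifs with h <;> simp [h]

theorem ne_of_cupW_ne_zero {s t : ℤˣ} (h : cupW s t ≠ 0) : s ≠ t := fun h' => h (if_pos h')

theorem ne_of_capW_ne_zero {s t : ℤˣ} (h : capW s t ≠ 0) : s ≠ t := fun h' => h (if_pos h')

theorem eq_of_edgeW_ne_zero {s t : ℤˣ} (h : edgeW s t ≠ 0) : s = t := by
  by_contra h'
  exact h (if_neg h')

/-- This explains the normalization by `q ^ P.caps`: with one factor `q` per cap, caps have the
weights of cups and no negative powers remain. -/
theorem q_mul_capW (s t : ℤˣ) : q * capW s t = cupW s t := by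
  have h : q * qi = 1 := by rw [mul_comm]; exact qi_mul_q
  unfold capW cupW
  split_ifs <;> simp [h]

theorem mul_eq_neg_of_ne {δ s t : ℤˣ} (h : δ * s ≠ t) : s * t = -δ := by
  rcases units_cases δ with rfl | rfl <;> rcases units_cases s with rfl | rfl <;>
    rcases units_cases t with rfl | rfl <;> simp at h ⊢

namespace PreDiag

section

variable {m n N : ℕ} {P : PreDiag m n} {l : Fin m ⊕ Fin n → ℤˣ}

theorem IsTangle.compW_top (hP : P.IsTangle) (l : Fin m ⊕ Fin n → ℤˣ) {i i' : Fin n} (h : i < i')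
    (he : P.e (Sum.inr i) = P.e (Sum.inr i')) : P.compW l (P.e (Sum.inr i)) =
      cupW (P.dsign (P.e (Sum.inr i)) * l (Sum.inr i)) (l (Sum.inr i')) := by
  rw [hP.compW_line l (u := Sum.inr i) (v := Sum.inr i') h rfl he.symm]
  rfl

theorem IsTangle.compW_bot (hP : P.IsTangle) (l : Fin m ⊕ Fin n → ℤˣ) {j j' : Fin m} (h : j < j')
    (he : P.e (Sum.inl j) = P.e (Sum.inl j')) : P.compW l (P.e (Sum.inl j)) =
      capW (P.dsign (P.e (Sum.inl j)) * l (Sum.inl j)) (l (Sum.inl j')) := by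
  rw [hP.compW_line l (u := Sum.inl j') (v := Sum.inl j) ?_ he.symm rfl]
  · rfl
  · have := j'.2
    rw [Fin.lt_def] at h
    rw [pos_inl, pos_inl]
    omega

theorem IsTangle.compW_edge (hP : P.IsTangle) (l : Fin m ⊕ Fin n → ℤˣ) {i : Fin n} {j : Fin m}
    (he : P.e (Sum.inl j) = P.e (Sum.inr i)) : P.compW l (P.e (Sum.inr i)) =
      edgeW (P.dsign (P.e (Sum.inr i)) * l (Sum.inr i)) (l (Sum.inl j)) := by
  rw [hP.compW_line l (u := Sum.inr i) (v := Sum.inl j) ?_ rfl he]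
  · rfl
  · have := i.2
    rw [pos_inl, pos_inr]
    omega

/-- The lines of a tangle are cups, caps and edges. -/
theorem IsTangle.line_cases (hP : P.IsTangle) (x : Fin m ⊕ Fin n) :
    (∃ i i', i < i' ∧ P.e (Sum.inr i) = P.e x ∧ P.e (Sum.inr i') = P.e x) ∨
    (∃ j j', j < j' ∧ P.e (Sum.inl j) = P.e x ∧ P.e (Sum.inl j') = P.e x) ∨
    (∃ j i, P.e (Sum.inl j) = P.e x ∧ P.e (Sum.inr i) = P.e x) := by
  obtain ⟨y, hy, hy'⟩ := hP.exists_partner x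
  rcases x with x | x <;> rcases y with y | y
  · refine Or.inr (Or.inl ?_)
    rcases lt_or_gt_of_ne (fun h => hy (congrArg _ h) : y ≠ x) with h | h
    · exact ⟨y, x, h, hy', rfl⟩
    · exact ⟨x, y, h, rfl, hy'⟩
  · exact Or.inr (Or.inr ⟨x, y, rfl, hy'⟩)
  · exact Or.inr (Or.inr ⟨y, x, hy', rfl⟩)
  · refine Or.inl ?_
    rcases lt_or_gt_of_ne (fun h => hy (congrArg _ h) : y ≠ x) with h | h
    · exact ⟨y, x, h, hy', rfl⟩
    · exact ⟨x, y, h, rfl, hy'⟩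

theorem IsTangle.not_isCap_top (hP : P.IsTangle) (i : Fin n) : ¬ P.IsCap (P.e (Sum.inr i)) := by
  rintro ⟨j, j', hne, h1, h2⟩
  rcases hP.eq_or_eq (fun h => hne (Sum.inl_injective h)) (h1.trans h2.symm) h1.symm with h | h <;>
    cases h

theorem compW_ne_zero (h : P.weight l ≠ 0) (c : P.Comp) : P.compW l c ≠ 0 := by
  have := P.finite
  let _ := Fintype.ofFinite P.Comp
  rw [weight_eq_prod] at h
  exact Finset.prod_ne_zero_iff.1 h c (Finset.mem_univ c)

theorem IsTangle.top_of_weight_ne_zero (hP : P.IsTangle) (h : P.weight l ≠ 0) {i i' : Fin n}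
    (hi : i < i') (he : P.e (Sum.inr i) = P.e (Sum.inr i')) :
    l (Sum.inr i) * l (Sum.inr i') = -P.dsign (P.e (Sum.inr i)) :=
  mul_eq_neg_of_ne (ne_of_cupW_ne_zero (hP.compW_top l hi he ▸ compW_ne_zero h _))

theorem IsTangle.bot_of_weight_ne_zero (hP : P.IsTangle) (h : P.weight l ≠ 0) {j j' : Fin m}
    (hj : j < j') (he : P.e (Sum.inl j) = P.e (Sum.inl j')) :
    l (Sum.inl j) * l (Sum.inl j') = -P.dsign (P.e (Sum.inl j)) :=
  mul_eq_neg_of_ne (ne_of_capW_ne_zero (hP.compW_bot l hj he ▸ compW_ne_zero h _))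

theorem IsTangle.edge_of_weight_ne_zero (hP : P.IsTangle) (h : P.weight l ≠ 0) {i : Fin n}
    {j : Fin m} (he : P.e (Sum.inl j) = P.e (Sum.inr i)) :
    P.dsign (P.e (Sum.inr i)) * l (Sum.inr i) = l (Sum.inl j) :=
  eq_of_edgeW_ne_zero (hP.compW_edge l he ▸ compW_ne_zero h _)

/-- The number of caps. -/
def caps (P : PreDiag m n) : ℕ := Nat.card {c // P.IsCap c}

/-- The signs at the end points of all lines have degree zero. -/
structure AllDegZero (P : PreDiag m n) (α : Seq m) (β : Seq n) : Prop where
  top : P.DegZero Sum.inr β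
  bot : P.DegZero Sum.inl α
  edge : ∀ j i, P.e (Sum.inl j) = P.e (Sum.inr i) → P.dsign (P.e (Sum.inr i)) * β i = α j

theorem dsign_mul_eq_one_iff {δ s : ℤˣ} : δ * s = 1 ↔ δ = s := by
  rcases units_cases δ with rfl | rfl <;> rcases units_cases s with rfl | rfl <;> simp

/-- Up to a factor `q ^ P.caps`, the weight is zero or a power of `q`. -/
theorem IsTangle.weight_isMonomial (hP : P.IsTangle) (hr : P.IsReduced) (α : Seq m) (β : Seq n) :
    IsMonomial (q ^ P.caps * P.weight (Sum.elim α β)) ∧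
      (q ^ P.caps * P.weight (Sum.elim α β) = 1 ↔ P.AllDegZero α β) := by
  classical
  have := P.finite
  let _ := Fintype.ofFinite P.Comp
  set l : Fin m ⊕ Fin n → ℤˣ := Sum.elim α β with hl
  -- Each cap takes one of the factors `q`; then all factors of the product are weights of cups or
  -- of edges.
  let g : P.Comp → L := fun c => (if P.IsCap c then q else 1) * P.compW l c
  have hg : q ^ P.caps * P.weight l = ∏ c, g c := by
    rw [weight_eq_prod, Finset.prod_mul_distrib, Finset.prod_ite, Finset.prod_const,
      Finset.prod_const_one, mul_one, caps, Nat.card_eq_fintype_card, Fintype.card_subtype]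
  have htop : ∀ i i', i < i' → P.e (Sum.inr i) = P.e (Sum.inr i') → g (P.e (Sum.inr i)) =
      cupW (P.dsign (P.e (Sum.inr i)) * β i) (β i') := fun i i' h he => by
    simp only [g]
    rw [if_neg (hP.not_isCap_top i), one_mul, hP.compW_top l h he]
    rfl
  have hbot : ∀ j j', j < j' → P.e (Sum.inl j) = P.e (Sum.inl j') → g (P.e (Sum.inl j)) =
      cupW (P.dsign (P.e (Sum.inl j)) * α j) (α j') := fun j j' h he => by
    simp only [g]
    rw [if_pos ⟨j, j', h.ne, rfl, he.symm⟩, hP.compW_bot l h he, q_mul_capW]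
    rfl
  have hedge : ∀ j i, P.e (Sum.inl j) = P.e (Sum.inr i) → g (P.e (Sum.inr i)) =
      edgeW (P.dsign (P.e (Sum.inr i)) * β i) (α j) := fun j i he => by
    simp only [g]
    rw [if_neg (hP.not_isCap_top i), one_mul, hP.compW_edge l he]
    rfl
  have hmon : ∀ c ∈ Finset.univ, IsMonomial (g c) := by
    intro c _
    obtain ⟨x, rfl⟩ := hr.noCircle c
    rcases hP.line_cases x with ⟨i, i', h, h1, h2⟩ | ⟨j, j', h, h1, h2⟩ | ⟨j, i, h1, h2⟩
    · rw [← h1, htop i i' h (h1.trans h2.symm)]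
      exact isMonomial_cupW _ _
    · rw [← h1, hbot j j' h (h1.trans h2.symm)]
      exact isMonomial_cupW _ _
    · rw [← h2, hedge j i (h1.trans h2.symm)]
      exact isMonomial_edgeW _ _
  rw [hg]
  refine ⟨(isMonomial_prod hmon).1, fun h => ?_, fun h => ?_⟩
  · have h1 := fun c => (isMonomial_prod hmon).2 h c (Finset.mem_univ c)
    refine ⟨fun i i' hi he => ?_, fun j j' hj he => ?_, fun j i he => ?_⟩
    · have := (htop i i' hi he).symm.trans (h1 _)
      rwa [cupW_eq_one_iff, dsign_mul_eq_one_iff] at this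
    · have := (hbot j j' hj he).symm.trans (h1 _)
      rwa [cupW_eq_one_iff, dsign_mul_eq_one_iff] at this
    · exact edgeW_eq_one_iff.1 ((hedge j i he).symm.trans (h1 _))
  · refine Finset.prod_eq_one fun c _ => ?_
    obtain ⟨x, rfl⟩ := hr.noCircle c
    rcases hP.line_cases x with ⟨i, i', h3, h1, h2⟩ | ⟨j, j', h3, h1, h2⟩ | ⟨j, i, h1, h2⟩
    · rw [← h1, htop i i' h3 (h1.trans h2.symm), cupW_eq_one_iff, dsign_mul_eq_one_iff]
      exact h.top i i' h3 (h1.trans h2.symm)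
    · rw [← h1, hbot j j' h3 (h1.trans h2.symm), cupW_eq_one_iff, dsign_mul_eq_one_iff]
      exact h.bot j j' h3 (h1.trans h2.symm)
    · rw [← h2, hedge j i (h1.trans h2.symm), edgeW_eq_one_iff]
      exact h.edge j i (h1.trans h2.symm)

/-! ### Diagrams of degree zero for the same signs -/

theorem IsTangle.dsign_eq_of_allDegZero {Q : PreDiag m n} (hP : P.IsTangle) {α : Seq m} {β : Seq n}
    (h : P.AllDegZero α β) (h' : Q.AllDegZero α β) (he : ∀ x y, P.e x = P.e y ↔ Q.e x = Q.e y)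
    (x : Fin m ⊕ Fin n) : P.dsign (P.e x) = Q.dsign (Q.e x) := by
  rcases hP.line_cases x with ⟨i, i', h3, h1, h2⟩ | ⟨j, j', h3, h1, h2⟩ | ⟨j, i, h1, h2⟩
  · rw [← h1, ← (he _ _).1 h1, (h.top i i' h3 (h1.trans h2.symm)).1,
      (h'.top i i' h3 ((he _ _).1 (h1.trans h2.symm))).1]
  · rw [← h1, ← (he _ _).1 h1, (h.bot j j' h3 (h1.trans h2.symm)).1,
      (h'.bot j j' h3 ((he _ _).1 (h1.trans h2.symm))).1]
  · rw [← h2, ← (he _ _).1 h2]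
    have h4 := h.edge j i (h1.trans h2.symm)
    rw [← h'.edge j i ((he _ _).1 (h1.trans h2.symm))] at h4
    exact mul_right_cancel h4

/-- The number of edges. -/
def edges (P : PreDiag m n) : ℕ := Nat.card {i : Fin n // P.mate Sum.inr i = i}

theorem IsTangle.edges_eq (hP : P.IsTangle) :
    P.edges = Nat.card {j : Fin m // P.mate Sum.inl j = j} :=
  Nat.card_congr hP.edgeIso.toEquiv

/-- By `IsArcSystem.eq_of_ne` every arc of `Q` is an arc of `P`. As `Q` does not have more rays than
`P`, it does not have fewer arcs. -/
theorem mate_eq_of_card_le {f : Fin N → Fin m ⊕ Fin n} {Q : PreDiag m n} {γ : Seq N}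
    (h : IsArcSystem (P.mate f) γ) (hr : RaysAccessible (P.mate f) γ)
    (h' : IsArcSystem (Q.mate f) γ)
    (hcard : Nat.card {i // Q.mate f i = i} ≤ Nat.card {i // P.mate f i = i}) :
    P.mate f = Q.mate f := by
  classical
  have h1 : ∀ i, Q.mate f i ≠ i → P.mate f i = Q.mate f i := fun i hi => h.eq_of_ne hr h' hi
  rw [Nat.card_eq_fintype_card, Nat.card_eq_fintype_card, Fintype.card_subtype,
    Fintype.card_subtype] at hcard
  have h2 : (Finset.univ.filter fun i => P.mate f i = i) ⊆
      Finset.univ.filter fun i => Q.mate f i = i := by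
    intro i hi
    rw [Finset.mem_filter] at hi ⊢
    refine ⟨hi.1, ?_⟩
    by_contra hne
    exact hne ((h1 i hne).symm.trans hi.2)
  have h3 := Finset.eq_of_subset_of_card_le h2 hcard
  funext i
  by_cases hi : Q.mate f i = i
  · have : i ∈ Finset.univ.filter fun i => P.mate f i = i := by
      rw [h3]; exact Finset.mem_filter.2 ⟨Finset.mem_univ i, hi⟩
    rw [hi, (Finset.mem_filter.1 this).2]
  · exact h1 i hi

/-- A reduced diagram is determined by signs of degree zero, up to diagrams with more edges. -/
theorem IsTangle.sameShape_of_allDegZero {Q : PreDiag m n} (hP : P.IsTangle) (hQ : Q.IsTangle)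
    {α : Seq m} {β : Seq n} (h : P.AllDegZero α β) (h' : Q.AllDegZero α β)
    (ht : RaysAccessible (P.mate Sum.inr) β) (hb : RaysAccessible (P.mate Sum.inl) α)
    (hcard : Q.edges ≤ P.edges) : P.SameShape Q := by
  have he := hP.e_iff_of_mate_eq hQ
    (mate_eq_of_card_le (hP.isArcSystem isFace_top h.top) ht (hQ.isArcSystem isFace_top h'.top)
      hcard)
    (mate_eq_of_card_le (hP.isArcSystem isFace_bot h.bot) hb (hQ.isArcSystem isFace_bot h'.bot)
      (by rwa [← hP.edges_eq, ← hQ.edges_eq]))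
  exact ⟨he, hP.dsign_eq_of_allDegZero h h' he⟩

/-! ### Parity -/

theorem neg_one_pow_card {X : Type*} [Fintype X] (A : X → Prop) [DecidablePred A] :
    ∏ c, (if A c then (-1 : ℤˣ) else 1) = (-1) ^ Nat.card {c // A c} := by
  rw [Finset.prod_ite, Finset.prod_const, Finset.prod_const_one, mul_one,
    Nat.card_eq_fintype_card, Fintype.card_subtype]

/-- Grouped by components, an arc contributes minus its dot sign and a ray its dot sign. So `-1`
arises from every ray with an odd and every arc with an even number of dots. -/
theorem IsTangle.prod_face (hP : P.IsTangle) {f : Fin N → Fin m ⊕ Fin n}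
    (hf : Function.Injective f) {γ : Seq N}
    (harc : ∀ i j, i < j → P.e (f i) = P.e (f j) → γ i * γ j = -P.dsign (P.e (f i)))
    (hray : ∀ i, P.mate f i = i → γ i = P.dsign (P.e (f i))) :
    ∏ i, γ i = (-1) ^ (Nat.card {c // (∃ i, P.mate f i = i ∧ P.e (f i) = c) ∧ Odd (P.dots c)} +
      Nat.card {c // (∃ i j, i ≠ j ∧ P.e (f i) = c ∧ P.e (f j) = c) ∧ Even (P.dots c)}) := by
  classical
  have := P.finite
  let _ := Fintype.ofFinite P.Comp
  rw [pow_add, ← neg_one_pow_card, ← neg_one_pow_card, ← Finset.prod_mul_distrib,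
    ← Finset.prod_fiberwise Finset.univ (fun i => P.e (f i))]
  refine Finset.prod_congr rfl fun c _ => ?_
  have hodd : P.dsign c = if Odd (P.dots c) then -1 else 1 := by
    rw [dsign]
    split_ifs with h
    · exact h.neg_one_pow
    · exact (Nat.not_odd_iff_even.1 h).neg_one_pow
  by_cases h1 : ∃ i j, i ≠ j ∧ P.e (f i) = c ∧ P.e (f j) = c
  · have h2 : ¬ ∃ i, P.mate f i = i ∧ P.e (f i) = c := by
      rintro ⟨k, hk, hk'⟩
      obtain ⟨i, j, hij, hi, hj⟩ := h1
      rw [mate_eq_self_iff] at hk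
      exact hij ((hk i (hi.trans hk'.symm)).trans (hk j (hj.trans hk'.symm)).symm)
    obtain ⟨i, j, hij, hi, hj⟩ : ∃ i j, i < j ∧ P.e (f i) = c ∧ P.e (f j) = c := by
      obtain ⟨i, j, hij, hi, hj⟩ := h1
      rcases lt_or_gt_of_ne hij with h | h
      · exact ⟨i, j, h, hi, hj⟩
      · exact ⟨j, i, h, hj, hi⟩
    have h3 : (Finset.univ.filter fun k => P.e (f k) = c) = {i, j} := by
      ext k
      simp only [Finset.mem_filter, Finset.mem_univ, true_and, Finset.mem_insert,
        Finset.mem_singleton]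
      constructor
      · intro hk
        exact (hP.eq_or_eq (fun h => hij.ne (hf h)) (hi.trans hj.symm) (hk.trans hi.symm)).imp
          (fun h => hf h) fun h => hf h
      · rintro (rfl | rfl)
        · exact hi
        · exact hj
    rw [h3, Finset.prod_pair hij.ne, harc i j hij (hi.trans hj.symm), hi,
      if_neg fun h => h2 h.1, one_mul, hodd]
    by_cases h4 : Odd (P.dots c)
    · rw [if_pos h4, if_neg fun h => Nat.not_even_iff_odd.2 h4 h.2, neg_neg]
    · rw [if_neg h4, if_pos ⟨⟨i, j, hij.ne, hi, hj⟩, Nat.not_odd_iff_even.1 h4⟩]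
  · rw [if_neg fun h : _ ∧ Even (P.dots c) => h1 h.1, mul_one]
    by_cases h2 : ∃ i, P.mate f i = i ∧ P.e (f i) = c
    · obtain ⟨i, hi, hi'⟩ := h2
      have h3 : (Finset.univ.filter fun k => P.e (f k) = c) = {i} := by
        ext k
        simp only [Finset.mem_filter, Finset.mem_univ, true_and, Finset.mem_singleton]
        constructor
        · intro hk
          exact mate_eq_self_iff.1 hi k (hk.trans hi'.symm)
        · rintro rfl
          exact hi'
      rw [h3, Finset.prod_singleton, hray i hi, hi', hodd]
      by_cases h4 : Odd (P.dots c)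
      · rw [if_pos h4, if_pos ⟨⟨i, hi, hi'⟩, h4⟩]
      · rw [if_neg h4, if_neg fun h => h4 h.2]
    · rw [if_neg fun h => h2 h.1]
      refine Finset.prod_eq_one fun k hk => ?_
      exfalso
      have hk' := (Finset.mem_filter.1 hk).2
      by_cases h5 : P.mate f k = k
      · exact h2 ⟨k, h5, hk'⟩
      · exact h1 ⟨_, k, h5, (e_mate k).trans hk', hk'⟩

theorem IsTangle.prod_top (hP : P.IsTangle) {γ : Seq n}
    (harc : ∀ i j, i < j → P.e (Sum.inr i) = P.e (Sum.inr j) →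
      γ i * γ j = -P.dsign (P.e (Sum.inr i)))
    (hray : ∀ j i, P.e (Sum.inl j) = P.e (Sum.inr i) → γ i = P.dsign (P.e (Sum.inr i))) :
    ∏ i, γ i = (-1) ^ (P.dottedEdges + P.undottedCups) := by
  rw [hP.prod_face Sum.inr_injective harc fun i hi => by
    obtain ⟨j, hj⟩ := hP.mate_top_eq_self_iff.1 hi
    exact hray j i hj]
  congr 2
  rw [dottedEdges]
  refine Nat.card_congr (Equiv.subtypeEquivRight fun c => and_congr_left fun _ => ?_)
  constructor
  · rintro ⟨i, hi, rfl⟩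
    obtain ⟨j, hj⟩ := hP.mate_top_eq_self_iff.1 hi
    exact ⟨j, i, hj, rfl⟩
  · rintro ⟨j, i, hj, rfl⟩
    exact ⟨i, hP.mate_top_eq_self_iff.2 ⟨j, hj⟩, rfl⟩

theorem IsTangle.prod_top_of_weight_ne_zero (hP : P.IsTangle) (hE : ∀ c, ¬ P.IsEdge c) {α : Seq m}
    {β : Seq n} (h : P.weight (Sum.elim α β) ≠ 0) : ∏ i, β i = (-1) ^ P.undottedCups := by
  rw [hP.prod_top (γ := β) (fun i j hij he => hP.top_of_weight_ne_zero h hij he)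
    fun j i hj => absurd ⟨j, i, hj, rfl⟩ (hE _)]
  have : P.dottedEdges = 0 := by
    rw [dottedEdges, Nat.card_eq_zero]
    exact Or.inl ⟨fun c => hE _ c.2.1⟩
  rw [this, zero_add]

theorem IsTangle.prod_bot_of_weight_ne_zero (hP : P.IsTangle) (hE : ∀ c, ¬ P.IsEdge c) {α : Seq m}
    {β : Seq n} (h : P.weight (Sum.elim α β) ≠ 0) : ∏ i, α i = (-1) ^ P.undottedCaps := by
  have hno : ∀ j, P.mate Sum.inl j ≠ j := fun j hj => by
    obtain ⟨i, hi⟩ := hP.mate_bot_eq_self_iff.1 hj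
    exact hE _ ⟨j, i, hi, rfl⟩
  rw [hP.prod_face (γ := α) Sum.inl_injective (fun i j hij he => hP.bot_of_weight_ne_zero h hij he)
    fun j hj => absurd hj (hno j)]
  have : Nat.card {c // (∃ i, P.mate Sum.inl i = i ∧ P.e (Sum.inl i) = c) ∧ Odd (P.dots c)} = 0 := by
    rw [Nat.card_eq_zero]
    refine Or.inl ⟨?_⟩
    rintro ⟨c, ⟨i, hi, -⟩, -⟩
    exact hno i hi
  rw [this, zero_add]
  rfl

end

end PreDiag

namespace PreDiag

/-! ### The leading sign sequence of a cup diagram -/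

section

variable {k n : ℕ} {P : PreDiag k n}

open scoped Classical in
/-- The signs of degree zero at the top of a cup diagram. -/
def lead (P : PreDiag k n) : Seq n := fun i =>
  if ∃ j, j < i ∧ P.e (Sum.inr j) = P.e (Sum.inr i) then -1 else P.dsign (P.e (Sum.inr i))

theorem IsTangle.lead_left (hP : P.IsTangle) {i j : Fin n} (hij : i < j)
    (h : P.e (Sum.inr i) = P.e (Sum.inr j)) : P.lead i = P.dsign (P.e (Sum.inr i)) := by
  refine if_neg ?_
  rintro ⟨l, hl, hl'⟩
  rcases hP.eq_or_eq (fun h => hij.ne (Sum.inr_injective h)) h hl' with h' | h'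
  · exact hl.ne (Sum.inr_injective h')
  · exact lt_asymm hl (hij.trans_eq (Sum.inr_injective h').symm)

theorem lead_right {i j : Fin n} (hij : i < j) (h : P.e (Sum.inr i) = P.e (Sum.inr j)) :
    P.lead j = -1 := if_pos ⟨i, hij, h⟩

theorem lead_ray {i : Fin n} (h : P.mate Sum.inr i = i) :
    P.lead i = P.dsign (P.e (Sum.inr i)) := by
  refine if_neg ?_
  rintro ⟨l, hl, hl'⟩
  exact hl.ne (mate_eq_self_iff.1 h l hl')

theorem NoCap.mate_bot (h : P.NoCap) (hP : P.IsTangle) (j : Fin k) : P.mate Sum.inl j = j :=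
  hP.mate_bot_eq_self_iff.2 (h j)

theorem NoCap.not_eq (h : P.NoCap) (hP : P.IsTangle) {j j' : Fin k} (hj : j ≠ j') :
    P.e (Sum.inl j) ≠ P.e (Sum.inl j') := fun h' =>
  hj (mate_eq_self_iff.1 (h.mate_bot hP j') j h')

theorem NoCap.caps_eq_zero (h : P.NoCap) (hP : P.IsTangle) : P.caps = 0 := by
  rw [caps, Nat.card_eq_zero]
  refine Or.inl ⟨?_⟩
  rintro ⟨c, j, j', hj, h1, h2⟩
  exact h.not_eq hP hj (h1.trans h2.symm)

theorem IsTangle.allDegZero_lead (hP : P.IsTangle) (h : P.NoCap) : P.AllDegZero 1 P.lead where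
  top i j hij he := ⟨(hP.lead_left hij he).symm, lead_right hij he⟩
  bot j j' hj he := absurd he (h.not_eq hP hj.ne)
  edge j i he := by
    rw [lead_ray (hP.mate_top_eq_self_iff.2 ⟨j, he⟩), Int.units_mul_self]
    rfl

theorem IsTangle.eq_lead (hP : P.IsTangle) {β : Seq n} (h : P.AllDegZero 1 β) : β = P.lead := by
  funext i
  rcases lt_trichotomy (P.mate Sum.inr i) i with h1 | h1 | h1
  · rw [(h.top _ i h1 (e_mate i)).2, lead_right h1 (e_mate i)]
  · rw [lead_ray h1]
    obtain ⟨j, hj⟩ := hP.mate_top_eq_self_iff.1 h1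
    exact (dsign_mul_eq_one_iff.1 (h.edge j i hj)).symm
  · rw [← (h.top i _ h1 (e_mate i).symm).1, hP.lead_left h1 (e_mate i).symm]

theorem IsTangle.raysAccessible_lead (hP : P.IsTangle) :
    RaysAccessible (P.mate Sum.inr) P.lead := fun a b ha hb hab => by
  rw [lead_ray hb, hP.dsign_ray isFace_top ha hab]

theorem IsTangle.isArcSystem_lead (hP : P.IsTangle) (h : P.NoCap) :
    IsArcSystem (P.mate Sum.inr) P.lead :=
  hP.isArcSystem isFace_top (hP.allDegZero_lead h).top

/-- The parity condition for even cup diagrams thus says that the leading signs contain an even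
number of minuses. -/
theorem IsTangle.prod_lead (hP : P.IsTangle) (h : P.NoCap) :
    ∏ i, P.lead i = (-1) ^ (P.dottedEdges + P.undottedCups) := by
  refine hP.prod_top (fun i j hij he => ?_) fun j i he => ?_
  · obtain ⟨h1, h2⟩ := (hP.allDegZero_lead h).top i j hij he
    rw [← h1, h2, mul_neg, mul_one]
  · exact lead_ray (hP.mate_top_eq_self_iff.2 ⟨j, he⟩)

theorem IsTangle.prod_eq_of_weight_ne_zero (hP : P.IsTangle) {β : Seq n}
    (hw : P.weight (Sum.elim 1 β) ≠ 0) :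
    ∏ i, β i = (-1) ^ (P.dottedEdges + P.undottedCups) := by
  refine hP.prod_top (fun i j hij he => hP.top_of_weight_ne_zero hw hij he) fun j i he => ?_
  exact (dsign_mul_eq_one_iff.1 (hP.edge_of_weight_ne_zero hw he)).symm

theorem IsTangle.weight_lead (hP : P.IsTangle) (hr : P.IsReduced) (h : P.NoCap) (β : Seq n) :
    IsMonomial (P.weight (Sum.elim 1 β)) ∧ (P.weight (Sum.elim 1 β) = 1 ↔ β = P.lead) := by
  have h1 := hP.weight_isMonomial hr 1 β
  rw [h.caps_eq_zero hP, pow_zero, one_mul] at h1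
  refine ⟨h1.1, h1.2.trans ⟨hP.eq_lead, ?_⟩⟩
  rintro rfl
  exact hP.allDegZero_lead h

/-- All signs in the expansion of a cup diagram have at most the height of the leading ones. -/
theorem IsTangle.ht_le (hP : P.IsTangle) (h : P.NoCap) {β : Seq n}
    (hw : P.weight (Sum.elim 1 β) ≠ 0) :
    ht β ≤ ht P.lead ∧ (ht β = ht P.lead → β = P.lead) := by
  classical
  set p := P.mate (Sum.inr : Fin n → Fin k ⊕ Fin n) with hp
  have hinv : ∀ i, p (p i) = i := hP.mate_mate Sum.inr_injective
  let g : Seq n → Fin n → ℕ := fun α i => if α i = -1 then i.1 else 0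
  -- Counting each point together with its partner allows a comparison arc by arc, without choosing
  -- representatives of the arcs.
  have hsum : ∀ α : Seq n, 2 * ht α = ∑ i, (g α i + g α (p i)) := by
    intro α
    rw [Finset.sum_add_distrib, two_mul]
    congr 1
    exact (Equiv.sum_comp (⟨p, p, hinv, hinv⟩ : Equiv.Perm (Fin n)) (g α)).symm
  have harc : ∀ i, i < p i → β i * β (p i) = P.lead i * P.lead (p i) ∧ P.lead (p i) = -1 := by
    intro i hi
    have he := (e_mate (P := P) (f := Sum.inr) i).symm
    obtain ⟨h1, h2⟩ := (hP.allDegZero_lead h).top i _ hi he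
    refine ⟨?_, h2⟩
    rw [h2, ← h1]
    exact (hP.top_of_weight_ne_zero hw hi he).trans (by rw [mul_neg, mul_one])
  -- On an arc the product of the two signs is determined, so both signs change or none does. The
  -- leading signs have a minus at the right end: changing both moves this minus to the left or
  -- removes two minuses, and in either case the height drops.
  have hle : ∀ i, i < p i → g β i + g β (p i) ≤ g P.lead i + g P.lead (p i) ∧
      (g β i + g β (p i) = g P.lead i + g P.lead (p i) →
        β i = P.lead i ∧ β (p i) = P.lead (p i)) := by
    intro i hi
    obtain ⟨h1, h2⟩ := harc i hi
    have h3 : i.1 < (p i).1 := hi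
    have hne : ((1 : ℤˣ) = -1) = False := eq_false one_ne_neg_one_units
    have hne' : ((-1 : ℤˣ) = 1) = False := eq_false one_ne_neg_one_units.symm
    simp only [g, h2] at h1 ⊢
    rcases units_cases (β i) with h4 | h4 <;> rcases units_cases (β (p i)) with h5 | h5 <;>
      rcases units_cases (P.lead i) with h6 | h6 <;>
      simp only [h4, h5, h6, mul_one, mul_neg, neg_neg, hne, hne', if_true,
        if_false, and_true, and_false, imp_false, implies_true] at h1 ⊢ <;> omega
  have hle' : ∀ i, g β i + g β (p i) ≤ g P.lead i + g P.lead (p i) ∧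
      (g β i + g β (p i) = g P.lead i + g P.lead (p i) → β i = P.lead i) := by
    intro i
    rcases lt_trichotomy i (p i) with hi | hi | hi
    · exact ⟨(hle i hi).1, fun h' => ((hle i hi).2 h').1⟩
    · obtain ⟨j, hj⟩ := hP.mate_top_eq_self_iff.1 hi.symm
      have h1 : β i = P.lead i := by
        rw [lead_ray hi.symm]
        exact (dsign_mul_eq_one_iff.1 (hP.edge_of_weight_ne_zero hw hj)).symm
      refine ⟨?_, fun _ => h1⟩
      simp only [g, ← hi, h1, le_refl]
    · have h1 := hle (p i) (by rwa [hinv])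
      rw [hinv] at h1
      exact ⟨by omega, fun h' => (h1.2 (by omega)).2⟩
  have h1 := hsum β
  have h2 := hsum P.lead
  have h3 := Finset.sum_le_sum fun i (_ : i ∈ Finset.univ) => (hle' i).1
  refine ⟨by omega, fun h4 => funext fun i => (hle' i).2 ?_⟩
  exact (Finset.sum_eq_sum_iff_of_le fun i _ => (hle' i).1).1 (by omega) i (Finset.mem_univ i)

/-- The arcs of `P` form an arc system for the leading signs, so the bracket rule applied to these
signs finds exactly the arcs of `P`. The dots agree because in degree zero the dot sign is the sign
at the left end or at the ray. -/
theorem IsTangle.isCupDiagramOf (hP : P.IsTangle) (hr : P.IsReduced) (h : P.NoCap) :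
    (Tangle.mk P hP).IsCupDiagramOf P.lead := by
  have h1 := hP.isArcSystem_lead h
  have h2 := hP.raysAccessible_lead
  have h3 := (hP.allDegZero_lead h).top
  have hdots : ∀ x, P.dots (P.e x) = if P.dsign (P.e x) = 1 then 0 else 1 := by
    intro x
    have := hr.dots_le (P.e x)
    rw [dsign]
    interval_cases P.dots (P.e x)
    · simp
    · rw [pow_one, if_neg one_ne_neg_one_units.symm]
  have he : ∀ {i j : Fin n}, P.mate Sum.inr i = j → P.e (Sum.inr i) = P.e (Sum.inr j) := by
    rintro i _ rfl
    exact (e_mate i).symm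
  refine ⟨P, hP, rfl, fun i j hij => ⟨fun h4 => ?_, ?_⟩, fun i j h4 => ?_, fun i j h4 => ?_,
    fun i j h4 => ?_⟩
  · have h5 := hP.mate_eq Sum.inr_injective hij.ne' h4.symm
    have := h1.plusMinus_or_minusMinus (i := i) (by rwa [h5])
    rwa [h5] at this
  · rintro (h4 | h4)
    · exact he (h1.eq_of_plusMinus h2 h4)
    · exact he (h1.eq_of_minusMinus h2 h4)
  · rw [hdots, if_pos]
    rw [(h3 i j h4.1 (he (h1.eq_of_plusMinus h2 h4))).1]
    exact h4.2.1
  · rw [hdots, if_neg]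
    rw [(h3 i j h4.1 (he (h1.eq_of_minusMinus h2 h4))).1, h4.2.1.1]
    exact one_ne_neg_one_units.symm
  · rw [hdots, lead_ray (hP.mate_top_eq_self_iff.2 ⟨j, h4⟩)]

/-- A cup diagram is determined by its leading signs. -/
theorem IsTangle.eq_of_lead_eq {k' : ℕ} {Q : PreDiag k' n} (hP : P.IsTangle) (hPr : P.IsReduced)
    (hPc : P.NoCap) (hQ : Q.IsTangle) (hQr : Q.IsReduced) (hQc : Q.NoCap)
    (h : P.lead = Q.lead) :
    (⟨k, .mk P hP⟩ : Σ k, Tangle k n) = ⟨k', .mk Q hQ⟩ := by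
  have h1 := hP.isArcSystem_lead hPc
  have h2 := hP.raysAccessible_lead
  have h3 := hQ.isArcSystem_lead hQc
  have h4 := hQ.raysAccessible_lead
  rw [← h] at h3 h4
  -- Both systems have accessible rays for the same signs, so the arcs of each belong to the other.
  -- Then the numbers of rays agree, and these are the numbers of bottom points.
  have hm : P.mate Sum.inr = Q.mate Sum.inr := by
    funext i
    by_cases h5 : Q.mate Sum.inr i = i
    · by_contra h6
      exact h6 (h3.eq_of_ne h4 h1 fun h7 => h6 (h7.trans h5.symm)).symm
    · exact h1.eq_of_ne h2 h3 h5
  have hedges : P.edges = Q.edges := by rw [edges, edges, hm]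
  have hcard : ∀ {k : ℕ} {P : PreDiag k n} (_ : P.IsTangle) (_ : P.NoCap), P.edges = k := by
    intro k P hP hPc
    rw [hP.edges_eq, Nat.card_congr (Equiv.subtypeUnivEquiv (hPc.mate_bot hP)), Nat.card_fin]
  obtain rfl : k = k' := by rw [← hcard hP hPc, ← hcard hQ hQc, hedges]
  have hz := hQ.allDegZero_lead hQc
  rw [← h] at hz
  have hsh := hP.sameShape_of_allDegZero hQ (hP.allDegZero_lead hPc) hz
    h2 (fun _ _ _ _ _ => rfl) hedges.ge
  rw [Tangle.sound (hP := hP) (hQ := hQ) (hPr.equiv hQr hsh)]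

end

end PreDiag

/-! ### The expansion of a cup diagram -/

/-- The expansion of a cup diagram with respect to the sign sequences. -/
def CupDiagram.vec {n : ℕ} (b : CupDiagram n) : Seq n → L := entry b.1.2 1

theorem CupDiagram.exists_lead {n : ℕ} (b : CupDiagram n) : ∃ (P : PreDiag b.1.1 n)
    (hP : P.IsTangle), b.1.2 = .mk P hP ∧ P.IsReduced ∧ P.NoCap ∧ ∏ i, P.lead i = 1 := by
  obtain ⟨P, hP, h1, h2, h3, h4, h5⟩ := b.2
  exact ⟨P, hP, h1, ⟨h2, h3⟩, h4, (hP.prod_lead h4).trans h5.neg_one_pow⟩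

/-- The leading signs of a cup diagram. -/
def CupDiagram.lead {n : ℕ} (b : CupDiagram n) : EvenSeq n :=
  ⟨b.exists_lead.choose.lead, b.exists_lead.choose_spec.choose_spec.2.2.2⟩

theorem even_of_neg_one_pow {d : ℕ} (h : (-1 : ℤˣ) ^ d = 1) : Even d := by
  by_contra hodd
  rw [(Nat.not_even_iff_odd.1 hodd).neg_one_pow] at h
  exact one_ne_neg_one_units h.symm

section CupDiagram

variable {n : ℕ}

/-- The cup diagram with the given data. -/
def CupDiagram.mk {k : ℕ} {P : PreDiag k n} (hP : P.IsTangle) (hr : P.IsReduced) (h : P.NoCap)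
    (heven : ∏ i, P.lead i = 1) : CupDiagram n :=
  ⟨⟨k, .mk P hP⟩, P, hP, rfl, hr.noCircle, hr.dots_le, h,
    even_of_neg_one_pow ((hP.prod_lead h).symm.trans heven)⟩

theorem CupDiagram.cases (b : CupDiagram n) : ∃ (k : ℕ) (P : PreDiag k n) (hP : P.IsTangle)
    (hr : P.IsReduced) (h : P.NoCap) (heven : ∏ i, P.lead i = 1),
    b = .mk hP hr h heven ∧ b.lead.1 = P.lead := by
  obtain ⟨⟨k, T⟩, hT⟩ := b
  let b : CupDiagram n := ⟨⟨k, T⟩, hT⟩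
  have h := b.exists_lead.choose_spec.choose_spec
  exact ⟨k, _, b.exists_lead.choose_spec.choose, h.2.1, h.2.2.1, h.2.2.2,
    Subtype.ext (Sigma.ext rfl (heq_of_eq h.1)), rfl⟩

theorem CupDiagram.vec_isMonomial (b : CupDiagram n) (β : Seq n) :
    IsMonomial (b.vec β) ∧ (b.vec β = 1 ↔ β = b.lead.1) := by
  obtain ⟨k, P, hP, hr, h, heven, h1, h2⟩ := b.cases
  rw [h2, h1]
  exact hP.weight_lead hr h β

theorem CupDiagram.vec_lead (b : CupDiagram n) : b.vec b.lead.1 = 1 := (b.vec_isMonomial _).2.2 rfl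

theorem CupDiagram.ht_le (b : CupDiagram n) {β : Seq n} (h : b.vec β ≠ 0) :
    ht β ≤ ht b.lead.1 ∧ (ht β = ht b.lead.1 → β = b.lead.1) := by
  obtain ⟨k, P, hP, hr, h1, heven, h2, h3⟩ := b.cases
  rw [h3]
  rw [h2] at h
  exact hP.ht_le h1 h

theorem CupDiagram.vec_mem (b : CupDiagram n) : b.vec ∈ EvenFun n := by
  obtain ⟨k, P, hP, hr, h, heven, h1, h2⟩ := b.cases
  rw [h1]
  intro β hβ
  by_contra hw
  refine hβ ?_
  rw [hP.prod_eq_of_weight_ne_zero hw, ← hP.prod_lead h, heven]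

theorem CupDiagram.isCupDiagramOf (b : CupDiagram n) : b.1.2.IsCupDiagramOf b.lead.1 := by
  obtain ⟨k, P, hP, hr, h, heven, h1, h2⟩ := b.cases
  rw [h2, h1]
  exact hP.isCupDiagramOf hr h

theorem CupDiagram.lead_injective : Function.Injective (CupDiagram.lead (n := n)) := by
  intro b b' hb
  obtain ⟨k, P, hP, hr, h, heven, h1, h2⟩ := b.cases
  obtain ⟨k', P', hP', hr', h', heven', h1', h2'⟩ := b'.cases
  rw [h1, h1']
  refine Subtype.ext (hP.eq_of_lead_eq hr h hP' hr' h' ?_)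
  rw [← h2, ← h2', hb]

end CupDiagram

/-! ### The action on cup diagrams -/

/-- The value of the state sum at `β`, as a linear map on the free module on all tangles. -/
def evalAt {n : ℕ} (β : Seq n) : ((Σ k, Tangle k n) →₀ L) →ₗ[L] L :=
  Finsupp.linearCombination L fun T => entry T.2 1 β

theorem evalAt_bas {k n : ℕ} (β : Seq n) (T : Tangle k n) : evalAt β (bas T) = entry T 1 β := by
  rw [evalAt, bas, Finsupp.linearCombination_single, one_smul]

/-- The rules reduce the concatenation to a multiple of a single reduced diagram without caps. As
the state sum respects the rules, the same multiple appears in the expansion. -/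
theorem exists_gen_comp {k n : ℕ} [Fact (2 ≤ n)] (i : Fin n) (T : Tangle k n) :
    ∃ (k' : ℕ) (Q : PreDiag k' n) (hQ : Q.IsTangle) (a : L), Q.IsReduced ∧ Q.NoCap ∧
      bas ((Tangle.gen i).comp T) - a • bas (.mk Q hQ) ∈ cupRel n ∧
      opE i (entry T 1) = a • entry (.mk Q hQ) 1 := by
  obtain ⟨k', Q, hQ, a, h1, h2, h3⟩ : ∃ (k' : ℕ) (Q : PreDiag k' n) (hQ : Q.IsTangle) (a : L),
      Q.IsReduced ∧ Q.NoCap ∧ bas ((Tangle.gen i).comp T) - a • bas (.mk Q hQ) ∈ cupRel n := by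
    generalize (Tangle.gen i).comp T = S
    induction S using Tangle.ind with
    | h P hP => exact PreDiag.exists_cup_diagram hP
  refine ⟨k', Q, hQ, a, h1, h2, h3, ?_⟩
  rw [← entry_gen_comp]
  funext β
  have := cupRel_le_ker (f := evalAt β) (fun k T => evalAt_bas β T) h3
  rwa [LinearMap.mem_ker, map_sub, map_smul, evalAt_bas, evalAt_bas, sub_eq_zero] at this

/-- For `a ≠ 0` the resulting diagram is even: its leading signs have the coefficient `a` in `opE i
b.vec`, and `opE i` preserves functions that are supported on even sequences. -/
theorem exists_gen_act {n : ℕ} [Fact (2 ≤ n)] (i : Fin n) (b : CupDiagram n) :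
    ∃ (a : L) (b' : CupDiagram n), opE i b.vec = a • b'.vec ∧
      bas ((Tangle.gen i).comp b.1.2) - a • bas b'.1.2 ∈ cupRel n := by
  obtain ⟨k', Q, hQ, a, h1, h2, h3, h4⟩ := exists_gen_comp i b.1.2
  by_cases ha : a = 0
  · subst ha
    rw [zero_smul] at h3 h4
    exact ⟨0, b, by rw [zero_smul]; exact h4, by rw [zero_smul]; exact h3⟩
  · have heven : ∏ l, Q.lead l = 1 := by
      by_contra hne
      have h5 : opE i b.vec Q.lead = 0 := opE_mem b.vec_mem i _ hne
      have h6 : entry (.mk Q hQ) 1 Q.lead = 1 := (hQ.weight_lead h1 h2 Q.lead).2.2 rfl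
      have h7 : opE i b.vec Q.lead = a • entry (.mk Q hQ) 1 Q.lead := congrFun h4 Q.lead
      rw [h5, h6, smul_eq_mul, mul_one] at h7
      exact ha h7.symm
    exact ⟨a, .mk hQ h1 h2 heven, h4, h3⟩

/-! ### The Kazhdan–Lusztig basis -/

theorem barN_smul {n : ℕ} (a : L) (x : N n) : barN n (a • x) = σ a • barN n x := by
  obtain ⟨y, rfl⟩ := Submodule.Quotient.mk_surjective _ x
  change (Submodule.Quotient.mk (bar n (a • y)) : N n) = σ a • Submodule.Quotient.mk (bar n y)
  rw [bar_smul, Submodule.Quotient.mk_smul]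

theorem barN_actN_C {n : ℕ} (i : Fin n) (x : N n) : barN n (actN (C i) x) = actN (C i) (barN n x) := by
  obtain ⟨y, rfl⟩ := Submodule.Quotient.mk_surjective _ x
  change (Submodule.Quotient.mk (bar n (y * C i)) : N n) = Submodule.Quotient.mk (bar n y * C i)
  rw [map_mul, bar_C]

theorem isReduced_id (n : ℕ) : (PreDiag.id n).IsReduced :=
  ⟨fun c => ⟨Sum.inl c, rfl⟩, fun _ => Nat.zero_le 1⟩

theorem noCap_id (n : ℕ) : (PreDiag.id n).NoCap := fun j => ⟨j, rfl⟩

theorem lead_id (n : ℕ) : (PreDiag.id n).lead = 1 := by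
  funext i
  refine (if_neg ?_).trans (pow_zero _)
  rintro ⟨j, hj, hj'⟩
  exact hj.ne hj'

theorem entry_one {n : ℕ} (α : Seq n) : entry (1 : Tangle n n) α = delta α := by
  funext β
  change (PreDiag.id n).weight (Sum.elim α β) = delta α β
  have hz : ∀ i : Fin n, (PreDiag.id n).dsign i = 1 := fun _ => pow_zero _
  by_cases h : β = α
  · rw [h, delta_self, PreDiag.weight_eq_prod]
    refine Finset.prod_eq_one fun i _ => ?_
    refine ((PreDiag.isTangle_id n).compW_edge (Sum.elim α α) (i := i) (j := i) rfl).trans ?_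
    rw [edgeW_eq_one_iff, hz, one_mul]
    rfl
  · rw [delta_of_ne h]
    by_contra hw
    refine h (funext fun i => ?_)
    have := (PreDiag.isTangle_id n).edge_of_weight_ne_zero hw (i := i) (j := i) rfl
    rwa [hz, one_mul] at this

/-! ### Unitriangularity and invariance under the bar involution -/

section

variable {n : ℕ} [hn : Fact (2 ≤ n)]

theorem fromCoord_delta {α : Seq n} (hα : ∏ k, α k = 1) : fromCoord n (delta α) = stdElt α := by
  rw [← coord_stdElt hα, fromCoord_coord]

theorem fromCoord_opE {f : Seq n → L} (hf : f ∈ EvenFun n) (i : Fin n) :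
    fromCoord n (opE i f) = actN (C i) (fromCoord n f) := by
  rw [← fromCoord_coord (actN (C i) (fromCoord n f)), coord_actN_C, coord_fromCoord hf]

/-- Every even sign sequence is the leading one of a cup diagram, whose expansion is invariant
under the bar involution. -/
theorem exists_lead_eq {α : Seq n} (hα : ∏ k, α k = 1) : ∃ b : CupDiagram n, b.lead.1 = α ∧
    barN n (fromCoord n b.vec) = fromCoord n b.vec := by
  induction hm : ht α using Nat.strong_induction_on generalizing α with
  | _ m ih =>
    by_cases h1 : α = 1
    · subst h1
      let b : CupDiagram n := .mk (PreDiag.isTangle_id n) (isReduced_id n) (noCap_id n)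
        (by rw [lead_id, hα])
      have hv : b.vec = delta 1 := entry_one 1
      refine ⟨b, ?_, ?_⟩
      · exact ((b.vec_isMonomial 1).2.1 (by rw [hv, delta_self])).symm
      · rw [hv, fromCoord_delta hα, stdElt, elt_one, H_one]
        change (Submodule.Quotient.mk (bar n 1) : N n) = _
        rw [map_one]
    obtain ⟨i, hi⟩ := exists_desc hα h1
    have h2 := hi.ht_reflSeq
    obtain ⟨b, hb, hbar⟩ := ih (ht (reflSeq i α)) (by omega) (α := reflSeq i α)
      (by rw [prod_reflSeq, hα]) rfl
    obtain ⟨a, b', hact, -⟩ := exists_gen_act i b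
    -- the expansion of `e_i b` has the leading term `α`
    have hle : ∀ γ, opE i b.vec γ ≠ 0 → ht γ ≤ ht α ∧ (ht γ = ht α → γ = α) := by
      intro γ hγ
      have h3 : b.vec (reflSeq i γ) ≠ 0 ∨ b.vec γ ≠ 0 := by
        by_contra hno
        push Not at hno
        refine hγ ?_
        rcases fixed_or_desc_or_asc i γ with h | h | h
        · exact opE_fixed h _
        · rw [opE_desc h, hno.1, hno.2, mul_zero, add_zero]
        · rw [opE_asc h, hno.1, hno.2, mul_zero, add_zero]
      rcases h3 with h3 | h3
      · obtain ⟨h4, h5⟩ := b.ht_le h3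
        have h6 := ht_reflSeq_le i (reflSeq i γ)
        rw [reflSeq_reflSeq] at h6
        rw [hb] at h4 h5
        refine ⟨by omega, fun h7 => ?_⟩
        have h8 := h5 (by omega)
        rw [← reflSeq_reflSeq i γ, h8, reflSeq_reflSeq]
      · have h4 := (b.ht_le h3).1
        rw [hb] at h4
        exact ⟨by omega, fun h5 => by omega⟩
    -- The sequence `α` is higher than the leading one of `b`, so it does not occur in the expansion
    -- of `b`. Its coefficient after applying `e_i` is that of the leading signs of `b`.
    have hval : opE i b.vec α = 1 := by
      have h3 : b.vec α = 0 := by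
        by_contra h3
        have h4 := (b.ht_le h3).1
        rw [hb] at h4
        omega
      rw [opE_desc hi, h3, mul_zero, add_zero, ← hb, b.vec_lead]
    have hval' : a * b'.vec α = 1 := by rw [← hval, hact]; rfl
    have ha : a ≠ 0 := fun h => by rw [h, zero_mul] at hval'; exact zero_ne_one hval'
    -- The leading signs of `b'` have the coefficient `a ≠ 0` in the expansion of `e_i b`, so they
    -- are not higher than `α`. Since `α` occurs in `b'`, they are not lower either.
    have hlead : b'.lead.1 = α := by
      have h3 : opE i b.vec b'.lead.1 = a := by
        rw [hact, Pi.smul_apply, b'.vec_lead, smul_eq_mul, mul_one]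
      obtain ⟨h4, h5⟩ := hle b'.lead.1 (h3 ▸ ha)
      have h6 := (b'.ht_le (β := α) fun h => by
        rw [h, mul_zero] at hval'; exact zero_ne_one hval').1
      exact h5 (le_antisymm h4 h6)
    have ha1 : a = 1 := by
      rw [← hlead, b'.vec_lead, mul_one] at hval'
      exact hval'
    rw [ha1, one_smul] at hact
    refine ⟨b', hlead, ?_⟩
    rw [← hact, fromCoord_opE b.vec_mem, barN_actN_C, hbar]

theorem lead_bijective : Function.Bijective (CupDiagram.lead (n := n)) :=
  ⟨CupDiagram.lead_injective, fun α => by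
    obtain ⟨b, hb, -⟩ := exists_lead_eq α.2
    exact ⟨b, Subtype.ext hb⟩⟩

/-- The invariant diagram constructed for the leading signs of `b` is `b` itself, since these signs
determine a diagram. -/
theorem barN_vec (b : CupDiagram n) : barN n (fromCoord n b.vec) = fromCoord n b.vec := by
  obtain ⟨b', hb', h⟩ := exists_lead_eq b.lead.2
  rwa [CupDiagram.lead_injective (Subtype.ext hb' : b'.lead = b.lead)] at h

omit hn in
/-- The expansion of a combination of cup diagrams. -/
def vecLin (n : ℕ) : Nt n →ₗ[L] (Seq n → L) := Finsupp.linearCombination L CupDiagram.vec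

omit hn in
theorem vecLin_single (b : CupDiagram n) (a : L) :
    vecLin n (Finsupp.single b a) = a • b.vec := Finsupp.linearCombination_single _ _ _

omit hn in
-- Another diagram in the support cannot contribute: it would contain `b.lead` in its expansion
-- although its own leading signs are not higher, and so they would be equal.
theorem vecLin_lead {f : Nt n} {b : CupDiagram n}
    (h : ∀ b', f b' ≠ 0 → ht b'.lead.1 ≤ ht b.lead.1) : vecLin n f b.lead.1 = f b := by
  rw [vecLin, Finsupp.linearCombination_apply, Finsupp.sum, Finset.sum_apply,
    Finset.sum_eq_single b]
  · rw [Pi.smul_apply, b.vec_lead, smul_eq_mul, mul_one]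
  · intro b' hb' hne
    rw [Pi.smul_apply]
    by_contra h1
    have h2 : b'.vec b.lead.1 ≠ 0 := fun h2 => h1 (by rw [h2, smul_zero])
    obtain ⟨h3, h4⟩ := b'.ht_le h2
    have h5 := h4 (le_antisymm h3 (h b' (Finsupp.mem_support_iff.1 hb')))
    exact hne (CupDiagram.lead_injective (Subtype.ext h5.symm))
  · intro hb
    rw [Finsupp.notMem_support_iff.1 hb, zero_smul, Pi.zero_apply]

omit hn in
theorem exists_max_lead {f : Nt n} (hf : f ≠ 0) :
    ∃ b, f b ≠ 0 ∧ ∀ b', f b' ≠ 0 → ht b'.lead.1 ≤ ht b.lead.1 := by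
  obtain ⟨b, hb, hmax⟩ := Finset.exists_max_image f.support (fun b => ht b.lead.1)
    (Finsupp.support_nonempty_iff.2 hf)
  exact ⟨b, Finsupp.mem_support_iff.1 hb, fun b' hb' => hmax b' (Finsupp.mem_support_iff.2 hb')⟩

omit hn in
theorem vecLin_injective : Function.Injective (vecLin n) := by
  rw [← LinearMap.ker_eq_bot, LinearMap.ker_eq_bot']
  intro f hf
  by_contra hne
  obtain ⟨b, hb, hmax⟩ := exists_max_lead hne
  refine hb ?_
  rw [← vecLin_lead hmax, hf, Pi.zero_apply]

omit hn in
theorem vecLin_mem (f : Nt n) : vecLin n f ∈ EvenFun n := by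
  rw [vecLin, Finsupp.linearCombination_apply]
  exact Submodule.sum_mem _ fun b _ => Submodule.smul_mem _ _ b.vec_mem

omit hn in
theorem eq_sum_delta {f : Seq n → L} (hf : f ∈ EvenFun n) :
    f = ∑ α : EvenSeq n, f α.1 • delta α.1 := by
  funext β
  rw [Finset.sum_apply]
  by_cases hβ : ∏ k, β k = 1
  · rw [Finset.sum_eq_single (⟨β, hβ⟩ : EvenSeq n), Pi.smul_apply, delta_self, smul_eq_mul, mul_one]
    · intro α _ hα
      rw [Pi.smul_apply, delta_of_ne (fun h => hα (Subtype.ext h.symm)), smul_zero]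
    · intro h
      exact absurd (Finset.mem_univ _) h
  · rw [hf β hβ, Finset.sum_eq_zero]
    intro α _
    rw [Pi.smul_apply, delta_mem α.2 β hβ, smul_zero]

/-- By induction on the height: the diagram with leading signs `α` is `delta α` plus a combination
of vectors of smaller height. -/
theorem range_vecLin : LinearMap.range (vecLin n) = EvenFun n := by
  classical
  refine le_antisymm (fun f hf => ?_) fun f hf => ?_
  · obtain ⟨g, rfl⟩ := hf
    exact vecLin_mem g
  have hdelta : ∀ α : EvenSeq n, delta α.1 ∈ LinearMap.range (vecLin n) := by
    intro α
    induction hm : ht α.1 using Nat.strong_induction_on generalizing α with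
    | _ m ih =>
      obtain ⟨b, rfl⟩ := lead_bijective.2 α
      have h1 := eq_sum_delta b.vec_mem
      rw [← Finset.add_sum_erase _ _ (Finset.mem_univ b.lead), b.vec_lead, one_smul,
        ← sub_eq_iff_eq_add] at h1
      rw [← h1]
      refine Submodule.sub_mem _ ⟨Finsupp.single b 1, by rw [vecLin_single, one_smul]⟩ ?_
      refine Submodule.sum_mem _ fun α hα => ?_
      by_cases h2 : b.vec α.1 = 0
      · rw [h2, zero_smul]
        exact zero_mem _
      · obtain ⟨h3, h4⟩ := b.ht_le h2
        refine Submodule.smul_mem _ _ (ih (ht α.1) ?_ α rfl)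
        rw [← hm]
        refine lt_of_le_of_ne h3 fun h5 => ?_
        exact (Finset.mem_erase.1 hα).1 (Subtype.ext (h4 h5))
  rw [eq_sum_delta hf]
  exact Submodule.sum_mem _ fun α _ => Submodule.smul_mem _ _ (hdelta α)

/-- The isomorphism between the module of cup diagrams and the parabolic Hecke module. -/
def ntEquiv (n : ℕ) [Fact (2 ≤ n)] : Nt n ≃ₗ[L] N n :=
  LinearEquiv.ofBijective ((fromCoord n).comp (vecLin n)) <| by
    constructor
    · intro f g h
      have := congrArg (coord n) h
      rw [LinearMap.comp_apply, LinearMap.comp_apply, coord_fromCoord (vecLin_mem f),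
        coord_fromCoord (vecLin_mem g)] at this
      exact vecLin_injective this
    · intro x
      have hx := coord_mem x
      rw [← range_vecLin] at hx
      obtain ⟨f, hf⟩ := hx
      exact ⟨f, by rw [LinearMap.comp_apply, hf, fromCoord_coord]⟩

theorem ntEquiv_apply (f : Nt n) : ntEquiv n f = fromCoord n (vecLin n f) := rfl

theorem coord_ntEquiv (f : Nt n) : coord n (ntEquiv n f) = vecLin n f := coord_fromCoord (vecLin_mem f)

theorem vecLin_ntEquiv_symm (x : N n) : vecLin n ((ntEquiv n).symm x) = coord n x := by
  rw [← coord_ntEquiv, LinearEquiv.apply_symm_apply]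

/-- The bijection `w ↦ w̲` between coset representatives and cup diagrams. -/
def cutEquiv (n : ℕ) [Fact (2 ≤ n)] : Wp n ≃ CupDiagram n :=
  (wpEquiv n).trans (Equiv.ofBijective _ lead_bijective).symm

theorem lead_cutEquiv (w : Wp n) : (cutEquiv n w).lead.1 = signSeq w.1 :=
  congrArg Subtype.val ((Equiv.ofBijective _ lead_bijective).apply_symm_apply (wpEquiv n w))

/-- The Kazhdan–Lusztig basis. -/
def klBasis (n : ℕ) [Fact (2 ≤ n)] : Module.Basis (Wp n) L (N n) :=
  (Module.Basis.ofRepr (ntEquiv n).symm).reindex (cutEquiv n).symm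

theorem klBasis_reindex : (klBasis n).reindex (cutEquiv n) = .ofRepr (ntEquiv n).symm := by
  refine Module.Basis.eq_of_apply_eq fun b => ?_
  rw [Module.Basis.reindex_apply, klBasis, Module.Basis.reindex_apply, Equiv.symm_symm,
    Equiv.apply_symm_apply]

theorem klBasis_apply (w : Wp n) : klBasis n w = fromCoord n (cutEquiv n w).vec := by
  rw [klBasis, Module.Basis.reindex_apply, Equiv.symm_symm]
  change ntEquiv n (Finsupp.single _ 1) = _
  rw [ntEquiv_apply, vecLin_single, one_smul]

/-- Since the cup diagrams are bar invariant, the involution only acts on the coefficients. -/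
theorem barN_ntEquiv (f : Nt n) :
    barN n (ntEquiv n f) = ntEquiv n (f.mapRange σ (map_zero σ)) := by
  induction f using Finsupp.induction_linear with
  | zero => rw [Finsupp.mapRange_zero, map_zero, map_zero]
  | add f g hf hg => rw [map_add, map_add, hf, hg, Finsupp.mapRange_add (map_add σ), map_add]
  | single b a =>
    rw [Finsupp.mapRange_single, ntEquiv_apply, ntEquiv_apply, vecLin_single, vecLin_single,
      (fromCoord n).map_smul, (fromCoord n).map_smul, barN_smul, barN_vec]

omit hn in
theorem eq_zero_of_σ_eq {x : L} (h : σ x = x) (h' : ∀ d ≤ 0, x.coeff d = 0) : x = 0 := by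
  refine LaurentPolynomial.ext fun d => ?_
  change x.coeff d = 0
  rcases le_total d 0 with hd | hd
  · exact h' d hd
  · rw [← h]
    exact (LaurentPolynomial.invert_apply x d).trans (h' _ (by omega))

theorem coeff_coord_of_mem_closure {w : Wp n} {x : N n} (hx : x ∈ AddSubgroup.closure
    {y : N n | ∃ (v : Wp n) (k : ℕ), v ≠ w ∧ y = q ^ (k + 1) • stdN v}) (α : Seq n) (d : ℤ)
    (hd : d ≤ 0) : (coord n x α).coeff d = 0 := by
  induction hx using AddSubgroup.closure_induction with
  | mem x hx =>
    obtain ⟨v, k, -, rfl⟩ := hx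
    rw [map_smul, stdN_eq, coord_stdElt (prod_signSeq _), Pi.smul_apply, smul_eq_mul]
    by_cases hα : α = signSeq v.1
    · rw [hα, delta_self, mul_one, LaurentPolynomial.T_pow, LaurentPolynomial.T_apply, if_neg]
      push_cast
      omega
    · rw [delta_of_ne hα, mul_zero]
      rfl
  | zero => rw [map_zero]; rfl
  | add x y _ _ hx hy =>
    rw [map_add, Pi.add_apply, AddMonoidAlgebra.coeff_add, Finsupp.add_apply, hx, hy, add_zero]
  | neg x _ hx =>
    rw [map_neg, Pi.neg_apply, AddMonoidAlgebra.coeff_neg, Finsupp.neg_apply, hx, neg_zero]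

/-- Away from the leading signs a nonzero coefficient is a power of `q` different from `1`, hence of
the form `q ^ (d + 1)`. -/
theorem isKLElement_klBasis (w : Wp n) : IsKLElement w (klBasis n w) := by
  refine ⟨by rw [klBasis_apply, barN_vec], ?_⟩
  set b := cutEquiv n w with hb
  have h1 : klBasis n w - stdN w =
      ∑ α : EvenSeq n, (b.vec α.1 - delta b.lead.1 α.1) • stdElt α.1 := by
    rw [klBasis_apply, stdN_eq, ← lead_cutEquiv, ← fromCoord_delta b.lead.2, ← map_sub]
    rfl
  rw [h1]
  refine AddSubgroup.sum_mem _ fun α _ => ?_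
  by_cases hα : α.1 = b.lead.1
  · rw [hα, b.vec_lead, delta_self, sub_self, zero_smul]
    exact zero_mem _
  rw [delta_of_ne hα, sub_zero]
  obtain ⟨h2, h3⟩ := b.vec_isMonomial α.1
  rcases h2 with h2 | ⟨d, h2⟩
  · rw [h2, zero_smul]
    exact zero_mem _
  rcases d with _ | d
  · rw [pow_zero] at h2
    exact absurd (h3.1 h2) hα
  · have h4 : signSeq ((wpEquiv n).symm α).1 = α.1 :=
      congrArg Subtype.val ((wpEquiv n).apply_symm_apply α)
    refine AddSubgroup.subset_closure ⟨(wpEquiv n).symm α, d, ?_, by rw [h2, stdN_eq, h4]⟩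
    intro h5
    rw [h5, ← lead_cutEquiv] at h4
    exact hα h4.symm

/-- The difference of two candidates is bar invariant with standard coefficients in `q ℤ[q]`. If it
is not zero, its coefficient at a highest cup diagram equals a standard coefficient; being invariant
under `q ↦ q⁻¹` and without terms of degree at most zero, it vanishes. -/
theorem isKLElement_iff (w : Wp n) (x : N n) : IsKLElement w x ↔ x = klBasis n w := by
  refine ⟨fun ⟨h1, h2⟩ => ?_, ?_⟩
  swap
  · rintro rfl
    exact isKLElement_klBasis w
  obtain ⟨h3, h4⟩ := isKLElement_klBasis w
  have h5 := sub_mem h2 h4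
  rw [sub_sub_sub_cancel_right] at h5
  have h6 : barN n (x - klBasis n w) = x - klBasis n w := by rw [map_sub, h1, h3]
  obtain ⟨f, hf⟩ := (ntEquiv n).surjective (x - klBasis n w)
  rw [← sub_eq_zero, ← hf]
  rw [← hf, barN_ntEquiv, (ntEquiv n).injective.eq_iff] at h6
  by_contra hne
  have hf0 : f ≠ 0 := by
    rintro rfl
    exact hne (map_zero _)
  obtain ⟨b, hb, hmax⟩ := exists_max_lead hf0
  refine hb (eq_zero_of_σ_eq (DFunLike.congr_fun h6 b) fun d hd => ?_)
  rw [← vecLin_lead hmax, ← coord_ntEquiv, hf]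
  exact coeff_coord_of_mem_closure h5 _ d hd

end

/-! ### The action on functions of sign sequences -/

/-- The coefficients of an element of the tangle algebra, as a linear map. -/
def coeffLin (n : ℕ) : TangleAlgebra n →ₗ[L] (Tangle n n →₀ L) where
  toFun := MonoidAlgebra.coeff
  map_add' := MonoidAlgebra.coeff_add
  map_smul' := MonoidAlgebra.coeff_smul

/-- The matrix entry of an element of the tangle algebra at `α` and `β`. -/
def matEntry {n : ℕ} (α β : Seq n) : TangleAlgebra n →ₗ[L] L :=
  (Finsupp.linearCombination L fun T : Tangle n n => entry T α β).comp (coeffLin n)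

theorem matEntry_of {n : ℕ} (α β : Seq n) (T : Tangle n n) :
    matEntry α β (MonoidAlgebra.of L _ T) = entry T α β := by
  change Finsupp.linearCombination L _ (Finsupp.single T 1) = _
  rw [Finsupp.linearCombination_single, one_smul]

/-- The action of the tangle algebra on functions of sign sequences. -/
def act (n : ℕ) : TangleAlgebra n →ₗ[L] Module.End L (Seq n → L) :=
  LinearMap.mk₂ L (fun x f β => ∑ α, matEntry α β x * f α)
    (fun x y f => by funext β; simp only [map_add, add_mul, Finset.sum_add_distrib, Pi.add_apply])
    (fun a x f => by
      funext β
      simp only [map_smul, smul_eq_mul, mul_assoc, Finset.mul_sum, Pi.smul_apply])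
    (fun x f g => by
      funext β; simp only [Pi.add_apply, mul_add, Finset.sum_add_distrib])
    (fun a x f => by
      funext β
      simp only [smul_eq_mul, mul_left_comm, Finset.mul_sum, Pi.smul_apply])

theorem act_apply {n : ℕ} (x : TangleAlgebra n) (f : Seq n → L) (β : Seq n) :
    act n x f β = ∑ α, matEntry α β x * f α := rfl

theorem act_of {n : ℕ} (T : Tangle n n) (f : Seq n → L) :
    act n (MonoidAlgebra.of L _ T) f = ∑ α, f α • entry T α := by
  funext β
  simp only [act_apply, matEntry_of, Finset.sum_apply, Pi.smul_apply, smul_eq_mul, mul_comm]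

theorem act_delta {n : ℕ} (x : TangleAlgebra n) (α β : Seq n) :
    act n x (delta α) β = matEntry α β x := by
  rw [act_apply, Finset.sum_eq_single α, delta_self, mul_one]
  · intro γ _ hγ
    rw [delta_of_ne hγ, mul_zero]
  · intro h
    exact absurd (Finset.mem_univ _) h

theorem act_one (n : ℕ) : act n 1 = 1 := by
  rw [← map_one (MonoidAlgebra.of L (Tangle n n))]
  refine LinearMap.ext fun f => ?_
  rw [act_of]
  funext β
  rw [Finset.sum_apply, Finset.sum_eq_single β]
  · rw [entry_one, Pi.smul_apply, delta_self, smul_eq_mul, mul_one]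
    rfl
  · intro α _ hα
    rw [entry_one, Pi.smul_apply, delta_of_ne hα.symm, smul_zero]
  · intro h
    exact absurd (Finset.mem_univ _) h

/-! ### Transport of the matrix action to cup diagrams -/

section

variable {n : ℕ} [hn : Fact (2 ≤ n)]

theorem act_gen_mul (i : Fin n) (x : TangleAlgebra n) :
    act n (MonoidAlgebra.of L _ (Tangle.gen i) * x) = opE i ∘ₗ act n x := by
  induction x using MonoidAlgebra.induction_linear with
  | zero => rw [mul_zero, map_zero, LinearMap.comp_zero]
  | add x y hx hy => rw [mul_add, map_add, hx, hy, map_add, LinearMap.comp_add]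
  | single T a =>
    have h : MonoidAlgebra.single T a = a • MonoidAlgebra.of L _ T := by simp
    rw [h, mul_smul_comm, ← map_mul, map_smul, map_smul, LinearMap.comp_smul]
    congr 1
    refine LinearMap.ext fun f => ?_
    rw [LinearMap.comp_apply, act_of, act_of, map_sum]
    refine Finset.sum_congr rfl fun α _ => ?_
    rw [map_smul, ← entry_gen_comp]
    rfl

theorem act_gen (i : Fin n) : act n (MonoidAlgebra.of L _ (Tangle.gen i)) = opE i := by
  have := act_gen_mul i (1 : TangleAlgebra n)
  rw [mul_one, act_one] at this
  rw [this]
  rfl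

/-- The concatenation formula is established for the generators on top of an arbitrary tangle.
Therefore the left factor is taken from `𝔻𝕋_n`, by induction over its elements, while the right
factor is free. -/
theorem act_mul {x : TangleAlgebra n} (hx : x ∈ DT n) (y : TangleAlgebra n) :
    act n (x * y) = act n x * act n y := by
  induction hx using Algebra.adjoin_induction generalizing y with
  | mem x hx =>
    obtain ⟨i, rfl⟩ := hx
    rw [act_gen_mul, act_gen]
    rfl
  | algebraMap a =>
    rw [Algebra.algebraMap_eq_smul_one, smul_mul_assoc, one_mul, map_smul, map_smul, act_one,
      smul_mul_assoc, one_mul]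
  | add x x' _ _ hx hx' => rw [add_mul, map_add, map_add, hx, hx', add_mul]
  | mul x x' _ _ hx hx' => rw [mul_assoc, hx, hx, hx', mul_assoc]

theorem act_mem {x : TangleAlgebra n} (hx : x ∈ DT n) {f : Seq n → L} (hf : f ∈ EvenFun n) :
    act n x f ∈ EvenFun n := by
  induction hx using Algebra.adjoin_induction generalizing f with
  | mem x hx =>
    obtain ⟨i, rfl⟩ := hx
    rw [act_gen]
    exact opE_mem hf i
  | algebraMap a =>
    rw [Algebra.algebraMap_eq_smul_one, map_smul, act_one]
    exact Submodule.smul_mem _ _ hf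
  | add x x' _ _ hx hx' =>
    rw [map_add]
    exact add_mem (hx hf) (hx' hf)
  | mul x x' hm _ hx hx' =>
    rw [act_mul hm]
    exact hx (hx' hf)

/-- The inverse of `vecLin` on the functions that are supported on even sign sequences. -/
def unvec (n : ℕ) [Fact (2 ≤ n)] : (Seq n → L) →ₗ[L] Nt n :=
  (ntEquiv n).symm.toLinearMap.comp (fromCoord n)

theorem vecLin_unvec {f : Seq n → L} (hf : f ∈ EvenFun n) : vecLin n (unvec n f) = f := by
  rw [unvec, LinearMap.comp_apply, LinearEquiv.coe_coe, vecLin_ntEquiv_symm, coord_fromCoord hf]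

/-- The action of `𝔻𝕋_n` on the module of cup diagrams. -/
def cupAction (n : ℕ) [Fact (2 ≤ n)] : DT n →ₐ[L] Module.End L (Nt n) :=
  AlgHom.ofLinearMap
    { toFun := fun x => (unvec n).comp ((act n x.1).comp (vecLin n))
      map_add' := fun x y => by
        rw [Subalgebra.coe_add, map_add, LinearMap.add_comp, LinearMap.comp_add]
      map_smul' := fun a x => by
        rw [Subalgebra.coe_smul, map_smul, LinearMap.smul_comp, LinearMap.comp_smul]
        rfl }
    (by
      refine LinearMap.ext fun f => vecLin_injective ?_
      change vecLin n (unvec n (act n 1 (vecLin n f))) = vecLin n f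
      rw [act_one]
      exact vecLin_unvec (vecLin_mem f))
    (fun x y => by
      refine LinearMap.ext fun f => ?_
      change unvec n (act n (x.1 * y.1) (vecLin n f)) =
        unvec n (act n x.1 (vecLin n (unvec n (act n y.1 (vecLin n f)))))
      rw [vecLin_unvec (act_mem y.2 (vecLin_mem f)), act_mul x.2]
      rfl)

theorem vecLin_cupAction (x : DT n) (f : Nt n) :
    vecLin n (cupAction n x f) = act n x.1 (vecLin n f) :=
  vecLin_unvec (act_mem x.2 (vecLin_mem f))

theorem vecLin_cupAction_e (i : Fin n) (f : Nt n) :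
    vecLin n (cupAction n (DT.e i) f) = opE i (vecLin n f) := by
  rw [vecLin_cupAction, DT.e, act_gen]

/-- The expansions of cup diagrams span all functions on even sequences, so the matrix columns at
even bottom signs are all that the action sees. -/
theorem cupAction_eq_zero_iff (x : DT n) :
    cupAction n x = 0 ↔ ∀ α β : Seq n, ∏ k, α k = 1 → matEntry α β x.1 = 0 := by
  constructor
  · intro h α β hα
    have hmem := delta_mem hα
    rw [← range_vecLin] at hmem
    obtain ⟨f, hf⟩ := hmem
    rw [← act_delta, ← hf, ← vecLin_cupAction, h]
    rfl
  · intro h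
    refine LinearMap.ext fun f => vecLin_injective ?_
    rw [vecLin_cupAction]
    funext β
    rw [act_apply]
    refine (Finset.sum_eq_zero fun α _ => ?_).trans (congrFun (map_zero (vecLin n)) β).symm
    by_cases hα : ∏ k, α k = 1
    · rw [h α β hα, zero_mul]
    · rw [vecLin_mem f α hα, mul_zero]

/-! ### Products of generators -/

omit hn in
/-- The monoid of all products of the tangles `e_i`. -/
def genMonoid (n : ℕ) : Submonoid (Tangle n n) := Submonoid.closure (Set.range Tangle.gen)

omit hn in
theorem of_mem_DT {T : Tangle n n} (hT : T ∈ genMonoid n) : MonoidAlgebra.of L _ T ∈ DT n := by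
  induction hT using Submonoid.closure_induction with
  | mem T hT =>
    obtain ⟨i, rfl⟩ := hT
    exact (DT.e i).2
  | one => rw [map_one]; exact one_mem _
  | mul S T _ _ hS hT => rw [map_mul]; exact mul_mem hS hT

omit hn in
-- An element of `𝔻𝕋_n` is a combination of products of the `e_i`, which are single tangles. This
-- makes the parity argument for such products available.
theorem exists_linearCombination {x : TangleAlgebra n} (hx : x ∈ DT n) :
    ∃ c : Tangle n n →₀ L, (∀ T ∈ c.support, T ∈ genMonoid n) ∧
      Finsupp.linearCombination L (MonoidAlgebra.of L (Tangle n n)) c = x := by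
  rw [← Subalgebra.mem_toSubmodule, DT, Algebra.adjoin_eq_span] at hx
  have h : ((Submonoid.closure (Set.range fun i : Fin n =>
      MonoidAlgebra.of L _ (Tangle.gen i)) : Submonoid (TangleAlgebra n)) :
      Set (TangleAlgebra n)) = MonoidAlgebra.of L _ '' (genMonoid n) := by
    rw [genMonoid, ← Submonoid.coe_map, MonoidHom.map_mclosure, ← Set.range_comp]
    rfl
  rw [h, Finsupp.mem_span_image_iff_linearCombination] at hx
  obtain ⟨c, hc, hc'⟩ := hx
  exact ⟨c, fun T hT => hc hT, hc'⟩

/-- A generator relates the coefficient at `β` only to those at `β` and at `reflSeq i β`, and these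
have the same parity. -/
theorem prod_eq_of_entry_ne_zero {T : Tangle n n} (hT : T ∈ genMonoid n) {α β : Seq n}
    (h : entry T α β ≠ 0) : ∏ k, α k = ∏ k, β k := by
  induction hT using Submonoid.closure_induction_left generalizing β with
  | one =>
    rw [entry_one] at h
    by_contra hne
    exact h (delta_of_ne fun h' => hne (by rw [h']))
  | mul_left S hS T _ ih =>
    obtain ⟨i, rfl⟩ := hS
    have h1 : entry (Tangle.gen i * T) α = opE i (entry T α) := entry_gen_comp i T α
    rw [h1] at h
    have h3 : entry T α (reflSeq i β) ≠ 0 ∨ entry T α β ≠ 0 := by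
      by_contra hno
      push Not at hno
      refine h ?_
      rcases fixed_or_desc_or_asc i β with h | h | h
      · exact opE_fixed h _
      · rw [opE_desc h, hno.1, hno.2, mul_zero, add_zero]
      · rw [opE_asc h, hno.1, hno.2, mul_zero, add_zero]
    rcases h3 with h3 | h3
    · rw [ih h3, prod_reflSeq]
    · exact ih h3

end

/-! ### Signs of degree zero for a tangle -/

namespace PreDiag

section

variable {m n : ℕ} {P : PreDiag m n}

open scoped Classical in
/-- Signs of degree zero at the bottom, with plus at the edges. -/
def botSigns (P : PreDiag m n) : Seq m := fun j =>
  if ∃ j', j' < j ∧ P.e (Sum.inl j') = P.e (Sum.inl j) then -1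
  else if P.mate Sum.inl j = j then 1 else P.dsign (P.e (Sum.inl j))

open scoped Classical in
/-- The signs of degree zero at the top for given signs at the bottom. -/
def topSigns (P : PreDiag m n) (α : Seq m) : Seq n := fun i =>
  if h : ∃ j, P.e (Sum.inl j) = P.e (Sum.inr i) then P.dsign (P.e (Sum.inr i)) * α h.choose
  else if ∃ i', i' < i ∧ P.e (Sum.inr i') = P.e (Sum.inr i) then -1
  else P.dsign (P.e (Sum.inr i))

theorem IsTangle.botSigns_degZero (hP : P.IsTangle) : P.DegZero Sum.inl P.botSigns := by
  intro i j hij he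
  refine ⟨(((if_neg ?_).trans (if_neg ?_) : P.botSigns i = _)).symm, if_pos ⟨i, hij, he⟩⟩
  · rintro ⟨l, hl, hl'⟩
    rcases hP.eq_or_eq (fun h => hij.ne (Sum.inl_injective h)) he hl' with h' | h'
    · exact hl.ne (Sum.inl_injective h')
    · exact lt_asymm hl (hij.trans_eq (Sum.inl_injective h').symm)
  · rw [hP.mate_eq Sum.inl_injective hij.ne' he.symm]
    exact hij.ne'

theorem botSigns_ray {j : Fin m} (h : P.mate Sum.inl j = j) : P.botSigns j = 1 := by
  refine (if_neg ?_).trans (if_pos h)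
  rintro ⟨l, hl, hl'⟩
  exact hl.ne (mate_eq_self_iff.1 h l hl')

theorem IsTangle.topSigns_edge (hP : P.IsTangle) (α : Seq m) {i : Fin n} {j : Fin m}
    (h : P.e (Sum.inl j) = P.e (Sum.inr i)) :
    P.topSigns α i = P.dsign (P.e (Sum.inr i)) * α j := by
  have hex : ∃ j, P.e (Sum.inl j) = P.e (Sum.inr i) := ⟨j, h⟩
  refine (dif_pos hex).trans ?_
  rw [mate_eq_self_iff.1 (hP.mate_bot_eq_self_iff.2 ⟨i, h⟩) hex.choose
    (hex.choose_spec.trans h.symm)]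

theorem IsTangle.topSigns_degZero (hP : P.IsTangle) (α : Seq m) :
    P.DegZero Sum.inr (P.topSigns α) := by
  intro i i' hi he
  have h1 : ¬ ∃ j, P.e (Sum.inl j) = P.e (Sum.inr i) := fun h => by
    have := hP.mate_top_eq_self_iff.2 h
    rw [hP.mate_eq Sum.inr_injective hi.ne' he.symm] at this
    exact hi.ne' this
  have h2 : ¬ ∃ j, P.e (Sum.inl j) = P.e (Sum.inr i') := by rwa [← he]
  refine ⟨((dif_neg h1).trans (if_neg ?_) : P.topSigns α i = _).symm, (dif_neg h2).trans (if_pos ⟨i, hi, he⟩)⟩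
  rintro ⟨l, hl, hl'⟩
  rcases hP.eq_or_eq (fun h => hi.ne (Sum.inr_injective h)) he hl' with h' | h'
  · exact hl.ne (Sum.inr_injective h')
  · exact lt_asymm hl (hi.trans_eq (Sum.inr_injective h').symm)

theorem IsTangle.allDegZero_topSigns (hP : P.IsTangle) {α : Seq m} (h : P.DegZero Sum.inl α) :
    P.AllDegZero α (P.topSigns α) where
  top := hP.topSigns_degZero α
  bot := h
  edge j i he := by rw [hP.topSigns_edge α he, ← mul_assoc, Int.units_mul_self, one_mul]

theorem IsTangle.raysAccessible_topSigns (hP : P.IsTangle) {α : Seq m}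
    (h : RaysAccessible (P.mate Sum.inl) α) :
    RaysAccessible (P.mate Sum.inr) (P.topSigns α) := by
  intro a b ha hb hab
  obtain ⟨j, hj⟩ := hP.mate_top_eq_self_iff.1 ha
  obtain ⟨j', hj'⟩ := hP.mate_top_eq_self_iff.1 hb
  rw [hP.topSigns_edge α hj', hP.dsign_ray isFace_top ha hab, one_mul]
  exact h j j' (hP.mate_bot_eq_self_iff.2 ⟨a, hj⟩) (hP.mate_bot_eq_self_iff.2 ⟨b, hj'⟩)
    (hP.edge_lt hj hj' hab)

/-- There are signs of degree zero which determine the tangle, and which are even at the bottom if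
there are edges. -/
theorem IsTangle.exists_signs (hP : P.IsTangle) : ∃ (α : Seq m) (β : Seq n), P.AllDegZero α β ∧
    RaysAccessible (P.mate Sum.inr) β ∧ RaysAccessible (P.mate Sum.inl) α ∧
    ((∃ c, P.IsEdge c) → ∏ k, α k = 1) := by
  classical
  suffices H : ∃ α : Seq m, P.DegZero Sum.inl α ∧ RaysAccessible (P.mate Sum.inl) α ∧
      ((∃ c, P.IsEdge c) → ∏ k, α k = 1) by
    obtain ⟨α, h1, h2, h3⟩ := H
    exact ⟨α, P.topSigns α, hP.allDegZero_topSigns h1, hP.raysAccessible_topSigns h2, h2, h3⟩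
  by_cases hE : ∃ c, P.IsEdge c
  swap
  · exact ⟨P.botSigns, hP.botSigns_degZero, fun a b ha hb hab => botSigns_ray hb,
      fun h => absurd h hE⟩
  have hne : (Finset.univ.filter fun j : Fin m => P.mate Sum.inl j = j).Nonempty := by
    obtain ⟨c, j, i, h1, h2⟩ := hE
    exact ⟨j, Finset.mem_filter.2 ⟨Finset.mem_univ _, hP.mate_bot_eq_self_iff.2
      ⟨i, h1.trans h2.symm⟩⟩⟩
  obtain ⟨j₀, hj₀, hmin⟩ := Finset.exists_min_image _ (fun j => j) hne
  have hray := (Finset.mem_filter.1 hj₀).2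
  -- The sign at the leftmost ray is unrestricted by degree zero and by `RaysAccessible`. It is
  -- multiplied by the product of all signs, so that the new product is `1`.
  refine ⟨Function.update P.botSigns j₀ (P.botSigns j₀ * ∏ j, P.botSigns j), fun i j hij he => ?_,
    fun a b ha hb hab => ?_, fun _ => ?_⟩
  · have hi : i ≠ j₀ := by
      rintro rfl
      rw [hP.mate_eq Sum.inl_injective hij.ne' he.symm] at hray
      exact hij.ne' hray
    have hj : j ≠ j₀ := by
      rintro rfl
      rw [hP.mate_eq Sum.inl_injective hij.ne he] at hray
      exact hij.ne hray
    rw [Function.update_of_ne hi, Function.update_of_ne hj]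
    exact hP.botSigns_degZero i j hij he
  · have hb' : b ≠ j₀ := by
      rintro rfl
      exact absurd hab (not_lt.2 (hmin a (Finset.mem_filter.2 ⟨Finset.mem_univ _, ha⟩)))
    rw [Function.update_of_ne hb']
    exact botSigns_ray hb
  · rw [Finset.prod_update_of_mem (Finset.mem_univ _), mul_right_comm,
      ← Finset.prod_eq_mul_prod_sdiff_singleton_of_mem (Finset.mem_univ j₀), Int.units_mul_self]

end

end PreDiag

/-! ### Independence of the reduced diagrams -/

open PreDiag in
/-- Reduced diagrams are independent modulo the kernel of the state sum, restricted to signs with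
the property `A` at the bottom, if they have signs of degree zero with this property. -/
theorem eq_zero_of_entries {m n : ℕ} (A : Seq m → Prop) (y : Tangle m n →₀ L)
    (hy : ∀ R ∈ y.support, ∃ (P : PreDiag m n) (hP : P.IsTangle), R = .mk P hP ∧ P.IsReduced ∧
      ∃ α β, A α ∧ P.AllDegZero α β ∧ RaysAccessible (P.mate Sum.inr) β ∧
        RaysAccessible (P.mate Sum.inl) α)
    (h0 : ∀ α β, A α → ∑ R ∈ y.support, y R * entry R α β = 0) : y = 0 := by
  classical
  by_contra hne
  have hy' : ∀ R : y.support, _ := fun R => hy R.1 R.2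
  choose P hP hRP hred α β hA hz hrt hrb using hy'
  -- the normalized coefficients
  let u : y.support → L := fun R => y R.1 * qi ^ (P R).caps
  have hu : ∀ R α β, y R.1 * entry R.1 α β =
      u R * (q ^ (P R).caps * (P R).weight (Sum.elim α β)) := by
    intro R α β
    rw [hRP R, entry_mk, ← hRP R]
    simp only [u]
    rw [mul_assoc, ← mul_assoc (qi ^ _), ← mul_pow, qi_mul_q, one_pow, one_mul]
  have hu0 : ∀ R, u R ≠ 0 := by
    intro R h
    have h1 : u R * q ^ (P R).caps = y R.1 := by
      simp only [u]
      rw [mul_assoc, ← mul_pow, qi_mul_q, one_pow, mul_one]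
    rw [h, zero_mul] at h1
    exact Finsupp.mem_support_iff.1 R.2 h1.symm
  -- the lowest degree
  obtain ⟨v, ⟨R₁, hR₁⟩, hv⟩ : ∃ v, (∃ R, (u R).coeff v ≠ 0) ∧ ∀ R d, (u R).coeff d ≠ 0 → v ≤ d := by
    have hne' : (Finset.univ.biUnion fun R => (u R).coeff.support).Nonempty := by
      obtain ⟨R, hR⟩ := Finsupp.support_nonempty_iff.2 hne
      have h1 := hu0 ⟨R, hR⟩
      have h2 : (u ⟨R, hR⟩).coeff ≠ 0 := fun h => h1 (AddMonoidAlgebra.coeff_injective h)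
      obtain ⟨d, hd⟩ := Finsupp.support_nonempty_iff.2 h2
      exact ⟨d, Finset.mem_biUnion.2 ⟨⟨R, hR⟩, Finset.mem_univ _, hd⟩⟩
    obtain ⟨v, hv, hmin⟩ := Finset.exists_min_image _ (fun d => d) hne'
    obtain ⟨R, -, hR⟩ := Finset.mem_biUnion.1 hv
    exact ⟨v, ⟨R, Finsupp.mem_support_iff.1 hR⟩, fun R d hd =>
      hmin d (Finset.mem_biUnion.2 ⟨R, Finset.mem_univ _, Finsupp.mem_support_iff.2 hd⟩)⟩
  -- a diagram with as many edges as possible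
  obtain ⟨R₀, hR₀, hmax⟩ := Finset.exists_max_image
    (Finset.univ.filter fun R => (u R).coeff v ≠ 0) (fun R => (P R).edges)
    ⟨R₁, Finset.mem_filter.2 ⟨Finset.mem_univ _, hR₁⟩⟩
  have hv0 := (Finset.mem_filter.1 hR₀).2
  -- The relation is evaluated at the signs of degree zero of `R₀`, and the coefficient of degree
  -- `v` is extracted. The following cases show that only `R₀` contributes to it.
  have hsum := h0 (α R₀) (β R₀) (hA R₀)
  rw [← Finset.sum_coe_sort] at hsum
  simp only [hu] at hsum
  have hcoeff := congrArg (fun x : L => x.coeff v) hsum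
  simp only [AddMonoidAlgebra.coeff_sum, Finsupp.finsetSum_apply] at hcoeff
  rw [Finset.sum_eq_single R₀] at hcoeff
  · rw [((hP R₀).weight_isMonomial (hred R₀) _ _).2.2 (hz R₀), mul_one] at hcoeff
    exact hv0 hcoeff
  -- By minimality of `v` a contribution of `R` needs the normalized weight `1`, so the signs of
  -- `R₀` have degree zero for `R` too, and it needs a term of degree `v` in `u R`, so `R` has no
  -- more edges than `R₀`. Then both diagrams have the same shape.
  · intro R _ hR
    obtain ⟨h1, h2⟩ := (hP R).weight_isMonomial (hred R) (α R₀) (β R₀)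
    rcases h1 with h1 | ⟨d, h1⟩
    · rw [h1, mul_zero]
      rfl
    · by_contra h3
      rw [h1, LaurentPolynomial.T_pow, mul_one] at h3
      have h4 : (u R * LaurentPolynomial.T (d : ℤ)).coeff v = (u R).coeff (v - d) := by
        have := AddMonoidAlgebra.coeff_mul_single_apply (u R) (1 : ℤ) (d : ℤ) v
        rw [mul_one] at this
        rw [sub_eq_add_neg]
        exact this
      rw [h4] at h3
      have h5 := hv R _ h3
      obtain rfl : d = 0 := by omega
      rw [Nat.cast_zero, sub_zero] at h3
      rw [pow_zero] at h1
      have h6 := hmax R (Finset.mem_filter.2 ⟨Finset.mem_univ _, h3⟩)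
      have h7 := (hP R₀).sameShape_of_allDegZero (hP R) (hz R₀) (h2.1 h1) (hrt R₀) (hrb R₀) h6
      refine hR (Subtype.ext ?_)
      rw [hRP R, hRP R₀]
      exact (Tangle.sound ((hred R₀).equiv (hred R) h7)).symm
  · intro h
    exact absurd (Finset.mem_univ _) h

/-! ### The kernel of the action -/

section

variable {n : ℕ} [hn : Fact (2 ≤ n)]

omit hn in
theorem matEntry_eq_of_sub_mem {x y : TangleAlgebra n}
    (h : x - y ∈ localRel (fun T : Tangle n n => MonoidAlgebra.of L _ T)) (α β : Seq n) :
    matEntry α β x = matEntry α β y := by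
  have := localRel_le_ker (f := matEntry α β) (fun T => matEntry_of α β T) h
  rwa [LinearMap.mem_ker, map_sub, sub_eq_zero] at this

theorem cupAction_eq_zero_of_mem_relDT {x : DT n} (hx : x ∈ relDT n) : cupAction n x = 0 := by
  rw [cupAction_eq_zero_iff]
  intro α β _
  rw [matEntry_eq_of_sub_mem (y := 0) (by rw [sub_zero]; exact hx), map_zero]

/-- The span of the elements of `𝔻𝕋_n` that are tangles in `B`. -/
def tangleSpan {n : ℕ} (B : Set (Tangle n n)) : Submodule L (DT n) :=
  Submodule.span L {x | ∃ T ∈ B, x.1 = MonoidAlgebra.of L _ T}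

theorem cupAction_eq_zero_of_mem {B : Set (Tangle n n)}
    (hB : ∀ T ∈ B, MonoidAlgebra.of L _ T ∈ DT n → ∀ α β, entry T α β ≠ 0 → ∏ k, α k ≠ 1)
    {x : DT n} (hx : x ∈ relDT n ⊔ tangleSpan B) : cupAction n x = 0 := by
  have h : relDT n ⊔ tangleSpan B ≤ LinearMap.ker (cupAction n).toLinearMap := by
    refine sup_le (fun x hx => cupAction_eq_zero_of_mem_relDT hx) ?_
    rw [tangleSpan, Submodule.span_le]
    rintro x ⟨T, hT, hx⟩
    refine (cupAction_eq_zero_iff x).2 fun α β hα => ?_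
    rw [hx, matEntry_of]
    by_contra hne
    exact hB T hT (hx ▸ x.2) α β hne hα
  exact h hx

omit hn in
theorem exists_reduced_tangle (T : Tangle n n) : ∃ (P Q : PreDiag n n) (hP : P.IsTangle)
    (hQ : Q.IsTangle) (a : L), T = .mk P hP ∧ P.SameShape Q ∧ Q.IsReduced ∧
      MonoidAlgebra.of L _ T - a • MonoidAlgebra.of L _ (.mk Q hQ) ∈
        localRel (fun T : Tangle n n => MonoidAlgebra.of L _ T) := by
  induction T using Tangle.ind with
  | h P hP =>
    obtain ⟨Q, hQ, a, h1, h2, h3⟩ := PreDiag.exists_reduced (M := TangleAlgebra n) hP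
    exact ⟨P, Q, hP, hQ, a, rfl, h1, h2, h3 fun T => MonoidAlgebra.of L _ T⟩

theorem cupAction_sub (x y : DT n) : cupAction n (x - y) = cupAction n x - cupAction n y :=
  eq_sub_of_add_eq ((map_add (cupAction n) _ _).symm.trans
    (congrArg (cupAction n) (sub_add_cancel x y)))

/-- An element of `𝔻𝕋_n` that acts by zero is a combination of tangles in `B`, modulo the local
relations. -/
theorem mem_of_cupAction_eq_zero {B : Set (Tangle n n)}
    (hB : ∀ T ∈ B, MonoidAlgebra.of L _ T ∈ DT n → ∀ α β, entry T α β ≠ 0 → ∏ k, α k ≠ 1)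
    (hB' : ∀ (P : PreDiag n n) (hP : P.IsTangle), .mk P hP ∈ genMonoid n → .mk P hP ∉ B →
      (∀ c, ¬ P.IsEdge c) → ∀ α β, entry (.mk P hP) α β ≠ 0 → ∏ k, α k = 1)
    {x : DT n} (hx : cupAction n x = 0) : x ∈ relDT n ⊔ tangleSpan B := by
  classical
  obtain ⟨c, hc, hcx⟩ := exists_linearCombination x.2
  have hs : ∀ T : ↥(c.support.filter (· ∈ B)), T.1 ∈ c.support ∧ T.1 ∈ B :=
    fun T => Finset.mem_filter.1 T.2
  -- The part of `x` on tangles in `B`. It lies in `tangleSpan B` and acts by zero, so the remaining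
  -- part acts by zero as well.
  let z : DT n := ∑ T : ↥(c.support.filter (· ∈ B)),
    c T.1 • ⟨MonoidAlgebra.of L _ T.1, of_mem_DT (hc _ (hs T).1)⟩
  have hz : z ∈ tangleSpan B := Submodule.sum_mem _ fun T _ =>
    Submodule.smul_mem _ _ (Submodule.subset_span ⟨T.1, (hs T).2, rfl⟩)
  have hz1 : z.1 = ∑ T ∈ c.support.filter (· ∈ B), c T • MonoidAlgebra.of L _ T := by
    change (DT n).val z = _
    rw [map_sum]
    exact Finset.sum_coe_sort (c.support.filter (· ∈ B))
      fun T => c T • MonoidAlgebra.of L (Tangle n n) T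
  have hsub : (x - z).1 = ∑ T ∈ c.support.filter (· ∉ B), c T • MonoidAlgebra.of L _ T := by
    rw [Subalgebra.coe_sub, hz1, ← hcx, Finsupp.linearCombination_apply, Finsupp.sum,
      ← Finset.sum_filter_add_sum_filter_not c.support (· ∈ B), add_sub_cancel_left]
  choose P Q hP hQ a hTP hsh hred hrel using exists_reduced_tangle (n := n)
  -- The remaining part, rewritten in terms of reduced diagrams. Equal diagrams are collected; their
  -- independence then forces `y = 0`.
  let y : Tangle n n →₀ L := ∑ T ∈ c.support.filter (· ∉ B),
    Finsupp.single (.mk (Q T) (hQ T)) (c T * a T)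
  have hxy : (x - z).1 - Finsupp.linearCombination L (MonoidAlgebra.of L (Tangle n n)) y ∈
      localRel (fun T : Tangle n n => MonoidAlgebra.of L _ T) := by
    rw [hsub, map_sum, ← Finset.sum_sub_distrib]
    refine Submodule.sum_mem _ fun T _ => ?_
    rw [Finsupp.linearCombination_single, mul_smul, ← smul_sub]
    exact Submodule.smul_mem _ _ (hrel T)
  have hy : y = 0 := by
    refine eq_zero_of_entries (fun α => ∏ k, α k = 1) y (fun R hR => ?_) fun α β hα => ?_
    · obtain ⟨T, hT, hT'⟩ := Finset.exists_ne_zero_of_sum_ne_zero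
        (f := fun T => Finsupp.single (.mk (Q T) (hQ T)) (c T * a T) R)
        (s := c.support.filter (· ∉ B)) (by
          rw [← Finsupp.finsetSum_apply]; exact Finsupp.mem_support_iff.1 hR)
      have hRQ : Tangle.mk (Q T) (hQ T) = R := by
        by_contra hne
        exact hT' (Finsupp.single_eq_of_ne' hne)
      have ha : a T ≠ 0 := by
        intro h
        refine hT' ?_
        simp only [h, mul_zero, Finsupp.single_zero, Finsupp.coe_zero, Pi.zero_apply]
      obtain ⟨hTc, hTB⟩ := Finset.mem_filter.1 hT
      have hTG := hc T hTc
      obtain ⟨α, β, h1, h2, h3, h4⟩ := (hQ T).exists_signs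
      refine ⟨Q T, hQ T, hRQ.symm, hred T, α, β, ?_, h1, h2, h3⟩
      -- With an edge the bottom signs have been chosen even. Without edges they cannot be adjusted,
      -- but they have a nonzero entry in the original tangle because `a T ≠ 0`, and `hB'` says that
      -- all such signs are even.
      by_cases hE : ∃ c, (Q T).IsEdge c
      · exact h4 hE
      · have hPE : ∀ c, ¬ (P T).IsEdge c := by
          rintro _ ⟨j, i, rfl, h6⟩
          exact hE ⟨_, j, i, rfl, ((hsh T).e_iff _ _).1 h6⟩
        have h5 : entry T α β = a T * entry (.mk (Q T) (hQ T)) α β := by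
          have := matEntry_eq_of_sub_mem (hrel T) α β
          rwa [map_smul, matEntry_of, matEntry_of, smul_eq_mul] at this
        have h6 : entry (.mk (Q T) (hQ T)) α β ≠ 0 := by
          intro h7
          have h8 := ((hQ T).weight_isMonomial (hred T) α β).2.2 h1
          rw [entry_mk] at h7
          rw [h7, mul_zero] at h8
          exact zero_ne_one h8
        refine hB' (P T) (hP T) (hTP T ▸ hTG) (hTP T ▸ hTB) hPE α β ?_
        rw [← hTP T, h5]
        exact mul_ne_zero ha h6
    · have h1 := matEntry_eq_of_sub_mem hxy α β
      have h2 : matEntry α β (x - z).1 = 0 :=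
        (cupAction_eq_zero_iff (x - z)).1 (by
          rw [cupAction_sub, hx, cupAction_eq_zero_of_mem hB (Submodule.mem_sup_right hz)]
          exact sub_zero (0 : Module.End L (Nt n)))
          α β hα
      rw [h2, Finsupp.linearCombination_apply, Finsupp.sum, map_sum] at h1
      rw [h1]
      refine Finset.sum_congr rfl fun R _ => ?_
      rw [map_smul, matEntry_of, smul_eq_mul]
  rw [hy, map_zero, sub_zero] at hxy
  have hmem : x - z ∈ relDT n := hxy
  rw [← sub_add_cancel x z]
  exact Submodule.add_mem_sup hmem hz

/-- The tangles without edges and with an odd number of undotted cups. -/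
def oddCupTangles (n : ℕ) : Set (Tangle n n) :=
  {T | ∃ P hP, T = .mk P hP ∧ (∀ c, ¬ P.IsEdge c) ∧ Odd P.undottedCups}

/-- The tangles without edges and with an odd number of undotted caps. -/
def oddCapTangles (n : ℕ) : Set (Tangle n n) :=
  {T | ∃ P hP, T = .mk P hP ∧ (∀ c, ¬ P.IsEdge c) ∧ Odd P.undottedCaps}

omit hn in
theorem oddCups_eq : oddCups n = tangleSpan (oddCupTangles n) := by
  rw [oddCups, tangleSpan]
  congr 1
  ext x
  constructor
  · rintro ⟨P, hP, h1, h2, h3⟩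
    exact ⟨_, ⟨P, hP, rfl, h2, h3⟩, h1⟩
  · rintro ⟨_, ⟨P, hP, rfl, h2, h3⟩, h1⟩
    exact ⟨P, hP, h1, h2, h3⟩

omit hn in
theorem oddCaps_eq : oddCaps n = tangleSpan (oddCapTangles n) := by
  rw [oddCaps, tangleSpan]
  congr 1
  ext x
  constructor
  · rintro ⟨P, hP, h1, h2, h3⟩
    exact ⟨_, ⟨P, hP, rfl, h2, h3⟩, h1⟩
  · rintro ⟨_, ⟨P, hP, rfl, h2, h3⟩, h1⟩
    exact ⟨P, hP, h1, h2, h3⟩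

theorem prod_top_eq_one_of_mem_DT {T : Tangle n n} (hT : MonoidAlgebra.of L _ T ∈ DT n)
    {α β : Seq n} (h : entry T α β ≠ 0) (hα : ∏ k, α k = 1) : ∏ k, β k = 1 := by
  by_contra hβ
  have := act_mem hT (delta_mem hα) β hβ
  rw [act_delta, matEntry_of] at this
  exact h this

/-- For a diagram without edges the parity of the top signs with nonzero weight is that of the
number of undotted cups. If this number is odd, even bottom signs would give both even and odd top
signs, so the diagram acts by zero. For products of generators with an even number, top and bottom
parity agree, so the bottom signs are even. -/
theorem mem_relDT_sup_oddCups_iff (x : DT n) :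
    x ∈ relDT n ⊔ oddCups n ↔ cupAction n x = 0 := by
  rw [oddCups_eq]
  have hB : ∀ T ∈ oddCupTangles n, MonoidAlgebra.of L _ T ∈ DT n → ∀ α β, entry T α β ≠ 0 →
      ∏ k, α k ≠ 1 := by
    rintro _ ⟨P, hP, rfl, hE, hodd⟩ hT α β h hα
    have h1 := prod_top_eq_one_of_mem_DT hT h hα
    rw [hP.prod_top_of_weight_ne_zero hE h, hodd.neg_one_pow] at h1
    exact one_ne_neg_one_units h1.symm
  refine ⟨cupAction_eq_zero_of_mem hB, mem_of_cupAction_eq_zero hB ?_⟩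
  intro P hP hG hnot hE α β h
  rw [prod_eq_of_entry_ne_zero hG h, hP.prod_top_of_weight_ne_zero hE h]
  refine Even.neg_one_pow ?_
  rw [← Nat.not_odd_iff_even]
  exact fun hodd => hnot ⟨P, hP, rfl, hE, hodd⟩

/-- The undotted caps determine the parity of the bottom signs directly. Cups and caps thus describe
the same subspace modulo the local relations, the kernel of the action. -/
theorem mem_relDT_sup_oddCaps_iff (x : DT n) :
    x ∈ relDT n ⊔ oddCaps n ↔ cupAction n x = 0 := by
  rw [oddCaps_eq]
  have hB : ∀ T ∈ oddCapTangles n, MonoidAlgebra.of L _ T ∈ DT n → ∀ α β, entry T α β ≠ 0 →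
      ∏ k, α k ≠ 1 := by
    rintro _ ⟨P, hP, rfl, hE, hodd⟩ hT α β h hα
    rw [hP.prod_bot_of_weight_ne_zero hE h, hodd.neg_one_pow] at hα
    exact one_ne_neg_one_units hα.symm
  refine ⟨cupAction_eq_zero_of_mem hB, mem_of_cupAction_eq_zero hB ?_⟩
  intro P hP hG hnot hE α β h
  rw [hP.prod_bot_of_weight_ne_zero hE h]
  refine Even.neg_one_pow ?_
  rw [← Nat.not_odd_iff_even]
  exact fun hodd => hnot ⟨P, hP, rfl, hE, hodd⟩

omit hn in
-- Without edges the cups pair up all top points.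
theorem PreDiag.IsTangle.even_of_no_edge {P : PreDiag n n} (hP : P.IsTangle)
    (hE : ∀ c, ¬ P.IsEdge c) : Even n := by
  have := Finset.prod_involution (s := (Finset.univ : Finset (Fin n))) (f := fun _ => (-1 : ℤˣ))
    (fun i _ => P.mate Sum.inr i) (fun _ _ => by simp) (fun i _ _ h => by
      obtain ⟨j, hj⟩ := hP.mate_top_eq_self_iff.1 h
      exact hE _ ⟨j, i, hj, rfl⟩) (fun _ _ => Finset.mem_univ _)
    (fun i _ => hP.mate_mate Sum.inr_injective i)
  rw [Finset.prod_const, Finset.card_univ, Fintype.card_fin] at this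
  exact even_of_neg_one_pow this

/-- For odd `n` every tangle has an edge, so the general statement on the kernel applies with no
exceptional tangles. -/
theorem mem_relTL_iff (x : DT n) : x ∈ relTL n ↔ cupAction n x = 0 := by
  rw [relTL]
  split_ifs with h
  · exact mem_relDT_sup_oddCups_iff x
  · refine ⟨cupAction_eq_zero_of_mem_relDT, fun hx => ?_⟩
    have := mem_of_cupAction_eq_zero (B := ∅) (fun T hT => absurd hT (Set.notMem_empty T))
      (fun P hP _ _ hE => absurd (hP.even_of_no_edge hE) h) hx
    have h0 : tangleSpan (∅ : Set (Tangle n n)) = ⊥ := by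
      rw [tangleSpan, Submodule.span_eq_bot]
      rintro x ⟨T, hT, -⟩
      exact absurd hT (Set.notMem_empty T)
    rwa [h0, sup_bot_eq] at this

theorem cupAction_eq_iff (x y : DT n) : cupAction n x = cupAction n y ↔ TLRel n x y := by
  rw [TLRel, mem_relTL_iff, cupAction_sub]
  exact (sub_eq_zero (a := (cupAction n x : Module.End L (Nt n)))).symm

/-- The action of `TL^(W)` on the module of cup diagrams. -/
def tlAction (n : ℕ) [Fact (2 ≤ n)] : TLhat n →ₐ[L] Module.End L (Nt n) :=
  RingQuot.liftAlgHom L ⟨cupAction n, fun x y h => (cupAction_eq_iff x y).2 h⟩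

theorem tlAction_proj (x : DT n) : tlAction n (TLproj n x) = cupAction n x :=
  RingQuot.liftAlgHom_mkAlgHom_apply ..

/-- As the kernel of an algebra homomorphism, `relTL n` is already a two-sided ideal, and passing to
the quotient kills nothing else. -/
theorem TLproj_eq_zero_iff (x : DT n) : TLproj n x = 0 ↔ x ∈ relTL n := by
  constructor
  · intro h
    rw [mem_relTL_iff, ← tlAction_proj, h, map_zero]
  · intro h
    have h1 : TLRel n x 0 := by
      rw [← cupAction_eq_iff, map_zero]
      exact (mem_relTL_iff x).1 h
    exact (RingQuot.mkAlgHom_rel L h1).trans (map_zero (TLproj n))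

theorem tlAction_injective : Function.Injective (tlAction n) := by
  intro y y' h
  obtain ⟨x, rfl⟩ := RingQuot.mkAlgHom_surjective L (TLRel n) y
  obtain ⟨x', rfl⟩ := RingQuot.mkAlgHom_surjective L (TLRel n) y'
  refine RingQuot.mkAlgHom_rel L ?_
  rw [← cupAction_eq_iff, ← tlAction_proj, ← tlAction_proj]
  exact h

end

end TypeD

end

open TypeD

theorem theorem4 (n : ℕ) (hn : 4 ≤ n) :
    ∃ (KL : Module.Basis (Wp n) L (N n)) (cut : Wp n ≃ CupDiagram n)
      (ρ : DT n →ₐ[L] Module.End L (Nt n)),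
      -- `KL` is the Kazhdan–Lusztig basis
      (∀ w x, IsKLElement w x ↔ x = KL w) ∧
      -- `cut w` is the decorated cup diagram of `w`
      (∀ w, (cut w).1.2.IsCupDiagramOf (signSeq w.1)) ∧
      -- `e_i` acts on cup diagrams by concatenation, followed by the reduction rules
      (∀ i b, ∃ (a : L) (b' : CupDiagram n),
        ρ (DT.e i) (Finsupp.single b 1) = Finsupp.single b' a ∧
        bas ((Tangle.gen i).comp b.1.2) - a • bas b'.1.2 ∈ cupRel n) ∧
      -- the isomorphism `Φ` intertwines `C_{s_i}` and `e_i`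
      (∀ i x, (KL.reindex cut).repr (actN (C i) x) = ρ (DT.e i) ((KL.reindex cut).repr x)) ∧
      -- the odd part can be described by cups or by caps
      (Even n → relDT n ⊔ oddCups n = relDT n ⊔ oddCaps n) ∧
      -- the kernel of the projection
      (∀ x, TLproj n x = 0 ↔ x ∈ relTL n) ∧
      ∃ ρ' : TLhat n →ₐ[L] Module.End L (Nt n),
        ρ'.comp (TLproj n) = ρ ∧ Function.Injective ρ' := by
  have : Fact (2 ≤ n) := ⟨by omega⟩
  refine ⟨klBasis n, cutEquiv n, cupAction n, fun w x => isKLElement_iff w x, fun w => ?_,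
    fun i b => ?_, fun i x => ?_, fun _ => ?_, TLproj_eq_zero_iff, tlAction n,
    AlgHom.ext tlAction_proj, tlAction_injective⟩
  · rw [← lead_cutEquiv]
    exact (cutEquiv n w).isCupDiagramOf
  · obtain ⟨a, b', h1, h2⟩ := exists_gen_act i b
    refine ⟨a, b', vecLin_injective ?_, h2⟩
    rw [vecLin_cupAction_e, vecLin_single, vecLin_single, one_smul, h1]
  · refine vecLin_injective ?_
    rw [vecLin_cupAction_e, klBasis_reindex]
    exact (vecLin_ntEquiv_symm _).trans
      ((coord_actN_C i x).trans (congrArg (opE i) (vecLin_ntEquiv_symm x).symm))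
  -- Both subspaces are the kernel of the action.
  · exact Submodule.ext fun x =>
      (mem_relDT_sup_oddCups_iff x).trans (mem_relDT_sup_oddCaps_iff x).symm
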